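/- Let $D$ be a central division algebra of degree $d$ over a field $F$ (so $\dim_F D=d^2$), $m\ge 1$, $n=md$, $\mathfrak g=\mathfrak{gl}_m(D)$, $G=\mathrm{GL}_m(D)$, and let $\nu$ be the reduced norm on $\mathfrak g$ (also on its points over commutative $F$-algebras). **Local case.** Let $F$ be a local field of characteristic $0$ with normalized absolute value $|\cdot|$. Let $\mathcal S(\mathfrak g(F))$ be the space of Schwartz functions on the real vector space $\mathfrak g(F)$, with its usual Fréchet topology, if $F$ is archimedean, and the space of locally constant compactly supported functions on $\mathfrak g(F)$, with the discrete topology, if $F$ is non-archimedean. For $f\in\mathcal S(\mathfrak g(F))$ and $s\in\mathbb C$ put $f_s(X)=f(X)\,|\nu(X)|^{s+\frac{n-1}{2}}$ and $\mathcal Z(\mathfrak g(F),s)=\{f_s: f\in\mathcal S(\mathfrak g(F))\}$. For $I\subseteq\mathbb C$, the union $\bigcup_{s\in I}\mathcal Z(\mathfrak g(F),s)$ (inside the functions on $\mathfrak g(F)$) carries the quotient topology of the product topology under $I\times\mathcal S(\mathfrak g(F))\to\bigcup_{s\in I}\mathcal Z(\mathfrak g(F),s)$, $(s,f)\mapsto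 f_s$; the set of restrictions of these functions to $G(F)$ carries the topology transported by restriction. Let $K=\mathrm{GL}_m(\mathcal O_D)$ if $F$ is non-archimedean and $K=\{g: g\,{}^t\bar g=1\}$ (for the principal involution of $D=\mathbb R,\mathbb C$ or $\mathbb H$) if $F$ is archimedean. Let $\Xi(g)=\int_K\delta(kg)^{1/2}\,dk$ be Harish-Chandra's function, where $\delta$ is the modulus character of the group of upper triangular matrices, $\delta(p)=\prod_{i=1}^m|\nu(p_{ii})|^{(m+1-2i)d}$, extended to $G(F)$ by right $K$-invariance by means of the Iwasawa decomposition, and let $\sigma(g)=\log\max(\|g\|,\|g^{-1}\|)$, where $\|X\|=\max_{i,j}|\nu(X_{ij})|^{1/d}$ if $F$ is non-archimedean and $\|X\|=(\sum_{i,j}X_{ij}\overline{X_{ij}})^{1/2}$ if $F$ is archimedean. The Harish-Chandra Schwartz space $\mathcal{CS}(G(F))$ is * for $F$ non-archimedean, the locally convex inductive limit, over the compact open subgroups $J$ of $G(F)$, of the spaces of $J$-bi-invariant functions $f$ with $\sup_{g}(1+\sigma(g))^r|f(g)|\,\Xi(g)^{-1}<\infty$ for all $r\ge 0$, topologized by these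 seminorms; * for $F$ archimedean, the space of smooth functions $f$ with $\sup_g(1+\sigma(g))^r|(A f B)(g)|\,\Xi(g)^{-1}<\infty$ for all $A,B\in\mathcal U(\mathfrak g(F)_{\mathbb C})$ and $r\ge 0$, topologized by these seminorms. Then $$\bigcup_{\mathrm{Re}(s)>\frac{1-d}{2}}\mathcal Z(\mathfrak g(F),s)\big|_{G(F)}\subseteq\mathcal{CS}(G(F)),$$ and this inclusion is continuous. **Global case.** Let $F$ be a number field with adele ring $\mathbb A_F=F_\infty\times\mathbb A_{F,\mathrm{fin}}$. Let $\mathcal S(\mathfrak g(\mathbb A_F))$ be the Schwartz–Bruhat space: the linear span of the functions $f_\infty\otimes f_{\mathrm{fin}}$ with $f_\infty\in\mathcal S(\mathfrak g(F_\infty))$ and $f_{\mathrm{fin}}$ locally constant with compact support on $\mathfrak g(\mathbb A_{F,\mathrm{fin}})$, with the finest locally convex topology for which all the maps $f_\infty\mapsto f_\infty\otimes f_{\mathrm{fin}}$ are continuous. For $f\in\mathcal S(\mathfrak g(\mathbb A_F))$ put $f_s(X)=f(X)\,|\nu(X)|_{\mathbb A_F}^{s+\frac{n-1}{2}}$, where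 $|x|_{\mathbb A_F}=\prod_v|x_v|_v$ over all places, and define $\mathcal Z(\mathfrak g(\mathbb A_F),s)$, the unions of these spaces, their restrictions to $G(\mathbb A_F)$ and the topologies as in the local case. For a compact open subgroup $J$ of $G(\mathbb A_{F,\mathrm{fin}})$ let $\mathcal C(G(\mathbb A_F),J)$ be the space of smooth right $J$-invariant functions $f$ on $G(\mathbb A_F)$ with $f*X\in L^1(G(\mathbb A_F))$ for all $X\in\mathcal U(\mathfrak g(F_\infty)_{\mathbb C})$, topologized by the seminorms $\|f*X\|_{L^1}$, and let the Müller–Finis–Lapid space $\mathcal C(G(\mathbb A_F))$ be the locally convex inductive limit of the $\mathcal C(G(\mathbb A_F),J)$ over $J$. Then $$\bigcup_{\mathrm{Re}(s)>\frac{n+1}{2}}\mathcal Z(\mathfrak g(\mathbb A_F),s)\big|_{G(\mathbb A_F)}\subseteq\mathcal C(G(\mathbb A_F)),$$ and this inclusion is continuous. -/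

import Mathlib

open scoped TensorProduct SchwartzMap NNReal ContDiff NumberField Valued ValuativeRel

namespace GodementJacquet

noncomputable section

/-! ### The reduced norm of a central simple algebra -/

/-- A splitting representation `ρ : A → M_n(F̄)` extended to `R ⊗ A → M_n(R ⊗ F̄)`. -/
def splitMap (F : Type*) [Field F] (A : Type*) [Ring A] [Algebra F A] (n : ℕ)
    (R : Type*) [CommRing R] [Algebra F R]
    (ρ : A →ₐ[F] Matrix (Fin n) (Fin n) (AlgebraicClosure F)) :
    R ⊗[F] A →ₐ[F] Matrix (Fin n) (Fin n) (R ⊗[F] AlgebraicClosure F) :=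
  Algebra.TensorProduct.lift
    (((Algebra.ofId (R ⊗[F] AlgebraicClosure F)
        (Matrix (Fin n) (Fin n) (R ⊗[F] AlgebraicClosure F))).restrictScalars F).comp
      (Algebra.TensorProduct.includeLeft : R →ₐ[F] R ⊗[F] AlgebraicClosure F))
    ((Algebra.TensorProduct.includeRight :
        AlgebraicClosure F →ₐ[F] R ⊗[F] AlgebraicClosure F).mapMatrix.comp ρ)
    (fun r _ => Algebra.commutes
      (Algebra.TensorProduct.includeLeft r : R ⊗[F] AlgebraicClosure F) _)

open Classical in
/-- The reduced norm `ν : R ⊗ A → R` of a central simple algebra `A` of degree `n` over `F`, on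
points with values in a commutative `F`-algebra `R`: the element `r` of `R` whose image in
`R ⊗ F̄` is the determinant of the image of `x` under a splitting representation
`A → M_n(F̄)` (these are all conjugate by Skolem–Noether). -/
def reducedNorm (F : Type*) [Field F] (A : Type*) [Ring A] [Algebra F A] (n : ℕ)
    (R : Type*) [CommRing R] [Algebra F R] (x : R ⊗[F] A) : R :=
  if h : ∃ r : R, ∃ ρ : A →ₐ[F] Matrix (Fin n) (Fin n) (AlgebraicClosure F),
      r ⊗ₜ[F] (1 : AlgebraicClosure F) = (splitMap F A n R ρ x).det
  then h.choose else 0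

/-- The reduced norm `ν : A → F`. -/
def reducedNormField (F : Type*) [Field F] (A : Type*) [Ring A] [Algebra F A] (n : ℕ)
    (x : A) : F :=
  reducedNorm F A n F (1 ⊗ₜ[F] x)

/-! ### The Godement–Jacquet spaces -/

/-- `f_s(x) = f(x) |ν(x)|^{s + (n-1)/2}`; here `abv x` stands for `|ν(x)|`.
The convention `0 ^ 0 = 1` is the one in force for complex powers. -/
def twist {X : Type*} (abv : X → ℝ) (n : ℕ) (s : ℂ) (f : X → ℂ) : X → ℂ :=
  fun x => f x * (abv x : ℂ) ^ (s + ((n : ℂ) - 1) / 2)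

/-- The space `𝒵(s) = {f_s}`, where `f` runs over the functions `ev φ`, `φ ∈ S`. -/
def gjSpace {X S : Type*} (ev : S → X → ℂ) (abv : X → ℝ) (n : ℕ) (s : ℂ) : Set (X → ℂ) :=
  Set.range fun φ : S => twist abv n s (ev φ)

/-- The union of the `𝒵(s)`, `s ∈ I`, inside the space of functions on `X`. -/
def GJUnion {X S : Type*} (ev : S → X → ℂ) (abv : X → ℝ) (n : ℕ) (I : Set ℂ) : Type _ :=
  {φ : X → ℂ // φ ∈ ⋃ s ∈ I, gjSpace ev abv n s}

/-- The map `I × S → ⋃ 𝒵(s)`, `(s, f) ↦ f_s`. -/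
def gjIota {X S : Type*} (ev : S → X → ℂ) (abv : X → ℝ) (n : ℕ) (I : Set ℂ) (p : I × S) :
    GJUnion ev abv n I :=
  ⟨twist abv n p.1 (ev p.2), Set.mem_biUnion p.1.2 ⟨p.2, rfl⟩⟩

/-- The topology pushed forward from `I × S`. -/
instance {X S : Type*} [TopologicalSpace S] (ev : S → X → ℂ) (abv : X → ℝ) (n : ℕ) (I : Set ℂ) :
    TopologicalSpace (GJUnion ev abv n I) :=
  TopologicalSpace.coinduced (gjIota ev abv n I) inferInstance

/-- The space of restrictions to `G` (along `j : G → X`) of the functions in `⋃ 𝒵(s)`. -/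
def GJRestr {X S G : Type*} (j : G → X) (ev : S → X → ℂ) (abv : X → ℝ) (n : ℕ) (I : Set ℂ) :
    Type _ :=
  {φ : G → ℂ // ∃ ψ : GJUnion ev abv n I, φ = ψ.1 ∘ j}

/-- The underlying function on `G`. -/
def GJRestr.eval {X S G : Type*} {j : G → X} {ev : S → X → ℂ} {abv : X → ℝ} {n : ℕ} {I : Set ℂ}
    (φ : GJRestr j ev abv n I) : G → ℂ := φ.1

/-- Restriction to `G`. -/
def gjRestrict {X S G : Type*} (j : G → X) (ev : S → X → ℂ) (abv : X → ℝ) (n : ℕ) (I : Set ℂ)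
    (ψ : GJUnion ev abv n I) : GJRestr j ev abv n I :=
  ⟨ψ.1 ∘ j, ψ, rfl⟩

/-- The topology transported along the restriction map (which is a bijection
in the cases considered below). -/
instance {X S G : Type*} [TopologicalSpace S] (j : G → X) (ev : S → X → ℂ) (abv : X → ℝ) (n : ℕ)
    (I : Set ℂ) : TopologicalSpace (GJRestr j ev abv n I) :=
  TopologicalSpace.coinduced (gjRestrict j ev abv n I) inferInstance

/-- The space `S` of functions on `G` is contained in the space `T` of functions on `G`
(`evS`, `evT` give the underlying functions), and the inclusion is continuous. -/
def IsContinuousInclusion {G S T : Type*} [TopologicalSpace S] [TopologicalSpace T]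
    (evS : S → G → ℂ) (evT : T → G → ℂ) : Prop :=
  ∃ i : S → T, Continuous i ∧ ∀ φ, evT (i φ) = evS φ

/-! ### Function spaces: seminorms and inductive limits -/

/-- The `f ∈ W` such that `T i f` is bounded on `G` for all `i`. -/
def boundedSub {W ι G : Type*} [AddCommGroup W] [Module ℂ W] (T : ι → W →ₗ[ℂ] (G → ℂ)) :
    Submodule ℂ W where
  carrier := {f | ∀ i, BddAbove (Set.range fun g => ‖T i f g‖)}
  zero_mem' := fun i => ⟨0, by rintro _ ⟨g, rfl⟩; simp⟩
  add_mem' := by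
    intro f h hf hh i
    obtain ⟨a, ha⟩ := hf i
    obtain ⟨b, hb⟩ := hh i
    refine ⟨a + b, ?_⟩
    rintro _ ⟨g, rfl⟩
    simp only [map_add, Pi.add_apply]
    exact (norm_add_le _ _).trans (add_le_add (ha ⟨g, rfl⟩) (hb ⟨g, rfl⟩))
  smul_mem' := by
    intro c f hf i
    obtain ⟨a, ha⟩ := hf i
    refine ⟨‖c‖ * a, ?_⟩
    rintro _ ⟨g, rfl⟩
    simp only [map_smul, Pi.smul_apply, norm_smul]
    exact mul_le_mul_of_nonneg_left (ha ⟨g, rfl⟩) (norm_nonneg c)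

/-- The seminorm `sup_g |T i f (g)|`. -/
def supSeminorm {W ι G : Type*} [AddCommGroup W] [Module ℂ W] (T : ι → W →ₗ[ℂ] (G → ℂ)) :
    SeminormFamily ℂ (boundedSub T) ι := fun i =>
  Seminorm.of (fun f => ⨆ g, ‖T i f.1 g‖)
    (fun f h => by
      refine Real.iSup_le (fun g => ?_)
        (add_nonneg (Real.iSup_nonneg fun _ => norm_nonneg _)
          (Real.iSup_nonneg fun _ => norm_nonneg _))
      simp only [Submodule.coe_add, map_add, Pi.add_apply]
      exact (norm_add_le _ _).trans (add_le_add (le_ciSup (f.2 i) g) (le_ciSup (h.2 i) g)))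
    (fun c f => by
      simp only [Submodule.coe_smul, map_smul, Pi.smul_apply, norm_smul]
      rw [Real.mul_iSup_of_nonneg (norm_nonneg c)])

/-- The space of the `f ∈ W` such that `T i f` is bounded on `G` for all `i`, with the topology
defined by the seminorms `sup_g |T i f (g)|`. -/
def BoundedSpace {W ι G : Type*} [AddCommGroup W] [Module ℂ W] (T : ι → W →ₗ[ℂ] (G → ℂ)) :
    Type _ := boundedSub T

instance {W ι G : Type*} [AddCommGroup W] [Module ℂ W] (T : ι → W →ₗ[ℂ] (G → ℂ)) :
    AddCommGroup (BoundedSpace T) := inferInstanceAs (AddCommGroup (boundedSub T))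

instance {W ι G : Type*} [AddCommGroup W] [Module ℂ W] (T : ι → W →ₗ[ℂ] (G → ℂ)) :
    Module ℂ (BoundedSpace T) := inferInstanceAs (Module ℂ (boundedSub T))

instance {W ι G : Type*} [AddCommGroup W] [Module ℂ W] [Nonempty ι] (T : ι → W →ₗ[ℂ] (G → ℂ)) :
    TopologicalSpace (BoundedSpace T) :=
  (supSeminorm T).moduleFilterBasis.topology

/-- The inclusion in `W`. -/
def BoundedSpace.incl {W ι G : Type*} [AddCommGroup W] [Module ℂ W] (T : ι → W →ₗ[ℂ] (G → ℂ)) :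
    BoundedSpace T →ₗ[ℂ] W := (boundedSub T).subtype

/-- The `f ∈ W` such that `T i f` is integrable on `G` for all `i`. -/
def integrableSub {W ι G : Type*} [AddCommGroup W] [Module ℂ W] [MeasurableSpace G]
    (μ : MeasureTheory.Measure G) (T : ι → W →ₗ[ℂ] (G → ℂ)) : Submodule ℂ W where
  carrier := {f | ∀ i, MeasureTheory.Integrable (T i f) μ}
  zero_mem' := fun i => by
    rw [map_zero]
    exact MeasureTheory.integrable_zero G ℂ μ
  add_mem' := by
    intro f h hf hh i
    rw [map_add]
    exact (hf i).add (hh i)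
  smul_mem' := by
    intro c f hf i
    rw [map_smul]
    exact (hf i).smul c

/-- The seminorm `‖T i f‖_{L¹}`. -/
def l1Seminorm {W ι G : Type*} [AddCommGroup W] [Module ℂ W] [MeasurableSpace G]
    (μ : MeasureTheory.Measure G) (T : ι → W →ₗ[ℂ] (G → ℂ)) :
    SeminormFamily ℂ (integrableSub μ T) ι := fun i =>
  Seminorm.of (fun f => ∫ g, ‖T i f.1 g‖ ∂μ)
    (fun f h => by
      rw [← MeasureTheory.integral_add (f.2 i).norm (h.2 i).norm]
      refine MeasureTheory.integral_mono ((f + h).2 i).norm ((f.2 i).norm.add (h.2 i).norm) ?_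
      intro g
      simp only [Submodule.coe_add, map_add, Pi.add_apply]
      exact norm_add_le _ _)
    (fun c f => by
      simp only [Submodule.coe_smul, map_smul, Pi.smul_apply, norm_smul]
      rw [MeasureTheory.integral_const_mul])

/-- The space of the `f ∈ W` such that `T i f` is integrable on `G` for all `i`, with the topology
defined by the seminorms `‖T i f‖_{L¹}`. -/
def IntegrableSpace {W ι G : Type*} [AddCommGroup W] [Module ℂ W] [MeasurableSpace G]
    (μ : MeasureTheory.Measure G) (T : ι → W →ₗ[ℂ] (G → ℂ)) : Type _ := integrableSub μ T

instance {W ι G : Type*} [AddCommGroup W] [Module ℂ W] [MeasurableSpace G]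
    (μ : MeasureTheory.Measure G) (T : ι → W →ₗ[ℂ] (G → ℂ)) :
    AddCommGroup (IntegrableSpace μ T) := inferInstanceAs (AddCommGroup (integrableSub μ T))

instance {W ι G : Type*} [AddCommGroup W] [Module ℂ W] [MeasurableSpace G]
    (μ : MeasureTheory.Measure G) (T : ι → W →ₗ[ℂ] (G → ℂ)) :
    Module ℂ (IntegrableSpace μ T) := inferInstanceAs (Module ℂ (integrableSub μ T))

instance {W ι G : Type*} [AddCommGroup W] [Module ℂ W] [MeasurableSpace G] [Nonempty ι]
    (μ : MeasureTheory.Measure G) (T : ι → W →ₗ[ℂ] (G → ℂ)) :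
    TopologicalSpace (IntegrableSpace μ T) :=
  (l1Seminorm μ T).moduleFilterBasis.topology

/-- The inclusion in `W`. -/
def IntegrableSpace.incl {W ι G : Type*} [AddCommGroup W] [Module ℂ W] [MeasurableSpace G]
    (μ : MeasureTheory.Measure G) (T : ι → W →ₗ[ℂ] (G → ℂ)) :
    IntegrableSpace μ T →ₗ[ℂ] W := (integrableSub μ T).subtype

/-- The sum, inside the functions on `X`, of the images of the linear maps `φ i : E i → (X → ℂ)`.
If the `φ i` are inclusions of a directed family of subspaces this is their union. -/
def indLimitSub {X ι : Type*} {E : ι → Type*} [∀ i, AddCommGroup (E i)] [∀ i, Module ℂ (E i)]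
    (φ : ∀ i, E i →ₗ[ℂ] (X → ℂ)) : Submodule ℂ (X → ℂ) :=
  ⨆ i, LinearMap.range (φ i)

/-- The same space, to be endowed with the inductive limit topology. -/
def IndLimit {X ι : Type*} {E : ι → Type*} [∀ i, AddCommGroup (E i)] [∀ i, Module ℂ (E i)]
    (φ : ∀ i, E i →ₗ[ℂ] (X → ℂ)) : Type _ := indLimitSub φ

instance {X ι : Type*} {E : ι → Type*} [∀ i, AddCommGroup (E i)] [∀ i, Module ℂ (E i)]
    (φ : ∀ i, E i →ₗ[ℂ] (X → ℂ)) : AddCommGroup (IndLimit φ) :=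
  inferInstanceAs (AddCommGroup (indLimitSub φ))

instance {X ι : Type*} {E : ι → Type*} [∀ i, AddCommGroup (E i)] [∀ i, Module ℂ (E i)]
    (φ : ∀ i, E i →ₗ[ℂ] (X → ℂ)) : Module ℂ (IndLimit φ) :=
  inferInstanceAs (Module ℂ (indLimitSub φ))

/-- The underlying function. -/
def IndLimit.eval {X ι : Type*} {E : ι → Type*} [∀ i, AddCommGroup (E i)] [∀ i, Module ℂ (E i)]
    (φ : ∀ i, E i →ₗ[ℂ] (X → ℂ)) (f : IndLimit φ) : X → ℂ := f.1

/-- The map from `E i` to the inductive limit. -/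
def toIndLimit {X ι : Type*} {E : ι → Type*} [∀ i, AddCommGroup (E i)] [∀ i, Module ℂ (E i)]
    (φ : ∀ i, E i →ₗ[ℂ] (X → ℂ)) (i : ι) : E i →ₗ[ℂ] IndLimit φ :=
  (φ i).codRestrict (indLimitSub φ)
    fun x => Submodule.mem_iSup_of_mem (p := fun i => LinearMap.range (φ i)) i ⟨x, rfl⟩

/-- The (locally convex) inductive limit topology: the finest locally convex vector space topology
that makes all the maps `E i → lim E i` continuous. -/
instance {X ι : Type*} {E : ι → Type*} [∀ i, AddCommGroup (E i)] [∀ i, Module ℂ (E i)]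
    [∀ i, TopologicalSpace (E i)] (φ : ∀ i, E i →ₗ[ℂ] (X → ℂ)) :
    TopologicalSpace (IndLimit φ) :=
  sInf {τ | @IsTopologicalAddGroup _ τ _ ∧ @ContinuousSMul ℂ _ _ _ τ ∧
    @LocallyConvexSpace ℝ (IndLimit φ) _ _ _ (Module.complexToReal (IndLimit φ)) τ ∧
    ∀ i, @Continuous _ _ _ τ (toIndLimit φ i)}

/-! ### Schwartz–Bruhat functions -/

/-- Locally constant functions with compact support. -/
def LocConstCompact (X : Type*) [TopologicalSpace X] : Type _ :=
  {f : X → ℂ // IsLocallyConstant f ∧ HasCompactSupport f}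

/-- Schwartz functions on a finite-dimensional real vector space, through coordinates in a basis. -/
abbrev SchwartzFD (E : Type*) [AddCommGroup E] [Module ℝ E] : Type :=
  𝓢(Fin (Module.finrank ℝ E) → ℝ, ℂ)

/-- Real coordinates on `E`. -/
def coord (E : Type*) [AddCommGroup E] [Module ℝ E] [Module.Finite ℝ E] :
    E ≃ₗ[ℝ] (Fin (Module.finrank ℝ E) → ℝ) :=
  (Module.finBasis ℝ E).equivFun

/-- The value of a Schwartz function at a point of `E`. -/
def SchwartzFD.eval {E : Type*} [AddCommGroup E] [Module ℝ E] [Module.Finite ℝ E]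
    (f : SchwartzFD E) (x : E) : ℂ :=
  f (coord E x)

/-! ### Smooth functions and invariant differential operators on the unit group of a real algebra -/

/-- A function on `Eˣ`, extended by zero to `E`. -/
def extendZero {E : Type*} [Ring E] (φ : Eˣ → ℂ) : E → ℂ := Function.extend Units.val φ 0

lemma extendZero_unit {E : Type*} [Ring E] (φ : Eˣ → ℂ) (g : Eˣ) : extendZero φ (g : E) = φ g :=
  Units.val_injective.extend_apply φ 0 g

lemma extendZero_add {E : Type*} [Ring E] (φ ψ : Eˣ → ℂ) : extendZero (φ + ψ) = extendZero φ + extendZero ψ := by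
  funext x
  by_cases hx : IsUnit x
  · obtain ⟨g, rfl⟩ := hx
    simp [extendZero_unit]
  · have : ¬ ∃ g : Eˣ, (g : E) = x := hx
    simp [extendZero, Function.extend_apply' _ _ _ this]

lemma extendZero_smul {E : Type*} [Ring E] (a : ℂ) (φ : Eˣ → ℂ) : extendZero (a • φ) = a • extendZero φ := by
  funext x
  by_cases hx : IsUnit x
  · obtain ⟨g, rfl⟩ := hx
    simp [extendZero_unit]
  · have : ¬ ∃ g : Eˣ, (g : E) = x := hx
    simp [extendZero, Function.extend_apply' _ _ _ this]

section Smooth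

variable (E : Type*) [Ring E] [Algebra ℝ E] [Module.Finite ℝ E]

lemma isOpen_units_coord : IsOpen {c | IsUnit ((coord E).symm c)} := by
  have h : {c | IsUnit ((coord E).symm c)} =
      {c | LinearMap.det (Algebra.lmul ℝ E ((coord E).symm c)) ≠ 0} := by
    ext c
    rw [Set.mem_ofPred_eq, Set.mem_ofPred_eq, ← isUnit_iff_ne_zero,
      ← LinearMap.isUnit_iff_isUnit_det, Algebra.lmul_isUnit_iff]
  rw [h]
  have hc : Continuous fun c => LinearMap.det (Algebra.lmul ℝ E ((coord E).symm c)) := by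
    have : (fun c => LinearMap.det (Algebra.lmul ℝ E ((coord E).symm c))) =
        fun c => ((LinearMap.toMatrix (Module.finBasis ℝ E) (Module.finBasis ℝ E)).toLinearMap ∘ₗ
          (Algebra.lmul ℝ E).toLinearMap ∘ₗ (coord E).symm.toLinearMap) c |>.det := by
      funext c
      simp [LinearMap.det_toMatrix]
    rw [this]
    exact (LinearMap.continuous_of_finiteDimensional _).matrix_det
  exact isOpen_ne_fun hc continuous_const

/-- Smooth functions on the open subset `Eˣ` of `E`. -/
def smoothUnits : Submodule ℂ (Eˣ → ℂ) where
  carrier := {φ | ContDiffOn ℝ ∞ (fun c => extendZero φ ((coord E).symm c))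
    {c | IsUnit ((coord E).symm c)}}
  zero_mem' := by
    have : extendZero (0 : Eˣ → ℂ) = 0 := by
      simpa using extendZero_smul (0 : ℂ) (0 : Eˣ → ℂ)
    simp only [Set.mem_ofPred_eq, this]
    exact contDiffOn_const
  add_mem' := by
    intro φ ψ hφ hψ
    simp only [Set.mem_ofPred_eq, extendZero_add] at *
    exact hφ.add hψ
  smul_mem' := by
    intro a φ hφ
    simp only [Set.mem_ofPred_eq, extendZero_smul] at *
    exact hφ.const_smul a

variable {E}

/-- The derivative of `φ` along the vector field `v : g ↦ v(g)` (a linear map `E → E`) on `Eˣ`. -/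
def fieldDeriv (v : E →ₗ[ℝ] E) (φ : Eˣ → ℂ) : Eˣ → ℂ :=
  fun g => lineDeriv ℝ (extendZero φ) (g : E) (v g)

lemma hasLineDerivAt_coord {φ : Eˣ → ℂ} (hφ : φ ∈ smoothUnits E) (x : E) (hx : IsUnit x) (w : E) :
    HasLineDerivAt ℝ (extendZero φ)
      (fderiv ℝ (fun c => extendZero φ ((coord E).symm c)) (coord E x) (coord E w)) x w := by
  have h1 : DifferentiableAt ℝ (fun c => extendZero φ ((coord E).symm c)) (coord E x) :=
    (ContDiffOn.contDiffAt hφ ((isOpen_units_coord E).mem_nhds (by simpa using hx))).differentiableAt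
      (by simp)
  have h2 := h1.hasFDerivAt.hasLineDerivAt (coord E w)
  simpa [HasLineDerivAt] using h2

lemma fieldDeriv_mem (v : E →ₗ[ℝ] E) {φ : Eˣ → ℂ} (hφ : φ ∈ smoothUnits E) :
    fieldDeriv v φ ∈ smoothUnits E := by
  have h1 : ContDiffOn ℝ ∞ (fderiv ℝ (fun c => extendZero φ ((coord E).symm c)))
      {c | IsUnit ((coord E).symm c)} :=
    ContDiffOn.fderiv_of_isOpen hφ (isOpen_units_coord E) (by simp)
  let L : (Fin (Module.finrank ℝ E) → ℝ) →L[ℝ] (Fin (Module.finrank ℝ E) → ℝ) :=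
    LinearMap.toContinuousLinearMap
      ((coord E).toLinearMap ∘ₗ v ∘ₗ (coord E).symm.toLinearMap)
  refine (h1.clm_apply L.contDiff.contDiffOn).congr ?_
  rintro c ⟨g, hg⟩
  have h2 := (hasLineDerivAt_coord hφ (g : E) g.isUnit (v g)).lineDeriv
  have h3 : coord E (g : E) = c := by rw [hg]; simp
  simp only [← hg, extendZero_unit, fieldDeriv, h2, h3]
  simp [L, hg]

/-- The derivative along a linear vector field, as an operator on smooth functions. -/
def fieldDerivEnd (v : E →ₗ[ℝ] E) : Module.End ℂ (smoothUnits E) where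
  toFun φ := ⟨fieldDeriv v φ.1, fieldDeriv_mem v φ.2⟩
  map_add' φ ψ := by
    ext g
    have h1 := hasLineDerivAt_coord φ.2 (g : E) g.isUnit (v g)
    have h2 := hasLineDerivAt_coord ψ.2 (g : E) g.isUnit (v g)
    change lineDeriv ℝ (extendZero (φ.1 + ψ.1)) (g : E) (v g) =
      lineDeriv ℝ (extendZero φ.1) (g : E) (v g) + lineDeriv ℝ (extendZero ψ.1) (g : E) (v g)
    have h3 := HasDerivAt.add h1 h2
    rw [extendZero_add, HasLineDerivAt.lineDeriv (f := extendZero φ.1 + extendZero ψ.1) h3,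
      h1.lineDeriv, h2.lineDeriv]
  map_smul' a φ := by
    ext g
    have h1 := hasLineDerivAt_coord φ.2 (g : E) g.isUnit (v g)
    change lineDeriv ℝ (extendZero (a • φ.1)) (g : E) (v g) =
      a • lineDeriv ℝ (extendZero φ.1) (g : E) (v g)
    have h3 := HasDerivAt.const_smul a h1
    rw [extendZero_smul, HasLineDerivAt.lineDeriv (f := a • extendZero φ.1) h3, h1.lineDeriv]

variable (E)

/-- The differential operators `f ↦ f * B` on the Lie group `Eˣ`, with Lie algebra `E`: an element
`X` of `E` acts by `(f * X)(g) = d/dt f(g exp(tX))` at `t = 0`, that is, by the derivative of `f` at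
`g` in the direction `gX`. The enveloping algebra of the complexification of `E` is the quotient
of the free algebra `ℂ⟨E⟩` by relations which hold for these operators, so that the operators `f ↦ f * B`
for `B` in the enveloping algebra are exactly the ones given by `B` in `ℂ⟨E⟩`. -/
def rightAct : FreeAlgebra ℂ E →ₐ[ℂ] Module.End ℂ (smoothUnits E) :=
  FreeAlgebra.lift ℂ fun X => fieldDerivEnd (LinearMap.mulRight ℝ X)

/-- Likewise the differential operators `f ↦ A * f`: an element `X` of `E` acts by
`(X * f)(g) = d/dt f(exp(tX) g)` at `t = 0`, the derivative of `f` at `g` in the direction `Xg`. Here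
the relations are those of the opposite enveloping algebra, which is identified with the
enveloping algebra by `X ↦ -X`. -/
def leftAct : FreeAlgebra ℂ E →ₐ[ℂ] Module.End ℂ (smoothUnits E) :=
  FreeAlgebra.lift ℂ fun X => fieldDerivEnd (LinearMap.mulLeft ℝ X)

end Smooth

/-! ### The Harish-Chandra function `Ξ` of `GL_m(D)` -/

/-- The value at `g ∈ GL_m(D)` of `e^{ρ(H(g))}`. Here `g = p k` is an Iwasawa decomposition, `p` upper
triangular, `k ∈ K`, and `ρ` is half the sum (with multiplicities) of the positive roots, so that
`e^{ρ(H(p))} = δ(p)^{1/2} = ∏_i |ν(p_ii)|^{((m+1)/2 - i) d}` with `i = 1, …, m` and `δ` the modulus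
character of the group of upper triangular matrices. The argument `abv` is `x ↦ |ν(x)|` on `D`. -/
def expRhoH {D : Type*} [Ring D] (abv : D → ℝ) (m d : ℕ)
    (K : Subgroup (Matrix (Fin m) (Fin m) D)ˣ) (g : (Matrix (Fin m) (Fin m) D)ˣ) : ℝ :=
  open Classical in
  if h : ∃ p : (Matrix (Fin m) (Fin m) D)ˣ, (∀ i j, j < i → p.1 i j = 0) ∧ ∃ k ∈ K, g = p * k
  then ∏ i : Fin m, abv (h.choose.1 i i) ^ (((m + 1 : ℝ) / 2 - ((i : ℕ) + 1)) * d)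
  else 0

/-- Harish-Chandra's function `Ξ(g) = ∫_K e^{ρ(H(kg))} dk`. -/
def xi {D : Type*} [Ring D] (abv : D → ℝ) (m d : ℕ)
    (K : Subgroup (Matrix (Fin m) (Fin m) D)ˣ) [MeasurableSpace K] (μ : MeasureTheory.Measure K)
    (g : (Matrix (Fin m) (Fin m) D)ˣ) : ℝ :=
  ∫ k : K, expRhoH abv m d K (k * g) ∂μ

/-- `σ(g) = log max(‖g‖, ‖g⁻¹‖)`. -/
def sigma {M : Type*} [Monoid M] (N : M → ℝ) (g : Mˣ) : ℝ :=
  Real.log (max (N (g : M)) (N ((g⁻¹ : Mˣ) : M)))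

/-- The weight `(1 + σ(g))^r / Ξ(g)`. -/
def hcWeight {M : Type*} [Monoid M] (N : M → ℝ) (Ξ : Mˣ → ℝ) (r : ℝ≥0) (g : Mˣ) : ℝ :=
  (1 + sigma N g) ^ (r : ℝ) / Ξ g

/-- Multiplication by a real function. -/
def weightMul {G : Type*} (w : G → ℝ) : (G → ℂ) →ₗ[ℂ] (G → ℂ) where
  toFun f g := (w g : ℂ) * f g
  map_add' f h := by
    funext g
    exact mul_add _ _ _
  map_smul' a f := by
    funext g
    exact mul_left_comm _ _ _

/-! ### Non-archimedean local fields -/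

section NonArchimedean

variable (F : Type*) [Field F] [ValuativeRel F] [TopologicalSpace F] [IsNonarchimedeanLocalField F]

/-- The absolute value of `F`, normalized so that a uniformizer has absolute value `1 / q`,
with `q` the cardinality of the residue field. -/
def absNA (x : F) : ℝ :=
  (WithZeroMulInt.toNNReal (e := (Nat.card 𝓀[F] : ℝ≥0)) (by exact_mod_cast Nat.card_pos.ne')
    (IsNonarchimedeanLocalField.valueGroupWithZeroIsoInt F (ValuativeRel.valuation F x)) : ℝ)

variable (D : Type*) [DivisionRing D] [Algebra F D]

/-- The ring of integers of `D`: the elements integral over the ring of integers of `F`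
(these already form a ring). -/
def integersNA : Subring D := Subring.closure {x : D | IsIntegral 𝒪[F] x}

/-- `K = GL_m(𝒪_D)`. -/
def maxCompactNA (m : ℕ) : Subgroup (Matrix (Fin m) (Fin m) D)ˣ :=
  (integersNA F D).matrix.toSubmonoid.units

/-- The vector space norm `max |ν(X_ij)|^{1/d}` on `M_m(D)`. -/
def normNA (m d : ℕ) (X : Matrix (Fin m) (Fin m) D) : ℝ :=
  ⨆ p : Fin m × Fin m, absNA F (reducedNormField F D d (X p.1 p.2)) ^ (1 / d : ℝ)

/-- The function `Ξ` of `GL_m(D)`. -/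
def xiNA (m d : ℕ) [MeasurableSpace (maxCompactNA F D m)]
    (μ : MeasureTheory.Measure (maxCompactNA F D m)) (g : (Matrix (Fin m) (Fin m) D)ˣ) : ℝ :=
  xi (fun x => absNA F (reducedNormField F D d x)) m d (maxCompactNA F D m) μ g

/-- Functions bi-invariant under `J`. -/
def biInvariant {G : Type*} [Group G] (J : Subgroup G) : Submodule ℂ (G → ℂ) where
  carrier := {f | ∀ j ∈ J, ∀ j' ∈ J, ∀ g, f (j * g * j') = f g}
  zero_mem' := fun _ _ _ _ _ => rfl
  add_mem' := fun hf hh j hj j' hj' g => congrArg₂ (· + ·) (hf j hj j' hj' g) (hh j hj j' hj' g)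
  smul_mem' := fun a _ hf j hj j' hj' g => congrArg (a * ·) (hf j hj j' hj' g)

/-- The compact open subgroups of `G`. -/
def CompactOpen (G : Type*) [Group G] [TopologicalSpace G] : Type _ :=
  {J : Subgroup G // IsOpen (J : Set G) ∧ IsCompact (J : Set G)}

variable [TopologicalSpace D]

/-- The space of functions `f` on `GL_m(D)` which are bi-invariant under `J` and such that
`sup (1 + σ)^r |f| / Ξ` is finite for all `r ≥ 0`, with the topology given by these seminorms. -/
abbrev HCNALevel (m d : ℕ) [MeasurableSpace (maxCompactNA F D m)]
    (μ : MeasureTheory.Measure (maxCompactNA F D m))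
    (J : CompactOpen (Matrix (Fin m) (Fin m) D)ˣ) : Type _ :=
  BoundedSpace (W := biInvariant J.1) fun r : ℝ≥0 =>
    (weightMul (hcWeight (normNA F D m d) (xiNA F D m d μ) r)).comp (biInvariant J.1).subtype

/-- The Harish-Chandra Schwartz space of `GL_m(D)`: the inductive limit over the compact
open subgroups. -/
abbrev HCNA (m d : ℕ) [MeasurableSpace (maxCompactNA F D m)]
    (μ : MeasureTheory.Measure (maxCompactNA F D m)) : Type _ :=
  IndLimit fun J : CompactOpen (Matrix (Fin m) (Fin m) D)ˣ =>
    ((biInvariant J.1).subtype.comp (BoundedSpace.incl _) : HCNALevel F D m d μ J →ₗ[ℂ] _)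

/-- The underlying function. -/
def HCNA.eval {m d : ℕ} [MeasurableSpace (maxCompactNA F D m)]
    {μ : MeasureTheory.Measure (maxCompactNA F D m)} (f : HCNA F D m d μ) :
    (Matrix (Fin m) (Fin m) D)ˣ → ℂ := IndLimit.eval _ f

/-- The Schwartz–Bruhat space of `M_m(D)`, with the discrete topology. -/
def SchwartzBruhatNA (m : ℕ) : Type _ := LocConstCompact (Matrix (Fin m) (Fin m) D)

instance (m : ℕ) : TopologicalSpace (SchwartzBruhatNA D m) := ⊥

/-- The underlying function. -/
def SchwartzBruhatNA.eval (m : ℕ) (f : SchwartzBruhatNA D m) : Matrix (Fin m) (Fin m) D → ℂ := f.1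

/-- The union of the `𝒵(s)` for `s ∈ I`, restricted to `GL_m(D)`. -/
abbrev GJRestrNA (m d : ℕ) (I : Set ℂ) : Type _ :=
  GJRestr (Units.val : (Matrix (Fin m) (Fin m) D)ˣ → Matrix (Fin m) (Fin m) D)
    (SchwartzBruhatNA.eval D m)
    (fun X => absNA F (reducedNormField F (Matrix (Fin m) (Fin m) D) (m * d) X)) (m * d) I

end NonArchimedean

/-! ### Archimedean local fields -/

section Archimedean

variable (F : Type*) [RCLike F]

/-- The normalized absolute value of `F` (the square of the usual one if `F` is complex). -/
def absArch (x : F) : ℝ := ‖x‖ ^ Module.finrank ℝ F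

variable (D : Type*) [DivisionRing D] [Algebra ℝ D]

variable {D} in
/-- The real part of an element of `D = ℝ`, `ℂ` or `ℍ`: the normalized trace of multiplication by `x`. -/
def reD (x : D) : ℝ := LinearMap.trace ℝ D (LinearMap.mulLeft ℝ x) / Module.finrank ℝ D

variable {D} in
/-- The principal involution of `D = ℝ`, `ℂ` or `ℍ` (the identity, the complex conjugation,
the quaternionic conjugation). -/
def principalInvolution (x : D) : D := algebraMap ℝ D (2 * reD x) - x

/-- `K = {g | g · ᵗḡ = 1}` (this set already is a subgroup). -/
def maxCompactArch (m : ℕ) : Subgroup (Matrix (Fin m) (Fin m) D)ˣ :=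
  Subgroup.closure {g | g.1 * (g.1.transpose.map principalInvolution) = 1}

/-- The norm `(∑ X_ij X̄_ij)^{1/2}` on `M_m(D)`. -/
def normArch (m : ℕ) (X : Matrix (Fin m) (Fin m) D) : ℝ :=
  Real.sqrt (∑ i, ∑ j, reD (X i j * principalInvolution (X i j)))

variable [Algebra F D]

/-- The function `Ξ` of `GL_m(D)`. -/
def xiArch (m d : ℕ) [MeasurableSpace (maxCompactArch D m)]
    (μ : MeasureTheory.Measure (maxCompactArch D m)) (g : (Matrix (Fin m) (Fin m) D)ˣ) : ℝ :=
  xi (fun x => absArch F (reducedNormField F D d x)) m d (maxCompactArch D m) μ g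

variable [FiniteDimensional ℝ D]

/-- The Harish-Chandra Schwartz space of `GL_m(D)`: the smooth functions `f` such that
`sup (1 + σ)^r |A f B| / Ξ` is finite for all `A`, `B` in the enveloping algebra and `r ≥ 0`, with the
topology given by these seminorms. -/
abbrev HCArch (m d : ℕ) [MeasurableSpace (maxCompactArch D m)]
    (μ : MeasureTheory.Measure (maxCompactArch D m)) : Type _ :=
  BoundedSpace (W := smoothUnits (Matrix (Fin m) (Fin m) D))
    fun i : (FreeAlgebra ℂ (Matrix (Fin m) (Fin m) D) × FreeAlgebra ℂ (Matrix (Fin m) (Fin m) D)) ×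
        ℝ≥0 =>
      (weightMul (hcWeight (normArch D m) (xiArch F D m d μ) i.2)).comp
        ((smoothUnits (Matrix (Fin m) (Fin m) D)).subtype.comp
          (leftAct _ i.1.1 * rightAct _ i.1.2))

/-- The underlying function. -/
def HCArch.eval {m d : ℕ} [MeasurableSpace (maxCompactArch D m)]
    {μ : MeasureTheory.Measure (maxCompactArch D m)} (f : HCArch F D m d μ) :
    (Matrix (Fin m) (Fin m) D)ˣ → ℂ := (BoundedSpace.incl _ f).1

/-- The union of the `𝒵(s)` for `s ∈ I`, restricted to `GL_m(D)`. -/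
abbrev GJRestrArch (m d : ℕ) (I : Set ℂ) : Type _ :=
  GJRestr (Units.val : (Matrix (Fin m) (Fin m) D)ˣ → Matrix (Fin m) (Fin m) D)
    (SchwartzFD.eval (E := Matrix (Fin m) (Fin m) D))
    (fun X => absArch F (reducedNormField F (Matrix (Fin m) (Fin m) D) (m * d) X)) (m * d) I

end Archimedean

/-! ### Number fields -/

section Global

open NumberField IsDedekindDomain MeasureTheory

variable (F : Type*) [Field F] [NumberField F]

/-- The diagonal embedding of `ℝ` in `F_∞ = ∏_{v ∣ ∞} F_v`. -/
def realToInf : ℝ →+* InfiniteAdeleRing F :=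
  ((InfiniteAdeleRing.ringEquiv_mixedSpace F).symm : mixedEmbedding.mixedSpace F →+* _).comp
    (algebraMap ℝ (mixedEmbedding.mixedSpace F))

variable (A : Type*) [Ring A] [Algebra F A]

/-- `𝔤(F_∞) = F_∞ ⊗ A`, for `𝔤 = A`. -/
def gInf : Type _ := InfiniteAdeleRing F ⊗[F] A

/-- `𝔤(𝔸_fin) = 𝔸_fin ⊗ A`. -/
def gFin : Type _ := FiniteAdeleRing (𝓞 F) F ⊗[F] A

instance : Ring (gInf F A) := inferInstanceAs (Ring (InfiniteAdeleRing F ⊗[F] A))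

instance : Ring (gFin F A) := inferInstanceAs (Ring (FiniteAdeleRing (𝓞 F) F ⊗[F] A))

instance : Algebra (InfiniteAdeleRing F) (gInf F A) :=
  inferInstanceAs (Algebra (InfiniteAdeleRing F) (InfiniteAdeleRing F ⊗[F] A))

instance : Algebra (FiniteAdeleRing (𝓞 F) F) (gFin F A) :=
  inferInstanceAs (Algebra (FiniteAdeleRing (𝓞 F) F) (FiniteAdeleRing (𝓞 F) F ⊗[F] A))

instance : Algebra ℝ (gInf F A) := Algebra.compHom _ (realToInf F)

instance : TopologicalSpace (gInf F A) := moduleTopology (InfiniteAdeleRing F) (gInf F A)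

instance : TopologicalSpace (gFin F A) := moduleTopology (FiniteAdeleRing (𝓞 F) F) (gFin F A)

instance [Module.Finite F A] : Module.Finite ℝ (gInf F A) := by
  let : Algebra ℝ (InfiniteAdeleRing F) := (realToInf F).toAlgebra
  have : IsScalarTower ℝ (InfiniteAdeleRing F) (gInf F A) := IsScalarTower.of_algebraMap_eq' rfl
  have : Module.Finite (InfiniteAdeleRing F) (gInf F A) :=
    inferInstanceAs (Module.Finite (InfiniteAdeleRing F) (InfiniteAdeleRing F ⊗[F] A))
  have : Module.Finite ℝ (InfiniteAdeleRing F) :=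
    Module.Finite.equiv (M := mixedEmbedding.mixedSpace F)
      { (InfiniteAdeleRing.ringEquiv_mixedSpace F).symm with
        map_smul' := fun c x => by
          change (InfiniteAdeleRing.ringEquiv_mixedSpace F).symm (c • x) =
            realToInf F c * (InfiniteAdeleRing.ringEquiv_mixedSpace F).symm x
          rw [Algebra.smul_def, map_mul]
          rfl }
  exact Module.Finite.trans (InfiniteAdeleRing F) _

/-- The adelic points `𝔤(𝔸) = 𝔤(F_∞) × 𝔤(𝔸_fin)`. -/
abbrev gAdele : Type _ := gInf F A × gFin F A

/-- The adelic points `G(𝔸) = G(F_∞) × G(𝔸_fin)` of the unit group `G` of `A`. -/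
def GAdele : Type _ := (gInf F A)ˣ × (gFin F A)ˣ

instance : Group (GAdele F A) := inferInstanceAs (Group ((gInf F A)ˣ × (gFin F A)ˣ))

instance : TopologicalSpace (GAdele F A) :=
  inferInstanceAs (TopologicalSpace ((gInf F A)ˣ × (gFin F A)ˣ))

instance : MeasurableSpace (GAdele F A) := borel _

instance : BorelSpace (GAdele F A) := ⟨rfl⟩

/-- The inclusion of `G(𝔸)` in `𝔤(𝔸)`. -/
def GAdele.val (g : GAdele F A) : gAdele F A := (g.1.val, g.2.val)

/-- The adelic absolute value of the reduced norm: `|ν(X)| = ∏_v |ν(X)_v|_v`, a product over all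
places, with normalized absolute values. -/
def absNuAdele (n : ℕ) (X : gAdele F A) : ℝ :=
  ‖reducedNorm F A n (InfiniteAdeleRing F) X.1‖ *
    ∏' v : HeightOneSpectrum (𝓞 F), ‖reducedNorm F A n (FiniteAdeleRing (𝓞 F) F) X.2 v‖

variable [Module.Finite F A]

/-- The map `f ↦ f ⊗ h` on Schwartz functions `f` on `𝔤(F_∞)`, for `h` locally constant
with compact support on `𝔤(𝔸_fin)`. -/
def tensorMap (h : LocConstCompact (gFin F A)) : SchwartzFD (gInf F A) →ₗ[ℂ] (gAdele F A → ℂ) where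
  toFun f X := SchwartzFD.eval f X.1 * h.1 X.2
  map_add' f f' := by
    funext X
    exact add_mul _ _ _
  map_smul' a f := by
    funext X
    exact mul_assoc _ _ _

/-- The Schwartz–Bruhat space of `𝔤(𝔸)`: the linear combinations of the functions `f ⊗ h`, with the
inductive limit topology. -/
abbrev SchwartzBruhatAdele : Type _ := IndLimit (tensorMap F A)

/-- Functions on `G(𝔸)` which are smooth in the archimedean variable. -/
def smoothAdele : Submodule ℂ (GAdele F A → ℂ) where
  carrier := {f | ∀ y : (gFin F A)ˣ, (fun x : (gInf F A)ˣ => f (x, y)) ∈ smoothUnits (gInf F A)}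
  zero_mem' := fun _ => (smoothUnits (gInf F A)).zero_mem
  add_mem' := fun hf hh y => (smoothUnits (gInf F A)).add_mem (hf y) (hh y)
  smul_mem' := fun a _ hf y => (smoothUnits (gInf F A)).smul_mem a (hf y)

variable {F A} in
/-- Restriction of `f` to the slice `G(F_∞) × {y}`. -/
def adeleSlice (f : smoothAdele F A) (y : (gFin F A)ˣ) : smoothUnits (gInf F A) :=
  ⟨fun x => f.1 (x, y), f.2 y⟩

/-- The operator `f ↦ f * X`, for `X` in the enveloping algebra of `𝔤(F_∞)_ℂ`. -/
def adeleAct (X : FreeAlgebra ℂ (gInf F A)) : Module.End ℂ (smoothAdele F A) where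
  toFun f := ⟨fun g => (rightAct (gInf F A) X (adeleSlice f g.2)).1 g.1,
    fun y => (rightAct (gInf F A) X (adeleSlice f y)).2⟩
  map_add' f f' := by
    ext g
    exact congrFun (congrArg Subtype.val
      (map_add (rightAct (gInf F A) X) (adeleSlice f g.2) (adeleSlice f' g.2))) g.1
  map_smul' a f := by
    ext g
    exact congrFun (congrArg Subtype.val
      (map_smul (rightAct (gInf F A) X) a (adeleSlice f g.2))) g.1

/-- Smooth functions on `G(𝔸)` which are right invariant under the subgroup `J` of `G(𝔸_fin)`. -/
def smoothRightInvariant (J : Subgroup (gFin F A)ˣ) : Submodule ℂ (smoothAdele F A) where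
  carrier := {f | ∀ x y, ∀ j ∈ J, f.1 (x, y * j) = f.1 (x, y)}
  zero_mem' := fun _ _ _ _ => rfl
  add_mem' := fun hf hh x y j hj => congrArg₂ (· + ·) (hf x y j hj) (hh x y j hj)
  smul_mem' := fun a _ hf x y j hj => congrArg (a * ·) (hf x y j hj)

/-- The space `𝒞(G(𝔸), J)` of smooth right `J`-invariant functions which are integrable together with
all their derivatives, with the topology of the seminorms `‖f * X‖_{L¹}`. -/
abbrev MFLLevel (μ : Measure (GAdele F A)) (J : CompactOpen (gFin F A)ˣ) : Type _ :=
  IntegrableSpace (W := smoothRightInvariant F A J.1) μ fun X : FreeAlgebra ℂ (gInf F A) =>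
    (smoothAdele F A).subtype.comp ((adeleAct F A X).comp (smoothRightInvariant F A J.1).subtype)

/-- The Müller–Finis–Lapid space `𝒞(G(𝔸))`: the inductive limit of the `𝒞(G(𝔸), J)` over
the compact open subgroups `J` of `G(𝔸_fin)`. -/
abbrev MFL (μ : Measure (GAdele F A)) : Type _ :=
  IndLimit fun J : CompactOpen (gFin F A)ˣ =>
    ((smoothAdele F A).subtype.comp
      ((smoothRightInvariant F A J.1).subtype.comp (IntegrableSpace.incl μ _)) :
        MFLLevel F A μ J →ₗ[ℂ] _)

/-- The underlying function. -/
def MFL.eval {μ : Measure (GAdele F A)} (f : MFL F A μ) : GAdele F A → ℂ := IndLimit.eval _ f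

/-- The union of the `𝒵(𝔤(𝔸), s)` for `s ∈ I`, restricted to `G(𝔸)`. -/
abbrev GJRestrAdele (n : ℕ) (I : Set ℂ) : Type _ :=
  GJRestr (GAdele.val F A) (IndLimit.eval (tensorMap F A)) (absNuAdele F A n) n I

end Global

end

end GodementJacquet

open GodementJacquet

/-!
Each inclusion is deduced from `GodementJacquet.isContinuousInclusion_of_lift`: since the source
carries a coinduced topology, it suffices to lift `(s, f) ↦ f_s` to a continuous map from
`I × 𝒮(𝔤)` to the target. The reduced norm enters only through `|ν|`. By `reducedNorm_pow` its
`n`-th power is the norm `N` of the regular representation (two `n`-th roots of the norm form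
agree up to a root of unity, so the determinant form of a splitting descends to `F`); hence `|ν|`
is continuous and multiplicative on the group, and `|ν|^e = |N|^{e/n}`.

*Local case.* If `kg = p k'` is an Iwasawa decomposition, the diagonal entries of `p` have size at
most that of `g`, and the exponents `((m+1)/2 - i) d` of `δ^{1/2}` are at most `(m-1)d/2`. Therefore
`Ξ(g)` is at least `|ν(g)|^{(m-1)d/2}` divided by a power of the size of `g` (`exists_le_xi`). The
weight `(1 + σ)^r / Ξ`, multiplied by `|ν|^{(m-1)d/2 + ε}` with `ε > 0`, then has polynomial growth,
the positive power of `|ν|` absorbing the logarithms in `σ` (`exists_hcWeight_reducedNorm_le`).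
Schwartz functions compensate this growth, and the exponent `s + (n-1)/2` is
`(m-1)d/2 + (s + (d-1)/2)`, which gives the condition `Re s > (1-d)/2`. For archimedean fields the
invariant differential operators map `φ |N|^z` to `φ' |N|^z`, where the Schwartz function `φ'`
depends continuously on `(z, φ)` (`exists_lift_fieldDerivEnd_normTwist`), so the same bound applies
to all derivatives. The argument for both kinds of fields uses only that the normalized absolute
value is a continuous multiplicative function with compact unit ball, and that `K` is compact and
contains rotations in the coordinate planes (`exists_iwasawa`).

*Global case.* With `z = (s + (n-1)/2)/n` the function `f_s` is `f |N|^z`, and `Re z > 1` exactly if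
`Re s > (n+1)/2`. What is needed is the absolute convergence of the integral of `|N|^τ` against a
Schwartz–Bruhat function for `τ > 1` (`exists_lintegral_adeleNorm_rpow_lt_top`). The archimedean
factor is an integral against the Haar measure `|N|⁻¹ dg` (`exists_lintegral_norm_rpow_lt_top`). The
finite part is a sum over the integral classes modulo the units of an order, which is bounded by an
Euler product (`exists_sum_finAbs_rpow_le`). At a place with residue field of `q` elements the
translates of the units of the order by inequivalent nonunits are disjoint sets of nonunits, of
measure proportional to `|N|`, and the proportion of nonunits is `O(1/q)` by the Schwartz–Zippel
lemma; so the nontrivial classes contribute `O(q^{-τ})` (`exists_sum_rpow_norm_le`). Finally, joint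
continuity in `(s, f)` for the inductive limit topologies is checked on the steps, because the
parameter space is locally compact (`continuous_indLimit_prod`).
-/

namespace GodementJacquet

noncomputable section

/-! ### Continuity into the function spaces -/

section

open Filter Topology

/-- To include the restrictions of the `f_s` continuously in `T` it suffices to lift
`(s, f) ↦ f_s` to a continuous map `I × S → T`: both topologies on the source are coinduced. -/
theorem isContinuousInclusion_of_lift {X S G T : Type*} [TopologicalSpace S] [TopologicalSpace T]
    {j : G → X} {ev : S → X → ℂ} {abv : X → ℝ} {n : ℕ} {I : Set ℂ} {evT : T → G → ℂ}
    (hinj : Function.Injective evT) (Φ : I × S → T) (hΦ : Continuous Φ)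
    (h : ∀ p : I × S, evT (Φ p) = twist abv n p.1 (ev p.2) ∘ j) :
    IsContinuousInclusion (GJRestr.eval : GJRestr j ev abv n I → G → ℂ) evT := by
  have hex : ∀ φ : GJRestr j ev abv n I, ∃ t, evT t = φ.eval := by
    rintro ⟨_, ⟨ψ, hψ⟩, rfl⟩
    obtain ⟨s, hs, f, rfl⟩ := Set.mem_iUnion₂.1 hψ
    exact ⟨Φ (⟨s, hs⟩, f), h _⟩
  choose i hi using hex
  refine ⟨i, ?_, hi⟩
  refine continuous_coinduced_dom.2 (continuous_coinduced_dom.2 ?_)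
  convert hΦ using 1
  funext p
  apply hinj
  rw [h]
  exact hi _

/-- The seminorms that define the topology of `BoundedSpace T`. -/
def BoundedSpace.seminorms {W ι G : Type*} [AddCommGroup W] [Module ℂ W]
    (T : ι → W →ₗ[ℂ] (G → ℂ)) : SeminormFamily ℂ (BoundedSpace T) ι := supSeminorm T

theorem BoundedSpace.withSeminorms {W ι G : Type*} [AddCommGroup W] [Module ℂ W] [Nonempty ι]
    (T : ι → W →ₗ[ℂ] (G → ℂ)) : WithSeminorms (BoundedSpace.seminorms T) := ⟨rfl⟩

/-- The seminorms that define the topology of `IntegrableSpace μ T`. -/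
def IntegrableSpace.seminorms {W ι G : Type*} [AddCommGroup W] [Module ℂ W] [MeasurableSpace G]
    (μ : MeasureTheory.Measure G) (T : ι → W →ₗ[ℂ] (G → ℂ)) :
    SeminormFamily ℂ (IntegrableSpace μ T) ι := l1Seminorm μ T

theorem IntegrableSpace.withSeminorms {W ι G : Type*} [AddCommGroup W] [Module ℂ W]
    [MeasurableSpace G] [Nonempty ι] (μ : MeasureTheory.Measure G) (T : ι → W →ₗ[ℂ] (G → ℂ)) :
    WithSeminorms (IntegrableSpace.seminorms μ T) := ⟨rfl⟩

/-- A map into a space topologized by sup seminorms is continuous if the seminorms of the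
differences tend to zero. -/
theorem BoundedSpace.continuous_of_tendsto {W ι G Z : Type*} [AddCommGroup W] [Module ℂ W]
    [Nonempty ι] [TopologicalSpace Z] {T : ι → W →ₗ[ℂ] (G → ℂ)} {Φ : Z → BoundedSpace T}
    (h : ∀ i z₀, Tendsto (fun z => ⨆ g, ‖T i (BoundedSpace.incl T (Φ z)) g -
      T i (BoundedSpace.incl T (Φ z₀)) g‖) (𝓝 z₀) (𝓝 0)) : Continuous Φ := by
  refine continuous_iff_continuousAt.2 fun z₀ => ?_
  refine ((BoundedSpace.withSeminorms T).tendsto_nhds _ _).2 fun i ε hε => ?_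
  filter_upwards [(h i z₀).eventually (gt_mem_nhds hε)] with z hz
  refine lt_of_eq_of_lt ?_ hz
  have : BoundedSpace.seminorms T i (Φ z - Φ z₀) =
      ⨆ g, ‖T i (BoundedSpace.incl T (Φ z - Φ z₀)) g‖ := rfl
  rw [this]
  simp only [map_sub, Pi.sub_apply]

/-- A map into a space topologized by `L¹` seminorms is continuous if the seminorms of the
differences tend to zero. -/
theorem IntegrableSpace.continuous_of_tendsto {W ι G Z : Type*} [AddCommGroup W] [Module ℂ W]
    [Nonempty ι] [TopologicalSpace Z] [MeasurableSpace G] {μ : MeasureTheory.Measure G}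
    {T : ι → W →ₗ[ℂ] (G → ℂ)} {Φ : Z → IntegrableSpace μ T}
    (h : ∀ i z₀, Tendsto (fun z => ∫ g, ‖T i (IntegrableSpace.incl μ T (Φ z)) g -
      T i (IntegrableSpace.incl μ T (Φ z₀)) g‖ ∂μ) (𝓝 z₀) (𝓝 0)) : Continuous Φ := by
  refine continuous_iff_continuousAt.2 fun z₀ => ?_
  refine ((IntegrableSpace.withSeminorms μ T).tendsto_nhds _ _).2 fun i ε hε => ?_
  filter_upwards [(h i z₀).eventually (gt_mem_nhds hε)] with z hz
  refine lt_of_eq_of_lt ?_ hz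
  have : IntegrableSpace.seminorms μ T i (Φ z - Φ z₀) =
      ∫ g, ‖T i (IntegrableSpace.incl μ T (Φ z - Φ z₀)) g‖ ∂μ := rfl
  rw [this]
  simp only [map_sub, Pi.sub_apply]

section IndLimit

variable {X ι : Type*} {E : ι → Type*} [∀ i, AddCommGroup (E i)] [∀ i, Module ℂ (E i)]

/-- For a family of linear maps out of the inductive limit, continuity in the parameter at a fixed
vector is checked on the vectors of the steps, which span. -/
theorem continuous_linear_indLimit_apply {Z Y : Type*} [TopologicalSpace Z] [TopologicalSpace Y]
    [AddCommGroup Y] [Module ℂ Y] [IsTopologicalAddGroup Y] (φ : ∀ i, E i →ₗ[ℂ] (X → ℂ))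
    (Φ : Z → IndLimit φ →ₗ[ℂ] Y) (h : ∀ i x, Continuous fun z => Φ z (toIndLimit φ i x))
    (f : IndLimit φ) : Continuous fun z => Φ z f := by
  obtain ⟨f, hf⟩ := f
  have := Submodule.iSup_induction' (fun i => LinearMap.range (φ i))
    (motive := fun f hf => Continuous fun z => Φ z (⟨f, hf⟩ : indLimitSub φ))
    (by rintro i _ ⟨x, rfl⟩; exact h i x)
    (by
      have : ∀ z, Φ z (⟨0, zero_mem _⟩ : indLimitSub φ) = 0 := fun z => (Φ z).map_zero
      simp only [this]
      exact continuous_const)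
    (by
      intro x y hx hy h1 h2
      have : ∀ z, Φ z (⟨x + y, add_mem hx hy⟩ : indLimitSub φ) =
          Φ z (⟨x, hx⟩ : indLimitSub φ) + Φ z (⟨y, hy⟩ : indLimitSub φ) :=
        fun z => (Φ z).map_add (⟨x, hx⟩ : indLimitSub φ) (⟨y, hy⟩ : indLimitSub φ)
      simp only [this]
      exact h1.add h2)
    hf
  exact this

variable [∀ i, TopologicalSpace (E i)]

instance (φ : ∀ i, E i →ₗ[ℂ] (X → ℂ)) : IsTopologicalAddGroup (IndLimit φ) :=
  topologicalAddGroup_sInf fun _ h => h.1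

instance (φ : ∀ i, E i →ₗ[ℂ] (X → ℂ)) : ContinuousSMul ℂ (IndLimit φ) :=
  continuousSMul_sInf fun _ h => h.2.1

instance (φ : ∀ i, E i →ₗ[ℂ] (X → ℂ)) : LocallyConvexSpace ℝ (IndLimit φ) :=
  LocallyConvexSpace.sInf fun _ h => h.2.2.1

theorem continuous_toIndLimit (φ : ∀ i, E i →ₗ[ℂ] (X → ℂ)) (i : ι) :
    Continuous (toIndLimit φ i) :=
  continuous_sInf_rng.2 fun _ h => h.2.2.2 i

/-- The topology of a single seminorm. -/
theorem exists_topology_of_seminorm {Y : Type*} [AddCommGroup Y] [Module ℂ Y] (p : Seminorm ℂ Y) :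
    ∃ _ : TopologicalSpace Y, IsTopologicalAddGroup Y ∧ ContinuousSMul ℂ Y ∧
      LocallyConvexSpace ℝ Y ∧ Continuous p ∧
      ∀ {Z : Type _} [TopologicalSpace Z] [AddCommGroup Z] [Module ℂ Z] [IsTopologicalAddGroup Z]
        (l : Z →ₗ[ℂ] Y), Continuous (fun x => p (l x)) → Continuous l := by
  let P : SeminormFamily ℂ Y Unit := fun _ => p
  let τ : TopologicalSpace Y := P.moduleFilterBasis.topology
  have hτ : WithSeminorms P := ⟨rfl⟩
  refine ⟨τ, hτ.topologicalAddGroup, hτ.continuousSMul, hτ.toLocallyConvexSpace,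
    hτ.continuous_seminorm (), fun l hl => ?_⟩
  exact hτ.continuous_of_continuous_comp l fun _ => hl

/-- A seminorm on an inductive limit is continuous if its restrictions to the steps are. -/
theorem continuous_seminorm_indLimit [∀ i, IsTopologicalAddGroup (E i)]
    (φ : ∀ i, E i →ₗ[ℂ] (X → ℂ)) (p : Seminorm ℂ (IndLimit φ))
    (hp : ∀ i, Continuous fun x => p (toIndLimit φ i x)) : Continuous p := by
  obtain ⟨τ, h1, h2, h3, h4, h5⟩ := exists_topology_of_seminorm p
  exact continuous_le_dom (sInf_le ⟨h1, h2, h3, fun i => h5 (toIndLimit φ i) (hp i)⟩) h4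

open scoped ComplexOrder in
/-- A family of linear maps out of an inductive limit, with a parameter in a locally compact space,
is jointly continuous if it is so on each step: near a parameter `s₀` with compact neighbourhood `U`,
a continuous seminorm `p` of the target is controlled by `f ↦ sup_{s ∈ U} p (Φ_s f)`. -/
theorem continuous_indLimit_prod {I Y : Type*} [TopologicalSpace I] [LocallyCompactSpace I]
    [TopologicalSpace Y] [AddCommGroup Y] [Module ℂ Y] [IsTopologicalAddGroup Y]
    [ContinuousSMul ℂ Y] [LocallyConvexSpace ℝ Y]
    [∀ i, IsTopologicalAddGroup (E i)] (φ : ∀ i, E i →ₗ[ℂ] (X → ℂ))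
    (Φ : I → IndLimit φ →ₗ[ℂ] Y)
    (h : ∀ i, Continuous fun q : I × E i => Φ q.1 (toIndLimit φ i q.2)) :
    Continuous fun q : I × IndLimit φ => Φ q.1 q.2 := by
  have hc : ∀ f, Continuous fun s => Φ s f :=
    continuous_linear_indLimit_apply φ Φ fun i x => (h i).comp (Continuous.prodMk_left x)
  refine continuous_iff_continuousAt.2 fun ⟨s₀, f₀⟩ => ?_
  have : LocallyConvexSpace ℂ Y := by
    rw [locallyConvexSpace_iff_exists_convex_subset_zero]
    simp_rw [convex_RCLike_iff_convex_real]
    exact (locallyConvexSpace_iff_exists_convex_subset_zero ℝ Y).1 inferInstance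
  have : ContinuousSMul ℝ Y := ⟨by
    have : Continuous fun q : ℝ × Y => ((q.1 : ℂ)) • q.2 := by fun_prop
    simpa using this⟩
  -- a locally convex space has a defining family of continuous complex seminorms
  refine ((with_gaugeSeminormFamily (𝕜 := ℂ) (E := Y)).tendsto_nhds _ _).2 fun i ε hε => ?_
  generalize hpq : gaugeSeminormFamily ℂ Y i = p
  have hp : Continuous p := by
    rw [← hpq]
    exact (with_gaugeSeminormFamily (𝕜 := ℂ) (E := Y)).continuous_seminorm i
  obtain ⟨U, hU, hU0⟩ := exists_compact_mem_nhds s₀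
  have hb : ∀ f, BddAbove (Set.range fun s : U => p (Φ s f)) := fun f => by
    have := (hU.image (hp.comp (hc f))).bddAbove
    rwa [Set.image_eq_range] at this
  -- the supremum over `U` is again a seminorm; its continuity on each step uses the compactness
  -- of `U`
  let P : Seminorm ℂ (IndLimit φ) := Seminorm.of (fun f => ⨆ s : U, p (Φ s f))
    (fun f g => by
      refine Real.iSup_le (fun s => ?_) (add_nonneg (Real.iSup_nonneg fun _ => apply_nonneg _ _)
          (Real.iSup_nonneg fun _ => apply_nonneg _ _))
      rw [map_add]
      exact (map_add_le_add p _ _).trans (add_le_add (le_ciSup (hb f) s) (le_ciSup (hb g) s)))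
    (fun c f => by
      simp only [map_smul, map_smul_eq_mul]
      rw [Real.mul_iSup_of_nonneg (norm_nonneg c)])
  have hle : ∀ s ∈ U, ∀ f, p (Φ s f) ≤ P f := fun s hs f => le_ciSup (hb f) ⟨s, hs⟩
  have hP : Continuous P := by
    refine continuous_seminorm_indLimit φ P fun i => ?_
    have h0 : ContinuousAt (P.comp (toIndLimit φ i)) 0 := by
      rw [Metric.continuousAt_iff']
      intro δ hδ
      have h1 : ∀ᶠ x in 𝓝 (0 : E i), ∀ s ∈ U, p (Φ s (toIndLimit φ i x)) < δ / 2 := by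
        refine hU.eventually_forall_of_forall_eventually fun s _ => ?_
        have h2 : ContinuousAt (fun q : E i × I => p (Φ q.2 (toIndLimit φ i q.1))) (0, s) :=
          (hp.comp ((h i).comp continuous_swap)).continuousAt
        refine h2.eventually (gt_mem_nhds ?_)
        simpa using half_pos hδ
      filter_upwards [h1] with x hx
      rw [map_zero, dist_zero_right, Real.norm_of_nonneg (apply_nonneg _ _)]
      refine lt_of_le_of_lt ?_ (half_lt_self hδ)
      exact Real.iSup_le (fun s => (hx s s.2).le) (half_pos hδ).le
    exact Seminorm.continuous_of_continuousAt_zero h0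
  -- `p (Φ_s f - Φ_{s₀} f₀) ≤ P (f - f₀) + p (Φ_s f₀ - Φ_{s₀} f₀)`
  have h1 : ∀ᶠ q : I × IndLimit φ in 𝓝 (s₀, f₀), P (q.2 - f₀) < ε / 2 := by
    have : Continuous fun q : I × IndLimit φ => P (q.2 - f₀) :=
      hP.comp (continuous_snd.sub continuous_const)
    refine this.continuousAt.eventually (gt_mem_nhds ?_)
    simpa using half_pos hε
  have h2 : ∀ᶠ q : I × IndLimit φ in 𝓝 (s₀, f₀), p (Φ q.1 f₀ - Φ s₀ f₀) < ε / 2 := by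
    have : Continuous fun q : I × IndLimit φ => p (Φ q.1 f₀ - Φ s₀ f₀) :=
      hp.comp (((hc f₀).comp continuous_fst).sub continuous_const)
    refine this.continuousAt.eventually (gt_mem_nhds ?_)
    simpa using half_pos hε
  have h3 : ∀ᶠ q : I × IndLimit φ in 𝓝 (s₀, f₀), q.1 ∈ U :=
    continuous_fst.continuousAt.eventually hU0
  filter_upwards [h1, h2, h3] with q hq1 hq2 hq3
  have : Φ q.1 q.2 - Φ s₀ f₀ = Φ q.1 (q.2 - f₀) + (Φ q.1 f₀ - Φ s₀ f₀) := by
    rw [map_sub]; abel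
  rw [this]
  calc _ ≤ p (Φ q.1 (q.2 - f₀)) + p (Φ q.1 f₀ - Φ s₀ f₀) := map_add_le_add p _ _
    _ < ε := by linarith [hle _ hq3 (q.2 - f₀)]

end IndLimit

end

/-! ### Powers of the reduced norm -/

section

open Algebra.TensorProduct Module

/-- A scalar extension of a central simple algebra is simple: an element of a nonzero two-sided ideal
with the fewest nonzero coordinates in a basis of `K` has, after normalization, central coordinates. -/
theorem isSimpleRing_tensorProduct (F K A : Type*) [Field F] [Field K] [Algebra F K] [Ring A]
    [Algebra F A] [Algebra.IsCentral F A] [IsSimpleRing A] : IsSimpleRing (K ⊗[F] A) := by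
  classical
  have : Nontrivial (K ⊗[F] A) :=
    Algebra.TensorProduct.nontrivial_of_algebraMap_injective_of_flat_left F K A
      (algebraMap F A).injective
  refine .of_eq_bot_or_eq_top fun I => or_iff_not_imp_left.2 fun hI => ?_
  let κ := Basis.ofVectorSpace F K
  let c := TensorProduct.equivFinsuppOfBasisLeft (N := A) κ
  have hc : ∀ (b b' : A) (x : K ⊗[F] A) i, c ((1 ⊗ₜ b) * x * (1 ⊗ₜ b')) i = b * c x i * b' := by
    intro b b' x i
    induction x with
    | zero => simp
    | tmul k a => simp [c, mul_assoc]
    | add x y hx hy => simp only [mul_add, add_mul, map_add, Finsupp.add_apply, hx, hy]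
  obtain ⟨x₀, hx₀, hx₀'⟩ : ∃ x ∈ I, x ≠ 0 := by
    by_contra! h
    exact hI (eq_bot_iff.2 fun x hx => (TwoSidedIdeal.mem_bot _).2 (h x hx))
  -- a nonzero element `x` of `I` with the fewest nonzero coordinates
  have hex : ∃ n, ∃ x ∈ I, x ≠ 0 ∧ (c x).support.card = n := ⟨_, x₀, hx₀, hx₀', rfl⟩
  obtain ⟨x, hxI, hx0, hxn⟩ := Nat.find_spec hex
  have hmin : ∀ y ∈ I, (c y).support.card < (c x).support.card → y = 0 := by
    intro y hy hlt
    by_contra h0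
    exact Nat.find_min hex (hxn ▸ hlt) ⟨y, hy, h0, rfl⟩
  obtain ⟨i₀, hi₀⟩ : ∃ i, c x i ≠ 0 := by
    by_contra! h
    exact hx0 (c.injective (by ext i; simp [h i]))
  -- the `i₀`-th coordinates of the elements of `I` supported where `x` is; by simplicity this
  -- ideal of `A` contains `1`
  let J : TwoSidedIdeal A := TwoSidedIdeal.mk'
    {a | ∃ y ∈ I, (∀ i, c x i = 0 → c y i = 0) ∧ c y i₀ = a}
    ⟨0, I.zero_mem, by simp, by simp⟩
    (by
      rintro _ _ ⟨y, hy, h1, rfl⟩ ⟨z, hz, h2, rfl⟩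
      exact ⟨y + z, I.add_mem hy hz, fun i hi => by simp [h1 i hi, h2 i hi], by simp⟩)
    (by
      rintro _ ⟨y, hy, h1, rfl⟩
      exact ⟨-y, I.neg_mem hy, fun i hi => by simp [h1 i hi], by simp⟩)
    (by
      rintro a _ ⟨y, hy, h1, rfl⟩
      refine ⟨(1 ⊗ₜ a) * y * (1 ⊗ₜ 1), I.mul_mem_right _ _ (I.mul_mem_left _ _ hy),
        fun i hi => by simp [hc, h1 i hi], by simp [hc]⟩)
    (by
      rintro _ a ⟨y, hy, h1, rfl⟩
      refine ⟨(1 ⊗ₜ 1) * y * (1 ⊗ₜ a), I.mul_mem_right _ _ (I.mul_mem_left _ _ hy),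
        fun i hi => by simp [hc, h1 i hi], by simp [hc]⟩)
  have hJ : (1 : A) ∈ J := IsSimpleRing.one_mem_of_ne_zero_mem J hi₀
    ((TwoSidedIdeal.mem_mk' _ _ _ _ _ _ _).2 ⟨x, hxI, fun _ h => h, rfl⟩)
  obtain ⟨y, hyI, hy1, hy2⟩ := (TwoSidedIdeal.mem_mk' _ _ _ _ _ _ _).1 hJ
  -- the commutator of `y` with `1 ⊗ b` is in `I` and has no `i₀`-th coordinate, hence is zero by
  -- minimality
  have hcomm : ∀ (b : A) i, b * c y i = c y i * b := by
    intro b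
    have h0 : (1 ⊗ₜ b) * y * (1 ⊗ₜ 1) - (1 ⊗ₜ 1) * y * (1 ⊗ₜ b) = 0 := by
      refine hmin _ (I.sub_mem (I.mul_mem_right _ _ (I.mul_mem_left _ _ hyI))
        (I.mul_mem_right _ _ (I.mul_mem_left _ _ hyI))) (Finset.card_lt_card ?_)
      refine ⟨fun i => ?_, fun h => ?_⟩
      · simp only [Finsupp.mem_support_iff, map_sub, Finsupp.sub_apply, hc]
        intro h h1
        exact h (by simp [hy1 i h1])
      · have := h (Finsupp.mem_support_iff.2 hi₀)
        simp [hc, hy2] at this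
    intro i
    have := congrArg (fun z => c z i) h0
    simpa [hc, sub_eq_zero] using this
  have hcen : ∀ i, ∃ f : F, c y i = algebraMap F A f := fun i =>
    (Algebra.IsCentral.mem_center_iff F).1 (Subalgebra.mem_center_iff.2 fun b => hcomm b i)
  choose f hf using hcen
  -- with coordinates in `F`, the element `y` lies in `K ⊗ 1`, hence is a unit
  have hy : ∃ k : K, y = k ⊗ₜ 1 := by
    refine ⟨(c y).sum fun i _ => f i • κ i, ?_⟩
    have h1 : y = (c y).sum fun i a => κ i ⊗ₜ a := by
      conv_lhs => rw [← c.symm_apply_apply y]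
      exact TensorProduct.equivFinsuppOfBasisLeft_symm_apply κ _
    conv_lhs => rw [h1]
    rw [Finsupp.sum, Finsupp.sum, TensorProduct.sum_tmul]
    refine Finset.sum_congr rfl fun i _ => ?_
    rw [hf i, Algebra.algebraMap_eq_smul_one, TensorProduct.smul_tmul]
  obtain ⟨k, hk⟩ := hy
  have hk0 : k ≠ 0 := by
    rintro rfl
    rw [hk] at hy2
    simp at hy2
  have h1 : (1 : K ⊗[F] A) ∈ I := by
    have := I.mul_mem_left (k⁻¹ ⊗ₜ 1) _ hyI
    rw [hk, tmul_mul_tmul, inv_mul_cancel₀ hk0, mul_one] at this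
    exact this
  exact eq_top_iff.2 fun z _ => by simpa using I.mul_mem_left z _ h1

/-- Central simple algebras of dimension `n²` split over an algebraic closure: the scalar
extension is simple, hence a matrix algebra, whose size is determined by the dimension. -/
theorem exists_algHom_matrix_algebraicClosure (F A : Type*) [Field F] [Ring A] [Algebra F A]
    [Algebra.IsCentral F A] [IsSimpleRing A] [FiniteDimensional F A] {n : ℕ}
    (hn : finrank F A = n ^ 2) :
    Nonempty (A →ₐ[F] Matrix (Fin n) (Fin n) (AlgebraicClosure F)) := by
  have := isSimpleRing_tensorProduct F (AlgebraicClosure F) A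
  obtain ⟨k, _, ⟨e⟩⟩ := IsSimpleRing.exists_algEquiv_matrix_of_isAlgClosed (AlgebraicClosure F)
    (AlgebraicClosure F ⊗[F] A)
  have h := e.toLinearEquiv.finrank_eq
  rw [finrank_baseChange, hn, finrank_matrix] at h
  have hk : n = k := by
    simp only [Fintype.card_fin, finrank_self, mul_one, ← sq] at h
    exact Nat.pow_left_injective two_ne_zero h
  subst hk
  exact ⟨(e.toAlgHom.restrictScalars F).comp includeRight⟩

/-- Left multiplication by `y` on `M_n(K)` is the Kronecker product of `y` with the identity. -/
theorem norm_matrix {K : Type*} [CommRing K] {n : Type*} [Fintype n] [DecidableEq n]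
    (y : Matrix n n K) : Algebra.norm K y = y.det ^ Fintype.card n := by
  have : Algebra.leftMulMatrix (Matrix.stdBasis K n n) y =
      Matrix.kroneckerMap (· * ·) y (1 : Matrix n n K) := by
    ext ⟨i, j⟩ ⟨k, l⟩
    rw [Algebra.leftMulMatrix_apply, LinearMap.toMatrix_apply, Matrix.stdBasis_eq_single]
    change (y * Matrix.single k l (1 : K) : Matrix n n K) i j = _
    by_cases h : j = l
    · subst h
      simp [Matrix.mul_apply, Matrix.single_apply]
    · simp [Matrix.mul_apply, h, Ne.symm h]
  rw [Algebra.norm_eq_matrix_det (Matrix.stdBasis K n n), this, Matrix.det_kronecker]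
  simp

section NormPoly

variable {F : Type*} [Field F] {A : Type*} [Ring A] [Algebra F A] {ι : Type*} [Fintype ι]
  [DecidableEq ι] (b : Basis ι F A)

/-- The norm form of `A` in the coordinates of a basis `b`: the determinant of left multiplication
by the generic element. -/
def normPoly : MvPolynomial ι F :=
  (∑ i, (MvPolynomial.X i : MvPolynomial ι F) •
    (Algebra.leftMulMatrix b (b i)).map MvPolynomial.C).det

theorem leftMulMatrix_tensorProduct (R : Type*) [CommRing R] [Algebra F R] (x : R ⊗[F] A) :
    Algebra.leftMulMatrix (Algebra.TensorProduct.basis R b) x =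
      ∑ i, (Algebra.TensorProduct.basis R b).repr x i •
        (Algebra.leftMulMatrix b (b i)).map (algebraMap F R) := by
  have h : ∀ i, Algebra.leftMulMatrix (Algebra.TensorProduct.basis R b)
      (Algebra.TensorProduct.basis R b i) =
        (Algebra.leftMulMatrix b (b i)).map (algebraMap F R) := by
    intro i
    ext k l
    simp [Algebra.leftMulMatrix_apply, LinearMap.toMatrix_apply]
  conv_lhs => rw [← (Algebra.TensorProduct.basis R b).sum_repr x]
  simp only [map_sum, map_smul, h]

/-- Over any commutative `F`-algebra the norm is the value of the norm form at the coordinates. -/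
theorem norm_eq_aeval_normPoly (R : Type*) [CommRing R] [Algebra F R] (x : R ⊗[F] A) :
    Algebra.norm R x =
      MvPolynomial.aeval (fun i => (Algebra.TensorProduct.basis R b).repr x i) (normPoly b) := by
  rw [Algebra.norm_eq_matrix_det (Algebra.TensorProduct.basis R b), leftMulMatrix_tensorProduct,
    normPoly, AlgHom.map_det]
  congr 1
  ext k l
  simp [Matrix.sum_apply]

variable {n : ℕ} (ρ : A →ₐ[F] Matrix (Fin n) (Fin n) (AlgebraicClosure F))

/-- The determinant of the generic element of `A` under a splitting representation `ρ`. -/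
def detPoly : MvPolynomial ι (AlgebraicClosure F) :=
  (∑ i, (MvPolynomial.X i : MvPolynomial ι (AlgebraicClosure F)) • (ρ (b i)).map MvPolynomial.C).det

theorem splitMap_tmul (R : Type*) [CommRing R] [Algebra F R] (r : R) (a : A) :
    splitMap F A n R ρ (r ⊗ₜ a) = (ρ a).map fun c => r ⊗ₜ[F] c := by
  have h : splitMap F A n R ρ (r ⊗ₜ a) =
      algebraMap (R ⊗[F] AlgebraicClosure F) _ (r ⊗ₜ 1) * (ρ a).map fun c => 1 ⊗ₜ[F] c :=
    Algebra.TensorProduct.lift_tmul _ _ _ _ _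
  rw [h]
  ext k l
  simp [Matrix.algebraMap_eq_diagonal, Matrix.diagonal_mul]

omit [DecidableEq ι] in
/-- The determinant of the image of a point under the splitting map is the value of the
determinant form at the coordinates of the point. -/
theorem det_splitMap (R : Type*) [CommRing R] [Algebra F R] (x : R ⊗[F] A) :
    (splitMap F A n R ρ x).det =
      MvPolynomial.eval₂Hom
        (includeRight : AlgebraicClosure F →ₐ[F] R ⊗[F] AlgebraicClosure F).toRingHom
        (fun i => ((Algebra.TensorProduct.basis R b).repr x i) ⊗ₜ 1) (detPoly b ρ) := by
  rw [detPoly, RingHom.map_det]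
  congr 1
  conv_lhs => rw [← (Algebra.TensorProduct.basis R b).sum_repr x]
  simp only [Algebra.TensorProduct.basis_apply, TensorProduct.smul_tmul', smul_eq_mul, mul_one,
    map_sum]
  ext k l
  simp [Matrix.sum_apply, splitMap_tmul]

/-- Over the algebraic closure the determinant form is an `n`-th root of the norm form, because
the norm of `M_n` is the `n`-th power of the determinant. -/
theorem detPoly_pow [Algebra.IsCentral F A] [IsSimpleRing A] (hn : finrank F A = n ^ 2) :
    detPoly b ρ ^ n = MvPolynomial.map (algebraMap F (AlgebraicClosure F)) (normPoly b) := by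
  have := isSimpleRing_tensorProduct F (AlgebraicClosure F) A
  have : FiniteDimensional F A := Module.Finite.of_basis b
  have hn0 : n ≠ 0 := by
    rintro rfl
    exact (finrank_pos (R := F) (M := A)).ne' (by simpa using hn)
  have : NeZero n := ⟨hn0⟩
  -- compare values: the point with coordinates `c` is mapped to `M_n` isomorphically by `l`
  refine MvPolynomial.funext fun c => ?_
  let l : AlgebraicClosure F ⊗[F] A →ₐ[AlgebraicClosure F] Matrix (Fin n) (Fin n) (AlgebraicClosure F) :=
    Algebra.TensorProduct.lift (Algebra.ofId _ _) ρ fun r _ => Algebra.commutes r _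
  have hl : Function.Bijective l := by
    have h1 : Function.Injective l := l.toRingHom.injective
    refine ⟨h1, ?_⟩
    refine (LinearMap.injective_iff_surjective_of_finrank_eq_finrank (f := l.toLinearMap) ?_).1 h1
    rw [finrank_baseChange, hn, finrank_matrix]
    simp [sq]
  let x : AlgebraicClosure F ⊗[F] A :=
    ∑ i, c i • (Algebra.TensorProduct.basis (AlgebraicClosure F) b) i
  have h2 : Algebra.norm (AlgebraicClosure F) x = Algebra.norm (AlgebraicClosure F) (l x) := by
    exact (Algebra.norm_eq_of_algEquiv (AlgEquiv.ofBijective l hl) x).symm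
  have hrepr : ∀ i, (Algebra.TensorProduct.basis (AlgebraicClosure F) b).repr x i = c i := by
    intro i
    simp only [x]
    rw [Basis.repr_sum_self]
  have h3 : l x = ∑ i, c i • ρ (b i) := by
    have h : ∀ a, l (1 ⊗ₜ a) = ρ a := fun a =>
      (Algebra.TensorProduct.lift_tmul _ _ _ _ _).trans (by simp)
    simp only [x, map_sum, map_smul, Algebra.TensorProduct.basis_apply, h]
  rw [norm_eq_aeval_normPoly b, norm_matrix, h3, Fintype.card_fin] at h2
  simp only [hrepr] at h2
  rw [MvPolynomial.eval_map, ← MvPolynomial.aeval_def, h2, map_pow, detPoly, RingHom.map_det]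
  congr 2
  ext k l
  simp [Matrix.sum_apply]

omit [DecidableEq ι] in
/-- The determinant form is `1` at the unit element. -/
theorem eval_detPoly_one : MvPolynomial.eval (fun i => algebraMap F (AlgebraicClosure F) (b.repr 1 i))
    (detPoly b ρ) = 1 := by
  rw [detPoly, RingHom.map_det]
  have h : ρ (∑ i, b.repr 1 i • b i) = 1 := by rw [b.sum_repr, map_one]
  simp only [map_sum, map_smul] at h
  rw [← Matrix.det_one (n := Fin n) (R := AlgebraicClosure F), ← h]
  congr 1
  ext k l
  simp only [Matrix.sum_apply, RingHom.mapMatrix_apply, Matrix.map_apply, map_sum, Matrix.smul_apply,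
    smul_eq_mul, map_mul, MvPolynomial.eval_X, MvPolynomial.eval_C, Algebra.smul_def (A := AlgebraicClosure F)]

/-- The `n`-th roots of a polynomial over a field of characteristic zero are determined by their
value at a point where it is nonzero: they differ by a root of unity. -/
theorem eq_of_pow_eq_of_eval_eq_one {σ K : Type*} [Field K] [IsAlgClosed K] [CharZero K] {n : ℕ}
    (hn : n ≠ 0) {P Q : MvPolynomial σ K} (h : P ^ n = Q ^ n) (c : σ → K)
    (hP : MvPolynomial.eval c P = 1) (hQ : MvPolynomial.eval c Q = 1) : P = Q := by
  have : NeZero (n : K) := ⟨by exact_mod_cast hn⟩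
  obtain ⟨ζ, hζ⟩ := HasEnoughRootsOfUnity.exists_primitiveRoot K n
  have hζ' : IsPrimitiveRoot (MvPolynomial.C (σ := σ) ζ) n :=
    hζ.map_of_injective (MvPolynomial.C_injective σ K)
  have h1 := hζ'.pow_sub_pow_eq_prod_sub_mul P Q (Nat.pos_of_ne_zero hn)
  rw [h, sub_self, eq_comm, Finset.prod_eq_zero_iff] at h1
  obtain ⟨ξ, hξ, h2⟩ := h1
  have hξ1 : ξ ^ n = 1 := (Polynomial.mem_nthRootsFinset (Nat.pos_of_ne_zero hn) 1).1 hξ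
  obtain ⟨z, hz, rfl⟩ := MvPolynomial.isUnit_iff_eq_C_of_isReduced.1 (IsUnit.of_pow_eq_one hξ1 hn)
  have h3 := congrArg (MvPolynomial.eval c) h2
  have hz1 : z = 1 := by
    rw [map_zero, map_sub, map_mul, MvPolynomial.eval_C, hP, hQ, mul_one] at h3
    exact (sub_eq_zero.1 h3).symm
  simpa [hz1, sub_eq_zero] using h2

/-- The determinant form descends to `F`: it is the `n`-th root of the norm form with value `1` at
the unit element, hence is fixed by the Galois group. -/
theorem exists_map_eq_detPoly [CharZero F] [Algebra.IsCentral F A] [IsSimpleRing A]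
    (hn : finrank F A = n ^ 2) :
    ∃ P : MvPolynomial ι F, MvPolynomial.map (algebraMap F (AlgebraicClosure F)) P = detPoly b ρ := by
  have : FiniteDimensional F A := Module.Finite.of_basis b
  have hn0 : n ≠ 0 := by
    rintro rfl
    exact (finrank_pos (R := F) (M := A)).ne' (by simpa using hn)
  have : CharZero (AlgebraicClosure F) := charZero_of_injective_algebraMap
    (algebraMap F (AlgebraicClosure F)).injective
  have : IsGalois F (AlgebraicClosure F) := {}
  have hfix : ∀ σ : AlgebraicClosure F ≃ₐ[F] AlgebraicClosure F,
      MvPolynomial.map (σ : AlgebraicClosure F →+* AlgebraicClosure F) (detPoly b ρ) =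
        detPoly b ρ := by
    intro σ
    refine eq_of_pow_eq_of_eval_eq_one hn0 ?_ _ ?_ (eval_detPoly_one b ρ)
    · rw [← map_pow, detPoly_pow b ρ hn, MvPolynomial.map_map]
      congr 2
      ext x
      simp
    · have h1 : σ _ = σ 1 := congrArg σ (eval_detPoly_one b ρ)
      rw [map_one σ] at h1
      rw [← h1, MvPolynomial.eval_map, ← RingHom.coe_coe σ, MvPolynomial.eval,
        MvPolynomial.coe_eval₂Hom, MvPolynomial.hom_eval₂]
      congr 1
      funext i
      simp
  -- the coefficients are fixed by the Galois group, hence in `F`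
  have := (MvPolynomial.mem_range_map_iff_coeffs_subset
    (f := algebraMap F (AlgebraicClosure F)) (x := detPoly b ρ)).2 (by
      intro a ha
      obtain ⟨m, hm, rfl⟩ := MvPolynomial.mem_coeffs_iff.1 ha
      have := (InfiniteGalois.mem_bot_iff_fixed (k := F) (MvPolynomial.coeff m (detPoly b ρ))).2
        fun σ => by
          have := congrArg (MvPolynomial.coeff m) (hfix σ)
          rw [MvPolynomial.coeff_map] at this
          exact this
      exact IntermediateField.mem_bot.1 this)
  exact this

end NormPoly

/-- The `n`-th power of the reduced norm is the norm. -/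
theorem reducedNorm_pow (F : Type*) [Field F] [CharZero F] (A : Type*) [Ring A] [Algebra F A]
    [Algebra.IsCentral F A] [IsSimpleRing A] [FiniteDimensional F A] {n : ℕ}
    (hn : finrank F A = n ^ 2) (R : Type*) [CommRing R] [Algebra F R] (x : R ⊗[F] A) :
    reducedNorm F A n R x ^ n = Algebra.norm R x := by
  let b := Module.finBasis F A
  have hdet : ∀ ρ : A →ₐ[F] Matrix (Fin n) (Fin n) (AlgebraicClosure F),
      (splitMap F A n R ρ x).det ^ n = Algebra.norm R x ⊗ₜ 1 := by
    intro ρ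
    rw [det_splitMap b, ← map_pow, detPoly_pow b ρ hn, norm_eq_aeval_normPoly b,
      MvPolynomial.coe_eval₂Hom, MvPolynomial.eval₂_map, MvPolynomial.aeval_def]
    have h := MvPolynomial.hom_eval₂ (normPoly b) (algebraMap F R)
      (includeLeft : R →ₐ[F] R ⊗[F] AlgebraicClosure F).toRingHom
      (fun i => (Algebra.TensorProduct.basis R b).repr x i)
    refine Eq.trans ?_ h.symm
    congr 1
    ext r
    simp
  -- the determinant form has coefficients in `F`, so the determinant comes from `R`
  have hex : ∃ r : R, ∃ ρ : A →ₐ[F] Matrix (Fin n) (Fin n) (AlgebraicClosure F),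
      r ⊗ₜ[F] (1 : AlgebraicClosure F) = (splitMap F A n R ρ x).det := by
    obtain ⟨ρ⟩ := exists_algHom_matrix_algebraicClosure F A hn
    obtain ⟨P, hP⟩ := exists_map_eq_detPoly b ρ hn
    refine ⟨MvPolynomial.aeval (fun i => (Algebra.TensorProduct.basis R b).repr x i) P, ρ, ?_⟩
    rw [det_splitMap b, ← hP, MvPolynomial.coe_eval₂Hom, MvPolynomial.eval₂_map,
      MvPolynomial.aeval_def]
    have h := MvPolynomial.hom_eval₂ P (algebraMap F R)
      (includeLeft : R →ₐ[F] R ⊗[F] AlgebraicClosure F).toRingHom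
      (fun i => (Algebra.TensorProduct.basis R b).repr x i)
    refine Eq.trans h ?_
    congr 1
    ext r
    simp
  -- whichever splitting and root are chosen, the `n`-th power is the norm by `hdet`
  obtain ⟨ρ, hρ⟩ := hex.choose_spec
  have hr : reducedNorm F A n R x = hex.choose := by rw [reducedNorm, dif_pos hex]
  have hinj : Function.Injective (includeLeft : R →ₐ[F] R ⊗[F] AlgebraicClosure F) :=
    includeLeft_injective (algebraMap F (AlgebraicClosure F)).injective
  apply hinj
  rw [hr, map_pow]
  refine Eq.trans ?_ (hdet ρ)
  rw [← hρ]
  rfl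

theorem reducedNormField_pow (F : Type*) [Field F] [CharZero F] (A : Type*) [Ring A] [Algebra F A]
    [Algebra.IsCentral F A] [IsSimpleRing A] [FiniteDimensional F A] {n : ℕ}
    (hn : finrank F A = n ^ 2) (x : A) :
    reducedNormField F A n x ^ n = Algebra.norm F x := by
  rw [reducedNormField, reducedNorm_pow F A hn F,
    ← Algebra.norm_eq_of_algEquiv (Algebra.TensorProduct.lid F A)]
  simp

end

/-! ### Lower bound for the Harish-Chandra function -/

section

open Filter Topology Pointwise MeasureTheory

/-- The properties of the normalized absolute value `|ν(x)|` of a division algebra over a local field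
which are common to the archimedean and the non-archimedean case. It need not satisfy the triangle
inequality, only a weak form of it. -/
structure IsLocalAbs {D : Type*} [DivisionRing D] [TopologicalSpace D] (abv : D → ℝ) : Prop where
  nonneg : ∀ x, 0 ≤ abv x
  eq_zero_iff : ∀ x, abv x = 0 ↔ x = 0
  map_mul : ∀ x y, abv (x * y) = abv x * abv y
  cont : Continuous abv
  quasi : ∃ C : ℝ, 1 ≤ C ∧ ∀ x y, abv (x + y) ≤ C * (abv x + abv y)

/-- The sum of the `|ν(X_ij)|` over the entries of a matrix. -/
def entrySum {D : Type*} (abv : D → ℝ) {m : ℕ} (X : Matrix (Fin m) (Fin m) D) : ℝ :=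
  ∑ i, ∑ j, abv (X i j)

namespace IsLocalAbs

variable {D : Type*} [DivisionRing D] [TopologicalSpace D] {abv : D → ℝ} (h : IsLocalAbs abv)
include h

theorem map_zero : abv 0 = 0 := (h.eq_zero_iff 0).2 rfl

theorem pos {x : D} (hx : x ≠ 0) : 0 < abv x :=
  lt_of_le_of_ne (h.nonneg x) fun h0 => hx ((h.eq_zero_iff x).1 h0.symm)

theorem map_one : abv 1 = 1 := by
  have h1 := h.map_mul 1 1
  rw [mul_one] at h1
  exact (mul_right_cancel₀ (h.pos one_ne_zero).ne' (by rw [one_mul]; exact h1)).symm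

theorem map_inv (x : D) : abv x⁻¹ = (abv x)⁻¹ := by
  by_cases hx : x = 0
  · simp [hx, h.map_zero]
  · refine eq_inv_of_mul_eq_one_left ?_
    rw [← h.map_mul, inv_mul_cancel₀ hx, h.map_one]

theorem exists_sum_le (ι : Type*) (s : Finset ι) :
    ∃ C : ℝ, 1 ≤ C ∧ ∀ f : ι → D, abv (∑ i ∈ s, f i) ≤ C * ∑ i ∈ s, abv (f i) := by
  classical
  induction s using Finset.induction_on with
  | empty => exact ⟨1, le_rfl, by simp [h.map_zero]⟩
  | insert a s ha ih =>
    obtain ⟨C, hC, hs⟩ := ih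
    obtain ⟨C', hC', hadd⟩ := h.quasi
    refine ⟨C' * C, one_le_mul_of_one_le_of_one_le hC' hC, fun f => ?_⟩
    rw [Finset.sum_insert ha, Finset.sum_insert ha]
    refine (hadd _ _).trans ?_
    rw [mul_assoc]
    refine mul_le_mul_of_nonneg_left ?_ (by linarith)
    have := hs f
    have h0 := h.nonneg (f a)
    nlinarith

theorem entrySum_nonneg {m : ℕ} (X : Matrix (Fin m) (Fin m) D) : 0 ≤ entrySum abv X :=
  Finset.sum_nonneg fun _ _ => Finset.sum_nonneg fun _ _ => h.nonneg _

theorem le_entrySum {m : ℕ} (X : Matrix (Fin m) (Fin m) D) (i j : Fin m) :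
    abv (X i j) ≤ entrySum abv X :=
  (Finset.single_le_sum (f := fun j => abv (X i j)) (fun _ _ => h.nonneg _)
    (Finset.mem_univ j)).trans (Finset.single_le_sum (f := fun i => ∑ j, abv (X i j))
      (fun _ _ => Finset.sum_nonneg fun _ _ => h.nonneg _) (Finset.mem_univ i))

theorem exists_entrySum_mul_le (m : ℕ) :
    ∃ C : ℝ, 1 ≤ C ∧ ∀ X Y : Matrix (Fin m) (Fin m) D,
      entrySum abv (X * Y) ≤ C * (entrySum abv X * entrySum abv Y) := by
  obtain ⟨C, hC, hs⟩ := h.exists_sum_le (Fin m) Finset.univ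
  refine ⟨C, hC, fun X Y => ?_⟩
  calc entrySum abv (X * Y) ≤ ∑ i, ∑ j, C * ∑ k, abv (X i k) * abv (Y k j) := by
        refine Finset.sum_le_sum fun i _ => Finset.sum_le_sum fun j _ => ?_
        rw [Matrix.mul_apply]
        simpa only [h.map_mul] using hs fun k => X i k * Y k j
    _ = C * ∑ i, ∑ k, abv (X i k) * ∑ j, abv (Y k j) := by
        simp only [← Finset.mul_sum]
        congr 1
        refine Finset.sum_congr rfl fun i _ => ?_
        rw [Finset.sum_comm]
        simp only [Finset.mul_sum]
    _ ≤ C * ∑ i, ∑ k, abv (X i k) * entrySum abv Y := by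
        gcongr with i _ k _
        · exact h.nonneg _
        · exact Finset.single_le_sum (f := fun k => ∑ j, abv (Y k j))
            (fun _ _ => Finset.sum_nonneg fun _ _ => h.nonneg _) (Finset.mem_univ k)
    _ = C * (entrySum abv X * entrySum abv Y) := by
        simp only [← Finset.sum_mul]
        rfl

theorem continuous_entrySum {m : ℕ} :
    Continuous fun X : Matrix (Fin m) (Fin m) D => entrySum abv X :=
  continuous_finsetSum _ fun i _ => continuous_finsetSum _ fun j _ =>
    h.cont.comp ((continuous_apply j).comp (continuous_apply i))

end IsLocalAbs

/-- A continuous positive character of a compact group is trivial: the powers of a value greater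
than `1` would be unbounded. -/
theorem eq_one_of_isCompact_of_mul {G : Type*} [Group G] [TopologicalSpace G] {H : Subgroup G}
    (hH : IsCompact (H : Set G)) {χ : G → ℝ} (hc : ContinuousOn χ H) (hpos : ∀ x ∈ H, 0 < χ x)
    (hmul : ∀ x ∈ H, ∀ y ∈ H, χ (x * y) = χ x * χ y) {x : G} (hx : x ∈ H) : χ x = 1 := by
  obtain ⟨B, hB⟩ := (hH.image_of_continuousOn hc).bddAbove
  have h1 : χ 1 = 1 := by
    have := hmul 1 H.one_mem 1 H.one_mem
    rw [mul_one] at this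
    exact (mul_right_cancel₀ (hpos 1 H.one_mem).ne' (by rw [one_mul]; exact this)).symm
  have hpow : ∀ y ∈ H, ∀ k : ℕ, χ (y ^ k) = χ y ^ k := by
    intro y hy k
    induction k with
    | zero => simp [h1]
    | succ k ih => rw [pow_succ, hmul _ (H.pow_mem hy k) _ hy, ih, pow_succ]
  have hle : ∀ y ∈ H, χ y ≤ 1 := by
    intro y hy
    by_contra! hlt
    obtain ⟨k, hk⟩ := pow_unbounded_of_one_lt B hlt
    exact absurd (hB ⟨_, H.pow_mem hy k, rfl⟩) (not_le.2 (by rw [hpow y hy]; exact hk))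
  refine le_antisymm (hle x hx) ?_
  have h2 := hmul x hx x⁻¹ (H.inv_mem hx)
  rw [mul_inv_cancel, h1] at h2
  nlinarith [hle x⁻¹ (H.inv_mem hx), hpos x hx]

/-- The subgroup of upper triangular matrices. Since the upper triangular matrices form a
finite-dimensional algebra, left multiplication by an invertible one is surjective on them, so it
contains the inverses. -/
def upperTriangular (F : Type*) [Field F] (D : Type*) [DivisionRing D] [Algebra F D]
    [FiniteDimensional F D] (m : ℕ) : Subgroup (Matrix (Fin m) (Fin m) D)ˣ where
  carrier := {p | ∀ i j, j < i → p.1 i j = 0}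
  one_mem' := fun _ _ hij => Matrix.one_apply_ne hij.ne'
  mul_mem' := fun {p q} hp hq i j hij =>
    Matrix.BlockTriangular.mul (b := id) (M := p.1) (N := q.1) (fun i j h => hp i j h)
      (fun i j h => hq i j h) hij
  inv_mem' := by
    intro p hp
    let T : Submodule F (Matrix (Fin m) (Fin m) D) :=
      { carrier := {x | ∀ i j, j < i → x i j = 0}
        zero_mem' := fun _ _ _ => rfl
        add_mem' := fun hx hy i j hij => by simp [hx i j hij, hy i j hij]
        smul_mem' := fun c x hx i j hij => by simp [hx i j hij] }
    have hT : ∀ x ∈ T, LinearMap.mulLeft F p.1 x ∈ T := fun x hx i j hij =>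
      Matrix.BlockTriangular.mul (b := id) (M := p.1) (N := x) (fun i j h => hp i j h)
        (fun i j h => hx i j h) hij
    have hinj : Function.Injective ((LinearMap.mulLeft F p.1).restrict hT) := by
      intro x y hxy
      have h1 : p.1 * x.1 = p.1 * y.1 := congrArg Subtype.val hxy
      exact Subtype.ext (p.isUnit.mul_left_cancel h1)
    obtain ⟨q, hq⟩ := LinearMap.injective_iff_surjective.1 hinj
      ⟨1, fun i j hij => Matrix.one_apply_ne hij.ne'⟩
    have h2 : p.1 * q.1 = 1 := congrArg Subtype.val hq
    have h3 : (p⁻¹).1 = q.1 := (left_inv_eq_right_inv p.inv_mul h2)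
    intro i j hij
    rw [h3]
    exact q.2 i j hij

section Iwasawa

variable {F : Type*} [Field F] {D : Type*} [DivisionRing D] [Algebra F D]
  [FiniteDimensional F D] {m : ℕ}

theorem mem_upperTriangular {p : (Matrix (Fin m) (Fin m) D)ˣ} :
    p ∈ upperTriangular F D m ↔ ∀ i j, j < i → p.1 i j = 0 := Iff.rfl

theorem mul_diag_upperTriangular {p q : (Matrix (Fin m) (Fin m) D)ˣ}
    (hp : p ∈ upperTriangular F D m) (hq : q ∈ upperTriangular F D m) (i : Fin m) :
    (p * q).1 i i = p.1 i i * q.1 i i := by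
  rw [Units.val_mul, Matrix.mul_apply, Finset.sum_eq_single i]
  · intro j _ hj
    rcases lt_or_gt_of_ne hj with h | h
    · rw [hp i j h, zero_mul]
    · rw [hq j i h, mul_zero]
  · simp

theorem diag_upperTriangular_ne_zero {p : (Matrix (Fin m) (Fin m) D)ˣ}
    (hp : p ∈ upperTriangular F D m) (i : Fin m) : p.1 i i ≠ 0 := by
  have h := mul_diag_upperTriangular hp ((upperTriangular F D m).inv_mem hp) i
  rw [mul_inv_cancel, Units.val_one, Matrix.one_apply_eq] at h
  exact left_ne_zero_of_mul_eq_one h.symm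

/-- The value `∏ |ν(p_ii)|^{((m+1)/2 - i) d}` of `δ^{1/2}` at `p`. -/
def sqrtModulus (abv : D → ℝ) (d : ℕ) (p : (Matrix (Fin m) (Fin m) D)ˣ) : ℝ :=
  ∏ i : Fin m, abv (p.1 i i) ^ (((m + 1 : ℝ) / 2 - ((i : ℕ) + 1)) * d)

variable [TopologicalSpace D] [IsTopologicalRing D] [T2Space D] {abv : D → ℝ}
  (h : IsLocalAbs abv) {K : Subgroup (Matrix (Fin m) (Fin m) D)ˣ}
  (hK : IsCompact (K : Set (Matrix (Fin m) (Fin m) D)ˣ)) (d : ℕ)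

omit [IsTopologicalRing D] [T2Space D] in
theorem continuous_unit_entry (i j : Fin m) :
    Continuous fun g : (Matrix (Fin m) (Fin m) D)ˣ => g.1 i j :=
  (continuous_apply j).comp ((continuous_apply i).comp
    (Units.continuous_val (M := Matrix (Fin m) (Fin m) D)))

omit [IsTopologicalRing D] in
theorem isClosed_upperTriangular :
    IsClosed (upperTriangular F D m : Set (Matrix (Fin m) (Fin m) D)ˣ) := by
  have : (upperTriangular F D m : Set (Matrix (Fin m) (Fin m) D)ˣ) =
      ⋂ i, ⋂ j, ⋂ (_ : j < i), {p | p.1 i j = 0} := by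
    ext p
    simp [mem_upperTriangular]
  rw [this]
  exact isClosed_iInter fun i => isClosed_iInter fun j => isClosed_iInter fun _ =>
    isClosed_eq (continuous_unit_entry i j) continuous_const

include h in
omit [IsTopologicalRing D] [T2Space D] in
theorem continuousOn_sqrtModulus :
    ContinuousOn (sqrtModulus abv d) (upperTriangular F D m : Set (Matrix (Fin m) (Fin m) D)ˣ) := by
  refine continuousOn_finsetProd _ fun i _ => ?_
  refine ContinuousOn.rpow_const (h.cont.comp (continuous_unit_entry i i)).continuousOn ?_
  exact fun p hp => Or.inl (h.pos (diag_upperTriangular_ne_zero hp i)).ne'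

include h in
omit [IsTopologicalRing D] [T2Space D] in
theorem sqrtModulus_pos {p : (Matrix (Fin m) (Fin m) D)ˣ} (hp : p ∈ upperTriangular F D m) :
    0 < sqrtModulus abv d p :=
  Finset.prod_pos fun i _ => Real.rpow_pos_of_pos (h.pos (diag_upperTriangular_ne_zero hp i)) _

include h in
omit [IsTopologicalRing D] [T2Space D] in
theorem sqrtModulus_mul {p q : (Matrix (Fin m) (Fin m) D)ˣ} (hp : p ∈ upperTriangular F D m)
    (hq : q ∈ upperTriangular F D m) :
    sqrtModulus abv d (p * q) = sqrtModulus abv d p * sqrtModulus abv d q := by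
  rw [sqrtModulus, sqrtModulus, sqrtModulus, ← Finset.prod_mul_distrib]
  refine Finset.prod_congr rfl fun i _ => ?_
  rw [mul_diag_upperTriangular hp hq, h.map_mul, Real.mul_rpow (h.nonneg _) (h.nonneg _)]

include F h hK in
omit [IsTopologicalRing D] in
/-- The value of `e^{ρ(H(g))}` does not depend on the Iwasawa decomposition `g = p k`: two choices
of `p` differ by an element of the compact group of triangular matrices in `K`, on which the
character `δ^{1/2}` is trivial. -/
theorem expRhoH_mul {p k : (Matrix (Fin m) (Fin m) D)ˣ} (hp : p ∈ upperTriangular F D m)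
    (hk : k ∈ K) : expRhoH abv m d K (p * k) = sqrtModulus abv d p := by
  have hex : ∃ p' : (Matrix (Fin m) (Fin m) D)ˣ, (∀ i j, j < i → p'.1 i j = 0) ∧
      ∃ k' ∈ K, p * k = p' * k' := ⟨p, hp, k, hk, rfl⟩
  obtain ⟨hp', k', hk', he⟩ := hex.choose_spec
  have h1 : expRhoH abv m d K (p * k) = sqrtModulus abv d hex.choose := by
    rw [expRhoH, dif_pos hex]
    rfl
  rw [h1]
  generalize hex.choose = p' at *
  have hp'' : p' ∈ upperTriangular F D m := hp'
  let H := upperTriangular F D m ⊓ K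
  have hH : IsCompact (H : Set (Matrix (Fin m) (Fin m) D)ˣ) := hK.inter_left isClosed_upperTriangular
  have hq : p⁻¹ * p' ∈ H := by
    refine ⟨mul_mem (Subgroup.inv_mem _ hp) hp'', ?_⟩
    have : p⁻¹ * p' = k * k'⁻¹ := by
      rw [eq_mul_inv_iff_mul_eq, mul_assoc, ← he, inv_mul_cancel_left]
    rw [this]
    exact mul_mem hk (K.inv_mem hk')
  have h2 : sqrtModulus abv d (p⁻¹ * p') = 1 :=
    eq_one_of_isCompact_of_mul hH ((continuousOn_sqrtModulus h d).mono fun x hx => hx.1)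
      (fun x hx => sqrtModulus_pos h d hx.1) (fun x hx y hy => sqrtModulus_mul h d hx.1 hy.1) hq
  have h3 := sqrtModulus_mul h d hp hq.1
  rwa [mul_inv_cancel_left, h2, mul_one] at h3

variable (hI : ∀ g : (Matrix (Fin m) (Fin m) D)ˣ, ∃ p ∈ upperTriangular F D m, ∃ k ∈ K, g = p * k)

include h hK hI in
/-- The sublevel and superlevel sets of `e^{ρ(H(g))}` are products of a closed set of triangular
matrices and the compact group `K`, hence closed. -/
theorem continuous_expRhoH : Continuous (expRhoH abv m d K) := by
  have key : ∀ S : Set ℝ, IsClosed S → IsClosed (expRhoH abv m d K ⁻¹' S) := by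
    intro S hS
    have : expRhoH abv m d K ⁻¹' S =
        ((upperTriangular F D m : Set (Matrix (Fin m) (Fin m) D)ˣ) ∩ sqrtModulus abv d ⁻¹' S) * K := by
      ext g
      constructor
      · intro hg
        obtain ⟨p, hp, k, hk, rfl⟩ := hI g
        rw [Set.mem_preimage, expRhoH_mul h hK d hp hk] at hg
        exact Set.mul_mem_mul ⟨hp, hg⟩ hk
      · rintro ⟨p, ⟨hp, hpS⟩, k, hk, rfl⟩
        rw [Set.mem_preimage, expRhoH_mul h hK d hp hk]
        exact hpS
    rw [this]
    exact ((continuousOn_sqrtModulus h d).preimage_isClosed_of_isClosed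
      isClosed_upperTriangular hS).mul_right_of_isCompact hK
  exact continuous_iff_lower_upperSemicontinuous.2
    ⟨lowerSemicontinuous_iff_isClosed_preimage.2 fun y => key _ isClosed_Iic,
      upperSemicontinuous_iff_isClosed_preimage.2 fun y => key _ isClosed_Ici⟩

variable {wA : (Matrix (Fin m) (Fin m) D)ˣ → ℝ} (hwc : Continuous wA) (hwpos : ∀ g, 0 < wA g)
  (hwmul : ∀ g g', wA (g * g') = wA g * wA g')
  (hwtri : ∀ p ∈ upperTriangular F D m, wA p = ∏ i, abv (p.1 i i))

include h hK hI hwc hwpos hwmul hwtri in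
omit [IsTopologicalRing D] in
/-- If `k g = p k'` then the diagonal entries of `p` are bounded in terms of the entries of `g`. Since
the exponents in `δ^{1/2}` are at most `(m-1)d/2`, it follows that `e^{ρ(H(kg))}` is at least
`|ν(g)|^{(m-1)d/2}`, up to a power of the size of `g`. -/
theorem exists_le_expRhoH :
    ∃ c L : ℝ, 0 < c ∧ 0 ≤ L ∧ ∀ k ∈ K, ∀ g : (Matrix (Fin m) (Fin m) D)ˣ,
      c * wA g ^ (((m : ℝ) - 1) * d / 2) * (1 + entrySum abv g.1) ^ (-L) ≤
        expRhoH abv m d K (k * g) := by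
  obtain ⟨C, hC, hmul⟩ := h.exists_entrySum_mul_le m
  obtain ⟨B, hB⟩ := (hK.image_of_continuousOn
    ((h.continuous_entrySum (m := m)).comp Units.continuous_val).continuousOn).bddAbove
  have hB' : ∀ k ∈ K, entrySum abv k.1 ≤ B := fun k hk => hB ⟨k, hk, rfl⟩
  have hB0 : 0 ≤ B := (h.entrySum_nonneg _).trans (hB' 1 K.one_mem)
  have hwK : ∀ k ∈ K, wA k = 1 := fun k hk =>
    eq_one_of_isCompact_of_mul hK hwc.continuousOn (fun x _ => hwpos x) (fun x _ y _ => hwmul x y) hk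
  set L : ℝ := ∑ i : Fin m, ((i : ℕ) : ℝ) * d with hL
  have hL0 : 0 ≤ L := Finset.sum_nonneg fun i _ => by positivity
  -- bounds the entries of `p = k g k⁻¹` by those of `g`
  set C₁ : ℝ := 1 + C * B * (C * B) with hC₁
  have hC₁1 : 1 ≤ C₁ := by
    have : 0 ≤ C * B := mul_nonneg (by linarith) hB0
    nlinarith
  refine ⟨C₁ ^ (-L), L, Real.rpow_pos_of_pos (by linarith) _, hL0, fun k hk g => ?_⟩
  obtain ⟨p, hp, k', hk', he⟩ := hI (k * g)
  have hM0 := h.entrySum_nonneg g.1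
  have hpM : entrySum abv p.1 ≤ C₁ * (1 + entrySum abv g.1) := by
    have h1 : p.1 = k.1 * (g.1 * (k'⁻¹).1) := by
      rw [← mul_assoc, ← Units.val_mul, he, ← Units.val_mul, mul_inv_cancel_right]
    have h2 := hmul g.1 (k'⁻¹).1
    have h3 := hmul k.1 (g.1 * (k'⁻¹).1)
    rw [h1]
    have h4 := hB' _ (K.inv_mem hk')
    have h5 := hB' _ hk
    calc _ ≤ _ := h3
      _ ≤ C * (B * (C * (entrySum abv g.1 * B))) := by
        have := h.entrySum_nonneg (g.1 * (k'⁻¹).1)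
        gcongr
        exact h2.trans (by gcongr)
      _ ≤ _ := by
        have : 0 ≤ C * B * (C * B) := by positivity
        nlinarith
  -- `|ν|` is trivial on `K`, hence `|ν(g)|` is the product of the diagonal absolute values
  have hwp : wA g = ∏ i, abv (p.1 i i) := by
    rw [← hwtri p hp]
    have h1 : wA (k * g) = wA (p * k') := by rw [he]
    rwa [hwmul, hwmul, hwK k hk, hwK k' hk', one_mul, mul_one] at h1
  -- both sides are products over `i`; with `i` counted from `0`, the exponent `(m + 1)/2 - (i +
  -- 1)` is `(m - 1)/2 - i`, and the power `-i d` is bounded below by the bound for the entries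
  rw [he, expRhoH_mul h hK d hp hk', hwp, ← Real.finsetProd_rpow _ _ fun i _ => h.nonneg _,
    mul_right_comm, ← Real.mul_rpow (by linarith) (by linarith), hL, ← Finset.sum_neg_distrib,
    Real.rpow_sum_of_pos (by positivity), ← Finset.prod_mul_distrib, sqrtModulus]
  refine Finset.prod_le_prod (fun i _ => ?_) fun i _ => ?_
  · have := h.nonneg (p.1 i i)
    positivity
  · have hpos := h.pos (diag_upperTriangular_ne_zero hp i)
    have he : ((m + 1 : ℝ) / 2 - ((i : ℕ) + 1)) * d = -((i : ℕ) * d) + ((m : ℝ) - 1) * d / 2 := by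
      ring
    rw [he, Real.rpow_add hpos]
    gcongr ?_ * _
    refine Real.rpow_le_rpow_of_nonpos hpos ((h.le_entrySum p.1 i i).trans hpM) ?_
    have : (0 : ℝ) ≤ (i : ℕ) * d := by positivity
    linarith

variable [MeasurableSpace K] [BorelSpace K] (μ : Measure K) [μ.IsHaarMeasure]

include h hK hI hwc hwpos hwmul hwtri in
/-- The lower bound for `e^{ρ(H(kg))}` is uniform in `k`, hence holds for the integral over `K`.
-/
theorem exists_le_xi :
    ∃ c L : ℝ, 0 < c ∧ 0 ≤ L ∧ ∀ g : (Matrix (Fin m) (Fin m) D)ˣ,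
      c * wA g ^ (((m : ℝ) - 1) * d / 2) * (1 + entrySum abv g.1) ^ (-L) ≤ xi abv m d K μ g := by
  obtain ⟨c, L, hc, hL, hle⟩ := exists_le_expRhoH h hK d hI hwc hwpos hwmul hwtri
  have : CompactSpace K := isCompact_iff_compactSpace.1 hK
  have hμ : 0 < μ.real Set.univ := by
    rw [Measure.real, ENNReal.toReal_pos_iff]
    exact ⟨isOpen_univ.measure_pos μ Set.univ_nonempty, isCompact_univ.measure_lt_top⟩
  refine ⟨c * μ.real Set.univ, L, mul_pos hc hμ, hL, fun g => ?_⟩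
  have hint : Integrable (fun k : K => expRhoH abv m d K (k * g)) μ := by
    have : Continuous fun k : K => expRhoH abv m d K (k * g) :=
      (continuous_expRhoH h hK d hI).comp (continuous_subtype_val.mul continuous_const)
    exact this.integrable_of_hasCompactSupport (HasCompactSupport.of_compactSpace _)
  have h1 := integral_mono (integrable_const (μ := μ)
    (c * wA g ^ (((m : ℝ) - 1) * d / 2) * (1 + entrySum abv g.1) ^ (-L))) hint
    fun k => hle k k.2 g
  rw [integral_const, smul_eq_mul] at h1
  refine le_of_eq_of_le ?_ h1
  ring

end Iwasawa

end

/-! ### Bounds for the weights of the Schwartz space -/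

section

open Filter Topology MeasureTheory

/-- A positive power absorbs powers of the logarithm at `0`, uniformly in the exponent as long as
it stays away from `0`; at infinity the growth is polynomial. -/
theorem exists_rpow_mul_log_le {ε₁ ε₂ R : ℝ} (h1 : 0 < ε₁) (h2 : ε₁ ≤ ε₂) (hR : 0 < R) :
    ∃ C : ℝ, 0 ≤ C ∧ ∀ x : ℝ, 0 < x → ∀ ε ∈ Set.Icc ε₁ ε₂,
      x ^ ε * (1 + |Real.log x|) ^ R ≤ C * (1 + x) ^ (ε₂ + R) := by
  -- `|log x| ≤ x^{-δ} / δ` for `x ≤ 1`, and `x^{-δ R}` cancels `x^{ε₁}`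
  set δ := ε₁ / R with hδ
  have hδ0 : 0 < δ := div_pos h1 hR
  refine ⟨(1 + 1 / δ) ^ R, by positivity, fun x hx ε hε => ?_⟩
  have hC : 1 ≤ (1 + 1 / δ) ^ R :=
    Real.one_le_rpow (by have : 0 < 1 / δ := by positivity
                         linarith) hR.le
  have hx1 : 1 ≤ (1 + x) ^ (ε₂ + R) := Real.one_le_rpow (by linarith) (by linarith)
  rcases le_total x 1 with hx' | hx'
  · have hlog : |Real.log x| ≤ x ^ (-δ) / δ := by
      rw [abs_of_nonpos (Real.log_nonpos hx.le hx'), ← Real.log_inv]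
      refine (Real.log_le_rpow_div (inv_pos.2 hx).le hδ0).trans ?_
      rw [Real.inv_rpow hx.le, Real.rpow_neg hx.le]
    have h3 : 1 ≤ x ^ (-δ) := Real.one_le_rpow_of_pos_of_le_one_of_nonpos hx hx' (by linarith)
    have h4 : 1 + |Real.log x| ≤ (1 + 1 / δ) * x ^ (-δ) := by
      have : (1 + 1 / δ) * x ^ (-δ) = x ^ (-δ) + x ^ (-δ) / δ := by ring
      linarith
    calc x ^ ε * (1 + |Real.log x|) ^ R ≤ x ^ ε₁ * ((1 + 1 / δ) * x ^ (-δ)) ^ R := by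
          exact mul_le_mul (Real.rpow_le_rpow_of_exponent_ge hx hx' hε.1)
            (Real.rpow_le_rpow (by positivity) h4 hR.le) (by positivity) (by positivity)
      _ = (1 + 1 / δ) ^ R * (x ^ ε₁ * x ^ (-δ * R)) := by
          rw [Real.mul_rpow (by positivity) (by positivity), ← Real.rpow_mul hx.le]; ring
      _ = (1 + 1 / δ) ^ R := by
          rw [← Real.rpow_add hx, hδ]
          have : ε₁ + -(ε₁ / R) * R = 0 := by field_simp; ring
          rw [this, Real.rpow_zero, mul_one]
      _ ≤ (1 + 1 / δ) ^ R * (1 + x) ^ (ε₂ + R) := le_mul_of_one_le_right (by positivity) hx1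
  · have hlog : 1 + |Real.log x| ≤ 1 + x := by
      rw [abs_of_nonneg (Real.log_nonneg hx')]
      linarith [Real.log_le_sub_one_of_pos hx]
    calc x ^ ε * (1 + |Real.log x|) ^ R ≤ (1 + x) ^ ε₂ * (1 + x) ^ R := by
          gcongr
          exact (Real.rpow_le_rpow_of_exponent_le hx' hε.2).trans
            (Real.rpow_le_rpow hx.le (by linarith) (by linarith))
      _ = (1 + x) ^ (ε₂ + R) := (Real.rpow_add (by linarith) _ _).symm
      _ ≤ _ := le_mul_of_one_le_left (by positivity) hC

/-- The combination of the bounds for `σ` and `Ξ` in terms of `w = |ν|` and of the size `M` of the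
entries: multiplied by `|ν|^{e + ε}` with `ε > 0`, the weights `(1 + σ)^r / Ξ` have polynomial growth. -/
theorem exists_hcWeight_mul_le {𝓜 : Type*} [Monoid 𝓜] {N : 𝓜 → ℝ} {Ξ : 𝓜ˣ → ℝ} {w M : 𝓜ˣ → ℝ} {e : ℝ}
    (hM : ∀ g, 0 ≤ M g) (hw : ∀ g, 0 < w g)
    (hΞ : ∃ c L : ℝ, 0 < c ∧ 0 ≤ L ∧ ∀ g, c * w g ^ e * (1 + M g) ^ (-L) ≤ Ξ g)
    (hwM : ∃ C a : ℝ, 0 ≤ C ∧ 0 ≤ a ∧ ∀ g, w g ≤ C * (1 + M g) ^ a)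
    (hN : ∃ C a : ℝ, 0 ≤ C ∧ 0 ≤ a ∧ ∀ g : 𝓜ˣ, N g ≤ C * (1 + M g) ^ a)
    (hinv : ∃ C a b : ℝ, 0 ≤ C ∧ 0 ≤ a ∧ 0 ≤ b ∧ ∀ g, M g⁻¹ ≤ C * (1 + M g) ^ a * w g ^ (-b))
    (hlow : ∃ c : ℝ, 0 < c ∧ ∀ g : 𝓜ˣ, c ≤ max (N g) (N ((g⁻¹ : 𝓜ˣ) : 𝓜)))
    (r : ℝ≥0) {ε₁ ε₂ : ℝ} (h1 : 0 < ε₁) (h2 : ε₁ ≤ ε₂) :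
    ∃ (C : ℝ) (k : ℕ), 0 ≤ C ∧ ∀ g, ∀ ε ∈ Set.Icc ε₁ ε₂,
      |hcWeight N Ξ r g| * (w g ^ (e + ε) * (1 + |Real.log (w g)|)) ≤ C * (1 + M g) ^ k := by
  obtain ⟨c, L, hc, hL, hΞ⟩ := hΞ
  obtain ⟨Cw, aw, hCw, haw, hwM⟩ := hwM
  obtain ⟨CN, aN, hCN, haN, hN⟩ := hN
  obtain ⟨Ci, ai, bi, hCi, hai, hbi, hinv⟩ := hinv
  obtain ⟨c₀, hc₀, hlow⟩ := hlow
  obtain ⟨CR, hCR, hR⟩ := exists_rpow_mul_log_le (R := r + 1) h1 h2 (by positivity)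
  -- the bound for `σ`
  obtain ⟨A, hA0, hσ⟩ : ∃ A : ℝ, 0 ≤ A ∧
      ∀ g, |1 + sigma N g| ≤ A * (1 + M g) * (1 + |Real.log (w g)|) := by
    -- with `u = log (1 + M g)` and `v = |log w g|`, the logarithms of `N g` and `N g⁻¹` are
    -- bounded by linear forms in `1, u, v`, all of which are at most `(1 + u)(1 + v)`
    set A₁ : ℝ := |Real.log (1 + CN)| + aN with hA₁
    set A₂ : ℝ := |Real.log (1 + CN)| + aN * (|Real.log (2 + Ci)| + ai + bi) with hA₂
    have hA₁0 : 0 ≤ A₁ := by positivity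
    have hA₂0 : 0 ≤ A₂ := by positivity
    refine ⟨1 + (A₁ + A₂ + |Real.log c₀|), by positivity, fun g => ?_⟩
    set u := Real.log (1 + M g) with hu
    set v := |Real.log (w g)| with hv
    have hMg := hM g
    have hu0 : 0 ≤ u := Real.log_nonneg (by linarith)
    have hv0 : 0 ≤ v := abs_nonneg _
    have huM : u ≤ M g := by
      have := Real.log_le_sub_one_of_pos (show 0 < 1 + M g by linarith)
      linarith
    have hN1 : ∀ g' : 𝓜ˣ, N g' ≤ Real.exp (|Real.log (1 + CN)| + aN * Real.log (1 + M g')) := by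
      intro g'
      have := hM g'
      rw [Real.exp_add, mul_comm aN, ← Real.rpow_def_of_pos (by linarith)]
      refine (hN g').trans ?_
      gcongr
      calc CN ≤ 1 + CN := by linarith
        _ = Real.exp (Real.log (1 + CN)) := (Real.exp_log (by linarith)).symm
        _ ≤ _ := Real.exp_le_exp.2 (le_abs_self _)
    have hlog2 : Real.log (1 + M g⁻¹) ≤ |Real.log (2 + Ci)| + ai * u + bi * v := by
      have h3 : w g ^ (-bi) ≤ Real.exp (bi * v) := by
        rw [Real.rpow_def_of_pos (hw g)]
        refine Real.exp_le_exp.2 ?_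
        have := neg_abs_le (Real.log (w g))
        nlinarith
      have h4 : (1 + M g) ^ ai = Real.exp (ai * u) := by
        rw [Real.rpow_def_of_pos (by linarith), mul_comm]
      have h5 : 1 + M g⁻¹ ≤ Real.exp (|Real.log (2 + Ci)| + ai * u + bi * v) := by
        rw [Real.exp_add, Real.exp_add]
        have h6 : 2 + Ci ≤ Real.exp |Real.log (2 + Ci)| := by
          calc 2 + Ci = Real.exp (Real.log (2 + Ci)) := (Real.exp_log (by linarith)).symm
            _ ≤ _ := Real.exp_le_exp.2 (le_abs_self _)
        have h7 : 1 ≤ Real.exp (ai * u) := Real.one_le_exp (by positivity)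
        have h8 : 1 ≤ Real.exp (bi * v) := Real.one_le_exp (by positivity)
        calc 1 + M g⁻¹ ≤ 1 * 1 * 1 + Ci * Real.exp (ai * u) * Real.exp (bi * v) := by
              have := hinv g
              rw [h4] at this
              have h9 : Ci * Real.exp (ai * u) * w g ^ (-bi) ≤
                Ci * Real.exp (ai * u) * Real.exp (bi * v) := by gcongr
              linarith
          _ ≤ 1 * Real.exp (ai * u) * Real.exp (bi * v) + Ci * Real.exp (ai * u) * Real.exp (bi * v) := by
              gcongr
          _ = (1 + Ci) * Real.exp (ai * u) * Real.exp (bi * v) := by ring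
          _ ≤ _ := by
              gcongr
              linarith
      have := hM g⁻¹
      exact (Real.log_le_iff_le_exp (by linarith)).2 h5
    have hmaxpos : 0 < max (N g) (N ((g⁻¹ : 𝓜ˣ) : 𝓜)) := hc₀.trans_le (hlow g)
    have huv : 1 ≤ (1 + u) * (1 + v) := by nlinarith [mul_nonneg hu0 hv0]
    have hs1 : sigma N g ≤ (A₁ + A₂) * ((1 + u) * (1 + v)) := by
      rw [sigma, Real.log_le_iff_le_exp hmaxpos]
      have hle : ∀ a b : ℝ, 0 ≤ a → 0 ≤ b → a ≤ (a + b) * ((1 + u) * (1 + v)) := by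
        intro a b ha hb
        nlinarith [mul_nonneg (add_nonneg ha hb) (sub_nonneg.2 huv)]
      refine max_le ((hN1 g).trans (Real.exp_le_exp.2 ?_)) ((hN1 g⁻¹).trans (Real.exp_le_exp.2 ?_))
      · have h10 : |Real.log (1 + CN)| + aN * u ≤ A₁ * ((1 + u) * (1 + v)) := by
          have := abs_nonneg (Real.log (1 + CN))
          have h11 : u ≤ (1 + u) * (1 + v) := by nlinarith [mul_nonneg hu0 hv0]
          have := mul_le_mul_of_nonneg_left h11 haN
          have := mul_le_mul_of_nonneg_left huv (abs_nonneg (Real.log (1 + CN)))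
          rw [hA₁, add_mul]
          linarith
        have : 0 ≤ A₂ * ((1 + u) * (1 + v)) := by positivity
        rw [add_mul]
        linarith
      · have h10 : |Real.log (1 + CN)| + aN * Real.log (1 + M g⁻¹) ≤ A₂ * ((1 + u) * (1 + v)) := by
          have h11 : u ≤ (1 + u) * (1 + v) := by nlinarith [mul_nonneg hu0 hv0]
          have h12 : v ≤ (1 + u) * (1 + v) := by nlinarith [mul_nonneg hu0 hv0]
          have e1 := mul_le_mul_of_nonneg_left h11 hai
          have e2 := mul_le_mul_of_nonneg_left h12 hbi
          have e3 := mul_le_mul_of_nonneg_left huv (abs_nonneg (Real.log (1 + CN)))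
          have e4 := mul_le_mul_of_nonneg_left huv (abs_nonneg (Real.log (2 + Ci)))
          have e5 : Real.log (1 + M g⁻¹) ≤
              (|Real.log (2 + Ci)| + ai + bi) * ((1 + u) * (1 + v)) := by
            rw [add_mul, add_mul]
            linarith
          have e6 := mul_le_mul_of_nonneg_left e5 haN
          rw [hA₂, add_mul, mul_assoc]
          linarith
        have : 0 ≤ A₁ * ((1 + u) * (1 + v)) := by positivity
        rw [add_mul]
        linarith
    -- `σ` may be negative, but it is bounded below by `log c₀`
    have hs2 : -(|Real.log c₀| * ((1 + u) * (1 + v))) ≤ sigma N g := by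
      have e1 := Real.log_le_log hc₀ (hlow g)
      have e2 := neg_abs_le (Real.log c₀)
      have e3 := mul_le_mul_of_nonneg_left huv (abs_nonneg (Real.log c₀))
      rw [sigma]
      linarith
    have h13 : |1 + sigma N g| ≤ (1 + (A₁ + A₂ + |Real.log c₀|)) * ((1 + u) * (1 + v)) := by
      have e1 : 0 ≤ (A₁ + A₂) * ((1 + u) * (1 + v)) := by positivity
      have e2 : 0 ≤ |Real.log c₀| * ((1 + u) * (1 + v)) := by positivity
      rw [abs_le]
      constructor <;> · rw [add_mul, add_mul]; linarith
    refine h13.trans ?_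
    rw [mul_assoc]
    gcongr
  have hε₂ : 0 < ε₂ := h1.trans_le h2
  -- `(1 + M)^r` comes from `σ`, `(1 + M)^L` from `Ξ⁻¹`, and the rest from `w^ε (1 + |log w|)^{r +
  -- 1}`, where `w` is bounded by a power of `1 + M`
  set k : ℝ := r + L + aw * (ε₂ + (r + 1)) with hk
  refine ⟨A ^ (r : ℝ) * c⁻¹ * (CR * (1 + Cw) ^ (ε₂ + (r + 1))), ⌈k⌉₊, by positivity, fun g ε hε => ?_⟩
  have hMg := hM g
  have hwg := hw g
  have hΞpos : 0 < c * w g ^ e * (1 + M g) ^ (-L) := by positivity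
  set v := |Real.log (w g)| with hv
  have hv0 : 0 ≤ v := abs_nonneg _
  have e1 : |hcWeight N Ξ r g| ≤ (A * (1 + M g) * (1 + v)) ^ (r : ℝ) /
      (c * w g ^ e * (1 + M g) ^ (-L)) := by
    rw [hcWeight, abs_div, abs_of_pos (hΞpos.trans_le (hΞ g))]
    refine div_le_div₀ (by positivity) ?_ hΞpos (hΞ g)
    exact (Real.abs_rpow_le_abs_rpow _ _).trans (Real.rpow_le_rpow (abs_nonneg _) (hσ g) r.2)
  have e2 : 1 + w g ≤ (1 + Cw) * (1 + M g) ^ aw := by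
    have h3 : 1 ≤ (1 + M g) ^ aw := Real.one_le_rpow (by linarith) haw
    have := hwM g
    nlinarith
  calc |hcWeight N Ξ r g| * (w g ^ (e + ε) * (1 + v))
      ≤ (A * (1 + M g) * (1 + v)) ^ (r : ℝ) / (c * w g ^ e * (1 + M g) ^ (-L)) *
        (w g ^ (e + ε) * (1 + v)) := by gcongr
    _ = A ^ (r : ℝ) * c⁻¹ * ((1 + M g) ^ ((r : ℝ) + L) * (w g ^ ε * (1 + v) ^ ((r : ℝ) + 1))) := by
        rw [Real.mul_rpow (by positivity) (by positivity), Real.mul_rpow (by positivity) (by positivity),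
          Real.rpow_neg (by positivity), Real.rpow_add hwg, Real.rpow_add (by positivity),
          Real.rpow_add (by positivity : 0 < 1 + v), Real.rpow_one]
        field_simp
    _ ≤ A ^ (r : ℝ) * c⁻¹ * ((1 + M g) ^ ((r : ℝ) + L) *
        (CR * ((1 + Cw) * (1 + M g) ^ aw) ^ (ε₂ + (r + 1)))) := by
        refine mul_le_mul_of_nonneg_left (mul_le_mul_of_nonneg_left ?_ (by positivity))
          (by positivity)
        exact (hR (w g) hwg ε hε).trans (mul_le_mul_of_nonneg_left
          (Real.rpow_le_rpow (by positivity) e2 (by positivity)) hCR)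
    _ = A ^ (r : ℝ) * c⁻¹ * (CR * (1 + Cw) ^ (ε₂ + (r + 1))) * (1 + M g) ^ k := by
        rw [Real.mul_rpow (by positivity) (by positivity), ← Real.rpow_mul (by positivity), hk,
          Real.rpow_add (by positivity) _ (aw * _)]
        ring
    _ ≤ _ := by
        gcongr
        rw [← Real.rpow_natCast]
        exact Real.rpow_le_rpow_of_exponent_le (by linarith) (Nat.le_ceil k)

end

/-! ### Iwasawa decomposition from rotations in coordinate planes -/

section

open Module

section Givens

variable {F : Type*} [Field F] {D : Type*} [DivisionRing D] [Algebra F D]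
  [FiniteDimensional F D] {m : ℕ}

/-- `K` contains, for any row vector `(a, b)` and any coordinate plane, a matrix which acts only on
this plane and moves `(a, b)` to a vector with first entry zero. -/
def HasGivens (K : Subgroup (Matrix (Fin m) (Fin m) D)ˣ) : Prop :=
  ∀ i j : Fin m, i < j → ∀ a b : D, ∃ k ∈ K,
    (∀ r c, (c ≠ i ∧ c ≠ j) ∨ (r ≠ i ∧ r ≠ j) → k.1 r c = (1 : Matrix (Fin m) (Fin m) D) r c) ∧
    a * k.1 i i + b * k.1 j i = 0

/-- All the entries below the diagonal in the rows after the `r`-th, and the first `c` ones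
in the `r`-th row, are zero. -/
def ClearedBelow (X : Matrix (Fin m) (Fin m) D) (r c : ℕ) : Prop :=
  ∀ r' i : Fin m, i < r' → (r < r'.1 ∨ (r = r'.1 ∧ i.1 < c)) → X r' i = 0

/-- A rotation in the plane of the columns `c` and `r` clears the entry `(r, c)` below the
diagonal. It does not affect the entries already cleared: the rows after the `r`-th vanish in both
columns, and the first `c` columns are not involved. -/
theorem exists_clearedBelow_succ {K : Subgroup (Matrix (Fin m) (Fin m) D)ˣ} (hK : HasGivens K)
    (g : (Matrix (Fin m) (Fin m) D)ˣ) (r c : ℕ) (hg : ClearedBelow g.1 r c) :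
    ∃ k ∈ K, ClearedBelow (g * k).1 r (c + 1) := by
  by_cases hc : c < r ∧ r < m
  swap
  -- there is no such entry
  · refine ⟨1, K.one_mem, fun r' i hi h => ?_⟩
    rw [mul_one]
    refine hg r' i hi ?_
    rcases h with h | ⟨h1, h2⟩
    · exact Or.inl h
    · have h3 : i.1 < r'.1 := hi
      have := r'.2
      exact Or.inr ⟨h1, by omega⟩
  set i : Fin m := ⟨c, hc.1.trans hc.2⟩ with hi
  set j : Fin m := ⟨r, hc.2⟩ with hj
  have hij : i < j := hc.1
  obtain ⟨k, hk, hk1, hk2⟩ := hK i j hij (g.1 j i) (g.1 j j)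
  refine ⟨k, hk, fun r' i' hi' h => ?_⟩
  rw [Units.val_mul, Matrix.mul_apply]
  by_cases h1 : i' ≠ i ∧ i' ≠ j
  -- columns outside the plane are unchanged
  · have : ∀ l, k.1 l i' = (1 : Matrix (Fin m) (Fin m) D) l i' := fun l => hk1 l i' (Or.inl h1)
    simp only [this, Matrix.one_apply, mul_ite, mul_one, mul_zero, Finset.sum_ite_eq',
      Finset.mem_univ, if_true]
    refine hg r' i' hi' ?_
    rcases h with h | ⟨h2, h3⟩
    · exact Or.inl h
    · have : i'.1 ≠ c := fun h => h1.1 (Fin.ext h)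
      exact Or.inr ⟨h2, by omega⟩
  · rw [Fintype.sum_eq_add i j hij.ne]
    · rcases h with h | ⟨h2, h3⟩
      · have e1 : g.1 r' i = 0 := hg r' i (hij.trans h) (Or.inl h)
        have e2 : g.1 r' j = 0 := hg r' j h (Or.inl h)
        rw [e1, e2, zero_mul, zero_mul, add_zero]
      · have h4 : r' = j := Fin.ext h2.symm
        have h5 : i' = i := by
          by_contra h6
          have h7 : i' = j := by by_contra h8; exact h1 ⟨h6, h8⟩
          rw [h7, h4] at hi'
          exact lt_irrefl _ hi'
        rw [h4, h5]
        exact hk2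
    · intro l hl
      rw [hk1 l i' (Or.inr hl), Matrix.one_apply_ne, mul_zero]
      rintro rfl
      exact h1 hl

/-- The Iwasawa decomposition: the entries below the diagonal are cleared row by row, starting from
the last row, by rotations which involve the diagonal column. -/
theorem exists_iwasawa {K : Subgroup (Matrix (Fin m) (Fin m) D)ˣ} (hK : HasGivens K)
    (g : (Matrix (Fin m) (Fin m) D)ˣ) : ∃ p ∈ upperTriangular F D m, ∃ k ∈ K, g = p * k := by
  have h1 : ∀ (r : ℕ) (g : (Matrix (Fin m) (Fin m) D)ˣ), ClearedBelow g.1 r 0 →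
      ∀ c, ∃ k ∈ K, ClearedBelow (g * k).1 r c := by
    intro r g hg c
    induction c with
    | zero => exact ⟨1, K.one_mem, by rwa [mul_one]⟩
    | succ c ih =>
      obtain ⟨k, hk, hk'⟩ := ih
      obtain ⟨k', hk1, hk2⟩ := exists_clearedBelow_succ hK _ r c hk'
      exact ⟨k * k', K.mul_mem hk hk1, by rwa [← mul_assoc]⟩
  have h2 : ∀ n : ℕ, n ≤ m → ∃ k ∈ K, ClearedBelow (g * k).1 (m - n) 0 := by
    intro n hn
    induction n with
    | zero =>
      refine ⟨1, K.one_mem, fun r' i _ h => ?_⟩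
      have := r'.2
      omega
    | succ n ih =>
      obtain ⟨k, hk, hk'⟩ := ih (by omega)
      obtain ⟨k', hk1, hk2⟩ := h1 _ _ hk' (m - n)
      refine ⟨k * k', K.mul_mem hk hk1, fun r' i hi h => ?_⟩
      rw [← mul_assoc]
      have : i.1 < r'.1 := hi
      exact hk2 r' i hi (by omega)
  obtain ⟨k, hk, hk'⟩ := h2 m le_rfl
  refine ⟨g * k, fun i j hij => ?_, k⁻¹, K.inv_mem hk, by rw [mul_inv_cancel_right]⟩
  have : j.1 < i.1 := hij
  exact hk' i j hij (by omega)

end Givens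

/-! ### Norms of triangular matrices and of inverses -/

section Norms

/-- The regular representation of a triangular matrix is block triangular: the `i`-th diagonal
block consists of `m` copies of the left multiplication by `p_ii`. -/
theorem norm_upperTriangular {F : Type*} [Field F] {D : Type*} [Ring D] [Algebra F D]
    [Module.Finite F D] {m : ℕ} (p : Matrix (Fin m) (Fin m) D)
    (hp : ∀ i j, j < i → p i j = 0) :
    Algebra.norm F p = ∏ i, Algebra.norm F (p i i) ^ m := by
  classical
  set b := Module.finBasis F D with hb
  -- the indices of this basis are row, column and coordinate in `D`
  set B := b.matrix (Fin m) (Fin m) with hB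
  have hrepr : ∀ X : Matrix (Fin m) (Fin m) D, ∀ i j k, B.repr X (i, j, k) = b.repr (X i j) k := by
    intro X i j k
    rw [hB, Module.Basis.matrix, Module.Basis.map_repr, LinearEquiv.trans_apply,
      Module.Basis.repr_reindex_apply]
    change (Pi.basis fun _ => Pi.basis fun _ => b).repr _ ⟨i, j, k⟩ = _
    rw [Pi.basis_repr, Pi.basis_repr]
    rfl
  have hent : ∀ i c k i' c' k', Algebra.leftMulMatrix B p (i, c, k) (i', c', k') =
      if c = c' then Algebra.leftMulMatrix b (p i i') k k' else 0 := by
    intro i c k i' c' k'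
    rw [Algebra.leftMulMatrix_eq_repr_mul, hrepr, hB, Module.Basis.matrix_apply,
      Algebra.leftMulMatrix_eq_repr_mul]
    split_ifs with h
    · subst h
      rw [Matrix.mul_single_apply_same]
    · rw [Matrix.mul_single_apply_of_ne _ _ _ _ _ (Ne.symm (Ne.symm h))]
      simp
  rw [Algebra.norm_eq_matrix_det B, Matrix.BlockTriangular.det_fintype
    (b := fun x : Fin m × Fin m × Fin (finrank F D) => x.1)]
  · refine Finset.prod_congr rfl fun i _ => ?_
    let e : Fin (finrank F D) × Fin m ≃ {a : Fin m × Fin m × Fin (finrank F D) // a.1 = i} :=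
      { toFun := fun x => ⟨(i, x.2, x.1), rfl⟩
        invFun := fun x => (x.1.2.2, x.1.2.1)
        left_inv := fun x => rfl
        right_inv := by rintro ⟨⟨i', c, k⟩, rfl⟩; rfl }
    rw [← Matrix.det_submatrix_equiv_self e, Algebra.norm_eq_matrix_det b]
    have : (Matrix.toSquareBlock (Algebra.leftMulMatrix B p) (fun x => x.1) i).submatrix e e =
        Matrix.blockDiagonal fun _ : Fin m => Algebra.leftMulMatrix b (p i i) := by
      ext ⟨k, c⟩ ⟨k', c'⟩
      simp only [Matrix.submatrix_apply, Matrix.toSquareBlock_def, Matrix.of_apply,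
        Matrix.blockDiagonal_apply]
      exact hent i c k i c' k'
    rw [this, Matrix.det_blockDiagonal, Finset.prod_const, Finset.card_univ, Fintype.card_fin]
  · rintro ⟨i, c, k⟩ ⟨i', c', k'⟩ h
    rw [hent, hp i i' h, map_zero]
    simp

variable {R A ι : Type*} [CommRing R] [Ring A] [Algebra R A] [Fintype ι] [DecidableEq ι]

/-- The element `x'` with `x x' = N(x)`, for `N(x)` the norm of the regular representation; its
coordinates in the basis `b` are polynomials in those of `x`. -/
def normAdj (b : Basis ι R A) (x : A) : A :=
  b.equivFun.symm ((Algebra.leftMulMatrix b x).adjugate.mulVec (b.equivFun 1))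

/-- The Cayley–Hamilton identity for left multiplication by `x`, applied to the unit element. -/
theorem mul_normAdj (b : Basis ι R A) (x : A) : x * normAdj b x = algebraMap R A (Algebra.norm R x) := by
  apply b.equivFun.injective
  have h := Algebra.leftMulMatrix_mulVec_repr b x (normAdj b x)
  have h2 : b.equivFun (normAdj b x) =
      (Algebra.leftMulMatrix b x).adjugate.mulVec (b.equivFun 1) := by
    rw [normAdj, LinearEquiv.apply_symm_apply]
  change (b.repr (x * normAdj b x) : ι → R) = _
  rw [← h]
  change (Algebra.leftMulMatrix b x).mulVec (b.equivFun (normAdj b x)) = _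
  rw [h2, Matrix.mulVec_mulVec, Matrix.mul_adjugate, ← Algebra.norm_eq_matrix_det b,
    Matrix.smul_mulVec, Matrix.one_mulVec, Algebra.algebraMap_eq_smul_one, map_smul]

theorem normAdj_smul (b : Basis ι R A) (c : R) (x : A) :
    normAdj b (c • x) = c ^ (Fintype.card ι - 1) • normAdj b x := by
  rw [normAdj, map_smul, Matrix.adjugate_smul, Matrix.smul_mulVec, map_smul, normAdj]

/-- Cramer’s rule for inverses in an algebra. -/
theorem norm_smul_inv (b : Basis ι R A) (g : Aˣ) :
    Algebra.norm R (g : A) • ((g⁻¹ : Aˣ) : A) = normAdj b (g : A) := by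
  have h := congrArg (fun y => ((g⁻¹ : Aˣ) : A) * y) (mul_normAdj b (g : A))
  simp only [Units.inv_mul_cancel_left] at h
  rw [h, Algebra.algebraMap_eq_smul_one, mul_smul_comm, mul_one]

variable [TopologicalSpace R] [IsTopologicalRing R] [TopologicalSpace A] [IsModuleTopology R A]

theorem continuous_leftMulMatrix (b : Basis ι R A) : Continuous (Algebra.leftMulMatrix b) :=
  have : ContinuousAdd (Matrix ι ι R) := inferInstanceAs (ContinuousAdd (ι → ι → R))
  have : ContinuousSMul R (Matrix ι ι R) := inferInstanceAs (ContinuousSMul R (ι → ι → R))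
  IsModuleTopology.continuous_of_linearMap (Algebra.leftMulMatrix b).toLinearMap

theorem continuous_normAdj (b : Basis ι R A) : Continuous (normAdj b) := by
  have h1 : Continuous b.equivFun.symm := by
    have := IsModuleTopology.toContinuousAdd R A
    exact IsModuleTopology.continuous_of_linearMap b.equivFun.symm.toLinearMap
  exact h1.comp ((continuous_leftMulMatrix b).matrix_adjugate.matrix_mulVec continuous_const)

theorem continuous_algebraNorm (b : Basis ι R A) : Continuous (Algebra.norm R : A → R) := by
  have : (Algebra.norm R : A → R) = fun x => (Algebra.leftMulMatrix b x).det :=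
    funext fun x => Algebra.norm_eq_matrix_det b x
  rw [this]
  exact (continuous_leftMulMatrix b).matrix_det

end Norms

end

/-! ### Homogeneous functions on vector spaces over local fields -/

section

open Module Filter Topology

theorem IsLocalAbs.map_pow {D : Type*} [DivisionRing D] [TopologicalSpace D] {abv : D → ℝ}
    (h : IsLocalAbs abv) (x : D) (n : ℕ) : abv (x ^ n) = abv x ^ n := by
  induction n with
  | zero => simp [h.map_one]
  | succ n ih => rw [pow_succ, h.map_mul, ih, pow_succ]

theorem IsLocalAbs.map_zpow {D : Type*} [DivisionRing D] [TopologicalSpace D] {abv : D → ℝ}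
    (h : IsLocalAbs abv) (x : D) (n : ℤ) : abv (x ^ n) = abv x ^ n := by
  cases n with
  | ofNat n => simpa using h.map_pow x n
  | negSucc n => simp only [zpow_negSucc, h.map_inv, h.map_pow]

/-- The properties of the normalized absolute value of a local field which are used below. -/
structure IsLocalFieldAbs {F : Type*} [Field F] [TopologicalSpace F] (a : F → ℝ) : Prop
    extends IsLocalAbs a where
  isCompact : IsCompact {x | a x ≤ 1}
  exists_one_lt : ∃ x, 1 < a x

/-- Continuous nonnegative functions which are homogeneous of degree `j`. -/
structure IsHomogeneousAbs {F : Type*} [Field F] (a : F → ℝ) {V : Type*} [AddCommGroup V] [Module F V]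
    [TopologicalSpace V] (j : ℕ) (φ : V → ℝ) : Prop where
  cont : Continuous φ
  nonneg : ∀ x, 0 ≤ φ x
  smul : ∀ (c : F) x, φ (c • x) = a c ^ j * φ x

section Homogeneous

variable {F : Type*} [Field F] [TopologicalSpace F] [IsTopologicalRing F] {a : F → ℝ}
  (ha : IsLocalFieldAbs a) {V : Type*} [AddCommGroup V] [Module F V] [Module.Finite F V]
  [TopologicalSpace V] [IsModuleTopology F V]

include ha in
/-- Balls of any radius are compact, since they are contained in dilates of the unit ball. -/
theorem IsLocalFieldAbs.isCompact_le (R : ℝ) : IsCompact {x | a x ≤ R} := by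
  obtain ⟨t, ht⟩ := ha.exists_one_lt
  obtain ⟨n, hn⟩ := pow_unbounded_of_one_lt R ht
  have ht0 : t ≠ 0 := by
    rintro rfl
    rw [ha.map_zero] at ht
    linarith
  have hpow := ha.toIsLocalAbs.map_pow t
  refine (ha.isCompact.image (continuous_const_mul (t ^ n))).of_isClosed_subset
    (isClosed_le ha.cont continuous_const) fun x hx => ⟨(t ^ n)⁻¹ * x, ?_, ?_⟩
  · change a ((t ^ n)⁻¹ * x) ≤ 1
    rw [ha.map_mul, ha.map_inv, hpow, inv_mul_le_one₀ (by positivity)]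
    exact le_trans hx hn.le
  · exact mul_inv_cancel_left₀ (pow_ne_zero n ht0) x

variable (V) in
include ha in
/-- A compact set away from zero which meets every orbit of the powers of some scalar. -/
theorem IsLocalFieldAbs.exists_isCompact_annulus :
    ∃ t : F, 1 < a t ∧ ∃ K : Set V, IsCompact K ∧ 0 ∉ K ∧
      ∀ x : V, x ≠ 0 → ∃ n : ℤ, ∃ y ∈ K, x = t ^ n • y := by
  obtain ⟨t, ht⟩ := ha.exists_one_lt
  have ht0 : t ≠ 0 := by
    rintro rfl
    rw [ha.map_zero] at ht
    linarith
  refine ⟨t, ht, ?_⟩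
  set e := (finBasis F V).equivFun with he
  have := IsModuleTopology.toContinuousAdd F V
  have hec : Continuous e.symm := IsModuleTopology.continuous_of_linearMap e.symm.toLinearMap
  -- in coordinates: all of absolute value at most `1`, and one of absolute value at least `|t|⁻¹`
  set S : Set (Fin (finrank F V) → F) :=
    (Set.univ.pi fun _ => {x | a x ≤ 1}) ∩ ⋃ i, {y | (a t)⁻¹ ≤ a (y i)} with hS
  have hSc : IsCompact S := (isCompact_univ_pi fun _ => ha.isCompact).inter_right
    (isClosed_iUnion_of_finite fun i =>
      isClosed_le continuous_const (ha.cont.comp (continuous_apply i)))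
  have hzpow := ha.toIsLocalAbs.map_zpow t
  refine ⟨e.symm '' S, hSc.image hec, ?_, fun x hx => ?_⟩
  · rintro ⟨y, hy, hy0⟩
    have : y = 0 := by simpa using hy0
    obtain ⟨i, hi⟩ := Set.mem_iUnion.1 hy.2
    have h1 : (a t)⁻¹ ≤ a (y i) := hi
    rw [this, Pi.zero_apply, ha.map_zero] at h1
    have : 0 < (a t)⁻¹ := by positivity
    linarith
  · have hne : ∃ i, e x i ≠ 0 := by
      by_contra! h
      exact hx (e.map_eq_zero_iff.1 (funext h))
    obtain ⟨i₀, hi₀⟩ := hne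
    obtain ⟨i, -, hi⟩ := Finset.exists_max_image Finset.univ (fun i => a (e x i)) ⟨i₀, Finset.mem_univ _⟩
    have hpos : 0 < a (e x i) := (ha.pos hi₀).trans_le (hi i₀ (Finset.mem_univ _))
    obtain ⟨n, hn1, hn2⟩ := exists_mem_Ioc_zpow hpos ht
    refine ⟨n + 1, (t ^ (n + 1))⁻¹ • x, ⟨e ((t ^ (n + 1))⁻¹ • x), ⟨fun j _ => ?_, ?_⟩, by simp⟩, ?_⟩
    · change a (e ((t ^ (n + 1))⁻¹ • x) j) ≤ 1
      rw [map_smul, Pi.smul_apply, smul_eq_mul, ha.map_mul, ha.map_inv, hzpow,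
        inv_mul_le_one₀ (by positivity)]
      exact (hi j (Finset.mem_univ _)).trans hn2
    · refine Set.mem_iUnion.2 ⟨i, ?_⟩
      change _ ≤ a (e ((t ^ (n + 1))⁻¹ • x) i)
      have : (0 : ℝ) < a t := by linarith
      rw [map_smul, Pi.smul_apply, smul_eq_mul, ha.map_mul, ha.map_inv, hzpow, zpow_add_one₀ this.ne',
        mul_inv, mul_right_comm]
      refine le_mul_of_one_le_left (by positivity) ?_
      rw [← div_eq_inv_mul, one_le_div (by positivity)]
      exact hn1.le
    · rw [smul_inv_smul₀ (zpow_ne_zero _ ht0)]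

include ha in
/-- Homogeneous functions are compared on the compact set of `exists_isCompact_annulus`. -/
theorem IsHomogeneousAbs.exists_le {j d : ℕ} {φ w : V → ℝ} (hφ : IsHomogeneousAbs a j φ)
    (hw : IsHomogeneousAbs a d w) (hd : 0 < d) (hw0 : ∀ x, w x = 0 → x = 0) :
    ∃ C : ℝ, 0 ≤ C ∧ ∀ x, x ≠ 0 → φ x ≤ C * w x ^ ((j : ℝ) / d) := by
  obtain ⟨t, ht, K, hK, h0K, hx⟩ := ha.exists_isCompact_annulus V
  have hzpow := ha.toIsLocalAbs.map_zpow t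
  have hwK : ∀ y ∈ K, 0 < w y := fun y hy => lt_of_le_of_ne (hw.nonneg y) fun h => by
    rw [hw0 y h.symm] at hy
    exact h0K hy
  have hcont : ContinuousOn (fun y => φ y / w y ^ ((j : ℝ) / d)) K :=
    hφ.cont.continuousOn.div (hw.cont.continuousOn.rpow_const fun y hy => Or.inl (hwK y hy).ne')
      fun y hy => (Real.rpow_pos_of_pos (hwK y hy) _).ne'
  obtain ⟨C, hC⟩ := (hK.image_of_continuousOn hcont).bddAbove
  refine ⟨max C 0, le_max_right _ _, fun x hx0 => ?_⟩
  obtain ⟨n, y, hy, rfl⟩ := hx x hx0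
  have h1 : φ y ≤ max C 0 * w y ^ ((j : ℝ) / d) := by
    rw [← div_le_iff₀ (Real.rpow_pos_of_pos (hwK y hy) _)]
    exact (hC ⟨y, hy, rfl⟩).trans (le_max_left _ _)
  have htp : 0 < a t := by linarith
  rw [hφ.smul, hw.smul, hzpow, Real.mul_rpow (by positivity) (hw.nonneg y),
    ← Real.rpow_natCast (a t ^ n) d, ← Real.rpow_mul (by positivity),
    mul_div_cancel₀ _ (by positivity : (d : ℝ) ≠ 0), Real.rpow_natCast, mul_left_comm]
  gcongr

include ha in
/-- The sublevel sets of a homogeneous function which vanishes only at `0` are compact: it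
controls the coordinates. -/
theorem IsHomogeneousAbs.isCompact_le {d : ℕ} {w : V → ℝ} (hw : IsHomogeneousAbs a d w) (hd : 0 < d)
    (hw0 : ∀ x, w x = 0 → x = 0) (R : ℝ) : IsCompact {x | w x ≤ R} := by
  set e := (finBasis F V).equivFun with he
  have := IsModuleTopology.toContinuousAdd F V
  have hec : Continuous e.symm := IsModuleTopology.continuous_of_linearMap e.symm.toLinearMap
  have hec' : Continuous e := IsModuleTopology.continuous_of_linearMap e.toLinearMap
  have h1 : ∀ i, IsHomogeneousAbs a 1 fun x => a (e x i) := fun i =>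
    ⟨ha.cont.comp ((continuous_apply i).comp hec'), fun x => ha.nonneg _, fun c x => by
      rw [map_smul, Pi.smul_apply, smul_eq_mul, ha.map_mul, pow_one]⟩
  choose C hC0 hC using fun i => (h1 i).exists_le ha hw hd hw0
  refine ((isCompact_univ_pi fun i => ha.isCompact_le (C i * |R| ^ (((1 : ℕ) : ℝ) / d))).image
    hec).of_isClosed_subset (isClosed_le hw.cont continuous_const) fun x hx => ⟨e x, fun i _ => ?_, by simp⟩
  change a (e x i) ≤ _
  have hRC : 0 ≤ C i * |R| ^ (((1 : ℕ) : ℝ) / d) := mul_nonneg (hC0 i) (by positivity)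
  by_cases hx0 : x = 0
  · rw [hx0, map_zero, Pi.zero_apply, ha.map_zero]
    exact hRC
  · exact (hC i x hx0).trans (mul_le_mul_of_nonneg_left (Real.rpow_le_rpow (hw.nonneg x)
      (le_trans hx (le_abs_self R)) (by positivity)) (hC0 i))

end Homogeneous

/-- The weak triangle inequality follows from the compactness of the unit ball. -/
theorem isLocalAbs_of_isCompact {D : Type*} [DivisionRing D] [TopologicalSpace D] [ContinuousAdd D]
    {w : D → ℝ} (hnonneg : ∀ x, 0 ≤ w x) (hzero : ∀ x, w x = 0 ↔ x = 0)
    (hmul : ∀ x y, w (x * y) = w x * w y) (hcont : Continuous w) (hc : IsCompact {x | w x ≤ 1}) :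
    IsLocalAbs w := by
  refine ⟨hnonneg, hzero, hmul, hcont, ?_⟩
  obtain ⟨C, hC⟩ := (hc.image (hcont.comp (continuous_const_add (1 : D)))).bddAbove
  have h0 : w 0 = 0 := (hzero 0).2 rfl
  have h1 : w 1 = 1 := by
    have h1 := hmul 1 1
    rw [mul_one] at h1
    have h2 : w 1 ≠ 0 := fun h => one_ne_zero ((hzero (1 : D)).1 h)
    exact (mul_right_cancel₀ h2 (by rw [one_mul]; exact h1)).symm
  have key : ∀ x y, w y ≤ w x → w (x + y) ≤ max C 1 * (w x + w y) := by
    intro x y hxy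
    by_cases hx : x = 0
    · rw [hx, zero_add, h0, zero_add]
      exact le_mul_of_one_le_left (hnonneg y) (le_max_right _ _)
    · have hwx : 0 < w x := lt_of_le_of_ne (hnonneg x) fun h => hx ((hzero x).1 h.symm)
      have h2 : w (x⁻¹ * y) ≤ 1 := by
        have h3 : w x * w (x⁻¹ * y) = w y := by rw [← hmul, mul_inv_cancel_left₀ hx]
        by_contra! h4
        nlinarith
      have h3 : w (1 + x⁻¹ * y) ≤ C := hC ⟨x⁻¹ * y, h2, rfl⟩
      have h4 : x + y = x * (1 + x⁻¹ * y) := by rw [mul_add, mul_one, mul_inv_cancel_left₀ hx]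
      rw [h4, hmul, mul_comm]
      have := hnonneg y
      exact mul_le_mul (h3.trans (le_max_left _ _)) (by linarith) hwx.le
        (zero_le_one.trans (le_max_right _ _))
  refine ⟨max C 1, le_max_right _ _, fun x y => ?_⟩
  rcases le_total (w y) (w x) with h | h
  · exact key x y h
  · rw [add_comm, add_comm (w x)]
    exact key y x h

end

/-! ### The reduced norm over a local field, and the local estimate -/

section

open Module Filter Topology MeasureTheory

section LocalNorm

variable {F : Type*} [Field F] [CharZero F] [TopologicalSpace F] [IsTopologicalRing F] {a : F → ℝ}
  (ha : IsLocalFieldAbs a) (A : Type*) [Ring A] [Algebra F A] [Algebra.IsCentral F A]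
  [IsSimpleRing A] [FiniteDimensional F A] {n : ℕ} (hn : finrank F A = n ^ 2)

omit [CharZero F] [TopologicalSpace F] [IsTopologicalRing F] [Algebra.IsCentral F A] in
include hn in
/-- The degree of a central simple algebra is positive. -/
theorem degree_pos : 0 < n := by
  rcases Nat.eq_zero_or_pos n with h | h
  · rw [h, zero_pow two_ne_zero] at hn
    exact absurd hn finrank_pos.ne'
  · exact h

omit [IsTopologicalRing F] in
include ha hn in
theorem abs_reducedNormField_pow (x : A) :
    a (reducedNormField F A n x) ^ n = a (Algebra.norm F x) := by
  rw [← ha.map_pow, reducedNormField_pow F A hn]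

omit [IsTopologicalRing F] in
include ha hn in
/-- Multiplicativity of `|ν|` follows from that of its `n`-th power, the absolute value of the
norm. -/
theorem abs_reducedNormField_mul (x y : A) : a (reducedNormField F A n (x * y)) =
    a (reducedNormField F A n x) * a (reducedNormField F A n y) := by
  refine (pow_left_inj₀ (ha.nonneg _) (mul_nonneg (ha.nonneg _) (ha.nonneg _))
    (degree_pos A hn).ne').1 ?_
  simp only [mul_pow, abs_reducedNormField_pow ha A hn, map_mul, ha.map_mul]

omit [IsTopologicalRing F] in
include ha hn in
theorem abs_reducedNormField_ne_zero {x : A} (hx : IsUnit x) :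
    a (reducedNormField F A n x) ≠ 0 := by
  intro h
  have h1 := abs_reducedNormField_pow ha A hn x
  rw [h, zero_pow (degree_pos A hn).ne'] at h1
  exact (hx.map (Algebra.norm F)).ne_zero ((ha.eq_zero_iff _).1 h1.symm)

variable [TopologicalSpace A] [IsModuleTopology F A]

include ha hn in
/-- The function `|ν|` is an `n`-th root of the absolute value of the norm, hence continuous and
homogeneous of degree `n`. -/
theorem isHomogeneousAbs_reducedNormField :
    IsHomogeneousAbs a n fun x : A => a (reducedNormField F A n x) := by
  have hn0 := degree_pos A hn
  have h1 : (fun x : A => a (reducedNormField F A n x)) =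
      fun x => a (Algebra.norm F x) ^ ((n : ℝ)⁻¹) := by
    funext x
    rw [← abs_reducedNormField_pow ha A hn, Real.pow_rpow_inv_natCast (ha.nonneg _) hn0.ne']
  refine ⟨?_, fun x => ha.nonneg _, fun c x => ?_⟩
  · rw [h1]
    exact (ha.cont.comp (continuous_algebraNorm (finBasis F A))).rpow_const
      fun x => Or.inr (by positivity)
  · refine (pow_left_inj₀ (ha.nonneg _) (mul_nonneg (pow_nonneg (ha.nonneg _) _) (ha.nonneg _))
      hn0.ne').1 ?_
    rw [mul_pow, abs_reducedNormField_pow ha A hn, abs_reducedNormField_pow ha A hn, Algebra.smul_def,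
      map_mul, Algebra.norm_algebraMap, hn, ha.map_mul, ha.map_pow, sq, pow_mul]

end LocalNorm

section LocalEstimate

variable {F : Type*} [Field F] [CharZero F] [TopologicalSpace F] [IsTopologicalRing F] [T2Space F]
  {a : F → ℝ} (ha : IsLocalFieldAbs a) (D : Type*) [DivisionRing D] [Algebra F D]
  [Algebra.IsCentral F D] [FiniteDimensional F D] {d : ℕ} (hd : finrank F D = d ^ 2)
  [TopologicalSpace D] [IsModuleTopology F D]

omit [T2Space F] in
include ha hd in
/-- On a division algebra `|ν|` vanishes only at `0`, and has compact unit ball. -/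
theorem isLocalAbs_reducedNormField : IsLocalAbs fun x : D => a (reducedNormField F D d x) := by
  have := IsModuleTopology.toContinuousAdd F D
  have h := isHomogeneousAbs_reducedNormField ha D hd
  have hzero : ∀ x : D, a (reducedNormField F D d x) = 0 ↔ x = 0 := by
    intro x
    constructor
    · intro hx
      by_contra h0
      exact abs_reducedNormField_ne_zero ha D hd (isUnit_iff_ne_zero.2 h0) hx
    · rintro rfl
      have := h.smul 0 0
      rwa [smul_zero, ha.map_zero, zero_pow (degree_pos D hd).ne', zero_mul] at this
  exact isLocalAbs_of_isCompact h.nonneg hzero (abs_reducedNormField_mul ha D hd) h.cont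
    (h.isCompact_le ha (degree_pos D hd) (fun x hx => (hzero x).1 hx) 1)

omit [Algebra.IsCentral F D] [CharZero F] in
include F in
variable (F) in
theorem t2Space_of_finiteDimensional : T2Space D := by
  have hec' : Continuous (finBasis F D).equivFun :=
    IsModuleTopology.continuous_of_linearMap (finBasis F D).equivFun.toLinearMap
  exact T2Space.of_injective_continuous (finBasis F D).equivFun.injective hec'

omit [T2Space F] [CharZero F] [Algebra.IsCentral F D] [IsTopologicalRing F] [FiniteDimensional F D] in
variable (F) in
theorem isModuleTopology_matrix (m : ℕ) : IsModuleTopology F (Matrix (Fin m) (Fin m) D) :=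
  inferInstanceAs (IsModuleTopology F (Fin m → Fin m → D))

omit [TopologicalSpace F] [IsTopologicalRing F] [T2Space F] [CharZero F] [TopologicalSpace D]
  [IsModuleTopology F D] [Algebra.IsCentral F D] [FiniteDimensional F D] in
include hd in
theorem finrank_matrix (m : ℕ) : finrank F (Matrix (Fin m) (Fin m) D) = (m * d) ^ 2 := by
  rw [Module.finrank_matrix, hd, Fintype.card_fin]
  ring

variable {m : ℕ} (hm : 0 < m) {K : Subgroup (Matrix (Fin m) (Fin m) D)ˣ}
  (hK : IsCompact (K : Set (Matrix (Fin m) (Fin m) D)ˣ)) (hG : HasGivens K)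
  [MeasurableSpace K] [BorelSpace K] (μ : Measure K) [μ.IsHaarMeasure]
  {N : Matrix (Fin m) (Fin m) D → ℝ} {i : ℕ} (hi : 0 < i)
  (hN : IsHomogeneousAbs a 1 fun X => N X ^ i) (hNn : ∀ X, 0 ≤ N X) (hN0 : ∀ X, N X = 0 → X = 0)

include ha hd hm hK hG hi hN hNn hN0 in
/-- The weights of the Schwartz space of `GL_m(D)`, multiplied by `|ν|^{(m-1)d/2 + ε}` with `ε > 0`,
have polynomial growth. The power `i` takes into account that the normalized absolute value of `ℂ` is the
square of the usual one. -/
theorem exists_hcWeight_reducedNorm_le (r : ℝ≥0) {ε₁ ε₂ : ℝ} (h1 : 0 < ε₁) (h2 : ε₁ ≤ ε₂) :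
    ∃ (C : ℝ) (k : ℕ), 0 ≤ C ∧ ∀ g : (Matrix (Fin m) (Fin m) D)ˣ, ∀ ε ∈ Set.Icc ε₁ ε₂,
      |hcWeight N (xi (fun x => a (reducedNormField F D d x)) m d K μ) r g| *
        (a (reducedNormField F (Matrix (Fin m) (Fin m) D) (m * d) g.1) ^ (((m : ℝ) - 1) * d / 2 + ε) *
          (1 + |Real.log (a (reducedNormField F (Matrix (Fin m) (Fin m) D) (m * d) g.1))|)) ≤
        C * (1 + N g.1) ^ k := by
  have : Nonempty (Fin m) := ⟨⟨0, hm⟩⟩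
  have := isModuleTopology_matrix F D m
  have := IsModuleTopology.isTopologicalRing F D
  have := t2Space_of_finiteDimensional F D
  have hdA := finrank_matrix D hd (F := F) m
  have hd0 := degree_pos D hd
  have hA0 := degree_pos (Matrix (Fin m) (Fin m) D) hdA
  have h := isLocalAbs_reducedNormField ha D hd
  have hhom := isHomogeneousAbs_reducedNormField ha D hd
  have hA := isHomogeneousAbs_reducedNormField ha (Matrix (Fin m) (Fin m) D) hdA
  set w : D → ℝ := fun x => a (reducedNormField F D d x) with hw
  set wA : Matrix (Fin m) (Fin m) D → ℝ :=
    fun x => a (reducedNormField F (Matrix (Fin m) (Fin m) D) (m * d) x) with hwA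
  have hpow : ∀ X, wA X ^ (m * d) = a (Algebra.norm F X) :=
    abs_reducedNormField_pow ha (Matrix (Fin m) (Fin m) D) hdA
  have hwpos : ∀ g : (Matrix (Fin m) (Fin m) D)ˣ, 0 < wA g.1 := fun g =>
    lt_of_le_of_ne (hA.nonneg _)
      (abs_reducedNormField_ne_zero ha (Matrix (Fin m) (Fin m) D) hdA g.isUnit).symm
  -- the `(m d)`-th powers agree by the formula for the norm of a triangular matrix
  have hwtri : ∀ p ∈ upperTriangular F D m, wA p.1 = ∏ i, w (p.1 i i) := by
    intro p hp
    refine (pow_left_inj₀ (hA.nonneg _) (Finset.prod_nonneg fun i _ => hhom.nonneg _) hA0.ne').1 ?_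
    rw [hpow, norm_upperTriangular p.1 hp, ← Finset.prod_pow]
    have h4 : a (∏ i, Algebra.norm F (p.1 i i) ^ m) = ∏ i, a (Algebra.norm F (p.1 i i) ^ m) :=
      map_prod (⟨⟨a, ha.map_one⟩, ha.map_mul⟩ : F →* ℝ) _ _
    rw [h4]
    refine Finset.prod_congr rfl fun i _ => ?_
    rw [ha.map_pow, ← abs_reducedNormField_pow ha D hd, ← pow_mul, mul_comm]
  have hM : IsHomogeneousAbs a d (entrySum w : Matrix (Fin m) (Fin m) D → ℝ) := by
    refine ⟨h.continuous_entrySum, h.entrySum_nonneg, fun c X => ?_⟩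
    simp only [entrySum, Finset.mul_sum, Matrix.smul_apply, hhom.smul]
  have hM0 : ∀ X : Matrix (Fin m) (Fin m) D, entrySum w X = 0 → X = 0 := by
    intro X hX
    ext i j
    exact (h.eq_zero_iff _).1 (le_antisymm (hX ▸ h.le_entrySum X i j) (h.nonneg _))
  have hne : ∀ g : (Matrix (Fin m) (Fin m) D)ˣ, g.1 ≠ 0 := fun g => g.isUnit.ne_zero
  -- homogeneous functions grow polynomially in the size of the entries
  have hpoly : ∀ {j : ℕ} {φ : Matrix (Fin m) (Fin m) D → ℝ}, IsHomogeneousAbs a j φ →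
      ∃ C b : ℝ, 0 ≤ C ∧ 0 ≤ b ∧ ∀ g : (Matrix (Fin m) (Fin m) D)ˣ, φ g.1 ≤ C * (1 + entrySum w g.1) ^ b := by
    intro j φ hφ
    obtain ⟨C, hC, hle⟩ := hφ.exists_le ha hM hd0 hM0
    refine ⟨C, (j : ℝ) / d, hC, by positivity, fun g => (hle g.1 (hne g)).trans ?_⟩
    exact mul_le_mul_of_nonneg_left (Real.rpow_le_rpow (hM.nonneg _)
      (by linarith) (by positivity)) hC
  -- the entries of the inverse
  have hinv : ∃ C b c : ℝ, 0 ≤ C ∧ 0 ≤ b ∧ 0 ≤ c ∧ ∀ g : (Matrix (Fin m) (Fin m) D)ˣ,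
      entrySum w (g⁻¹).1 ≤ C * (1 + entrySum w g.1) ^ b * wA g.1 ^ (-c) := by
    -- `N(g) g⁻¹` has coordinates which are homogeneous polynomials in those of `g`, and `|N(g)|`
    -- is a power of `|ν(g)|`
    set B := finBasis F (Matrix (Fin m) (Fin m) D) with hB
    have h5 : IsHomogeneousAbs a
        ((Fintype.card (Fin (finrank F (Matrix (Fin m) (Fin m) D))) - 1) * d)
        fun X => entrySum w (normAdj B X) :=
      ⟨hM.cont.comp (continuous_normAdj B), fun X => hM.nonneg _, fun c X => by
        rw [normAdj_smul, hM.smul, ha.map_pow, pow_mul]⟩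
    obtain ⟨C, b, hC, hb, hle⟩ := hpoly h5
    refine ⟨C, b, ((m * d * d : ℕ) : ℝ), hC, hb, by positivity, fun g => ?_⟩
    have h6 := hle g
    simp only [← norm_smul_inv B g] at h6
    rw [hM.smul, ← hpow, ← pow_mul] at h6
    rw [Real.rpow_neg (hwpos g).le, Real.rpow_natCast, ← div_eq_mul_inv, le_div_iff₀ (pow_pos (hwpos g) _),
      mul_comm]
    exact h6
  have hN0' : ∀ X, N X ^ i = 0 → X = 0 := fun X hX => hN0 X (pow_eq_zero_iff hi.ne' |>.1 hX)
  -- lower bound for the maximum in the definition of `σ`, for the homogeneous function `N ^ i`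
  have hlow : ∃ c : ℝ, 0 < c ∧ ∀ g : (Matrix (Fin m) (Fin m) D)ˣ,
      c ≤ max (N g.1 ^ i) (N (g⁻¹).1 ^ i) := by
    obtain ⟨C, hC, hle⟩ := hM.exists_le ha hN one_pos hN0'
    obtain ⟨C', hC', hmul⟩ := h.exists_entrySum_mul_le m
    have h7 : 0 < entrySum w (1 : Matrix (Fin m) (Fin m) D) :=
      lt_of_le_of_ne (hM.nonneg _) fun h0 => one_ne_zero (hM0 _ h0.symm)
    by_contra! hcon
    -- if both `N g` and `N g⁻¹` were small, then `1 = g g⁻¹` would have small entries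
    set S : ℝ := C' * (C * C) + 1 with hS
    have hS0 : 0 < S := by positivity
    set c : ℝ := min 1 (entrySum w (1 : Matrix (Fin m) (Fin m) D) / (2 * S)) with hc
    have hc0 : 0 < c := by positivity
    obtain ⟨g, hg⟩ := hcon c hc0
    have hb : ∀ g' : (Matrix (Fin m) (Fin m) D)ˣ, N g'.1 ^ i ≤ c → entrySum w g'.1 ≤ C * c := by
      intro g' hg'
      refine (hle g'.1 (hne g')).trans (mul_le_mul_of_nonneg_left ?_ hC)
      have hd1 : (1 : ℝ) ≤ (d : ℝ) / ((1 : ℕ) : ℝ) := by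
        rw [Nat.cast_one, div_one]; exact_mod_cast hd0
      calc (N g'.1 ^ i) ^ ((d : ℝ) / ((1 : ℕ) : ℝ)) ≤ c ^ ((d : ℝ) / ((1 : ℕ) : ℝ)) :=
            Real.rpow_le_rpow (hN.nonneg _) hg' (by positivity)
        _ ≤ c ^ (1 : ℝ) := Real.rpow_le_rpow_of_exponent_ge hc0 (min_le_left _ _) hd1
        _ = c := Real.rpow_one c
    have e1 := hb g ((le_max_left _ _).trans hg.le)
    have e2 := hb g⁻¹ ((le_max_right _ _).trans hg.le)
    have e3 := hmul g.1 (g⁻¹).1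
    rw [Units.mul_inv] at e3
    have e4 : entrySum w g.1 * entrySum w (g⁻¹).1 ≤ C * c * (C * c) :=
      mul_le_mul e1 e2 (hM.nonneg _) (by positivity)
    have e6 : c ≤ entrySum w (1 : Matrix (Fin m) (Fin m) D) / (2 * S) := min_le_right _ _
    have e7 : c ≤ 1 := min_le_left _ _
    rw [le_div_iff₀ (by positivity)] at e6
    have e8 : entrySum w (1 : Matrix (Fin m) (Fin m) D) ≤ C' * (C * C) * (c * c) := by
      refine e3.trans (le_of_le_of_eq (mul_le_mul_of_nonneg_left e4 (by linarith)) (by ring))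
    have e9 : C' * (C * C) * (c * c) ≤ S * c := by
      have : c * c ≤ c := by nlinarith
      have h10 : C' * (C * C) ≤ S := by rw [hS]; linarith
      exact mul_le_mul h10 this (by positivity) hS0.le
    nlinarith
  have hlow' : ∃ c : ℝ, 0 < c ∧ ∀ g : (Matrix (Fin m) (Fin m) D)ˣ, c ≤ max (N g.1) (N (g⁻¹).1) := by
    obtain ⟨c, hc, hle⟩ := hlow
    refine ⟨min 1 c, lt_min one_pos hc, fun g => ?_⟩
    have key : ∀ x : ℝ, 0 ≤ x → c ≤ x ^ i → min 1 c ≤ x := by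
      intro x hx hcx
      rcases le_total 1 x with h1 | h1
      · exact (min_le_left _ _).trans h1
      · exact (min_le_right _ _).trans (hcx.trans (pow_le_of_le_one hx h1 hi.ne'))
    rcases le_max_iff.1 (hle g) with h1 | h1
    · exact (key _ (hNn _) h1).trans (le_max_left _ _)
    · exact (key _ (hNn _) h1).trans (le_max_right _ _)
  have hNpoly : ∃ C b : ℝ, 0 ≤ C ∧ 0 ≤ b ∧ ∀ g : (Matrix (Fin m) (Fin m) D)ˣ,
      N g.1 ≤ C * (1 + entrySum w g.1) ^ b := by
    obtain ⟨C, b, hC, hb, hle⟩ := hpoly hN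
    refine ⟨1 + C, b, by linarith, hb, fun g => ?_⟩
    have h1 : (1 : ℝ) ≤ (1 + entrySum w g.1) ^ b :=
      Real.one_le_rpow (by linarith [hM.nonneg g.1]) hb
    have h2 := hle g
    have h3 : N g.1 ≤ 1 + N g.1 ^ i := by
      rcases le_total 1 (N g.1) with h4 | h4
      · linarith [le_self_pow₀ h4 hi.ne']
      · linarith [pow_nonneg (hNn g.1) i]
    rw [add_mul, one_mul]
    linarith
  obtain ⟨C, k, hC, hle⟩ := exists_hcWeight_mul_le (N := N) (Ξ := xi w m d K μ)
    (w := fun g : (Matrix (Fin m) (Fin m) D)ˣ => wA g.1)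
    (M := fun g : (Matrix (Fin m) (Fin m) D)ˣ => entrySum w g.1)
    (e := ((m : ℝ) - 1) * d / 2) (fun g => hM.nonneg _) hwpos
    (exists_le_xi (F := F) h hK d (exists_iwasawa hG) (hA.cont.comp Units.continuous_val) hwpos
      (fun g g' => abs_reducedNormField_mul ha (Matrix (Fin m) (Fin m) D) hdA g.1 g'.1) hwtri μ)
    (hpoly hA) hNpoly hinv hlow' r h1 h2
  -- replace the size of the entries by the norm `N`
  obtain ⟨C₁, hC₁, hle₁⟩ := hM.exists_le ha hN one_pos hN0'
  refine ⟨C * (1 + C₁) ^ k, i * d * k, by positivity, fun g ε hε => (hle g ε hε).trans ?_⟩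
  rw [mul_assoc, pow_mul, ← mul_pow]
  have hNg := hNn g.1
  have h11 : entrySum w g.1 ≤ C₁ * (1 + N g.1) ^ (i * d) := by
    have := hle₁ g.1 (hne g)
    rw [Nat.cast_one, div_one, Real.rpow_natCast, ← pow_mul] at this
    exact this.trans (mul_le_mul_of_nonneg_left (pow_le_pow_left₀ hNg (by linarith) _) hC₁)
  have h12 : (1 : ℝ) ≤ (1 + N g.1) ^ (i * d) := one_le_pow₀ (by linarith)
  have := hM.nonneg g.1
  gcongr
  rw [add_mul, one_mul]
  linarith

end LocalEstimate

end

/-! ### Complex powers, plane matrices, stabilizers -/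

section

open Module Filter Topology MeasureTheory

theorem IsLocalAbs.t2Space {D : Type*} [DivisionRing D] [TopologicalSpace D] [IsTopologicalRing D]
    {a : D → ℝ} (ha : IsLocalAbs a) : T2Space D := by
  have h : IsClosed ({0} : Set D) := by
    have : ({0} : Set D) = a ⁻¹' {0} := by
      ext x
      simp [ha.eq_zero_iff]
    rw [this]
    exact isClosed_singleton.preimage ha.cont
  have := IsTopologicalAddGroup.t1Space D h
  infer_instance

/-- The mean value inequality for `z ↦ w^z` on a vertical strip. -/
theorem norm_cpow_sub_cpow_le {w b c : ℝ} (hw : 0 < w) {z z₀ : ℂ} (hz : z.re ∈ Set.Icc b c)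
    (hz₀ : z₀.re ∈ Set.Icc b c) :
    ‖(w : ℂ) ^ z - (w : ℂ) ^ z₀‖ ≤ |Real.log w| * (w ^ b + w ^ c) * ‖z - z₀‖ := by
  have hw' : (w : ℂ) ≠ 0 := by exact_mod_cast hw.ne'
  have hconv : Convex ℝ {z : ℂ | z.re ∈ Set.Icc b c} :=
    (convex_Icc b c).linear_preimage Complex.reCLM.toLinearMap
  refine hconv.norm_image_sub_le_of_norm_hasDerivWithin_le
    (f := fun z => (w : ℂ) ^ z) (f' := fun z => (w : ℂ) ^ z * Complex.log w) ?_ ?_ hz₀ hz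
  · intro x _
    exact ((hasDerivAt_id x).const_cpow (Or.inl hw')).hasDerivWithinAt.congr_deriv (by simp)
  · intro x hx
    rw [norm_mul, Complex.norm_cpow_eq_rpow_re_of_pos hw, ← Complex.ofReal_log hw.le,
      Complex.norm_real, Real.norm_eq_abs, mul_comm]
    refine mul_le_mul_of_nonneg_left ?_ (abs_nonneg _)
    rcases le_total w 1 with h | h
    · have := Real.rpow_le_rpow_of_exponent_ge hw h hx.1
      have := Real.rpow_pos_of_pos hw c
      linarith
    · have := Real.rpow_le_rpow_of_exponent_le h hx.2
      have := Real.rpow_pos_of_pos hw b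
      linarith

section PlaneMatrix

variable {D : Type*} [Ring D] {m : ℕ}

/-- The matrix with entries `p, q; r, s` in the coordinate plane `{i, j}`, and otherwise the
identity. -/
def planeMatrix (i j : Fin m) (P : Matrix (Fin 2) (Fin 2) D) : Matrix (Fin m) (Fin m) D :=
  fun x y =>
    if x = i then (if y = i then P 0 0 else if y = j then P 0 1 else 0)
    else if x = j then (if y = i then P 1 0 else if y = j then P 1 1 else 0)
    else if x = y then 1 else 0

theorem planeMatrix_one {i j : Fin m} (hij : i ≠ j) : planeMatrix i j (1 : Matrix (Fin 2) (Fin 2) D) = 1 := by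
  ext x y
  simp only [planeMatrix, Matrix.one_apply]
  split_ifs <;> simp_all

theorem planeMatrix_mul {i j : Fin m} (hij : i ≠ j) (P Q : Matrix (Fin 2) (Fin 2) D) :
    planeMatrix i j P * planeMatrix i j Q = planeMatrix i j (P * Q) := by
  ext x y
  rw [Matrix.mul_apply]
  by_cases hx : x = i ∨ x = j
  · rw [Fintype.sum_eq_add i j hij]
    · rcases hx with rfl | rfl <;> simp only [planeMatrix, Matrix.mul_apply, Fin.sum_univ_two]
      <;> split_ifs <;> simp_all
    · intro l hl
      rcases hx with rfl | rfl <;> simp [planeMatrix, hl.1, hl.2]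
  · push Not at hx
    rw [Fintype.sum_eq_single x]
    · simp only [planeMatrix]
      split_ifs <;> simp_all
    · intro l hl
      simp [planeMatrix, hx.1, hx.2, Ne.symm hl]

/-- The unit defined by a plane matrix with an inverse. -/
def planeUnit {i j : Fin m} (hij : i ≠ j) (P : (Matrix (Fin 2) (Fin 2) D)ˣ) :
    (Matrix (Fin m) (Fin m) D)ˣ where
  val := planeMatrix i j P.1
  inv := planeMatrix i j (P⁻¹).1
  val_inv := by rw [planeMatrix_mul hij, Units.mul_inv, planeMatrix_one hij]
  inv_val := by rw [planeMatrix_mul hij, Units.inv_mul, planeMatrix_one hij]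

theorem planeMatrix_apply_of_ne {i j : Fin m} (P : Matrix (Fin 2) (Fin 2) D) (r c : Fin m)
    (h : (c ≠ i ∧ c ≠ j) ∨ (r ≠ i ∧ r ≠ j)) :
    planeMatrix i j P r c = (1 : Matrix (Fin m) (Fin m) D) r c := by
  simp only [planeMatrix, Matrix.one_apply]
  split_ifs <;> simp_all

theorem planeMatrix_apply_same (i j : Fin m) (P : Matrix (Fin 2) (Fin 2) D) :
    planeMatrix i j P i i = P 0 0 := by
  simp [planeMatrix]

theorem planeMatrix_apply_swap {i j : Fin m} (hij : i ≠ j) (P : Matrix (Fin 2) (Fin 2) D) :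
    planeMatrix i j P j i = P 1 0 := by
  simp [planeMatrix, hij.symm]

end PlaneMatrix

/-- For the existence of rotations it is enough to treat matrices of size two. -/
theorem hasGivens_of_planeUnit {F : Type*} [Field F] {D : Type*} [DivisionRing D] [Algebra F D]
    {m : ℕ} {K : Subgroup (Matrix (Fin m) (Fin m) D)ˣ}
    (h : ∀ a b : D, ∃ P : (Matrix (Fin 2) (Fin 2) D)ˣ, a * P.1 0 0 + b * P.1 1 0 = 0 ∧
      ∀ (i j : Fin m) (hij : i ≠ j), planeUnit hij P ∈ K) : HasGivens K := by
  intro i j hij a b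
  obtain ⟨P, hP, hK⟩ := h a b
  refine ⟨planeUnit hij.ne P, hK i j hij.ne, planeMatrix_apply_of_ne P.1, ?_⟩
  change a * planeMatrix i j P.1 i i + b * planeMatrix i j P.1 j i = 0
  rw [planeMatrix_apply_same, planeMatrix_apply_swap hij.ne, hP]

/-- The units `u` which stabilize `f` under the translations `x ↦ u x` and `x ↦ x u`. -/
def biStabilizer {M : Type*} [Monoid M] (f : M → ℂ) : Subgroup Mˣ where
  carrier := {u | ∀ x, f (u * x) = f x ∧ f (x * u) = f x}
  one_mem' := fun x => by simp
  mul_mem' := fun {u v} hu hv x => by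
    constructor
    · rw [Units.val_mul, mul_assoc, (hu _).1, (hv _).1]
    · rw [Units.val_mul, ← mul_assoc, (hv _).2, (hu _).2]
  inv_mem' := fun {u} hu x => by
    constructor
    · rw [← (hu _).1, Units.mul_inv_cancel_left]
    · rw [← (hu _).2, Units.inv_mul_cancel_right]

/-- Locally constant functions with compact support are invariant under open groups of units. -/
theorem isOpen_biStabilizer {M : Type*} [Monoid M] [TopologicalSpace M] [ContinuousMul M] {f : M → ℂ}
    (hf : IsLocallyConstant f) (hc : HasCompactSupport f) :
    IsOpen (biStabilizer f : Set Mˣ) := by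
  -- by the tube lemma, translations by `u` close to `1` preserve `f` on its compact support
  have h1 : ∀ (p : M × M → M), Continuous p → (∀ x, p (1, x) = x) →
      ∃ U : Set M, IsOpen U ∧ 1 ∈ U ∧ ∀ u ∈ U, ∀ x ∈ tsupport f, f (p (u, x)) = f x := by
    intro p hp h1
    have ho : IsOpen {q : M × M | f (p q) = f q.2} := by
      have h2 : IsLocallyConstant fun q : M × M => (f (p q), f q.2) :=
        (hf.comp_continuous hp).prodMk (hf.comp_continuous continuous_snd)
      exact h2 {y : ℂ × ℂ | y.1 = y.2}
    obtain ⟨U, V, hU, -, h1U, hV, hUV⟩ := generalized_tube_lemma (isCompact_singleton (x := (1 : M))) hc ho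
      (by rintro ⟨u, x⟩ ⟨rfl, -⟩; simp [h1])
    exact ⟨U, hU, h1U rfl, fun u hu x hx => hUV (Set.mk_mem_prod hu (hV hx))⟩
  obtain ⟨U, hU, h1U, hU'⟩ := h1 (fun q => q.1 * q.2) (continuous_fst.mul continuous_snd) (by simp)
  obtain ⟨V, hV, h1V, hV'⟩ := h1 (fun q => q.2 * q.1) (continuous_snd.mul continuous_fst) (by simp)
  refine Subgroup.isOpen_of_mem_nhds _ (g := 1) ?_
  have hn : ∀ W : Set M, IsOpen W → 1 ∈ W → {u : Mˣ | u.1 ∈ W ∧ (u⁻¹).1 ∈ W} ∈ 𝓝 (1 : Mˣ) := by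
    intro W hW h1W
    refine ((hW.preimage Units.continuous_val).inter (hW.preimage
      (Units.continuous_val.comp continuous_inv))).mem_nhds ?_
    exact ⟨h1W, by simpa using h1W⟩
  -- a point outside the support cannot be moved into it, because translation by `u⁻¹` preserves
  -- `f` on the support
  filter_upwards [hn U hU h1U, hn V hV h1V] with u hu hv x
  constructor
  · by_cases hx : x ∈ tsupport f
    · exact hU' u hu.1 x hx
    · by_contra hne
      have h0 : f x = 0 := image_eq_zero_of_notMem_tsupport hx
      rw [h0] at hne
      have := hU' (u⁻¹).1 hu.2 _ (subset_tsupport f hne)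
      rw [Units.inv_mul_cancel_left, h0] at this
      exact hne this.symm
  · by_cases hx : x ∈ tsupport f
    · exact hV' u hv.1 x hx
    · by_contra hne
      have h0 : f x = 0 := image_eq_zero_of_notMem_tsupport hx
      rw [h0] at hne
      have := hV' (u⁻¹).1 hv.2 _ (subset_tsupport f hne)
      simp only [Units.mul_inv_cancel_right, h0] at this
      exact hne this.symm

/-- The stabilizer of a locally constant function inside a compact open subgroup. -/
def biStabilizerIn {M : Type*} [Monoid M] [TopologicalSpace M] [ContinuousMul M]
    (J : CompactOpen Mˣ) (f : LocConstCompact M) : CompactOpen Mˣ :=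
  ⟨biStabilizer f.1 ⊓ J.1, by
    have ho := isOpen_biStabilizer f.2.1 f.2.2
    refine ⟨ho.inter J.2.1, ?_⟩
    have hcl : IsClosed (biStabilizer f.1 : Set Mˣ) := Subgroup.isClosed_of_isOpen _ ho
    exact J.2.2.inter_left hcl⟩

/-- Units which remain with their inverses in a compact set form a compact set, because the
topology of the units is induced by `g ↦ (g, g⁻¹)`. -/
theorem isCompact_units {M : Type*} [Monoid M] [TopologicalSpace M] [T1Space M] [ContinuousMul M]
    {S : Set M} (hS : IsCompact S) : IsCompact {g : Mˣ | g.1 ∈ S ∧ (g⁻¹).1 ∈ S} := by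
  have h1 := Units.isClosedEmbedding_embedProduct (α := M)
  have h2 := h1.isCompact_preimage (hS.prod (hS.image MulOpposite.continuous_op))
  convert h2 using 1
  ext g
  simp [Units.embedProduct]

end

/-! ### The non-archimedean local case -/

section

open Module Filter Topology MeasureTheory

section NA

section Field

variable (F : Type*) [Field F] [ValuativeRel F] [TopologicalSpace F] [IsNonarchimedeanLocalField F]

theorem one_lt_card_residueField : (1 : ℝ≥0) < (Nat.card 𝓀[F] : ℝ≥0) := by
  exact_mod_cast Finite.one_lt_card

variable {F}

theorem absNA_le_iff (x y : F) :
    absNA F x ≤ absNA F y ↔ ValuativeRel.valuation F x ≤ ValuativeRel.valuation F y := by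
  rw [absNA, absNA, NNReal.coe_le_coe,
    (WithZeroMulInt.toNNReal_strictMono (one_lt_card_residueField F)).le_iff_le]
  exact (IsNonarchimedeanLocalField.valueGroupWithZeroIsoInt F).strictMono.le_iff_le

theorem absNA_le_one_iff (x : F) : absNA F x ≤ 1 ↔ ValuativeRel.valuation F x ≤ 1 := by
  have := absNA_le_iff x (1 : F)
  rw [map_one] at this
  rw [← this]
  simp [absNA]

theorem absNA_mul (x y : F) : absNA F (x * y) = absNA F x * absNA F y := by
  simp [absNA]

theorem absNA_eq_zero_iff (x : F) : absNA F x = 0 ↔ x = 0 := by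
  simp [absNA]

theorem absNA_nonneg (x : F) : 0 ≤ absNA F x := NNReal.coe_nonneg _

theorem absNA_add_le (x y : F) : absNA F (x + y) ≤ max (absNA F x) (absNA F y) := by
  rcases le_total (ValuativeRel.valuation F x) (ValuativeRel.valuation F y) with h | h
  · exact ((absNA_le_iff _ _).2 ((Valuation.map_add _ x y).trans (max_le h le_rfl))).trans
      (le_max_right _ _)
  · exact ((absNA_le_iff _ _).2 ((Valuation.map_add _ x y).trans (max_le le_rfl h))).trans
      (le_max_left _ _)

theorem exists_one_lt_absNA : ∃ x : F, 1 < absNA F x := by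
  obtain ⟨x, hx0, hx⟩ := Valuation.IsNontrivial.exists_lt_one (v := ValuativeRel.valuation F)
  refine ⟨x⁻¹, ?_⟩
  rw [← not_le, absNA_le_one_iff, map_inv₀, not_le]
  exact (one_lt_inv₀ (zero_lt_iff.2 ((Valuation.ne_zero_iff _).2 hx0))).2 hx

theorem absNA_one : absNA F 1 = 1 := by simp [absNA]

theorem absNA_neg (x : F) : absNA F (-x) = absNA F x :=
  by
  have h := Valuation.map_neg (ValuativeRel.valuation F) x
  exact le_antisymm ((absNA_le_iff _ _).2 h.le) ((absNA_le_iff _ _).2 h.ge)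

theorem continuous_absNA : Continuous (absNA F) := by
  have h0 : ∀ ε : ℝ, 0 < ε → {x : F | absNA F x < ε} ∈ 𝓝 (0 : F) := by
    intro ε hε
    obtain ⟨t, ht⟩ := exists_one_lt_absNA (F := F)
    obtain ⟨n, hn⟩ := pow_unbounded_of_one_lt ε⁻¹ ht
    have hpow : absNA F (t ^ n) = absNA F t ^ n := by simp [absNA]
    have ht0 : t ≠ 0 := by
      rintro rfl
      rw [(absNA_eq_zero_iff _).2 rfl] at ht
      linarith
    refine mem_of_superset ((IsValuativeTopology.hasBasis_nhds_zero' F).mem_of_mem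
      (i := ValuativeRel.valuation F (t ^ n)⁻¹) ?_) ?_
    · simpa using fun h => absurd h ht0
    · intro x hx
      have h1 : absNA F x ≤ absNA F (t ^ n)⁻¹ := (absNA_le_iff _ _).2 (le_of_lt hx)
      have h2 : absNA F (t ^ n)⁻¹ * absNA F (t ^ n) = 1 := by
        rw [← absNA_mul, inv_mul_cancel₀ (pow_ne_zero n ht0), absNA_one]
      rw [eq_inv_of_mul_eq_one_left h2, hpow] at h1
      exact h1.trans_lt (inv_lt_of_inv_lt₀ hε hn)
  rw [continuous_iff_continuousAt]
  intro x
  rw [ContinuousAt, Metric.tendsto_nhds]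
  intro ε hε
  have h1 : {y : F | absNA F (y - x) < ε} ∈ 𝓝 x := by
    have : Tendsto (fun y => y - x) (𝓝 x) (𝓝 0) := by
      have := (continuous_sub_right x).tendsto x
      rwa [sub_self] at this
    exact this (h0 ε hε)
  filter_upwards [h1] with y hy
  -- the ultrametric inequality implies the usual one
  have key : ∀ y x : F, absNA F y - absNA F x ≤ absNA F (y - x) := by
    intro y x
    have := absNA_add_le (y - x) x
    rw [sub_add_cancel] at this
    rcases max_choice (absNA F (y - x)) (absNA F x) with h | h <;> rw [h] at this
    · linarith [absNA_nonneg x]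
    · linarith [absNA_nonneg (y - x)]
  rw [Real.dist_eq, abs_lt]
  have h2 := key y x
  have h3 := key x y
  rw [← absNA_neg (x - y), neg_sub] at h3
  have h4 : absNA F (y - x) < ε := hy
  constructor <;> linarith

variable (F) in
theorem isLocalFieldAbs_absNA : IsLocalFieldAbs (absNA F) where
  nonneg := absNA_nonneg
  eq_zero_iff := absNA_eq_zero_iff
  map_mul := absNA_mul
  cont := continuous_absNA
  quasi := ⟨1, le_rfl, fun x y => by
    rw [one_mul]
    refine (absNA_add_le x y).trans (max_le ?_ ?_)
    · linarith [absNA_nonneg y]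
    · linarith [absNA_nonneg x]⟩
  isCompact := by
    have := IsNonarchimedeanLocalField.isCompact_closedBall F 1
    simpa only [← absNA_le_one_iff] using this
  exists_one_lt := exists_one_lt_absNA

end Field

section Division

variable (F : Type*) [Field F] [ValuativeRel F] [TopologicalSpace F] [IsNonarchimedeanLocalField F]
  [CharZero F] (D : Type*) [DivisionRing D] [Algebra F D] [Algebra.IsCentral F D]
  [FiniteDimensional F D] [TopologicalSpace D] [IsModuleTopology F D] {d : ℕ}
  (hd : finrank F D = d ^ 2)

variable {D}

include hd in
/-- An element is integral exactly if its powers are bounded. -/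
theorem isIntegral_iff_absNA_le_one (x : D) :
    IsIntegral 𝒪[F] x ↔ absNA F (reducedNormField F D d x) ≤ 1 := by
  have ha := isLocalFieldAbs_absNA F
  have hT2F := ha.t2Space
  have h := isLocalAbs_reducedNormField ha D hd
  have hhom := isHomogeneousAbs_reducedNormField ha D hd
  have hd0 := degree_pos D hd
  have := IsModuleTopology.isTopologicalRing F D
  set w : D → ℝ := fun x => absNA F (reducedNormField F D d x) with hw
  change _ ↔ w x ≤ 1
  constructor
  -- if `x` is integral, its powers lie in a finitely generated module over the compact ring of
  -- integers, on which `|ν|` is bounded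
  · intro hx
    obtain ⟨s, hs⟩ := hx.fg_adjoin_singleton
    have hcont : Continuous fun c : s → 𝒪[F] => ∑ b : s, (c b : F) • (b : D) := by
      have : ContinuousSMul F D := inferInstance
      fun_prop
    obtain ⟨C, hC⟩ := (isCompact_univ.image (h.cont.comp hcont)).bddAbove
    have hbd : ∀ k : ℕ, w x ^ k ≤ C := by
      intro k
      have h1 : x ^ k ∈ Subalgebra.toSubmodule (Algebra.adjoin 𝒪[F] {x}) :=
        pow_mem (Algebra.self_mem_adjoin_singleton _ x) k
      rw [← hs] at h1
      obtain ⟨c, hc⟩ := (Submodule.mem_span_finset' (R := 𝒪[F])).1 h1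
      rw [← h.map_pow, ← hc]
      exact hC ⟨c, Set.mem_univ _, rfl⟩
    by_contra! hlt
    obtain ⟨k, hk⟩ := pow_unbounded_of_one_lt C hlt
    exact absurd (hbd k) (not_le.2 hk)
  -- conversely the unit ball of `|ν|` is contained in a lattice `L`, so that the powers of `x`
  -- generate a submodule of a noetherian module
  · intro hx
    set e := (finBasis F D).equivFun with he
    have hec : Continuous e := IsModuleTopology.continuous_of_linearMap e.toLinearMap
    have h1 : ∀ i, ∃ t : F, t ≠ 0 ∧ ∀ y : D, w y ≤ 1 → absNA F (t * e y i) ≤ 1 := by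
      intro i
      obtain ⟨C, hC⟩ := ((hhom.isCompact_le ha hd0 (fun x => (h.eq_zero_iff x).1) 1).image
        (ha.cont.comp ((continuous_apply i).comp hec))).bddAbove
      obtain ⟨t, ht⟩ := ha.exists_one_lt
      obtain ⟨n, hn⟩ := pow_unbounded_of_one_lt C ht
      have ht0 : t ≠ 0 := by
        rintro rfl
        rw [ha.map_zero] at ht
        linarith
      refine ⟨(t ^ n)⁻¹, inv_ne_zero (pow_ne_zero n ht0), fun y hy => ?_⟩
      rw [ha.map_mul, ha.map_inv, ha.map_pow, inv_mul_le_one₀ (by positivity)]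
      have : absNA F (e y i) ≤ C := hC ⟨y, hy, rfl⟩
      linarith
    choose t ht0 ht using h1
    set L : Submodule 𝒪[F] D := Submodule.span 𝒪[F] (Set.range fun i => (t i)⁻¹ • finBasis F D i)
      with hL
    have hmem : ∀ y : D, w y ≤ 1 → y ∈ L := by
      intro y hy
      rw [← (finBasis F D).sum_equivFun y]
      refine L.sum_mem fun i _ => ?_
      have h2 : e y i • finBasis F D i =
          (⟨t i * e y i, (absNA_le_one_iff _).1 (ht i y hy)⟩ : 𝒪[F]) • ((t i)⁻¹ • finBasis F D i) := by
        change _ = (t i * e y i) • ((t i)⁻¹ • finBasis F D i)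
        rw [smul_smul, mul_right_comm, mul_inv_cancel₀ (ht0 i), one_mul]
      rw [← he, h2]
      exact L.smul_mem _ (Submodule.subset_span ⟨i, rfl⟩)
    have hLfg : L.FG := Submodule.fg_span (Set.finite_range _)
    have hsub : Subalgebra.toSubmodule (Algebra.adjoin 𝒪[F] {x}) ≤ L := by
      rw [Algebra.adjoin_eq_span, Submodule.span_le]
      rintro y hy
      obtain ⟨k, rfl⟩ := Submonoid.mem_closure_singleton.1 hy
      refine hmem _ ?_
      rw [h.map_pow]
      exact pow_le_one₀ (h.nonneg _) hx
    have : IsNoetherian 𝒪[F] L := isNoetherian_of_fg_of_noetherian L hLfg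
    have hfg : (Subalgebra.toSubmodule (Algebra.adjoin 𝒪[F] {x})).FG :=
      Submodule.FG.of_le hLfg hsub
    exact IsIntegral.of_mem_of_fg _ hfg x (Algebra.self_mem_adjoin_singleton _ x)

include hd in
/-- The ring of integers is the unit ball of `|ν|`. For the sum of `x` and `y` with `|ν(y)| ≤ |ν(x)|` one
writes `x + y = x (1 + x⁻¹ y)` and uses that `1 + z` is integral if `z` is. -/
theorem mem_integersNA_iff (x : D) :
    x ∈ integersNA F D ↔ absNA F (reducedNormField F D d x) ≤ 1 := by
  have ha := isLocalFieldAbs_absNA F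
  have hT2F := ha.t2Space
  have h := isLocalAbs_reducedNormField ha D hd
  constructor
  swap
  · intro hx
    exact Subring.subset_closure ((isIntegral_iff_absNA_le_one F hd x).2 hx)
  intro hx
  have hadd : ∀ x y : D, absNA F (reducedNormField F D d y) ≤ absNA F (reducedNormField F D d x) →
      absNA F (reducedNormField F D d x) ≤ 1 → absNA F (reducedNormField F D d (x + y)) ≤ 1 := by
    intro x y hxy hx
    by_cases hx0 : x = 0
    · rw [hx0, zero_add]
      exact hxy.trans hx
    · have hz : absNA F (reducedNormField F D d (x⁻¹ * y)) ≤ 1 := by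
        rw [h.map_mul, h.map_inv, inv_mul_le_one₀ (h.pos hx0)]
        exact hxy
      have h1 : IsIntegral 𝒪[F] (1 + x⁻¹ * y) :=
        IsIntegral.of_mem_of_fg _ ((isIntegral_iff_absNA_le_one F hd _).2 hz).fg_adjoin_singleton _
          (add_mem (one_mem _) (Algebra.self_mem_adjoin_singleton _ _))
      have h2 : x + y = x * (1 + x⁻¹ * y) := by rw [mul_add, mul_one, mul_inv_cancel_left₀ hx0]
      rw [h2, h.map_mul]
      exact mul_le_one₀ hx (h.nonneg _) ((isIntegral_iff_absNA_le_one F hd _).1 h1)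
  have hneg1 : absNA F (reducedNormField F D d (-1)) = 1 := by
    have h1 := h.map_mul (-1) (-1)
    rw [neg_mul_neg, one_mul, h.map_one] at h1
    nlinarith [h.nonneg (-1)]
  let B : Subring D :=
    { carrier := {x | absNA F (reducedNormField F D d x) ≤ 1}
      mul_mem' := fun {x y} hx hy => by
        change absNA F (reducedNormField F D d (x * y)) ≤ 1
        rw [h.map_mul]
        exact mul_le_one₀ hx (h.nonneg _) hy
      one_mem' := h.map_one.le
      add_mem' := fun {x y} hx hy => by
        rcases le_total (absNA F (reducedNormField F D d y)) (absNA F (reducedNormField F D d x)) with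
          hxy | hxy
        · exact hadd x y hxy hx
        · rw [add_comm]
          exact hadd y x hxy hy
      zero_mem' := by
        change absNA F (reducedNormField F D d 0) ≤ 1
        rw [h.map_zero]
        exact zero_le_one
      neg_mem' := fun {x} hx => by
        change absNA F (reducedNormField F D d (-x)) ≤ 1
        rw [← neg_one_mul, h.map_mul, hneg1, one_mul]
        exact hx }
  have hle : integersNA F D ≤ B :=
    Subring.closure_le.2 fun x hx => (isIntegral_iff_absNA_le_one F hd x).1 hx
  exact hle hx

include hd in
/-- The ring of integers of `D` is the unit ball of `|ν|`, which is compact and open. -/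
theorem isCompact_maxCompactNA (m : ℕ) :
    IsCompact (maxCompactNA F D m : Set (Matrix (Fin m) (Fin m) D)ˣ) ∧
      IsOpen (maxCompactNA F D m : Set (Matrix (Fin m) (Fin m) D)ˣ) := by
  have ha := isLocalFieldAbs_absNA F
  have hT2F := ha.t2Space
  have h := isLocalAbs_reducedNormField ha D hd
  have hhom := isHomogeneousAbs_reducedNormField ha D hd
  have := IsModuleTopology.isTopologicalRing F D
  have := t2Space_of_finiteDimensional F D
  have hB : (integersNA F D : Set D) = {x | absNA F (reducedNormField F D d x) ≤ 1} := by
    ext x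
    exact mem_integersNA_iff F hd x
  have hc : IsCompact (integersNA F D : Set D) := by
    rw [hB]
    exact hhom.isCompact_le ha (degree_pos D hd) (fun x => (h.eq_zero_iff x).1) 1
  have ho : IsOpen (integersNA F D : Set D) := by
    refine AddSubgroup.isOpen_of_mem_nhds (integersNA F D).toAddSubgroup (g := 0) ?_
    change (integersNA F D : Set D) ∈ 𝓝 0
    rw [hB]
    have h1 : {x : D | absNA F (reducedNormField F D d x) < 1} ∈ 𝓝 (0 : D) :=
      (isOpen_lt h.cont continuous_const).mem_nhds (by
        change absNA F (reducedNormField F D d 0) < 1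
        rw [h.map_zero]
        exact zero_lt_one)
    exact mem_of_superset h1 fun x hx => le_of_lt (α := ℝ) hx
  have hM : (((integersNA F D).matrix (n := Fin m)).toSubmonoid : Set (Matrix (Fin m) (Fin m) D)) =
      Set.univ.pi fun _ => Set.univ.pi fun _ => (integersNA F D : Set D) := by
    ext X
    exact ⟨fun hX i _ j _ => hX i j, fun hX i j => hX i trivial j trivial⟩
  constructor
  · refine Submonoid.units_isCompact ?_
    rw [hM]
    exact isCompact_univ_pi fun _ => isCompact_univ_pi fun _ => hc
  · have hMo : IsOpen (((integersNA F D).matrix (n := Fin m)).toSubmonoid : Set (Matrix (Fin m) (Fin m) D)) := by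
      rw [hM]
      exact isOpen_set_pi Set.finite_univ fun _ _ => isOpen_set_pi Set.finite_univ fun _ _ => ho
    have : (maxCompactNA F D m : Set (Matrix (Fin m) (Fin m) D)ˣ) =
        {g | g.1 ∈ (((integersNA F D).matrix (n := Fin m)).toSubmonoid : Set (Matrix (Fin m) (Fin m) D))} ∩
        {g | (g⁻¹).1 ∈ (((integersNA F D).matrix (n := Fin m)).toSubmonoid : Set (Matrix (Fin m) (Fin m) D))} := by
      ext g
      exact Submonoid.mem_units_iff _ _
    rw [this]
    exact (hMo.preimage Units.continuous_val).inter
      (hMo.preimage (Units.continuous_val.comp continuous_inv))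

omit [TopologicalSpace D] in
theorem planeMatrix_mem {m : ℕ} (R : Subring D) (i j : Fin m) {P : Matrix (Fin 2) (Fin 2) D}
    (hP : ∀ x y, P x y ∈ R) (x y : Fin m) : planeMatrix i j P x y ∈ R := by
  simp only [planeMatrix]
  split_ifs <;> first | exact hP _ _ | exact R.zero_mem | exact R.one_mem

include hd in
/-- The vector `(a, b)` is cleared by dividing by the entry of larger absolute value; the quotient
is integral. -/
theorem hasGivens_maxCompactNA (m : ℕ) : HasGivens (maxCompactNA F D m) := by
  have ha := isLocalFieldAbs_absNA F
  have hT2F := ha.t2Space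
  have h := isLocalAbs_reducedNormField ha D hd
  have key : ∀ x y : D, x ≠ 0 → absNA F (reducedNormField F D d y) ≤
      absNA F (reducedNormField F D d x) → x⁻¹ * y ∈ integersNA F D := by
    intro x y hx hxy
    rw [mem_integersNA_iff F hd, h.map_mul, h.map_inv, inv_mul_le_one₀ (h.pos hx)]
    exact hxy
  have hmem : ∀ (P : (Matrix (Fin 2) (Fin 2) D)ˣ), (∀ x y, P.1 x y ∈ integersNA F D) →
      (∀ x y, (P⁻¹).1 x y ∈ integersNA F D) →
      ∀ (i j : Fin m) (hij : i ≠ j), planeUnit hij P ∈ maxCompactNA F D m := by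
    intro P h1 h2 i j hij
    refine (Submonoid.mem_units_iff _ _).2 ⟨fun x y => ?_, fun x y => ?_⟩
    · exact planeMatrix_mem (integersNA F D) i j h1 x y
    · exact planeMatrix_mem (integersNA F D) i j h2 x y
  refine hasGivens_of_planeUnit (F := F) fun a b => ?_
  by_cases hab : absNA F (reducedNormField F D d a) ≤ absNA F (reducedNormField F D d b)
  · by_cases hb : b = 0
    · have ha0 : a = 0 := by
        rw [hb, h.map_zero] at hab
        exact (h.eq_zero_iff a).1 (le_antisymm hab (h.nonneg _))
      refine ⟨1, by simp [ha0, hb], hmem 1 ?_ ?_⟩ <;> intro x y <;> fin_cases x <;> fin_cases y <;>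
        simp [(integersNA F D).one_mem, (integersNA F D).zero_mem]
    · set c := b⁻¹ * a with hc
      have hcm : c ∈ integersNA F D := key b a hb hab
      refine ⟨⟨!![1, 0; -c, 1], !![1, 0; c, 1], ?_, ?_⟩, ?_, hmem _ ?_ ?_⟩
      · ext x y; fin_cases x <;> fin_cases y <;> simp [Matrix.mul_apply, Fin.sum_univ_two]
      · ext x y; fin_cases x <;> fin_cases y <;> simp [Matrix.mul_apply, Fin.sum_univ_two]
      · simp [hc, mul_inv_cancel_left₀ hb]
      all_goals intro x y; fin_cases x <;> fin_cases y <;>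
        simp [(integersNA F D).one_mem, (integersNA F D).zero_mem, hcm]
  · have ha0 : a ≠ 0 := by
      rintro rfl
      rw [h.map_zero] at hab
      exact hab (h.nonneg _)
    set c := a⁻¹ * b with hc
    have hcm : c ∈ integersNA F D := key a b ha0 (not_le.1 hab).le
    refine ⟨⟨!![c, 1; -1, 0], !![0, -1; 1, c], ?_, ?_⟩, ?_, hmem _ ?_ ?_⟩
    · ext x y; fin_cases x <;> fin_cases y <;> simp [Matrix.mul_apply, Fin.sum_univ_two]
    · ext x y; fin_cases x <;> fin_cases y <;> simp [Matrix.mul_apply, Fin.sum_univ_two]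
    · simp [hc, mul_inv_cancel_left₀ ha0]
    all_goals intro x y; fin_cases x <;> fin_cases y <;>
      simp [(integersNA F D).one_mem, (integersNA F D).zero_mem, (integersNA F D).neg_mem, hcm]

variable (D)

include hd in
/-- The norm `max_{i,j} |ν(X_ij)|^{1/d}` is homogeneous of degree one and vanishes only at `0`. -/
theorem isHomogeneousAbs_normNA {m : ℕ} (hm : 0 < m) :
    IsHomogeneousAbs (absNA F) 1 (normNA F D m d) ∧ ∀ X, normNA F D m d X = 0 → X = 0 := by
  have ha := isLocalFieldAbs_absNA F
  have hT2F := ha.t2Space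
  have h := isLocalAbs_reducedNormField ha D hd
  have hhom := isHomogeneousAbs_reducedNormField ha D hd
  have hd0 := degree_pos D hd
  have : Nonempty (Fin m) := ⟨⟨0, hm⟩⟩
  have hle : ∀ (X : Matrix (Fin m) (Fin m) D) (p : Fin m × Fin m),
      absNA F (reducedNormField F D d (X p.1 p.2)) ^ (1 / d : ℝ) ≤ normNA F D m d X := fun X p =>
    le_ciSup (f := fun p : Fin m × Fin m =>
      absNA F (reducedNormField F D d (X p.1 p.2)) ^ (1 / d : ℝ)) (Set.finite_range _).bddAbove p
  refine ⟨⟨?_, fun X => ?_, fun c X => ?_⟩, fun X hX => ?_⟩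
  · have h1 : normNA F D m d = fun X => Finset.univ.sup' Finset.univ_nonempty
        fun p : Fin m × Fin m => absNA F (reducedNormField F D d (X p.1 p.2)) ^ (1 / d : ℝ) := by
      funext X
      rw [Finset.sup'_univ_eq_ciSup]
      rfl
    rw [h1]
    refine Continuous.finset_sup'_apply _ fun p _ => ?_
    exact (h.cont.comp ((continuous_apply p.2).comp (continuous_apply p.1))).rpow_const
      fun _ => Or.inr (by positivity)
  · exact Real.iSup_nonneg fun p => Real.rpow_nonneg (h.nonneg _) _
  · have h1 : ∀ p : Fin m × Fin m,
        absNA F (reducedNormField F D d ((c • X) p.1 p.2)) ^ (1 / d : ℝ) =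
        absNA F c * absNA F (reducedNormField F D d (X p.1 p.2)) ^ (1 / d : ℝ) := by
      intro p
      rw [Matrix.smul_apply, hhom.smul, Real.mul_rpow (pow_nonneg (ha.nonneg _) _) (h.nonneg _),
        one_div, Real.pow_rpow_inv_natCast (ha.nonneg _) hd0.ne']
    rw [normNA, pow_one, normNA, Real.mul_iSup_of_nonneg (ha.nonneg _)]
    exact iSup_congr h1
  · ext i j
    have h1 := hle X (i, j)
    rw [hX] at h1
    have h2 := le_antisymm h1 (Real.rpow_nonneg (h.nonneg _) _)
    rw [Real.rpow_eq_zero (h.nonneg _) (by positivity)] at h2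
    exact (h.eq_zero_iff _).1 h2

end Division

end NA

end

/-! ### The twisted functions on a local group -/

section

open Module Filter Topology MeasureTheory

/-- A bound for `W w^{e+ε} (1 + |log w|)`, uniform for `ε` in an interval, bounds the twisted
function `W w^z` for `Re z - e` in this interval. -/
theorem mul_norm_cpow_le {W w e ε₁ ε₂ B : ℝ} (hW : 0 ≤ W) (hw : 0 < w)
    (hB : ∀ ε ∈ Set.Icc ε₁ ε₂, W * (w ^ (e + ε) * (1 + |Real.log w|)) ≤ B) {z : ℂ}
    (hz : z.re - e ∈ Set.Icc ε₁ ε₂) : W * ‖(w : ℂ) ^ z‖ ≤ B := by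
  refine le_trans ?_ (hB _ hz)
  rw [Complex.norm_cpow_eq_rpow_re_of_pos hw, add_sub_cancel]
  have := abs_nonneg (Real.log w)
  have := Real.rpow_pos_of_pos hw z.re
  exact mul_le_mul_of_nonneg_left (le_mul_of_one_le_right this.le (by linarith)) hW

/-- The same bound makes the twisted function Lipschitz in the exponent; this is what the factor
`1 + |log w|` is for. -/
theorem mul_norm_cpow_sub_le {W w e ε₁ ε₂ B : ℝ} (hW : 0 ≤ W) (hw : 0 < w)
    (hB : ∀ ε ∈ Set.Icc ε₁ ε₂, W * (w ^ (e + ε) * (1 + |Real.log w|)) ≤ B) {z z₀ : ℂ}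
    (hz : z.re - e ∈ Set.Icc ε₁ ε₂) (hz₀ : z₀.re - e ∈ Set.Icc ε₁ ε₂) :
    W * ‖(w : ℂ) ^ z - (w : ℂ) ^ z₀‖ ≤ 2 * B * ‖z - z₀‖ := by
  have h12 : ε₁ ≤ ε₂ := hz.1.trans hz.2
  have h1 := norm_cpow_sub_cpow_le (b := e + ε₁) (c := e + ε₂) hw (z := z) (z₀ := z₀)
    ⟨by linarith [hz.1], by linarith [hz.2]⟩ ⟨by linarith [hz₀.1], by linarith [hz₀.2]⟩
  have key : ∀ ε ∈ Set.Icc ε₁ ε₂, W * (w ^ (e + ε) * |Real.log w|) ≤ B := fun ε hε => by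
    refine le_trans ?_ (hB _ hε)
    have := Real.rpow_pos_of_pos hw (e + ε)
    exact mul_le_mul_of_nonneg_left (mul_le_mul_of_nonneg_left (by linarith) this.le) hW
  have h2 := key ε₁ ⟨le_rfl, h12⟩
  have h3 := key ε₂ ⟨h12, le_rfl⟩
  calc W * ‖(w : ℂ) ^ z - (w : ℂ) ^ z₀‖
      ≤ W * (|Real.log w| * (w ^ (e + ε₁) + w ^ (e + ε₂)) * ‖z - z₀‖) :=
        mul_le_mul_of_nonneg_left h1 hW
    _ = (W * (w ^ (e + ε₁) * |Real.log w|) + W * (w ^ (e + ε₂) * |Real.log w|)) * ‖z - z₀‖ := by ring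
    _ ≤ 2 * B * ‖z - z₀‖ := mul_le_mul_of_nonneg_right (by linarith) (norm_nonneg _)

/-- The function `|ν|^e` in terms of the `n`-th power of `|ν|`, which is the absolute value of the
norm. -/
theorem pow_cpow_div {w : ℝ} (hw : 0 < w) {n : ℕ} (hn : n ≠ 0) (e : ℂ) :
    ((w ^ n : ℝ) : ℂ) ^ (e / n) = (w : ℂ) ^ e := by
  have h1 : (w : ℂ) ≠ 0 := by exact_mod_cast hw.ne'
  have h2 : (n : ℂ) ≠ 0 := by exact_mod_cast hn
  rw [Complex.cpow_def_of_ne_zero (by exact_mod_cast (pow_pos hw n).ne'),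
    Complex.cpow_def_of_ne_zero h1, ← Complex.ofReal_log (pow_pos hw n).le,
    ← Complex.ofReal_log hw.le, Real.log_pow, Complex.ofReal_mul, Complex.ofReal_natCast]
  congr 1
  field_simp

/-- The exponent `s + (n-1)/2` exceeds the critical exponent `(m-1)d/2` of the bound for `Ξ⁻¹` by
`s + (d-1)/2`, whose real part is positive exactly if `Re s > (1-d)/2`. -/
theorem re_twist_exponent (m d : ℕ) (s : ℂ) :
    (s + (((m * d : ℕ) : ℂ) - 1) / 2).re - ((m : ℝ) - 1) * d / 2 = s.re + ((d : ℝ) - 1) / 2 := by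
  have : (((m * d : ℕ) : ℂ) - 1) / 2 = (((((m * d : ℕ) : ℝ) - 1) / 2 : ℝ) : ℂ) := by
    push_cast
    ring
  rw [this, Complex.add_re, Complex.ofReal_re]
  push_cast
  ring

/-- The space of test functions being discrete, it suffices to fix `f`. The functions `f_s` are
then bi-invariant under a fixed compact open subgroup, and depend continuously on `s` for the
weighted sup norms, since `f` has compact support. -/
theorem isContinuousInclusion_nonarchimedean (F : Type*) [Field F] [ValuativeRel F]
    [TopologicalSpace F] [IsNonarchimedeanLocalField F]
    [CharZero F] (D : Type*) [DivisionRing D] [Algebra F D] [Algebra.IsCentral F D]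
    [FiniteDimensional F D] [TopologicalSpace D] [IsModuleTopology F D] (m d : ℕ)
    (hm : 0 < m) (hd : finrank F D = d ^ 2)
    [MeasurableSpace (maxCompactNA F D m)] [BorelSpace (maxCompactNA F D m)]
    (μ : Measure (maxCompactNA F D m)) [μ.IsHaarMeasure] :
    IsContinuousInclusion
      (GJRestr.eval : GJRestrNA F D m d {s : ℂ | (1 - d : ℝ) / 2 < s.re} → _)
      (HCNA.eval F D : HCNA F D m d μ → _) := by
  have ha := isLocalFieldAbs_absNA F
  have hT2F := ha.t2Space
  have := IsModuleTopology.isTopologicalRing F D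
  have := t2Space_of_finiteDimensional F D
  have := isModuleTopology_matrix F D m
  have : Nonempty (Fin m) := ⟨⟨0, hm⟩⟩
  have hdA := finrank_matrix D hd (F := F) m
  have hA := isHomogeneousAbs_reducedNormField ha (Matrix (Fin m) (Fin m) D) hdA
  set w : Matrix (Fin m) (Fin m) D → ℝ :=
    fun X => absNA F (reducedNormField F (Matrix (Fin m) (Fin m) D) (m * d) X) with hw
  have hwpos : ∀ g : (Matrix (Fin m) (Fin m) D)ˣ, 0 < w g.1 := fun g =>
    lt_of_le_of_ne (hA.nonneg _)
      (abs_reducedNormField_ne_zero ha (Matrix (Fin m) (Fin m) D) hdA g.isUnit).symm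
  have hwmul : ∀ X Y, w (X * Y) = w X * w Y :=
    abs_reducedNormField_mul ha (Matrix (Fin m) (Fin m) D) hdA
  obtain ⟨hKc, hKo⟩ := isCompact_maxCompactNA F hd m
  obtain ⟨hN, hN0⟩ := isHomogeneousAbs_normNA F D hd hm
  set J₀ : CompactOpen (Matrix (Fin m) (Fin m) D)ˣ := ⟨maxCompactNA F D m, hKo, hKc⟩ with hJ₀
  -- the bound for the functions `f_s`
  have hbound : ∀ (f : SchwartzBruhatNA D m) (r : ℝ≥0) {ε₁ ε₂ : ℝ}, 0 < ε₁ → ε₁ ≤ ε₂ → ∃ B : ℝ,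
      0 ≤ B ∧ ∀ g : (Matrix (Fin m) (Fin m) D)ˣ, ∀ ε ∈ Set.Icc ε₁ ε₂,
        |hcWeight (normNA F D m d) (xiNA F D m d μ) r g| * ‖f.1 g.1‖ *
          (w g.1 ^ (((m : ℝ) - 1) * d / 2 + ε) * (1 + |Real.log (w g.1)|)) ≤ B := by
    intro f r ε₁ ε₂ h1 h2
    obtain ⟨C, k, hC, hle⟩ := exists_hcWeight_reducedNorm_le ha D hd hm hKc
      (hasGivens_maxCompactNA F hd m) μ one_pos (by simpa only [pow_one] using hN) hN.nonneg hN0 r h1 h2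
    have hcont : Continuous fun X => (1 + normNA F D m d X) ^ k * ‖f.1 X‖ :=
      ((continuous_const.add hN.cont).pow k).mul f.2.1.continuous.norm
    obtain ⟨B, hB⟩ := (f.2.2.image hcont).bddAbove
    refine ⟨C * |B|, by positivity, fun g ε hε => ?_⟩
    rw [mul_right_comm]
    refine (mul_le_mul_of_nonneg_right (hle g ε hε) (norm_nonneg _)).trans ?_
    rw [mul_assoc]
    refine mul_le_mul_of_nonneg_left ?_ hC
    by_cases hg : g.1 ∈ tsupport f.1
    · exact (hB ⟨g.1, hg, rfl⟩).trans (le_abs_self B)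
    · rw [image_eq_zero_of_notMem_tsupport hg, norm_zero, mul_zero]
      exact abs_nonneg B
  -- the function `f_s` as an element of the space of level `J`
  have hinv : ∀ (f : SchwartzBruhatNA D m) (s : ℂ),
      twist w (m * d) s f.1 ∘ Units.val ∈ biInvariant (biStabilizerIn J₀ f).1 := by
    intro f s j hj j' hj' g
    have hone : ∀ j ∈ (biStabilizerIn J₀ f).1, w j.1 = 1 := fun j hj =>
      eq_one_of_isCompact_of_mul (χ := fun g : (Matrix (Fin m) (Fin m) D)ˣ => w g.1)
        (biStabilizerIn J₀ f).2.2 (hA.cont.comp Units.continuous_val).continuousOn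
        (fun g _ => hwpos g) (fun g _ g' _ => hwmul g.1 g'.1) hj
    have h1 : f.1 (j.1 * g.1 * j'.1) = f.1 g.1 := by rw [(hj'.1 _).2, (hj.1 _).1]
    change f.1 (j.1 * g.1 * j'.1) * (w (j.1 * g.1 * j'.1) : ℂ) ^ _ = f.1 g.1 * (w g.1 : ℂ) ^ _
    rw [h1, hwmul, hwmul, hone j hj, hone j' hj', one_mul, mul_one]
  have hexp : ∀ s : ℂ, (1 - d : ℝ) / 2 < s.re → 0 < s.re + ((d : ℝ) - 1) / 2 := fun s hs => by
    linarith
  have hwt : ∀ (f : SchwartzBruhatNA D m) (r : ℝ≥0) (s : ℂ) (g : (Matrix (Fin m) (Fin m) D)ˣ),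
      weightMul (hcWeight (normNA F D m d) (xiNA F D m d μ) r) (twist w (m * d) s f.1 ∘ Units.val) g =
      (hcWeight (normNA F D m d) (xiNA F D m d μ) r g : ℂ) * f.1 g.1 *
        (w g.1 : ℂ) ^ (s + (((m * d : ℕ) : ℂ) - 1) / 2) := fun f r s g => (mul_assoc _ _ _).symm
  have hmem : ∀ (f : SchwartzBruhatNA D m) (s : {s : ℂ | (1 - d : ℝ) / 2 < s.re}),
      (⟨_, hinv f s⟩ : biInvariant (biStabilizerIn J₀ f).1) ∈ boundedSub
        (fun r : ℝ≥0 => (weightMul (hcWeight (normNA F D m d) (xiNA F D m d μ) r)).comp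
          (biInvariant (biStabilizerIn J₀ f).1).subtype) := by
    intro f s r
    have hpos := hexp s s.2
    obtain ⟨B, -, hB⟩ := hbound f r hpos le_rfl
    refine ⟨B, ?_⟩
    rintro _ ⟨g, rfl⟩
    change ‖weightMul (hcWeight (normNA F D m d) (xiNA F D m d μ) r)
      (twist w (m * d) s f.1 ∘ Units.val) g‖ ≤ B
    rw [hwt, norm_mul, norm_mul, Complex.norm_real, Real.norm_eq_abs]
    refine mul_norm_cpow_le (by positivity) (hwpos g) (hB g) ?_
    rw [re_twist_exponent]
    exact ⟨le_rfl, le_rfl⟩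
  refine isContinuousInclusion_of_lift Subtype.val_injective
    (fun p => toIndLimit _ (biStabilizerIn J₀ p.2) ⟨⟨_, hinv p.2 p.1⟩, hmem p.2 p.1⟩) ?_
    (fun p => rfl)
  have : DiscreteTopology (SchwartzBruhatNA D m) := ⟨rfl⟩
  refine continuous_prod_of_discrete_right.2 fun f => ?_
  refine (continuous_toIndLimit (fun J : CompactOpen (Matrix (Fin m) (Fin m) D)ˣ =>
    ((biInvariant J.1).subtype.comp (BoundedSpace.incl _) : HCNALevel F D m d μ J →ₗ[ℂ] _))
    (biStabilizerIn J₀ f)).comp ?_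
  refine BoundedSpace.continuous_of_tendsto (T := fun r : ℝ≥0 =>
    (weightMul (hcWeight (normNA F D m d) (xiNA F D m d μ) r)).comp
      (biInvariant (biStabilizerIn J₀ f).1).subtype)
    (Φ := fun s : {s : ℂ | (1 - d : ℝ) / 2 < s.re} => ⟨⟨_, hinv f s⟩, hmem f s⟩) fun r s₀ => ?_
  set ε₀ : ℝ := s₀.1.re + ((d : ℝ) - 1) / 2 with hε₀
  have hε₀pos : 0 < ε₀ := hexp s₀ s₀.2
  obtain ⟨B, hB0, hB⟩ := hbound f r (half_pos hε₀pos) (by linarith : ε₀ / 2 ≤ 2 * ε₀)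
  have hre : ∀ᶠ s : {s : ℂ | (1 - d : ℝ) / 2 < s.re} in 𝓝 s₀,
      s.1.re + ((d : ℝ) - 1) / 2 ∈ Set.Icc (ε₀ / 2) (2 * ε₀) := by
    have hc : Continuous fun s : {s : ℂ | (1 - d : ℝ) / 2 < s.re} => s.1.re + ((d : ℝ) - 1) / 2 :=
      (Complex.continuous_re.comp continuous_subtype_val).add continuous_const
    exact hc.continuousAt.eventually (Icc_mem_nhds (by linarith) (by linarith))
  have hlim : Tendsto (fun s : {s : ℂ | (1 - d : ℝ) / 2 < s.re} => 2 * B * ‖s.1 - s₀.1‖) (𝓝 s₀) (𝓝 0) := by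
    have hc : Continuous fun s : {s : ℂ | (1 - d : ℝ) / 2 < s.re} => 2 * B * ‖s.1 - s₀.1‖ :=
      continuous_const.mul (continuous_subtype_val.sub continuous_const).norm
    simpa using hc.tendsto s₀
  refine tendsto_of_tendsto_of_tendsto_of_le_of_le' tendsto_const_nhds hlim
    (Eventually.of_forall fun s => Real.iSup_nonneg fun g => norm_nonneg _) ?_
  filter_upwards [hre] with s hs
  refine Real.iSup_le (fun g => ?_) (by positivity)
  change ‖weightMul (hcWeight (normNA F D m d) (xiNA F D m d μ) r)
      (twist w (m * d) s f.1 ∘ Units.val) g -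
    weightMul (hcWeight (normNA F D m d) (xiNA F D m d μ) r)
      (twist w (m * d) s₀ f.1 ∘ Units.val) g‖ ≤ _
  rw [hwt, hwt, ← mul_sub, norm_mul, norm_mul, Complex.norm_real, Real.norm_eq_abs]
  refine (mul_norm_cpow_sub_le (by positivity) (hwpos g) (hB g) ?_ ?_).trans_eq ?_
  · rw [re_twist_exponent]
    exact hs
  · rw [re_twist_exponent]
    constructor <;> linarith
  · rw [add_sub_add_right_eq_sub]

end

/-! ### Real division algebras -/

section

open Module Filter Topology MeasureTheory

section RealDivision

variable {D : Type*} [DivisionRing D] [Algebra ℝ D] [FiniteDimensional ℝ D]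

omit [DivisionRing D] [Algebra ℝ D] [FiniteDimensional ℝ D] in
/-- In a basis adapted to the complex structure, multiplication by `I` has zero diagonal entries. -/
theorem trace_eq_zero_of_eq_I_smul {V : Type*} [AddCommGroup V] [Module ℂ V] [Module ℝ V]
    [IsScalarTower ℝ ℂ V] [Module.Finite ℝ V] (T : V →ₗ[ℝ] V) (hT : ∀ v, T v = Complex.I • v) :
    LinearMap.trace ℝ V T = 0 := by
  classical
  have : Module.Finite ℂ V := Module.Finite.of_restrictScalars_finite ℝ ℂ V
  set b := Complex.basisOneI.smulTower (finBasis ℂ V) with hb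
  rw [LinearMap.trace_eq_matrix_trace ℝ b]
  refine Finset.sum_eq_zero fun ⟨i, j⟩ _ => ?_
  have h1 : T (b (i, j)) = (Complex.I * Complex.basisOneI i) • finBasis ℂ V j := by
    rw [hb, Basis.smulTower_apply, mul_smul, hT]
  rw [Matrix.diag_apply, LinearMap.toMatrix_apply, h1, hb, Basis.smulTower_repr_mk, map_smul,
    Basis.repr_self]
  fin_cases i <;> simp [Complex.basisOneI]

theorem trace_mulLeft_eq_zero {J : D} (hJ : J * J = -1) :
    LinearMap.trace ℝ D (LinearMap.mulLeft ℝ J) = 0 := by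
  let f : ℂ →ₐ[ℝ] D := Complex.liftAux J hJ
  -- a square root of `-1` makes `D` a complex vector space
  let : Module ℂ D := Module.compHom D f.toRingHom
  let : Module ℝ D := Algebra.toModule
  have hsmul : ∀ (z : ℂ) (x : D), z • x = f z * x := fun z x => rfl
  have : IsScalarTower ℝ ℂ D := ⟨fun r z x => by
    rw [hsmul, hsmul, map_smul, smul_mul_assoc]⟩
  refine trace_eq_zero_of_eq_I_smul (V := D) _ fun v => ?_
  rw [hsmul, Complex.liftAux_apply_I, LinearMap.mulLeft_apply]

omit [FiniteDimensional ℝ D] in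
theorem reD_add (x y : D) : reD (x + y) = reD x + reD y := by
  have : LinearMap.mulLeft ℝ (x + y) = LinearMap.mulLeft ℝ x + LinearMap.mulLeft ℝ y := by
    ext z
    simp [add_mul]
  rw [reD, this, map_add, add_div, reD, reD]

omit [FiniteDimensional ℝ D] in
theorem reD_smul (r : ℝ) (x : D) : reD (r • x) = r * reD x := by
  have : LinearMap.mulLeft ℝ (r • x) = r • LinearMap.mulLeft ℝ x := by
    ext z
    simp
  rw [reD, this, map_smul, smul_eq_mul, mul_div_assoc, reD]

theorem reD_one : reD (1 : D) = 1 := by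
  have : LinearMap.mulLeft ℝ (1 : D) = LinearMap.id := by
    ext z
    simp
  rw [reD, this, LinearMap.trace_id, div_self]
  exact_mod_cast finrank_pos.ne'

theorem reD_algebraMap (r : ℝ) : reD (algebraMap ℝ D r) = r := by
  rw [Algebra.algebraMap_eq_smul_one, reD_smul, reD_one, mul_one]

omit [FiniteDimensional ℝ D] in
theorem reD_sub (x y : D) : reD (x - y) = reD x - reD y := by
  have := reD_add (x - y) y
  rw [sub_add_cancel] at this
  linarith

/-- The square of `x - Re x` is a nonpositive real number. -/
theorem exists_sq_eq_neg (x : D) : ∃ c : ℝ, 0 ≤ c ∧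
    (x - algebraMap ℝ D (reD x)) * (x - algebraMap ℝ D (reD x)) = algebraMap ℝ D (-c) := by
  have hint : IsIntegral ℝ x := Algebra.IsIntegral.isIntegral x
  set p := minpoly ℝ x with hp
  have hirr : Irreducible p := minpoly.irreducible hint
  have hmonic : p.Monic := minpoly.monic hint
  -- the minimal polynomial over `ℝ` has degree one or two
  obtain ⟨a, b, h⟩ : ∃ a b : ℝ, p = Polynomial.X + Polynomial.C a ∨
      p = Polynomial.X ^ 2 + Polynomial.C b * Polynomial.X + Polynomial.C a := by
    have h2 := Polynomial.natDegree_le_of_degree_le hirr.degree_le_two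
    have h1 : 0 < p.natDegree := hirr.natDegree_pos
    rcases Nat.lt_or_ge p.natDegree 2 with h3 | h3
    · have h4 : p.natDegree = 1 := by omega
      refine ⟨p.coeff 0, 0, Or.inl ?_⟩
      have := Polynomial.eq_X_add_C_of_natDegree_le_one h4.le
      have hc : p.coeff 1 = 1 := by
        have := hmonic.coeff_natDegree
        rwa [h4] at this
      rw [hc] at this
      simpa using this
    · have h4 : p.natDegree = 2 := le_antisymm h2 h3
      refine ⟨p.coeff 0, p.coeff 1, Or.inr ?_⟩
      have h5 := Polynomial.eq_quadratic_of_degree_le_two hirr.degree_le_two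
      have hc : p.coeff 2 = 1 := by
        have := hmonic.coeff_natDegree
        rwa [h4] at this
      rw [hc] at h5
      simpa using h5
  have h0 : Polynomial.aeval x p = 0 := minpoly.aeval ℝ x
  rcases h with h | h
  · rw [h] at h0
    have hx : x = algebraMap ℝ D (-a) := by
      rw [map_neg]
      exact eq_neg_of_add_eq_zero_left (by simpa using h0)
    refine ⟨0, le_rfl, ?_⟩
    rw [hx, reD_algebraMap]
    simp
  · rw [h] at h0
    set c : ℝ := a - b ^ 2 / 4 with hc
    have hcpos : 0 < c := by
      by_contra! hle
      -- otherwise the minimal polynomial has a real root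
      set s := Real.sqrt (-c) with hs
      have hss : s ^ 2 = -c := Real.sq_sqrt (by linarith)
      have hroot : p.IsRoot (-b / 2 + s) := by
        rw [h]
        simp only [Polynomial.IsRoot, Polynomial.eval_add, Polynomial.eval_pow, Polynomial.eval_X,
          Polynomial.eval_mul, Polynomial.eval_C]
        rw [hc] at hss
        linear_combination hss
      have h1 := Polynomial.degree_eq_one_of_irreducible_of_root hirr hroot
      have h2 : p.natDegree = 2 := by
        rw [h]
        compute_degree!
      rw [Polynomial.degree_eq_natDegree hirr.ne_zero, h2] at h1
      norm_num at h1
    set u := x + algebraMap ℝ D (b / 2) with hu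
    have hu2 : u * u = algebraMap ℝ D (-c) := by
      have h1 : x * x + algebraMap ℝ D b * x + algebraMap ℝ D a = 0 := by
        simpa [sq] using h0
      have h2 : x * algebraMap ℝ D (b / 2) = algebraMap ℝ D (b / 2) * x :=
        (Algebra.commutes _ _).symm
      have h3 : algebraMap ℝ D b = algebraMap ℝ D (b / 2) + algebraMap ℝ D (b / 2) := by
        rw [← map_add, add_halves]
      have h4 : algebraMap ℝ D (-c) = algebraMap ℝ D (b / 2) * algebraMap ℝ D (b / 2) -
          algebraMap ℝ D a := by
        rw [← map_mul, ← map_sub, hc]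
        congr 1
        ring
      rw [hu, h4, add_mul, mul_add, mul_add, h2]
      rw [h3, add_mul] at h1
      rw [eq_sub_iff_add_eq]
      rw [← sub_eq_zero, ← h1]
      abel
    have hre : reD u = 0 := by
      have hJ : ((Real.sqrt c)⁻¹ • u) * ((Real.sqrt c)⁻¹ • u) = -1 := by
        rw [smul_mul_smul_comm, hu2, ← mul_inv, Real.mul_self_sqrt hcpos.le,
          Algebra.algebraMap_eq_smul_one, smul_smul]
        rw [mul_neg, inv_mul_cancel₀ hcpos.ne', neg_one_smul]
      have h1 := trace_mulLeft_eq_zero hJ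
      have h2 : reD ((Real.sqrt c)⁻¹ • u) = 0 := by rw [reD, h1, zero_div]
      rw [reD_smul] at h2
      exact (mul_eq_zero.1 h2).resolve_left (inv_ne_zero (Real.sqrt_pos.2 hcpos).ne')
    have hrx : reD x = -(b / 2) := by
      rw [hu, reD_add, reD_algebraMap] at hre
      linarith
    refine ⟨c, hcpos.le, ?_⟩
    rw [hrx, map_neg, sub_neg_eq_add]
    exact hu2

/-- The reduced norm form `x x̄` of `ℝ`, `ℂ` or `ℍ`, i.e. the square of the usual absolute value. -/
def normSqD (x : D) : ℝ := reD (x * principalInvolution x)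

/-- The form `x x̄` is scalar and positive definite. -/
theorem mul_principalInvolution (x : D) :
    x * principalInvolution x = algebraMap ℝ D (normSqD x) ∧ 0 ≤ normSqD x ∧
      (normSqD x = 0 → x = 0) := by
  obtain ⟨c, hc, h⟩ := exists_sq_eq_neg x
  -- `x x̄ = (Re x)² + c` with `(x - Re x)² = -c`
  have h1 : x * principalInvolution x = algebraMap ℝ D (reD x * reD x + c) := by
    have h2 : x * algebraMap ℝ D (reD x) = algebraMap ℝ D (reD x) * x := (Algebra.commutes _ _).symm
    have h3 : algebraMap ℝ D (2 * reD x) = algebraMap ℝ D (reD x) + algebraMap ℝ D (reD x) := by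
      rw [two_mul, map_add]
    rw [principalInvolution, h3, map_add, map_mul]
    rw [map_neg, sub_mul, mul_sub, mul_sub, h2] at h
    rw [mul_sub, mul_add, h2, ← neg_eq_iff_eq_neg.2 h]
    abel
  have h2 : normSqD x = reD x * reD x + c := by rw [normSqD, h1, reD_algebraMap]
  refine ⟨by rw [h2, h1], by rw [h2]; nlinarith [mul_self_nonneg (reD x)], fun h0 => ?_⟩
  have h3 : reD x = 0 := by nlinarith [mul_self_nonneg (reD x)]
  have h4 : c = 0 := by nlinarith
  rw [h3, h4] at h
  simpa using h

omit [FiniteDimensional ℝ D] in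
theorem reD_mul_comm (x y : D) : reD (x * y) = reD (y * x) := by
  have h : ∀ x y : D, LinearMap.mulLeft ℝ (x * y) = LinearMap.mulLeft ℝ x * LinearMap.mulLeft ℝ y := by
    intro x y
    ext z
    simp
  rw [reD, reD, h, h, LinearMap.trace_mul_comm]

omit [FiniteDimensional ℝ D] in
theorem principalInvolution_add (x y : D) :
    principalInvolution (x + y) = principalInvolution x + principalInvolution y := by
  simp only [principalInvolution, reD_add, mul_add, map_add]
  abel

omit [FiniteDimensional ℝ D] in
theorem principalInvolution_smul (r : ℝ) (x : D) :
    principalInvolution (r • x) = r • principalInvolution x := by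
  simp only [principalInvolution, reD_smul, smul_sub, Algebra.algebraMap_eq_smul_one, smul_smul]
  ring_nf

theorem principalInvolution_one : principalInvolution (1 : D) = 1 := by
  rw [principalInvolution, reD_one, mul_one]
  have : algebraMap ℝ D 2 = 1 + 1 := by rw [← one_add_one_eq_two, map_add, map_one]
  rw [this, add_sub_cancel_right]

omit [FiniteDimensional ℝ D] in
theorem principalInvolution_zero : principalInvolution (0 : D) = 0 := by
  have := principalInvolution_smul 0 (0 : D)
  rwa [zero_smul, zero_smul] at this

omit [FiniteDimensional ℝ D] in
theorem principalInvolution_neg (x : D) : principalInvolution (-x) = -principalInvolution x := by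
  rw [← neg_one_smul ℝ, principalInvolution_smul, neg_one_smul]

omit [FiniteDimensional ℝ D] in
theorem principalInvolution_sum {ι : Type*} (s : Finset ι) (f : ι → D) :
    principalInvolution (∑ i ∈ s, f i) = ∑ i ∈ s, principalInvolution (f i) := by
  classical
  induction s using Finset.induction_on with
  | empty => simp [principalInvolution_zero]
  | insert a s ha ih => rw [Finset.sum_insert ha, Finset.sum_insert ha, principalInvolution_add, ih]

/-- The involution reverses products, by polarization of `x x̄ = |x|²`. -/
theorem principalInvolution_mul (x y : D) :
    principalInvolution (x * y) = principalInvolution y * principalInvolution x := by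
  have hx := (mul_principalInvolution x).1
  have hy := (mul_principalInvolution y).1
  have hxy := (mul_principalInvolution (x + y)).1
  set B := normSqD (x + y) - normSqD x - normSqD y with hB
  have h1 : x * principalInvolution y + y * principalInvolution x = algebraMap ℝ D B := by
    rw [principalInvolution_add, add_mul, mul_add, mul_add, hx, hy] at hxy
    rw [hB, map_sub, map_sub, ← hxy]
    abel
  -- the constant is determined by taking real parts
  have h2 : B = 2 * reD x * (2 * reD y) - 2 * reD (x * y) := by
    have h3 := congrArg reD h1
    rw [reD_algebraMap] at h3
    have h4 : ∀ x y : D, reD (x * principalInvolution y) = 2 * reD y * reD x - reD (x * y) := by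
      intro x y
      rw [principalInvolution, mul_sub, reD_sub, Algebra.algebraMap_eq_smul_one, mul_smul_comm, mul_one,
        reD_smul]
    rw [reD_add, h4, h4, reD_mul_comm y x] at h3
    rw [← h3]
    ring
  rw [h2] at h1
  simp only [principalInvolution] at h1 ⊢
  have hcx : x * algebraMap ℝ D (2 * reD y) = algebraMap ℝ D (2 * reD y) * x :=
    (Algebra.commutes _ _).symm
  have hcy : y * algebraMap ℝ D (2 * reD x) = algebraMap ℝ D (2 * reD x) * y :=
    (Algebra.commutes _ _).symm
  have hcc : algebraMap ℝ D (2 * reD y) * algebraMap ℝ D (2 * reD x) =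
      algebraMap ℝ D (2 * reD x * (2 * reD y)) := by
    rw [← map_mul, mul_comm]
  rw [mul_sub, mul_sub, hcx, hcy, map_sub] at h1
  rw [sub_mul, mul_sub, mul_sub, hcc, hcy]
  rw [eq_sub_iff_add_eq] at h1
  rw [sub_eq_iff_eq_add, ← h1]
  abel_nf

theorem principalInvolution_mul_self (x : D) :
    principalInvolution x * x = algebraMap ℝ D (normSqD x) := by
  rw [← (mul_principalInvolution x).1, principalInvolution, sub_mul, mul_sub, Algebra.commutes]

theorem normSqD_mul (x y : D) : normSqD (x * y) = normSqD x * normSqD y := by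
  have h1 := (mul_principalInvolution (x * y)).1
  rw [principalInvolution_mul, mul_assoc, ← mul_assoc y, (mul_principalInvolution y).1,
    Algebra.commutes, ← mul_assoc, (mul_principalInvolution x).1, ← map_mul] at h1
  exact ((algebraMap ℝ D).injective h1).symm

omit [FiniteDimensional ℝ D] in
theorem normSqD_smul (r : ℝ) (x : D) : normSqD (r • x) = r ^ 2 * normSqD x := by
  rw [normSqD, principalInvolution_smul, smul_mul_smul_comm, reD_smul, normSqD, sq]

end RealDivision

end

/-! ### The maximal compact subgroup and the norms in the archimedean case -/

section

open Module Filter Topology MeasureTheory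

section ArchGroup

variable {D : Type*} [DivisionRing D] [Algebra ℝ D] [FiniteDimensional ℝ D] {m : ℕ}

/-- The conjugate transpose for the principal involution. -/
def conjT {m : ℕ} (X : Matrix (Fin m) (Fin m) D) : Matrix (Fin m) (Fin m) D :=
  X.transpose.map principalInvolution

theorem conjT_mul (X Y : Matrix (Fin m) (Fin m) D) : conjT (X * Y) = conjT Y * conjT X := by
  ext i j
  simp only [conjT, Matrix.map_apply, Matrix.transpose_apply, Matrix.mul_apply,
    principalInvolution_sum, principalInvolution_mul]

theorem conjT_one : conjT (1 : Matrix (Fin m) (Fin m) D) = 1 := by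
  ext i j
  by_cases h : i = j
  · subst h
    simp [conjT, principalInvolution_one]
  · simp [conjT, Matrix.one_apply_ne h, principalInvolution_zero]

/-- The matrices with `g ᵗḡ = 1` form a subgroup, so they are all of the subgroup they generate.
-/
theorem mem_maxCompactArch_iff {g : (Matrix (Fin m) (Fin m) D)ˣ} :
    g ∈ maxCompactArch D m ↔ g.1 * conjT g.1 = 1 := by
  let U : Subgroup (Matrix (Fin m) (Fin m) D)ˣ :=
    { carrier := {g | g.1 * conjT g.1 = 1}
      one_mem' := by simp [conjT_one]
      mul_mem' := fun {g h} hg hh => by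
        change g.1 * h.1 * conjT (g.1 * h.1) = 1
        rw [conjT_mul, mul_assoc, ← mul_assoc h.1]
        have hh' : h.1 * conjT h.1 = 1 := hh
        rw [hh', one_mul]
        exact hg
      inv_mem' := fun {g} hg => by
        have hg' : g.1 * conjT g.1 = 1 := hg
        have h1 : conjT g.1 = (g⁻¹).1 := (left_inv_eq_right_inv g.inv_mul hg').symm
        have h2 : conjT (g⁻¹).1 * conjT g.1 = 1 := by rw [← conjT_mul, Units.mul_inv, conjT_one]
        have h3 : conjT (g⁻¹).1 = g.1 := by
          rw [h1] at h2
          exact left_inv_eq_right_inv h2 g.inv_mul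
        change (g⁻¹).1 * conjT (g⁻¹).1 = 1
        rw [h3, Units.inv_mul] }
  constructor
  · intro hg
    have : maxCompactArch D m ≤ U := (Subgroup.closure_le U).2 fun g hg => hg
    exact this hg
  · intro hg
    exact Subgroup.subset_closure hg

/-- Conjugate transposition acts on plane matrices through the matrix of size two. -/
theorem conjT_planeMatrix (i j : Fin m) (P : Matrix (Fin 2) (Fin 2) D) :
    conjT (planeMatrix i j P) = planeMatrix i j (conjT P) := by
  ext x y
  have h0 := principalInvolution_zero (D := D)
  have h1 := principalInvolution_one (D := D)
  simp only [conjT, planeMatrix, Matrix.map_apply, Matrix.transpose_apply]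
  split_ifs <;> first | rfl | exact h0 | exact h1 | grind

/-- The rotation which clears `(a, b)` with `b ≠ 0` is the unitary matrix with first column
proportional to `(1, -c)`, for `c = b⁻¹ a`. -/
theorem hasGivens_maxCompactArch (m : ℕ) : HasGivens (maxCompactArch D m) := by
  have hmem : ∀ (P : (Matrix (Fin 2) (Fin 2) D)ˣ), P.1 * conjT P.1 = 1 →
      ∀ (i j : Fin m) (hij : i ≠ j), planeUnit hij P ∈ maxCompactArch D m := by
    intro P hP i j hij
    rw [mem_maxCompactArch_iff]
    change planeMatrix i j P.1 * conjT (planeMatrix i j P.1) = 1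
    rw [conjT_planeMatrix, planeMatrix_mul hij, hP, planeMatrix_one hij]
  refine hasGivens_of_planeUnit (F := ℝ) fun a b => ?_
  by_cases hb : b = 0
  · refine ⟨⟨!![0, 1; 1, 0], !![0, 1; 1, 0], ?_, ?_⟩, by simp [hb], hmem _ ?_⟩
    · ext x y; fin_cases x <;> fin_cases y <;> simp [Matrix.mul_apply, Fin.sum_univ_two]
    · ext x y; fin_cases x <;> fin_cases y <;> simp [Matrix.mul_apply, Fin.sum_univ_two]
    · ext x y
      fin_cases x <;> fin_cases y <;> simp [Matrix.mul_apply, Fin.sum_univ_two, conjT,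
        principalInvolution_zero, principalInvolution_one]
  · set c := b⁻¹ * a with hc
    obtain ⟨h1, h2, -⟩ := mul_principalInvolution c
    have h1' := principalInvolution_mul_self c
    set N := normSqD c with hN
    set l : ℝ := (Real.sqrt (1 + N))⁻¹ with hl
    have hll : l * l * (1 + N) = 1 := by
      rw [hl, ← mul_inv, Real.mul_self_sqrt (by linarith), inv_mul_cancel₀ (by linarith)]
    set c' := principalInvolution c with hc'
    have hinvol : principalInvolution c' = c := by
      rw [hc']
      simp only [principalInvolution, reD_sub, reD_algebraMap]
      rw [show 2 * (2 * reD c - reD c) = 2 * reD c by ring]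
      abel
    have e1 : algebraMap ℝ D l * algebraMap ℝ D l * (1 + algebraMap ℝ D N) = 1 := by
      rw [← map_one (algebraMap ℝ D), ← map_mul, ← map_add, ← map_mul, hll]
    set P : Matrix (Fin 2) (Fin 2) D := l • !![1, c'; -c, 1] with hP
    have hPc : conjT P = l • !![1, -c'; c, 1] := by
      ext x y
      fin_cases x <;> fin_cases y <;>
        simp [hP, conjT, principalInvolution_smul, principalInvolution_one,
          principalInvolution_neg, hinvol, ← hc']
    have hone : (l * l) • (1 : D) + (l * l) • algebraMap ℝ D N = 1 := by
      rw [← smul_add, Algebra.smul_def, map_mul]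
      exact e1
    have hPP : P * conjT P = 1 := by
      rw [hPc, hP, smul_mul_smul_comm]
      ext x y
      fin_cases x <;> fin_cases y <;> simp [h1, h1']
      · exact hone
      · rw [add_comm]; exact hone
    have hPP' : conjT P * P = 1 := by
      rw [hPc, hP, smul_mul_smul_comm]
      ext x y
      fin_cases x <;> fin_cases y <;> simp [h1, h1']
      · exact hone
      · rw [add_comm]; exact hone
    refine ⟨⟨P, conjT P, hPP, hPP'⟩, ?_, hmem _ hPP⟩
    simp [hP, hc, mul_inv_cancel_left₀ hb]

end ArchGroup

section ArchNorm

variable (F : Type*) [RCLike F]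

/-- The normalized absolute value of `ℝ` or `ℂ`; for `ℂ` it is the square of the usual one, which
satisfies the triangle inequality only up to a constant. -/
theorem isLocalFieldAbs_absArch : IsLocalFieldAbs (absArch F) := by
  have hk : finrank ℝ F ≠ 0 := finrank_pos.ne'
  have hcont : Continuous (absArch F) := continuous_norm.pow _
  have hcomp : IsCompact {x : F | absArch F x ≤ 1} := by
    have : {x : F | absArch F x ≤ 1} = Metric.closedBall 0 1 := by
      ext x
      simp [absArch, pow_le_one_iff_of_nonneg (norm_nonneg x) hk]
    rw [this]
    exact isCompact_closedBall 0 1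
  have h := isLocalAbs_of_isCompact (w := absArch F) (fun x => by rw [absArch]; positivity)
    (fun x => by simp [absArch, hk]) (fun x y => by simp [absArch, mul_pow]) hcont hcomp
  refine { h with isCompact := hcomp, exists_one_lt := ⟨2, ?_⟩ }
  rw [absArch, RCLike.norm_ofNat]
  exact one_lt_pow₀ one_lt_two hk

variable {F}

/-- A multiplicative continuous function on `F = ℝ` or `ℂ` which is `r^i` on the positive reals is the
power `i` of the absolute value. -/
theorem eq_norm_pow_of_mul {χ : F → ℝ} {i : ℕ} (hc : Continuous χ) (hpos : ∀ x, x ≠ 0 → 0 < χ x)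
    (hmul : ∀ x y, χ (x * y) = χ x * χ y) (hr : ∀ r : ℝ, 0 < r → χ (r : F) = r ^ i) {x : F}
    (hx : x ≠ 0) : χ x = ‖x‖ ^ i := by
  have hn : 0 < ‖x‖ := norm_pos_iff.2 hx
  have hn' : ((‖x‖ : ℝ) : F) ≠ 0 := by exact_mod_cast hn.ne'
  have h1 : x = ((‖x‖ : ℝ) : F) * (((‖x‖ : ℝ) : F)⁻¹ * x) := by rw [mul_inv_cancel_left₀ hn']
  set u : F := ((‖x‖ : ℝ) : F)⁻¹ * x with hu
  have hu1 : ‖u‖ = 1 := by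
    rw [hu, norm_mul, norm_inv, RCLike.norm_ofReal, abs_of_pos hn, inv_mul_cancel₀ hn.ne']
  obtain ⟨B, hB⟩ := ((isCompact_sphere (0 : F) 1).image hc).bddAbove
  have hχ1 : χ 1 = 1 := by
    have := hmul 1 1
    rw [mul_one] at this
    exact (mul_right_cancel₀ (hpos 1 one_ne_zero).ne' (by rw [one_mul]; exact this)).symm
  -- `χ` is trivial on the compact group of elements of norm one
  have hle : ∀ v : F, ‖v‖ = 1 → χ v ≤ 1 := by
    intro v hv
    have hpow : ∀ k : ℕ, χ (v ^ k) = χ v ^ k := by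
      intro k
      induction k with
      | zero => simp [hχ1]
      | succ k ih => rw [pow_succ, hmul, ih, pow_succ]
    by_contra! hlt
    obtain ⟨k, hk⟩ := pow_unbounded_of_one_lt B hlt
    refine absurd (hB ⟨v ^ k, by simp [hv], rfl⟩) (not_le.2 ?_)
    rw [hpow]
    exact hk
  have hu0 : u ≠ 0 := norm_ne_zero_iff.1 (by rw [hu1]; exact one_ne_zero)
  have h2 : χ u = 1 := by
    refine le_antisymm (hle u hu1) ?_
    have h3 := hmul u u⁻¹
    rw [mul_inv_cancel₀ hu0, hχ1] at h3
    nlinarith [hle u⁻¹ (by rw [norm_inv, hu1, inv_one]), hpos u hu0]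
  rw [h1, hmul, h2, mul_one, hr _ hn, ← h1]

end ArchNorm

end

/-! ### Topology of real division algebras -/

section

open Module Filter Topology MeasureTheory

section ArchTop

variable (F : Type*) [RCLike F] {D : Type*} [DivisionRing D] [Algebra F D] [FiniteDimensional F D]
  [Algebra ℝ D] [IsScalarTower ℝ F D] [FiniteDimensional ℝ D] [TopologicalSpace D]
  [IsModuleTopology F D]

omit [FiniteDimensional ℝ D] in
include F in
theorem continuousSMul_real : ContinuousSMul ℝ D := by
  have := IsModuleTopology.isTopologicalRing F D
  refine ⟨?_⟩
  have h : (fun p : ℝ × D => p.1 • p.2) = fun p => ((p.1 : F)) • p.2 := by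
    funext p
    rw [← algebraMap_smul F p.1 p.2]
  rw [h]
  exact (RCLike.continuous_ofReal.comp continuous_fst).smul continuous_snd

include F in
/-- Real linear maps out of `D` are continuous for the module topology over `F`. -/
theorem continuous_of_real_linearMap {V : Type*} [AddCommGroup V] [Module ℝ V] [TopologicalSpace V]
    [IsTopologicalAddGroup V] [ContinuousSMul ℝ V] (f : D →ₗ[ℝ] V) : Continuous f := by
  have := IsModuleTopology.isTopologicalRing F D
  have := t2Space_of_finiteDimensional F D
  have := continuousSMul_real F (D := D)
  exact LinearMap.continuous_of_finiteDimensional f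

omit [FiniteDimensional F D] [TopologicalSpace D] [IsModuleTopology F D] [FiniteDimensional ℝ D] [Algebra F D]
  [IsScalarTower ℝ F D] in
variable (D) in
/-- The real part as a linear form. -/
def reLin : D →ₗ[ℝ] ℝ where
  toFun := reD
  map_add' := reD_add
  map_smul' := reD_smul

omit [FiniteDimensional F D] [TopologicalSpace D] [IsModuleTopology F D] [FiniteDimensional ℝ D] [Algebra F D]
  [IsScalarTower ℝ F D] in
variable (D) in
/-- The principal involution as a linear map. -/
def involLin : D →ₗ[ℝ] D where
  toFun := principalInvolution
  map_add' := principalInvolution_add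
  map_smul' := principalInvolution_smul

include F in
theorem continuous_principalInvolution : Continuous (principalInvolution : D → D) := by
  have := IsModuleTopology.isTopologicalRing F D
  have := continuousSMul_real F (D := D)
  exact continuous_of_real_linearMap F (involLin D)

include F in
theorem continuous_normSqD : Continuous (normSqD : D → ℝ) := by
  have := IsModuleTopology.isTopologicalRing F D
  exact (continuous_of_real_linearMap F (reLin D)).comp
    (continuous_id.mul (continuous_principalInvolution F))

/-- On `F` the form `x x̄` is a multiplicative function with value `r²` at `r > 0`, hence the
square of the absolute value. -/
theorem normSqD_smul_field (c : F) (x : D) : normSqD (c • x) = ‖c‖ ^ 2 * normSqD x := by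
  have := IsModuleTopology.isTopologicalRing F D
  have hone : normSqD (1 : D) = 1 := by
    rw [normSqD, principalInvolution_one, one_mul, reD_one]
  have hzero : normSqD (0 : D) = 0 := by
    have := normSqD_smul 0 (0 : D)
    rwa [zero_smul, zero_pow two_ne_zero, zero_mul] at this
  by_cases hc : c = 0
  · rw [hc, zero_smul, hzero, norm_zero, zero_pow two_ne_zero, zero_mul]
  have h1 : normSqD (algebraMap F D c) = ‖c‖ ^ 2 := by
    refine eq_norm_pow_of_mul (χ := fun c : F => normSqD (algebraMap F D c)) ?_ ?_ ?_ ?_ hc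
    · exact (continuous_normSqD F).comp (continuous_algebraMap F D)
    · intro x hx
      obtain ⟨-, h2, h3⟩ := mul_principalInvolution (algebraMap F D x)
      refine lt_of_le_of_ne h2 fun h => hx ?_
      exact (map_eq_zero _).1 (h3 h.symm)
    · intro x y
      rw [map_mul, normSqD_mul]
    · intro r _
      change normSqD (algebraMap F D (algebraMap ℝ F r)) = _
      rw [← IsScalarTower.algebraMap_apply, Algebra.algebraMap_eq_smul_one, normSqD_smul, hone, mul_one]
  rw [Algebra.smul_def, normSqD_mul, h1]

theorem isHomogeneousAbs_normSqD : IsHomogeneousAbs (absArch F) 2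
    fun x : D => normSqD x ^ finrank ℝ F := by
  refine ⟨(continuous_normSqD F).pow _, fun x => pow_nonneg (mul_principalInvolution x).2.1 _,
    fun c x => ?_⟩
  rw [normSqD_smul_field, mul_pow, absArch, ← pow_mul, ← pow_mul, mul_comm 2]

include F in
/-- The diagonal entries of `g ᵗḡ = 1` bound the entries of `g`. -/
theorem isCompact_maxCompactArch (m : ℕ) :
    IsCompact (maxCompactArch D m : Set (Matrix (Fin m) (Fin m) D)ˣ) := by
  have := IsModuleTopology.isTopologicalRing F D
  have := t2Space_of_finiteDimensional F D
  have hk : finrank ℝ F ≠ 0 := finrank_pos.ne'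
  have hB : IsCompact {x : D | normSqD x ≤ 1} := by
    have h1 := (isHomogeneousAbs_normSqD F (D := D)).isCompact_le (isLocalFieldAbs_absArch F) two_pos
      (fun x hx => (mul_principalInvolution x).2.2 (pow_eq_zero_iff hk |>.1 hx)) 1
    simpa only [pow_le_one_iff_of_nonneg (mul_principalInvolution _).2.1 hk] using h1
  set S : Set (Matrix (Fin m) (Fin m) D) := Set.univ.pi fun _ => Set.univ.pi fun _ =>
    {x : D | normSqD x ≤ 1} with hS
  have hSc : IsCompact S := isCompact_univ_pi fun _ => isCompact_univ_pi fun _ => hB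
  have hsub : ∀ g ∈ maxCompactArch D m, g.1 ∈ S := by
    intro g hg i _ j _
    have h1 := congrFun (congrFun (mem_maxCompactArch_iff.1 hg) i) i
    rw [Matrix.mul_apply, Matrix.one_apply_eq] at h1
    have h2 : algebraMap ℝ D (∑ j, normSqD (g.1 i j)) = algebraMap ℝ D 1 := by
      rw [map_sum, map_one, ← h1]
      exact Finset.sum_congr rfl fun j _ => (mul_principalInvolution _).1.symm
    have h3 := (algebraMap ℝ D).injective h2
    change normSqD (g.1 i j) ≤ 1
    rw [← h3]
    exact Finset.single_le_sum (fun j _ => (mul_principalInvolution (g.1 i j)).2.1)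
      (Finset.mem_univ j)
  refine (isCompact_units hSc).of_isClosed_subset ?_
    fun g hg => ⟨hsub g hg, hsub g⁻¹ (inv_mem hg)⟩
  have h1 : (maxCompactArch D m : Set (Matrix (Fin m) (Fin m) D)ˣ) = {g | g.1 * conjT g.1 = 1} := by
    ext g
    exact mem_maxCompactArch_iff
  rw [h1]
  have h2 : Continuous (conjT : Matrix (Fin m) (Fin m) D → _) :=
    continuous_id.matrix_transpose.matrix_map (continuous_principalInvolution F)
  exact isClosed_eq (Units.continuous_val.mul (h2.comp Units.continuous_val)) continuous_const

variable (D) in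
/-- The Euclidean norm, raised to the power `[F : ℝ]`, is homogeneous for the normalized absolute
value. -/
theorem isHomogeneousAbs_normArch (m : ℕ) :
    IsHomogeneousAbs (absArch F) 1 (fun X => normArch D m X ^ finrank ℝ F) ∧
      ∀ X, normArch D m X = 0 → X = 0 := by
  have hnn : ∀ x : D, 0 ≤ normSqD x := fun x => (mul_principalInvolution x).2.1
  have hdef : ∀ X : Matrix (Fin m) (Fin m) D, normArch D m X = Real.sqrt (∑ i, ∑ j, normSqD (X i j)) :=
    fun X => rfl
  refine ⟨⟨?_, fun X => pow_nonneg (Real.sqrt_nonneg _) _, fun c X => ?_⟩, fun X hX => ?_⟩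
  · refine Continuous.pow (Real.continuous_sqrt.comp (continuous_finsetSum _ fun i _ =>
      continuous_finsetSum _ fun j _ => ?_)) _
    exact (continuous_normSqD F).comp ((continuous_apply j).comp (continuous_apply i))
  · rw [hdef, hdef, pow_one, absArch, ← mul_pow]
    congr 1
    simp only [Matrix.smul_apply, normSqD_smul_field, ← Finset.mul_sum]
    rw [Real.sqrt_mul (by positivity), Real.sqrt_sq (norm_nonneg _)]
  · have hi : ∀ i, 0 ≤ ∑ j, normSqD (X i j) := fun i => Finset.sum_nonneg fun j _ => hnn _
    have h0 := (Real.sqrt_eq_zero (Finset.sum_nonneg fun i _ => hi i)).1 ((hdef X).symm.trans hX)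
    ext i j
    have h1 := (Finset.sum_eq_zero_iff_of_nonneg fun i _ => hi i).1 h0 i (Finset.mem_univ i)
    exact (mul_principalInvolution _).2.2
      ((Finset.sum_eq_zero_iff_of_nonneg fun j _ => hnn _).1 h1 j (Finset.mem_univ j))

omit [FiniteDimensional F D] [TopologicalSpace D] [IsModuleTopology F D] [FiniteDimensional ℝ D]
  [Algebra F D] [IsScalarTower ℝ F D] [Algebra ℝ D] [DivisionRing D] in
/-- The normalized absolute value is the absolute value of the norm to `ℝ`. -/
theorem absArch_eq_abs_norm (c : F) : absArch F c = |Algebra.norm ℝ c| := by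
  by_cases hc : c = 0
  · subst hc
    rw [absArch, norm_zero, zero_pow finrank_pos.ne', Algebra.norm_zero, abs_zero]
  · refine (eq_norm_pow_of_mul (χ := fun c : F => |Algebra.norm ℝ c|) ?_ ?_ ?_ ?_ hc).symm
    · have h1 : Continuous fun c : F => (Algebra.leftMulMatrix (finBasis ℝ F)) c :=
        LinearMap.continuous_of_finiteDimensional (Algebra.leftMulMatrix (finBasis ℝ F)).toLinearMap
      simp only [Algebra.norm_eq_matrix_det (finBasis ℝ F)]
      exact h1.matrix_det.abs
    · intro x hx
      exact abs_pos.2 ((Algebra.norm_ne_zero_iff).2 hx)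
    · intro x y
      rw [map_mul, abs_mul]
    · intro r hr
      change |Algebra.norm ℝ (algebraMap ℝ F r)| = _
      rw [Algebra.norm_algebraMap, abs_pow, abs_of_pos hr]

end ArchTop

end

/-! ### Invariant differential operators on twisted Schwartz functions -/

section

open Module Filter Topology MeasureTheory

section ArchOperators

variable (E : Type*) [Ring E] [Algebra ℝ E] [Module.Finite ℝ E]

/-- The norm is a polynomial in the coordinates. -/
theorem contDiff_algebraNorm_coord : ContDiff ℝ ∞ fun c => Algebra.norm ℝ ((coord E).symm c) := by
  let L : (Fin (finrank ℝ E) → ℝ) →ₗ[ℝ] (Fin (finrank ℝ E) → Fin (finrank ℝ E) → ℝ) :=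
    (Algebra.leftMulMatrix (finBasis ℝ E)).toLinearMap ∘ₗ (coord E).symm.toLinearMap
  have h1 : ContDiff ℝ ∞ L :=
    (LinearMap.toContinuousLinearMap
      (F' := Fin (finrank ℝ E) → Fin (finrank ℝ E) → ℝ) L).contDiff
  simp only [Algebra.norm_eq_matrix_det (finBasis ℝ E), Matrix.det_apply]
  refine ContDiff.sum fun σ _ => ?_
  have h2 : ContDiff ℝ ∞ fun c => ∏ i, L c (σ i) i :=
    contDiff_prod fun i _ => contDiff_pi.1 (contDiff_pi.1 h1 _) _
  exact h2.const_smul (Equiv.Perm.sign σ : ℤ)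

variable {E}

theorem isUnit_iff_algebraNorm_ne_zero (x : E) : IsUnit x ↔ Algebra.norm ℝ x ≠ 0 := by
  rw [← isUnit_iff_ne_zero, Algebra.norm_apply, ← LinearMap.isUnit_iff_isUnit_det]
  exact Algebra.lmul_isUnit_iff.symm

theorem abs_cpow_eq_exp {x : ℝ} (hx : x ≠ 0) (z : ℂ) :
    ((|x| : ℝ) : ℂ) ^ z = Complex.exp (z * (Real.log x : ℝ)) := by
  rw [Complex.cpow_def_of_ne_zero (by exact_mod_cast abs_ne_zero.2 hx), ← Complex.ofReal_log
    (abs_nonneg x), Real.log_abs, mul_comm]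

/-- The smooth function `g ↦ φ(g) |N(g)|^z` on `Eˣ`, with `N` the norm of the real algebra `E`. -/
def normTwist (z : ℂ) (φ : SchwartzFD E) : smoothUnits E :=
  ⟨fun g => SchwartzFD.eval φ (g : E) * ((|Algebra.norm ℝ (g : E)| : ℝ) : ℂ) ^ z, by
    have h1 : ContDiffOn ℝ ∞ (fun c => φ c *
        Complex.exp (z * (Real.log (Algebra.norm ℝ ((coord E).symm c)) : ℝ)))
        {c | IsUnit ((coord E).symm c)} := by
      refine (φ.smooth ⊤).contDiffOn.mul (ContDiffOn.cexp (contDiffOn_const.mul ?_))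
      refine Complex.ofRealCLM.contDiff.comp_contDiffOn ?_
      exact (contDiff_algebraNorm_coord E).contDiffOn.log fun c hc =>
        (isUnit_iff_algebraNorm_ne_zero _).1 hc
    refine h1.congr ?_
    rintro c ⟨g, hg⟩
    simp only [← hg, extendZero_unit, SchwartzFD.eval]
    rw [abs_cpow_eq_exp ((isUnit_iff_algebraNorm_ne_zero _).1 g.isUnit), hg,
      LinearEquiv.apply_symm_apply]⟩

theorem normTwist_add (z : ℂ) (φ ψ : SchwartzFD E) :
    normTwist z (φ + ψ) = normTwist z φ + normTwist z ψ :=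
  Subtype.ext (funext fun _ => add_mul _ _ _)

theorem normTwist_smul (z c : ℂ) (φ : SchwartzFD E) : normTwist z (c • φ) = c • normTwist z φ :=
  Subtype.ext (funext fun _ => mul_assoc _ _ _)

/-- The derivative of a Schwartz function along a linear vector field. -/
def schwartzFieldDeriv (v : E →ₗ[ℝ] E) : SchwartzFD E →L[ℝ] SchwartzFD E :=
  (SchwartzMap.bilinLeftCLM (ContinuousLinearMap.id ℝ _)
    (LinearMap.toContinuousLinearMap
      ((coord E).toLinearMap ∘ₗ v ∘ₗ (coord E).symm.toLinearMap)).hasTemperateGrowth).comp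
  (SchwartzMap.fderivCLM ℝ _ ℂ)

theorem schwartzFieldDeriv_apply (v : E →ₗ[ℝ] E) (φ : SchwartzFD E) (c) :
    schwartzFieldDeriv v φ c = fderiv ℝ φ c (coord E (v ((coord E).symm c))) := rfl

/-- The trace of left multiplication by `X`. -/
def leftTrace (X : E) : ℝ := (Algebra.leftMulMatrix (finBasis ℝ E) X).trace

/-- The derivative of the determinant at the identity is the trace. -/
theorem hasDerivAt_algebraNorm_one_add (X : E) :
    HasDerivAt (fun t : ℝ => Algebra.norm ℝ (1 + t • X)) (leftTrace X) 0 := by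
  have h : (fun t : ℝ => Algebra.norm ℝ (1 + t • X)) = fun t =>
      1 + (Algebra.leftMulMatrix (finBasis ℝ E) X).trace * t +
        (Matrix.det (1 + (Polynomial.X : Polynomial ℝ) •
          (Algebra.leftMulMatrix (finBasis ℝ E) X).map Polynomial.C)).divX.divX.eval t * t ^ 2 := by
    funext t
    rw [Algebra.norm_eq_matrix_det (finBasis ℝ E), map_add, map_one, map_smul,
      Matrix.det_one_add_smul]
  rw [h, leftTrace]
  have h1 := (((hasDerivAt_id (0 : ℝ)).const_mul
    (Algebra.leftMulMatrix (finBasis ℝ E) X).trace).const_add 1).add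
    (((Matrix.det (1 + (Polynomial.X : Polynomial ℝ) •
          (Algebra.leftMulMatrix (finBasis ℝ E) X).map Polynomial.C)).divX.divX.hasDerivAt 0).mul
        ((hasDerivAt_id (0 : ℝ)).pow 2))
  convert! h1 using 1
  simp

/-- The derivative of `φ |N|^z` along an invariant vector field `g ↦ v(g)` is `(v φ + z tr(X) φ)
|N|^z`, because `N(g + t v(g)) = N(g) N(1 + t X)`. -/
theorem fieldDerivEnd_normTwist (v : E →ₗ[ℝ] E) (X : E)
    (hv : ∀ (g : E) (t : ℝ), Algebra.norm ℝ (g + t • v g) =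
      Algebra.norm ℝ g * Algebra.norm ℝ (1 + t • X)) (z : ℂ) (φ : SchwartzFD E) :
    fieldDerivEnd v (normTwist z φ) =
      normTwist z (schwartzFieldDeriv v φ + (z * (leftTrace X : ℝ)) • φ) := by
  ext g
  have hg : Algebra.norm ℝ (g : E) ≠ 0 := (isUnit_iff_algebraNorm_ne_zero _).1 g.isUnit
  have hX := hasDerivAt_algebraNorm_one_add X
  have hone : Algebra.norm ℝ (1 + (0 : ℝ) • X) = 1 := by rw [zero_smul, add_zero, map_one]
  have hev : ∀ᶠ t : ℝ in 𝓝 0, Algebra.norm ℝ (1 + t • X) ≠ 0 :=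
    hX.continuousAt.eventually_ne (by rw [hone]; exact one_ne_zero)
  have h1 : HasDerivAt (fun t : ℝ => φ (coord E g + t • coord E (v g)))
      (fderiv ℝ φ (coord E g) (coord E (v g))) 0 := by
    have h := (φ.hasFDerivAt (coord E g)).hasLineDerivAt (coord E (v g))
    exact h
  -- `|N|^z = exp (z log |N|)`, which is differentiable regardless of the sign of `N`
  have h2 : HasDerivAt (fun t : ℝ => Complex.exp (z * (Real.log (Algebra.norm ℝ (g : E) *
      Algebra.norm ℝ (1 + t • X)) : ℝ)))
      (((|Algebra.norm ℝ (g : E)| : ℝ) : ℂ) ^ z * (z * (leftTrace X : ℝ))) 0 := by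
    have h3 := (((hX.const_mul (Algebra.norm ℝ (g : E))).log
      (by rw [hone, mul_one]; exact hg)).ofReal_comp.const_mul z).cexp
    rw [hone, mul_one, mul_div_cancel_left₀ _ hg, ← abs_cpow_eq_exp hg] at h3
    exact h3
  have h4 : HasLineDerivAt ℝ (extendZero (normTwist z φ).1)
      (fderiv ℝ φ (coord E g) (coord E (v g)) * ((|Algebra.norm ℝ (g : E)| : ℝ) : ℂ) ^ z +
        φ (coord E g) * (((|Algebra.norm ℝ (g : E)| : ℝ) : ℂ) ^ z *
          (z * (leftTrace X : ℝ)))) (g : E) (v g) := by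
    have h5 := h1.mul h2
    simp only [zero_smul, add_zero, map_one, mul_one, ← abs_cpow_eq_exp hg] at h5
    -- near `t = 0` the point `g + t v(g)` is a unit, so that the extension by zero is given by
    -- the formula
    refine HasDerivAt.congr_of_eventuallyEq h5 ?_
    filter_upwards [hev] with t ht
    have hu : Algebra.norm ℝ ((g : E) + t • v g) ≠ 0 := by
      rw [hv]
      exact mul_ne_zero hg ht
    obtain ⟨u, hu'⟩ := (isUnit_iff_algebraNorm_ne_zero _).2 hu
    rw [← hu', extendZero_unit]
    simp only [normTwist, SchwartzFD.eval]
    rw [hu', hv, abs_cpow_eq_exp (mul_ne_zero hg ht), map_add, map_smul]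
    rfl
  change lineDeriv ℝ (extendZero (normTwist z φ).1) (g : E) (v g) = _
  rw [h4.lineDeriv]
  simp only [normTwist, SchwartzFD.eval, add_apply, smul_apply,
    schwartzFieldDeriv_apply, LinearEquiv.symm_apply_apply, smul_eq_mul]
  ring

/-- Invariant differential operators preserve the twisted Schwartz functions `φ |N|^z`,
and their effect on `φ` depends continuously on `(z, φ)`. -/
theorem exists_lift_fieldDerivEnd_normTwist (v : E → E →ₗ[ℝ] E)
    (act : FreeAlgebra ℂ E →ₐ[ℂ] Module.End ℂ (smoothUnits E))
    (hact : ∀ X, act (FreeAlgebra.ι ℂ X) = fieldDerivEnd (v X))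
    (hv : ∀ (X g : E) (t : ℝ), Algebra.norm ℝ (g + t • v X g) =
      Algebra.norm ℝ g * Algebra.norm ℝ (1 + t • X)) (B : FreeAlgebra ℂ E) :
    ∃ P : ℂ × SchwartzFD E → SchwartzFD E, Continuous P ∧ ∀ z φ,
      act B (normTwist z φ) = normTwist z (P (z, φ)) := by
  induction B using FreeAlgebra.induction with
  | grade0 c =>
    refine ⟨fun p => c • p.2, continuous_snd.const_smul c, fun z φ => ?_⟩
    rw [AlgHom.commutes, normTwist_smul]
    rfl
  | grade1 X =>
    refine ⟨fun p => schwartzFieldDeriv (v X) p.2 + (p.1 * (leftTrace X : ℝ)) • p.2, ?_,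
      fun z φ => ?_⟩
    · exact ((schwartzFieldDeriv (v X)).continuous.comp continuous_snd).add
        ((continuous_fst.mul continuous_const).smul continuous_snd)
    · rw [hact, fieldDerivEnd_normTwist (v X) X (hv X)]
  | mul a b ha hb =>
    obtain ⟨P, hP, hPa⟩ := ha
    obtain ⟨Q, hQ, hQb⟩ := hb
    refine ⟨fun p => P (p.1, Q p), hP.comp (continuous_fst.prodMk hQ), fun z φ => ?_⟩
    rw [map_mul, Module.End.mul_apply, hQb, hPa]
  | add a b ha hb =>
    obtain ⟨P, hP, hPa⟩ := ha
    obtain ⟨Q, hQ, hQb⟩ := hb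
    refine ⟨fun p => P p + Q p, hP.add hQ, fun z φ => ?_⟩
    rw [map_add, LinearMap.add_apply, hPa, hQb, normTwist_add]

/-- The left invariant fields `g ↦ g X` satisfy `N(g + t g X) = N(g) N(1 + t X)`. -/
theorem exists_lift_rightAct (B : FreeAlgebra ℂ E) :
    ∃ P : ℂ × SchwartzFD E → SchwartzFD E, Continuous P ∧ ∀ z φ,
      rightAct E B (normTwist z φ) = normTwist z (P (z, φ)) := by
  refine exists_lift_fieldDerivEnd_normTwist (fun X => LinearMap.mulRight ℝ X) (rightAct E)
    (fun X => FreeAlgebra.lift_ι_apply _ _) (fun X g t => ?_) B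
  rw [← map_mul, mul_add, mul_one, mul_smul_comm, LinearMap.mulRight_apply]

/-- The right invariant fields `g ↦ X g` satisfy `N(g + t X g) = N(g) N(1 + t X)`. -/
theorem exists_lift_leftAct (B : FreeAlgebra ℂ E) :
    ∃ P : ℂ × SchwartzFD E → SchwartzFD E, Continuous P ∧ ∀ z φ,
      leftAct E B (normTwist z φ) = normTwist z (P (z, φ)) := by
  refine exists_lift_fieldDerivEnd_normTwist (fun X => LinearMap.mulLeft ℝ X) (leftAct E)
    (fun X => FreeAlgebra.lift_ι_apply _ _) (fun X g t => ?_) B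
  rw [mul_comm, ← map_mul, add_mul, one_mul, smul_mul_assoc, LinearMap.mulLeft_apply]

end ArchOperators

end

/-! ### The archimedean local case -/

section

open Module Filter Topology MeasureTheory

section Schwartz

variable (E : Type*) [AddCommGroup E] [Module ℝ E]

/-- The polynomially weighted sup norms of a Schwartz function are bounded by continuous functions
on the Schwartz space. -/
theorem exists_schwartz_bound (k : ℕ) : ∃ q : SchwartzFD E → ℝ, Continuous q ∧ q 0 = 0 ∧
    ∀ ψ c, (1 + ‖c‖) ^ k * ‖ψ c‖ ≤ q ψ := by
  set p : Seminorm ℂ (SchwartzFD E) :=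
    (Finset.Iic (k, 0)).sup fun m => SchwartzMap.seminorm ℂ m.1 m.2 with hp
  have hpc : Continuous p := by
    refine Seminorm.continuous_of_le (q := ∑ m ∈ Finset.Iic (k, 0), SchwartzMap.seminorm ℂ m.1 m.2) ?_
      (Seminorm.finset_sup_le_sum _ _)
    have h : ⇑(∑ m ∈ Finset.Iic (k, 0), SchwartzMap.seminorm ℂ m.1 m.2 : Seminorm ℂ (SchwartzFD E)) =
        ∑ m ∈ Finset.Iic (k, 0), ⇑(SchwartzMap.seminorm ℂ m.1 m.2 : Seminorm ℂ (SchwartzFD E)) :=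
      map_sum (FunLike.coeAddMonoidHom (Seminorm ℂ (SchwartzFD E)) (SchwartzFD E) ℝ) _ _
    rw [h]
    rw [show (∑ m ∈ Finset.Iic (k, 0), ⇑(SchwartzMap.seminorm ℂ m.1 m.2 : Seminorm ℂ (SchwartzFD E))) =
      fun ψ => ∑ m ∈ Finset.Iic (k, 0), SchwartzMap.seminorm ℂ m.1 m.2 ψ from
        funext fun ψ => Finset.sum_apply _ _ _]
    exact continuous_finsetSum _ fun m _ =>
      (schwartz_withSeminorms ℂ (Fin (finrank ℝ E) → ℝ) ℂ).continuous_seminorm m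
  refine ⟨fun ψ => 2 ^ k * p ψ, continuous_const.mul hpc, by simp only [map_zero, mul_zero], fun ψ c => ?_⟩
  have h := SchwartzMap.one_add_le_sup_seminorm_apply (𝕜 := ℂ) (m := (k, 0)) le_rfl le_rfl ψ c
  rwa [norm_iteratedFDeriv_zero] at h

end Schwartz

theorem exists_le_mul_norm_of_homogeneous {V : Type*} [NormedAddCommGroup V] [NormedSpace ℝ V]
    [FiniteDimensional ℝ V] {f : V → ℝ} (hf : Continuous f) (hs : ∀ (r : ℝ) c, f (r • c) = |r| * f c) :
    ∃ C, 1 ≤ C ∧ ∀ c, f c ≤ C * ‖c‖ := by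
  obtain ⟨C, hC⟩ := ((isCompact_closedBall (0 : V) 1).image hf).bddAbove
  refine ⟨max 1 C, le_max_left _ _, fun c => ?_⟩
  by_cases hc : c = 0
  · have h := hs 0 c
    rw [zero_smul, abs_zero, zero_mul] at h
    rw [hc, h, norm_zero, mul_zero]
  · have hc' : 0 < ‖c‖ := norm_pos_iff.2 hc
    have h1 : f (‖c‖⁻¹ • c) ≤ C := hC ⟨_, by
      rw [mem_closedBall_zero_iff, norm_smul, norm_inv, norm_norm, inv_mul_cancel₀ hc'.ne'], rfl⟩
    rw [hs, abs_of_pos (inv_pos.2 hc'), inv_mul_le_iff₀ hc', mul_comm] at h1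
    exact h1.trans (mul_le_mul_of_nonneg_right (le_max_right _ _) hc'.le)

/-- Each seminorm applies a differential operator, which replaces `f` by another Schwartz function
depending continuously on `(s, f)`; the difference of two twisted functions is then split into a
change of the Schwartz function and a change of the exponent. -/
theorem isContinuousInclusion_archimedean (F : Type*) [RCLike F] (D : Type*) [DivisionRing D]
    [Algebra F D] [Algebra.IsCentral F D] [FiniteDimensional F D] [Algebra ℝ D]
    [IsScalarTower ℝ F D] [FiniteDimensional ℝ D] [TopologicalSpace D] [IsModuleTopology F D]
    (m d : ℕ) (hm : 0 < m) (hd : finrank F D = d ^ 2)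
    [MeasurableSpace (maxCompactArch D m)] [BorelSpace (maxCompactArch D m)]
    (μ : Measure (maxCompactArch D m)) [μ.IsHaarMeasure] :
    IsContinuousInclusion
      (GJRestr.eval : GJRestrArch F D m d {s : ℂ | (1 - d : ℝ) / 2 < s.re} → _)
      (HCArch.eval F D : HCArch F D m d μ → _) := by
  have ha := isLocalFieldAbs_absArch F
  have := IsModuleTopology.isTopologicalRing F D
  have := t2Space_of_finiteDimensional F D
  have := continuousSMul_real F (D := D)
  have := isModuleTopology_matrix F D m
  have : Nonempty (Fin m) := ⟨⟨0, hm⟩⟩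
  have hdA := finrank_matrix D hd (F := F) m
  have hn0 : m * d ≠ 0 := (degree_pos (Matrix (Fin m) (Fin m) D) hdA).ne'
  have hA := isHomogeneousAbs_reducedNormField ha (Matrix (Fin m) (Fin m) D) hdA
  set w : Matrix (Fin m) (Fin m) D → ℝ :=
    fun X => absArch F (reducedNormField F (Matrix (Fin m) (Fin m) D) (m * d) X) with hw
  have hwpos : ∀ g : (Matrix (Fin m) (Fin m) D)ˣ, 0 < w g.1 := fun g =>
    lt_of_le_of_ne (hA.nonneg _)
      (abs_reducedNormField_ne_zero ha (Matrix (Fin m) (Fin m) D) hdA g.isUnit).symm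
  have hwN : ∀ X, |Algebra.norm ℝ X| = w X ^ (m * d) := fun X => by
    rw [hw, abs_reducedNormField_pow ha (Matrix (Fin m) (Fin m) D) hdA, absArch_eq_abs_norm,
      Algebra.norm_norm]
  obtain ⟨hN, hN0⟩ := isHomogeneousAbs_normArch F D m
  have hcoord : ∃ C, 1 ≤ C ∧ ∀ X, normArch D m X ≤ C * ‖coord _ X‖ := by
    have hcont : Continuous fun c => normArch D m ((coord _).symm c) := by
      refine Real.continuous_sqrt.comp (continuous_finsetSum _ fun i _ =>
        continuous_finsetSum _ fun j _ => (continuous_normSqD F).comp ?_)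
      let L : (Fin (finrank ℝ (Matrix (Fin m) (Fin m) D)) → ℝ) →ₗ[ℝ] D :=
        Matrix.entryLinearMap ℝ D i j ∘ₗ (coord (Matrix (Fin m) (Fin m) D)).symm.toLinearMap
      exact L.continuous_of_finiteDimensional
    obtain ⟨C, hC1, hC⟩ := exists_le_mul_norm_of_homogeneous hcont fun r c => by
      rw [map_smul]
      simp only [normArch, Matrix.smul_apply]
      change Real.sqrt (∑ i, ∑ j, normSqD (r • _)) = |r| * Real.sqrt (∑ i, ∑ j, normSqD _)
      simp only [normSqD_smul, ← Finset.mul_sum]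
      rw [Real.sqrt_mul (sq_nonneg r), Real.sqrt_sq_eq_abs]
    exact ⟨C, hC1, fun X => by simpa using hC (coord _ X)⟩
  -- the bound for the functions `ψ |ν|^z`
  have hbound : ∀ (r : ℝ≥0) {ε₁ ε₂ : ℝ}, 0 < ε₁ → ε₁ ≤ ε₂ →
      ∃ q : SchwartzFD (Matrix (Fin m) (Fin m) D) → ℝ, Continuous q ∧ q 0 = 0 ∧
        ∀ ψ (g : (Matrix (Fin m) (Fin m) D)ˣ), ∀ ε ∈ Set.Icc ε₁ ε₂,
        |hcWeight (normArch D m) (xiArch F D m d μ) r g| * ‖SchwartzFD.eval ψ g.1‖ *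
          (w g.1 ^ (((m : ℝ) - 1) * d / 2 + ε) * (1 + |Real.log (w g.1)|)) ≤ q ψ := by
    intro r ε₁ ε₂ h1 h2
    obtain ⟨C, k, hC, hle⟩ := exists_hcWeight_reducedNorm_le ha D hd hm (isCompact_maxCompactArch F m)
      (hasGivens_maxCompactArch m) μ (finrank_pos (R := ℝ) (M := F)) hN
      (fun X => Real.sqrt_nonneg _) hN0 r h1 h2
    obtain ⟨C', hC1, hC'⟩ := hcoord
    obtain ⟨q, hq, hq0, hqle⟩ := exists_schwartz_bound (Matrix (Fin m) (Fin m) D) k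
    refine ⟨fun ψ => C * C' ^ k * q ψ, continuous_const.mul hq, by simp only [hq0, mul_zero],
      fun ψ g ε hε => ?_⟩
    rw [mul_right_comm]
    refine (mul_le_mul_of_nonneg_right (hle g ε hε) (norm_nonneg _)).trans ?_
    change _ ≤ C * C' ^ k * q ψ
    rw [mul_assoc, mul_assoc]
    refine mul_le_mul_of_nonneg_left ?_ hC
    refine le_trans ?_ (mul_le_mul_of_nonneg_left (hqle ψ (coord _ g.1)) (by positivity))
    rw [← mul_assoc, ← mul_pow]
    refine mul_le_mul_of_nonneg_right (pow_le_pow_left₀ ?_ ?_ k) (norm_nonneg _)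
    · exact add_nonneg zero_le_one (Real.sqrt_nonneg _)
    · have := hC' g.1
      linarith
  -- the function `f_s` in terms of the norm of the real algebra
  set z : ℂ → ℂ := fun s => (s + (((m * d : ℕ) : ℂ) - 1) / 2) / ((m * d : ℕ) : ℂ) with hz
  have hzc : Continuous z := (continuous_id.add continuous_const).div_const _
  have hcpow : ∀ (g : (Matrix (Fin m) (Fin m) D)ˣ) (s : ℂ),
      ((|Algebra.norm ℝ g.1| : ℝ) : ℂ) ^ z s = (w g.1 : ℂ) ^ (s + (((m * d : ℕ) : ℂ) - 1) / 2) := by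
    intro g s
    rw [hwN]
    exact pow_cpow_div (hwpos g) hn0 _
  have hexp : ∀ s : ℂ, (1 - d : ℝ) / 2 < s.re → 0 < s.re + ((d : ℝ) - 1) / 2 := fun s hs => by
    linarith
  -- the differential operators act through Schwartz functions
  have hop : ∀ i : FreeAlgebra ℂ (Matrix (Fin m) (Fin m) D) × FreeAlgebra ℂ (Matrix (Fin m) (Fin m) D),
      ∃ P : ℂ × SchwartzFD (Matrix (Fin m) (Fin m) D) → SchwartzFD (Matrix (Fin m) (Fin m) D),
        Continuous P ∧ ∀ z φ, (leftAct (Matrix (Fin m) (Fin m) D) i.1 *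
          rightAct (Matrix (Fin m) (Fin m) D) i.2) (normTwist z φ) = normTwist z (P (z, φ)) := by
    rintro ⟨A, B⟩
    obtain ⟨P, hP, hPA⟩ := exists_lift_leftAct A
    obtain ⟨Q, hQ, hQB⟩ := exists_lift_rightAct B
    refine ⟨fun p => P (p.1, Q p), hP.comp (continuous_fst.prodMk hQ), fun z φ => ?_⟩
    rw [Module.End.mul_apply, hQB, hPA]
  choose P hPc hP using hop
  set T := fun i : (FreeAlgebra ℂ (Matrix (Fin m) (Fin m) D) ×
      FreeAlgebra ℂ (Matrix (Fin m) (Fin m) D)) × ℝ≥0 =>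
    (weightMul (hcWeight (normArch D m) (xiArch F D m d μ) i.2)).comp
      ((smoothUnits (Matrix (Fin m) (Fin m) D)).subtype.comp
        (leftAct _ i.1.1 * rightAct _ i.1.2)) with hT
  have hwt : ∀ i (φ : SchwartzFD (Matrix (Fin m) (Fin m) D)) (s : ℂ)
      (g : (Matrix (Fin m) (Fin m) D)ˣ), T i (normTwist (z s) φ) g =
      (hcWeight (normArch D m) (xiArch F D m d μ) i.2 g : ℂ) *
        SchwartzFD.eval (P i.1 (z s, φ)) g.1 * (w g.1 : ℂ) ^ (s + (((m * d : ℕ) : ℂ) - 1) / 2) := by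
    intro i φ s g
    have h1 : T i (normTwist (z s) φ) = weightMul (hcWeight (normArch D m) (xiArch F D m d μ) i.2)
        ((leftAct (Matrix (Fin m) (Fin m) D) i.1.1 *
          rightAct (Matrix (Fin m) (Fin m) D) i.1.2) (normTwist (z s) φ)).1 := rfl
    rw [h1, hP, mul_assoc, ← hcpow]
    rfl
  have hmem : ∀ (φ : SchwartzFD (Matrix (Fin m) (Fin m) D)) (s : {s : ℂ | (1 - d : ℝ) / 2 < s.re}),
      normTwist (z s) φ ∈ boundedSub T := by
    intro φ s i
    have hpos := hexp s s.2
    obtain ⟨q, -, -, hq⟩ := hbound i.2 hpos le_rfl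
    refine ⟨q (P i.1 (z s, φ)), ?_⟩
    rintro _ ⟨g, rfl⟩
    change ‖T i (normTwist (z s) φ) g‖ ≤ _
    rw [hwt, norm_mul, norm_mul, Complex.norm_real, Real.norm_eq_abs]
    refine mul_norm_cpow_le (by positivity) (hwpos g) (hq _ g) ?_
    rw [re_twist_exponent]
    exact ⟨le_rfl, le_rfl⟩
  refine isContinuousInclusion_of_lift (fun a b hab => Subtype.ext (Subtype.ext hab))
    (fun p => (⟨normTwist (z p.1) p.2, hmem p.2 p.1⟩ : BoundedSpace T)) ?_ (fun p => ?_)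
  swap
  · funext g
    change SchwartzFD.eval p.2 g.1 * ((|Algebra.norm ℝ g.1| : ℝ) : ℂ) ^ z p.1 = _
    rw [hcpow]
    rfl
  refine BoundedSpace.continuous_of_tendsto (T := T)
    (Φ := fun p : {s : ℂ | (1 - d : ℝ) / 2 < s.re} × SchwartzFD (Matrix (Fin m) (Fin m) D) =>
      (⟨normTwist (z p.1) p.2, hmem p.2 p.1⟩ : BoundedSpace T)) fun i p₀ => ?_
  set ε₀ : ℝ := p₀.1.1.re + ((d : ℝ) - 1) / 2 with hε₀
  have hε₀pos : 0 < ε₀ := hexp p₀.1 p₀.1.2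
  obtain ⟨q, hqc, hq0, hq⟩ := hbound i.2 (half_pos hε₀pos) (by linarith : ε₀ / 2 ≤ 2 * ε₀)
  have hs : Continuous fun p : {s : ℂ | (1 - d : ℝ) / 2 < s.re} ×
      SchwartzFD (Matrix (Fin m) (Fin m) D) => p.1.1 := continuous_subtype_val.comp continuous_fst
  have hψ : Continuous fun p : {s : ℂ | (1 - d : ℝ) / 2 < s.re} ×
      SchwartzFD (Matrix (Fin m) (Fin m) D) => P i.1 (z p.1, p.2) :=
    (hPc i.1).comp ((hzc.comp hs).prodMk continuous_snd)
  have hre : ∀ᶠ p : {s : ℂ | (1 - d : ℝ) / 2 < s.re} × SchwartzFD (Matrix (Fin m) (Fin m) D) in 𝓝 p₀,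
      p.1.1.re + ((d : ℝ) - 1) / 2 ∈ Set.Icc (ε₀ / 2) (2 * ε₀) :=
    ((Complex.continuous_re.comp hs).add continuous_const).continuousAt.eventually
      (Icc_mem_nhds (by change _ < ε₀; linarith) (by change ε₀ < _; linarith))
  have hlim : Tendsto (fun p : {s : ℂ | (1 - d : ℝ) / 2 < s.re} ×
      SchwartzFD (Matrix (Fin m) (Fin m) D) =>
        q (P i.1 (z p.1, p.2) - P i.1 (z p₀.1, p₀.2)) +
          2 * q (P i.1 (z p₀.1, p₀.2)) * ‖p.1.1 - p₀.1.1‖) (𝓝 p₀) (𝓝 0) := by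
    have hc := (hqc.comp (hψ.sub continuous_const)).add
      (continuous_const.mul (hs.sub continuous_const).norm) |>.tendsto p₀
        (f := fun p : {s : ℂ | (1 - d : ℝ) / 2 < s.re} × SchwartzFD (Matrix (Fin m) (Fin m) D) =>
        q (P i.1 (z p.1, p.2) - P i.1 (z p₀.1, p₀.2)) +
          2 * q (P i.1 (z p₀.1, p₀.2)) * ‖p.1.1 - p₀.1.1‖)
    simpa [hq0] using hc
  refine tendsto_of_tendsto_of_tendsto_of_le_of_le' tendsto_const_nhds hlim
    (Eventually.of_forall fun p => Real.iSup_nonneg fun g => norm_nonneg _) ?_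
  filter_upwards [hre] with p hp
  have hqnn : ∀ ψ, 0 ≤ q ψ := fun ψ => by
    have h := hq ψ 1 (ε₀ / 2) ⟨le_rfl, by linarith⟩
    have := hwpos 1
    exact le_trans (by positivity) h
  refine Real.iSup_le (fun g => ?_) (add_nonneg (hqnn _)
    (mul_nonneg (mul_nonneg zero_le_two (hqnn _)) (norm_nonneg _)))
  change ‖T i (normTwist (z p.1) p.2) g - T i (normTwist (z p₀.1) p₀.2) g‖ ≤ _
  rw [hwt, hwt]
  set ψ := P i.1 (z p.1, p.2)
  set ψ₀ := P i.1 (z p₀.1, p₀.2)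
  set W : ℂ := (hcWeight (normArch D m) (xiArch F D m d μ) i.2 g : ℂ)
  have hsub : SchwartzFD.eval (ψ - ψ₀) g.1 = SchwartzFD.eval ψ g.1 - SchwartzFD.eval ψ₀ g.1 := rfl
  have hWn : ‖W‖ = |hcWeight (normArch D m) (xiArch F D m d μ) i.2 g| := Complex.norm_real _
  have hsplit : W * SchwartzFD.eval ψ g.1 * (w g.1 : ℂ) ^ (p.1.1 + (((m * d : ℕ) : ℂ) - 1) / 2) -
      W * SchwartzFD.eval ψ₀ g.1 * (w g.1 : ℂ) ^ (p₀.1.1 + (((m * d : ℕ) : ℂ) - 1) / 2) =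
      W * SchwartzFD.eval (ψ - ψ₀) g.1 * (w g.1 : ℂ) ^ (p.1.1 + (((m * d : ℕ) : ℂ) - 1) / 2) +
      W * SchwartzFD.eval ψ₀ g.1 * ((w g.1 : ℂ) ^ (p.1.1 + (((m * d : ℕ) : ℂ) - 1) / 2) -
        (w g.1 : ℂ) ^ (p₀.1.1 + (((m * d : ℕ) : ℂ) - 1) / 2)) := by
    rw [hsub]
    ring
  rw [hsplit]
  refine (norm_add_le _ _).trans (add_le_add ?_ ?_)
  · rw [norm_mul, norm_mul, hWn]
    refine mul_norm_cpow_le (by positivity) (hwpos g) (hq _ g) ?_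
    rw [re_twist_exponent]
    exact hp
  · rw [norm_mul, norm_mul, hWn]
    refine (mul_norm_cpow_sub_le (by positivity) (hwpos g) (hq _ g) ?_ ?_).trans_eq ?_
    · rw [re_twist_exponent]
      exact hp
    · rw [re_twist_exponent]
      constructor <;> linarith
    · rw [add_sub_add_right_eq_sub]

end

/-! ### Haar measure on vector spaces over non-archimedean local fields -/

section

open Module Filter Topology MeasureTheory
open scoped Pointwise ENNReal

/-- `ρ` is the reduction map of the ring `O` of integers of a normed field, onto a residue field with `q`
elements, and the absolute value is normalized: its values are the powers of `q`. -/
structure IsResidueMap {k κ : Type*} [NormedField k] [Field κ] [Fintype κ] {O : Subring k}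
    (ρ : O →+* κ) : Prop where
  mem_iff : ∀ x, x ∈ O ↔ ‖x‖ ≤ 1
  surjective : Function.Surjective ρ
  map_eq_zero_iff : ∀ x : O, ρ x = 0 ↔ ‖(x : k)‖ < 1
  exists_norm_eq : ∃ π : k, ‖π‖ = (Fintype.card κ : ℝ)⁻¹
  norm_eq_zpow : ∀ x : k, x ≠ 0 → ∃ j : ℤ, ‖x‖ = (Fintype.card κ : ℝ) ^ j

section LocalMeasure

variable {k κ : Type*} [NormedField k] [Field κ] [Fintype κ] {O : Subring k} {ρ : O →+* κ}
  (h : IsResidueMap ρ)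

variable (κ) in
theorem one_lt_card_field : (1 : ℝ) < Fintype.card κ := by
  exact_mod_cast Fintype.one_lt_card

include h in
theorem IsResidueMap.norm_le_inv_card {x : k} (hx : ‖x‖ < 1) : ‖x‖ ≤ (Fintype.card κ : ℝ)⁻¹ := by
  have hq := one_lt_card_field κ
  by_cases hx0 : x = 0
  · rw [hx0, norm_zero]
    positivity
  · obtain ⟨j, hj⟩ := h.norm_eq_zpow x hx0
    rw [hj] at hx ⊢
    have : j < 0 := by
      by_contra! hj0
      exact absurd hx (not_lt.2 (one_le_zpow₀ hq.le hj0))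
    rw [← zpow_neg_one]
    exact zpow_le_zpow_right₀ hq.le (by omega)

include h in
theorem IsResidueMap.isOpen : IsOpen (O : Set k) := by
  refine Metric.isOpen_iff.2 fun x hx => ⟨1, one_pos, fun y hy => ?_⟩
  rw [Metric.mem_ball, dist_eq_norm] at hy
  have h1 : y - x ∈ O := (h.mem_iff _).2 hy.le
  have h2 := O.add_mem h1 hx
  rwa [sub_add_cancel] at h2

/-- The fibre of the reduction map. -/
def residueFibre (ρ : O →+* κ) (c : κ) : Set k := {x | ∃ hx : x ∈ O, ρ ⟨x, hx⟩ = c}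

omit [Fintype κ] in
theorem iUnion_residueFibre (ρ : O →+* κ) : ⋃ c, residueFibre ρ c = (O : Set k) := by
  ext x
  simp only [Set.mem_iUnion, residueFibre, Set.mem_ofPred_eq]
  exact ⟨fun ⟨_, hx, _⟩ => hx, fun hx => ⟨_, hx, rfl⟩⟩

omit [Fintype κ] in
theorem pairwise_disjoint_residueFibre (ρ : O →+* κ) :
    Pairwise (Function.onFun Disjoint (residueFibre ρ)) := by
  intro c c' hcc
  refine Set.disjoint_left.2 ?_
  rintro x ⟨hx, h1⟩ ⟨hx', h2⟩
  exact hcc (h1.symm.trans h2)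

include h in
theorem IsResidueMap.isOpen_residueFibre (c : κ) : IsOpen (residueFibre ρ c) := by
  refine Metric.isOpen_iff.2 fun x hx => ⟨1, one_pos, fun y hy => ?_⟩
  obtain ⟨hx, hxc⟩ := hx
  rw [Metric.mem_ball, dist_eq_norm] at hy
  have h1 : y - x ∈ O := (h.mem_iff _).2 hy.le
  have h2 : y ∈ O := by
    have := O.add_mem h1 hx
    rwa [sub_add_cancel] at this
  refine ⟨h2, ?_⟩
  have h3 : ρ (⟨y, h2⟩ - ⟨x, hx⟩) = 0 := (h.map_eq_zero_iff _).2 hy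
  rw [map_sub, sub_eq_zero] at h3
  rw [h3, hxc]

variable [MeasurableSpace k] [BorelSpace k] (α : Measure k) [α.IsAddHaarMeasure]

include h in
theorem IsResidueMap.measure_residueFibre (c : κ) :
    α (residueFibre ρ c) = (Fintype.card κ : ℝ≥0∞)⁻¹ * α O := by
  -- the fibres are translates of each other
  have htr : ∀ c, α (residueFibre ρ c) = α (residueFibre ρ 0) := fun c => by
    obtain ⟨σ, hσ⟩ := h.surjective c
    have h1 : residueFibre ρ 0 = (fun x => (σ : k) + x) ⁻¹' residueFibre ρ c := by
      ext x
      constructor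
      · rintro ⟨hx, h0⟩
        refine ⟨O.add_mem σ.2 hx, ?_⟩
        have : (⟨σ + x, O.add_mem σ.2 hx⟩ : O) = σ + ⟨x, hx⟩ := rfl
        rw [this, map_add, h0, add_zero, hσ]
      · rintro ⟨hx, h0⟩
        have hx' : x ∈ O := by
          have := O.sub_mem hx σ.2
          rwa [add_sub_cancel_left] at this
        refine ⟨hx', ?_⟩
        have : (⟨σ + x, hx⟩ : O) = σ + ⟨x, hx'⟩ := rfl
        rw [this, map_add, hσ] at h0
        simpa using h0
    rw [h1, measure_preimage_add]
  have h1 : α O = Fintype.card κ * α (residueFibre ρ 0) := by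
    rw [← iUnion_residueFibre ρ, measure_iUnion (pairwise_disjoint_residueFibre ρ)
      fun c => (h.isOpen_residueFibre c).measurableSet, tsum_fintype, Finset.sum_congr rfl
        fun c _ => htr c, Finset.sum_const, nsmul_eq_mul, Finset.card_univ]
  rw [htr, h1, ← mul_assoc, ENNReal.inv_mul_cancel, one_mul]
  · exact_mod_cast Fintype.card_ne_zero
  · exact ENNReal.natCast_ne_top _

variable [ProperSpace k]

omit [BorelSpace k] in
include h in
theorem IsResidueMap.measure_ne_top : α O ≠ ⊤ := by
  have h1 : (O : Set k) = Metric.closedBall 0 1 := by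
    ext x
    rw [mem_closedBall_zero_iff]
    exact h.mem_iff x
  rw [h1]
  exact (isCompact_closedBall 0 1).measure_lt_top.ne

include h in
/-- The module of multiplication by `a` is the normalized absolute value of `a`. -/
theorem IsResidueMap.measure_image_mul {a : k} (ha : a ≠ 0) :
    α ((fun x => a * x) '' O) = ENNReal.ofReal ‖a‖ * α O := by
  have hq := one_lt_card_field κ
  have hq0 : (0 : ℝ) < Fintype.card κ := by linarith
  have hO := h.measure_ne_top α
  have hO0 : α O ≠ 0 := (h.isOpen.measure_pos α ⟨0, O.zero_mem⟩).ne'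
  -- the module `χ` is a character; it is trivial on units, and its value at a uniformizer `π` is
  -- `1/q` because `π O` is the zero fibre of the reduction
  let χ := distribHaarChar k (G := kˣ)
  have hχ : ∀ (u : kˣ) (s : Set k), α ((fun x => (u : k) * x) '' s) = χ u * α s := fun u s =>
    (distribHaarChar_mul α u s).symm
  have key : ∀ (u : kˣ) (r : ℝ≥0), α ((fun x => (u : k) * x) '' O) = r * α O → χ u = r := by
    intro u r hu
    rw [hχ] at hu
    exact ENNReal.coe_injective ((ENNReal.mul_left_inj hO0 hO).1 hu)
  have hunit : ∀ u : kˣ, ‖(u : k)‖ = 1 → χ u = 1 := by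
    intro u hu
    refine key u 1 ?_
    rw [ENNReal.coe_one, one_mul]
    congr 1
    ext x
    constructor
    · rintro ⟨y, hy, rfl⟩
      refine (h.mem_iff _).2 ?_
      rw [norm_mul, hu, one_mul]
      exact (h.mem_iff _).1 hy
    · intro hx
      refine ⟨(u : k)⁻¹ * x, (h.mem_iff _).2 ?_, mul_inv_cancel_left₀ u.ne_zero x⟩
      rw [norm_mul, norm_inv, hu, inv_one, one_mul]
      exact (h.mem_iff _).1 hx
  obtain ⟨π, hπ⟩ := h.exists_norm_eq
  have hπ0 : π ≠ 0 := norm_pos_iff.1 (by rw [hπ]; positivity)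
  have hχπ : χ (Units.mk0 π hπ0) = (Fintype.card κ : ℝ≥0)⁻¹ := by
    refine key _ _ ?_
    have h1 : (fun x => ((Units.mk0 π hπ0 : kˣ) : k) * x) '' O = residueFibre ρ 0 := by
      ext x
      constructor
      · rintro ⟨y, hy, rfl⟩
        have h2 : ‖π * y‖ < 1 := by
          rw [norm_mul, hπ]
          exact (mul_le_of_le_one_right (by positivity) ((h.mem_iff _).1 hy)).trans_lt
            (inv_lt_one_of_one_lt₀ hq)
        exact ⟨(h.mem_iff _).2 h2.le, (h.map_eq_zero_iff _).2 h2⟩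
      · rintro ⟨hx, hx0⟩
        have h2 := h.norm_le_inv_card ((h.map_eq_zero_iff _).1 hx0)
        refine ⟨π⁻¹ * x, (h.mem_iff _).2 ?_, mul_inv_cancel_left₀ hπ0 x⟩
        rw [norm_mul, norm_inv, hπ, inv_inv]
        exact (mul_le_mul_of_nonneg_left h2 hq0.le).trans_eq (mul_inv_cancel₀ hq0.ne')
    rw [h1, h.measure_residueFibre, ENNReal.coe_inv (by exact_mod_cast Fintype.card_ne_zero),
      ENNReal.coe_natCast]
  obtain ⟨j, hj⟩ := h.norm_eq_zpow a ha
  have h1 : χ (Units.mk0 a ha * Units.mk0 π hπ0 ^ j) = 1 := by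
    refine hunit _ ?_
    rw [Units.val_mul, Units.val_zpow_eq_zpow_val, norm_mul, norm_zpow]
    change ‖a‖ * ‖π‖ ^ j = 1
    rw [hj, hπ, inv_zpow, mul_inv_cancel₀ (zpow_ne_zero _ hq0.ne')]
  have h2 : χ (Units.mk0 a ha) = (Fintype.card κ : ℝ≥0) ^ j := by
    rw [map_mul, map_zpow, hχπ, inv_zpow] at h1
    exact (eq_inv_of_mul_eq_one_left h1).trans (inv_inv _)
  have h3 := hχ (Units.mk0 a ha) O
  rw [h2] at h3
  refine h3.trans ?_
  congr 1
  rw [hj, ENNReal.ofReal, ENNReal.coe_inj]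
  ext
  rw [Real.coe_toNNReal _ (by positivity)]
  push_cast
  rfl

variable {ι : Type*} [Fintype ι] [DecidableEq ι]

omit [DecidableEq ι] in
/-- Linear automorphisms multiply a Haar measure by a constant. -/
theorem exists_measure_image_linearEquiv (μ : Measure (ι → k)) [μ.IsAddHaarMeasure]
    (e : (ι → k) ≃ₗ[k] (ι → k)) : ∃ c : ℝ≥0, ∀ S, μ (e '' S) = c * μ S := by
  have : ContinuousConstSMul ((ι → k) ≃ₗ[k] (ι → k)) (ι → k) :=
    ⟨fun e => LinearMap.continuous_on_pi e.toLinearMap⟩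
  exact ⟨distribHaarChar (ι → k) e, fun S => (distribHaarChar_mul μ e S).symm⟩

omit [MeasurableSpace k] [BorelSpace k] [ProperSpace k] in
theorem mulVec_image_eq {M : Matrix ι ι k} (hM : M.det ≠ 0) :
    ∃ e : (ι → k) ≃ₗ[k] (ι → k), ∀ x, e x = M.mulVec x := by
  have hu : IsUnit M.det := isUnit_iff_ne_zero.2 hM
  refine ⟨LinearEquiv.ofLinearMap (Matrix.toLin' M) (Matrix.toLin' M⁻¹) ?_ ?_, fun x => rfl⟩
  · rw [← Matrix.toLin'_mul, Matrix.mul_nonsing_inv M hu, Matrix.toLin'_one]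
  · rw [← Matrix.toLin'_mul, Matrix.nonsing_inv_mul M hu, Matrix.toLin'_one]

/-- The factor by which a matrix changes the measure can be computed on one set of finite positive
measure. -/
theorem measure_image_mulVec_of_eq (μ : Measure (ι → k)) [μ.IsAddHaarMeasure] {M : Matrix ι ι k}
    (hM : M.det ≠ 0) {S₀ : Set (ι → k)} (h0 : μ S₀ ≠ 0) (h1 : μ S₀ ≠ ⊤) {r : ℝ≥0∞}
    (hr : μ (M.mulVec '' S₀) = r * μ S₀) (S : Set (ι → k)) : μ (M.mulVec '' S) = r * μ S := by
  obtain ⟨e, he⟩ := mulVec_image_eq hM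
  obtain ⟨c, hc⟩ := exists_measure_image_linearEquiv μ e
  have h2 : (e : (ι → k) → ι → k) = M.mulVec := funext he
  rw [h2] at hc
  rw [hc] at hr
  rw [hc, (ENNReal.mul_left_inj h0 h1).1 hr]

include h in
/-- The module of an invertible matrix is the absolute value of its determinant: this holds for
diagonal matrices and for transvections, which preserve some box. -/
theorem IsResidueMap.measure_image_mulVec {M : Matrix ι ι k} (hM : M.det ≠ 0) (S : Set (ι → k)) :
    Measure.pi (fun _ : ι => α) (M.mulVec '' S) =
      ENNReal.ofReal ‖M.det‖ * Measure.pi (fun _ : ι => α) S := by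
  have hO := h.measure_ne_top α
  have hO0 : α O ≠ 0 := (h.isOpen.measure_pos α ⟨0, O.zero_mem⟩).ne'
  set μ := Measure.pi (fun _ : ι => α) with hμ
  have hbox : ∀ a : ι → k, (∀ i, a i ≠ 0) → μ (Set.univ.pi fun i => (fun x => a i * x) '' O) =
      (∏ i, ENNReal.ofReal ‖a i‖) * ∏ _i : ι, α O := fun a ha => by
    rw [hμ, Measure.pi_pi, ← Finset.prod_mul_distrib]
    exact Finset.prod_congr rfl fun i _ => h.measure_image_mul α (ha i)
  have hprod0 : ∀ a : ι → k, (∀ i, a i ≠ 0) →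
      (∏ i, ENNReal.ofReal ‖a i‖) * ∏ _i : ι, α O ≠ 0 := fun a ha =>
    mul_ne_zero (Finset.prod_ne_zero_iff.2 fun i _ => by
      rw [Ne, ENNReal.ofReal_eq_zero, not_le]
      exact norm_pos_iff.2 (ha i)) (Finset.prod_ne_zero_iff.2 fun i _ => hO0)
  have hprodt : ∀ a : ι → k, (∏ i, ENNReal.ofReal ‖a i‖) * ∏ _i : ι, α O ≠ ⊤ := fun a =>
    ENNReal.mul_ne_top (ENNReal.prod_ne_top fun i _ => ENNReal.ofReal_ne_top)
      (ENNReal.prod_ne_top fun i _ => hO)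
  revert S
  refine Matrix.diagonal_transvection_induction_of_det_ne_zero
    (fun M => ∀ S, μ (M.mulVec '' S) = ENNReal.ofReal ‖M.det‖ * μ S) M hM ?_ ?_ ?_
  · intro a ha S
    have ha' : ∀ i, a i ≠ 0 := by
      rw [Matrix.det_diagonal, Finset.prod_ne_zero_iff] at ha
      exact fun i => ha i (Finset.mem_univ i)
    have h1 := hbox 1 fun i => one_ne_zero
    refine measure_image_mulVec_of_eq μ ha (h1 ▸ hprod0 1 fun i => one_ne_zero) (h1 ▸ hprodt 1) ?_ S
    have h2 : (Matrix.diagonal a).mulVec '' (Set.univ.pi fun i => (fun x => (1 : ι → k) i * x) '' O) =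
        Set.univ.pi fun i => (fun x => a i * x) '' O := by
      ext x
      simp only [Pi.one_apply, one_mul, Set.image_id', Set.mem_image, Set.mem_univ_pi]
      constructor
      · rintro ⟨y, hy, rfl⟩ i
        exact ⟨y i, hy i, (Matrix.mulVec_diagonal a y i).symm⟩
      · intro hx
        choose y hy hxy using hx
        exact ⟨y, hy, funext fun i => (Matrix.mulVec_diagonal a y i).trans (hxy i)⟩
    rw [h2, hbox a ha', h1, Matrix.det_diagonal, norm_prod,
      ENNReal.ofReal_prod_of_nonneg fun i _ => norm_nonneg _]
    simp
  · rintro ⟨i, j, hij, c⟩ S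
    change μ ((Matrix.transvection i j c).mulVec '' S) =
      ENNReal.ofReal ‖(Matrix.transvection i j c).det‖ * μ S
    have hdet : (Matrix.transvection i j c).det = 1 := Matrix.det_transvection_of_ne i j hij c
    rw [hdet, norm_one, ENNReal.ofReal_one]
    -- a box which is so thin in the direction `j` that the transvection preserves it
    obtain ⟨e, he0, he⟩ : ∃ e : k, e ≠ 0 ∧ ‖c * e‖ ≤ 1 := by
      by_cases hc : c = 0
      · exact ⟨1, one_ne_zero, by simp [hc]⟩
      · exact ⟨c⁻¹, inv_ne_zero hc, by rw [mul_inv_cancel₀ hc, norm_one]⟩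
    set a : ι → k := Function.update 1 j e with ha
    have ha0 : ∀ l, a l ≠ 0 := fun l => by
      by_cases hl : l = j
      · subst hl
        rwa [ha, Function.update_self]
      · rw [ha, Function.update_of_ne hl]
        exact one_ne_zero
    have h1 := hbox a ha0
    refine measure_image_mulVec_of_eq μ (by rw [hdet]; exact one_ne_zero) (h1 ▸ hprod0 a ha0)
      (h1 ▸ hprodt a) ?_ S
    rw [one_mul]
    have happly : ∀ (c : k) (x : ι → k) l, (Matrix.transvection i j c).mulVec x l =
        x l + if l = i then c * x j else 0 := fun c x l => by
      rw [Matrix.transvection, Matrix.add_mulVec, Matrix.one_mulVec, Pi.add_apply]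
      congr 1
      rw [Matrix.single_mulVec]
      by_cases hl : l = i
      · subst hl
        simp
      · simp [hl]
    have hsub : ∀ c' : k, ‖c' * e‖ ≤ 1 → ∀ x ∈ Set.univ.pi fun i => (fun x => a i * x) '' (O : Set k),
        (Matrix.transvection i j c').mulVec x ∈ Set.univ.pi fun i => (fun x => a i * x) '' (O : Set k) := by
      intro c' hc' x hx l _
      rw [happly]
      by_cases hl : l = i
      · subst hl
        have hal : a l = 1 := by rw [ha, Function.update_of_ne hij, Pi.one_apply]
        obtain ⟨y, hy, hxy⟩ := hx l (Set.mem_univ l)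
        obtain ⟨y', hy', hxy'⟩ := hx j (Set.mem_univ j)
        have haj : a j = e := by rw [ha, Function.update_self]
        rw [if_pos rfl]
        refine ⟨y + c' * e * y', O.add_mem hy (O.mul_mem ((h.mem_iff _).2 hc') hy'), ?_⟩
        change a l * (y + c' * e * y') = _
        rw [← hxy, ← hxy']
        simp only [hal, haj]
        ring
      · rw [if_neg hl, add_zero]
        exact hx l (Set.mem_univ l)
    congr 1
    refine Set.Subset.antisymm ?_ fun x hx => ⟨(Matrix.transvection i j (-c)).mulVec x,
      hsub (-c) (by rwa [neg_mul, norm_neg]) x hx, ?_⟩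
    · rintro _ ⟨x, hx, rfl⟩
      exact hsub c he x hx
    · rw [Matrix.mulVec_mulVec, Matrix.transvection_mul_transvection_same i j hij, add_neg_cancel,
        Matrix.transvection_zero, Matrix.one_mulVec]
  · intro A B hA hB hPA hPB S
    have h1 : (A * B).mulVec '' S = A.mulVec '' (B.mulVec '' S) := by
      rw [Set.image_image]
      exact Set.image_congr fun x _ => (Matrix.mulVec_mulVec x A B).symm
    rw [h1, hPA, hPB, ← mul_assoc, Matrix.det_mul, norm_mul,
      ENNReal.ofReal_mul (norm_nonneg _)]

end LocalMeasure

end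

/-! ### Lattices and their unit groups -/

section

open Module Filter Topology MeasureTheory
open scoped Pointwise ENNReal

section Lattice

variable {R B : Type*} [CommRing R] [Ring B] [Algebra R B] {r : ℕ} (O : Subring R)
  (b : Basis (Fin r) R B) (hb : ∀ i j l, Algebra.leftMulMatrix b (b i) j l ∈ O)
  (h1 : ∀ i, b.repr 1 i ∈ O)

theorem mulVec_mem_subring {M : Matrix (Fin r) (Fin r) R} (hM : ∀ i j, M i j ∈ O) {v : Fin r → R}
    (hv : ∀ i, v i ∈ O) (i : Fin r) : M.mulVec v i ∈ O := by
  rw [Matrix.mulVec, dotProduct]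
  exact O.sum_mem fun j _ => O.mul_mem (hM i j) (hv j)

theorem leftMulMatrix_eq_sum (x : B) :
    Algebra.leftMulMatrix b x = ∑ i, b.repr x i • Algebra.leftMulMatrix b (b i) := by
  conv_lhs => rw [← b.sum_repr x]
  simp only [map_sum, map_smul]

include hb in
/-- In a basis with structure constants in `O`, integral elements act by integral matrices. -/
theorem leftMulMatrix_mem {x : B} (hx : ∀ i, b.repr x i ∈ O) (j l : Fin r) :
    Algebra.leftMulMatrix b x j l ∈ O := by
  rw [leftMulMatrix_eq_sum, Matrix.sum_apply]
  exact O.sum_mem fun i _ => O.mul_mem (hx i) (hb i j l)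

/-- The order spanned over `O` by a basis with structure constants in `O`. -/
def basisOrder : Subring B where
  carrier := {x | ∀ i, b.repr x i ∈ O}
  zero_mem' := fun i => by
    rw [map_zero]
    exact O.zero_mem
  one_mem' := h1
  add_mem' := fun hx hy i => by
    rw [map_add]
    exact O.add_mem (hx i) (hy i)
  neg_mem' := fun hx i => by
    rw [map_neg]
    exact O.neg_mem (hx i)
  mul_mem' := fun {x y} hx hy i => by
    rw [← Algebra.leftMulMatrix_mulVec_repr b x y]
    exact mulVec_mem_subring O (leftMulMatrix_mem O b hb hx) hy i

/-- The matrix of left multiplication by an element of the order. -/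
def integralMatrix (x : B) (hx : ∀ i, b.repr x i ∈ O) : Matrix (Fin r) (Fin r) O :=
  Matrix.of fun j l => ⟨Algebra.leftMulMatrix b x j l, leftMulMatrix_mem O b hb hx j l⟩

theorem coe_det_integralMatrix (x : B) (hx : ∀ i, b.repr x i ∈ O) :
    ((integralMatrix O b hb x hx).det : R) = Algebra.norm R x := by
  rw [Algebra.norm_eq_matrix_det b]
  exact O.subtype.map_det _

include hb in
theorem norm_mem_of_mem {x : B} (hx : ∀ i, b.repr x i ∈ O) : Algebra.norm R x ∈ O := by
  rw [← coe_det_integralMatrix O b hb x hx]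
  exact Subtype.prop _

include hb h1 in
/-- The adjugate of an integral matrix is integral. -/
theorem normAdj_mem_of_mem {x : B} (hx : ∀ i, b.repr x i ∈ O) (i : Fin r) :
    b.repr (normAdj b x) i ∈ O := by
  have h2 : (b.repr (normAdj b x) : Fin r → R) =
      (Algebra.leftMulMatrix b x).adjugate.mulVec (b.equivFun 1) := by
    change b.equivFun _ = _
    rw [normAdj, LinearEquiv.apply_symm_apply]
  rw [h2]
  have h3 : (Algebra.leftMulMatrix b x).adjugate =
      (integralMatrix O b hb x hx).adjugate.map O.subtype :=
    (O.subtype.map_adjugate (integralMatrix O b hb x hx)).symm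
  rw [h3]
  exact mulVec_mem_subring O (fun _ _ => Subtype.prop _) h1 i

include hb h1 in
/-- A unit of `B` in the order is a unit of the order if its norm is a unit. -/
theorem inv_mem_of_norm {g : Bˣ} (hg : ∀ i, b.repr (g : B) i ∈ O) {u : R} (hu : u ∈ O)
    (hgu : u * Algebra.norm R (g : B) = 1) (i : Fin r) : b.repr ((g⁻¹ : Bˣ) : B) i ∈ O := by
  have h2 : ((g⁻¹ : Bˣ) : B) = u • normAdj b (g : B) := by
    rw [← norm_smul_inv, smul_smul, hgu, one_smul]
  rw [h2, map_smul]
  exact O.mul_mem hu (normAdj_mem_of_mem O b hb h1 hg i)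

/-- The units of the order. -/
def orderUnits : Subgroup Bˣ := (basisOrder O b hb h1).toSubmonoid.units

theorem mem_orderUnits {g : Bˣ} : g ∈ orderUnits O b hb h1 ↔
    (∀ i, b.repr (g : B) i ∈ O) ∧ ∀ i, b.repr ((g⁻¹ : Bˣ) : B) i ∈ O := Iff.rfl

end Lattice

/-! ### Sums over the integral classes modulo the units of an order -/

section LocalSum

variable {k κ : Type*} [NormedField k] [Field κ] [Fintype κ] {O : Subring k} {ρ : O →+* κ}
  (h : IsResidueMap ρ) {B : Type*} [Ring B] [Algebra k B] {r : ℕ}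
  (b : Basis (Fin r) k B) (hb : ∀ i j l, Algebra.leftMulMatrix b (b i) j l ∈ O)
  (h1 : ∀ i, b.repr 1 i ∈ O)

include h in
theorem norm_eq_one_of_mem_orderUnits {g : Bˣ} (hg : g ∈ orderUnits O b hb h1) :
    ‖Algebra.norm k (g : B)‖ = 1 := by
  have h2 : ‖Algebra.norm k (g : B)‖ ≤ 1 := (h.mem_iff _).1 (norm_mem_of_mem O b hb hg.1)
  have h3 : ‖Algebra.norm k ((g⁻¹ : Bˣ) : B)‖ ≤ 1 :=
    (h.mem_iff _).1 (norm_mem_of_mem O b hb hg.2)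
  have h4 : ‖Algebra.norm k (g : B)‖ * ‖Algebra.norm k ((g⁻¹ : Bˣ) : B)‖ = 1 := by
    rw [← norm_mul, ← map_mul, Units.mul_inv, map_one, norm_one]
  nlinarith [norm_nonneg (Algebra.norm k (g : B)), norm_nonneg (Algebra.norm k ((g⁻¹ : Bˣ) : B))]

include h in
/-- An integral element is a unit of the order exactly if its norm has absolute value one. -/
theorem mem_orderUnits_iff {g : Bˣ} : g ∈ orderUnits O b hb h1 ↔
    (∀ i, b.repr (g : B) i ∈ O) ∧ ‖Algebra.norm k (g : B)‖ = 1 := by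
  refine ⟨fun hg => ⟨hg.1, norm_eq_one_of_mem_orderUnits h b hb h1 hg⟩, fun hg => ⟨hg.1, ?_⟩⟩
  have h0 : Algebra.norm k (g : B) ≠ 0 := norm_ne_zero_iff.1 (by rw [hg.2]; exact one_ne_zero)
  refine inv_mem_of_norm O b hb h1 hg.1 (u := (Algebra.norm k (g : B))⁻¹) ?_ (inv_mul_cancel₀ h0)
  rw [h.mem_iff, norm_inv, hg.2, inv_one]

/-- The units of the order, in coordinates. -/
def unitCoords (O : Subring k) (b : Basis (Fin r) k B) : Set (Fin r → k) :=
  {x | (∀ i, x i ∈ O) ∧ ‖Algebra.norm k (b.equivFun.symm x)‖ = 1}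

/-- The coordinates of the nonunits of the order. -/
def nonunitCoords (O : Subring k) (b : Basis (Fin r) k B) : Set (Fin r → k) :=
  {x | (∀ i, x i ∈ O) ∧ ‖Algebra.norm k (b.equivFun.symm x)‖ < 1}

theorem continuous_norm_equivFun_symm :
    Continuous fun x : Fin r → k => Algebra.norm k (b.equivFun.symm x) := by
  simp only [Algebra.norm_eq_matrix_det b]
  refine Continuous.matrix_det ?_
  have : (fun x : Fin r → k => Algebra.leftMulMatrix b (b.equivFun.symm x)) =
      fun x => ∑ i, x i • Algebra.leftMulMatrix b (b i) := by
    funext x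
    rw [leftMulMatrix_eq_sum]
    refine Finset.sum_congr rfl fun i _ => ?_
    congr 1
    exact congrFun (b.equivFun.apply_symm_apply x) i
  rw [this]
  exact continuous_finsetSum _ fun i _ => (continuous_apply i).smul continuous_const

include h hb in
theorem norm_le_one_of_coords {x : Fin r → k} (hx : ∀ i, x i ∈ O) :
    ‖Algebra.norm k (b.equivFun.symm x)‖ ≤ 1 := by
  refine (h.mem_iff _).1 (norm_mem_of_mem O b hb fun i => ?_)
  have := congrFun (b.equivFun.apply_symm_apply x) i
  rw [b.equivFun_apply] at this
  rw [this]
  exact hx i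

include h in
theorem isOpen_coords : IsOpen {x : Fin r → k | ∀ i, x i ∈ O} := by
  have : {x : Fin r → k | ∀ i, x i ∈ O} = Set.univ.pi fun _ => (O : Set k) := by
    ext x
    simp
  rw [this]
  exact isOpen_set_pi Set.finite_univ fun i _ => h.isOpen

include h hb in
theorem isOpen_unitCoords : IsOpen (unitCoords O b) := by
  have hq := one_lt_card_field κ
  have : unitCoords O b = {x | ∀ i, x i ∈ O} ∩
      {x | (Fintype.card κ : ℝ)⁻¹ < ‖Algebra.norm k (b.equivFun.symm x)‖} := by
    ext x
    refine and_congr_right fun hx => ⟨fun h2 => ?_, fun h2 => ?_⟩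
    · change _ < ‖Algebra.norm k (b.equivFun.symm x)‖
      rw [h2]
      exact inv_lt_one_of_one_lt₀ hq
    · by_contra h3
      exact absurd h2 (not_lt.2 (h.norm_le_inv_card
        (lt_of_le_of_ne (norm_le_one_of_coords h b hb hx) h3)))
  rw [this]
  exact (isOpen_coords h).inter (isOpen_lt continuous_const (continuous_norm_equivFun_symm b).norm)

variable [MeasurableSpace k] [BorelSpace k] [ProperSpace k] (α : Measure k) [α.IsAddHaarMeasure]

omit [MeasurableSpace k] [BorelSpace k] [ProperSpace k] in
theorem equivFun_mul_eq_mulVec (x y : B) :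
    b.equivFun (x * y) = (Algebra.leftMulMatrix b x).mulVec (b.equivFun y) :=
  (Algebra.leftMulMatrix_mulVec_repr b x y).symm

include h in
/-- The translates of the units of the order by inequivalent elements are disjoint; comparing
measures bounds the sum of the norms of the classes. -/
theorem sum_norm_mul_le (S : Finset (Bˣ ⧸ orderUnits O b hb h1)) {X : Set (Fin r → k)}
    (hX : ∀ c ∈ S, ∀ u ∈ orderUnits O b hb h1, b.equivFun ((c.out : B) * (u : B)) ∈ X) :
    (∑ c ∈ S, ENNReal.ofReal ‖Algebra.norm k (c.out : B)‖) *
      Measure.pi (fun _ : Fin r => α) (unitCoords O b) ≤ Measure.pi (fun _ : Fin r => α) X := by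
  set μ := Measure.pi (fun _ : Fin r => α)
  have hU : ∀ x ∈ unitCoords O b, ∃ u ∈ orderUnits O b hb h1, b.equivFun (u : B) = x := by
    rintro x ⟨hx, hx1⟩
    have h0 : Algebra.norm k (b.equivFun.symm x) ≠ 0 :=
      norm_ne_zero_iff.1 (by rw [hx1]; exact one_ne_zero)
    have hfin : Module.Finite k B := Module.Finite.of_basis b
    have hu : IsUnit (b.equivFun.symm x) := by
      rw [Algebra.norm_apply, ← isUnit_iff_ne_zero, ← LinearMap.isUnit_iff_isUnit_det] at h0
      exact Algebra.lmul_isUnit_iff.1 h0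
    obtain ⟨u, hu⟩ := hu
    have hux : b.equivFun (u : B) = x := by rw [hu, LinearEquiv.apply_symm_apply]
    refine ⟨u, (mem_orderUnits_iff h b hb h1).2 ⟨fun i => ?_, by rw [hu, hx1]⟩, hux⟩
    rw [← b.equivFun_apply, hux]
    exact hx i
  have hdet : ∀ c : Bˣ, (Algebra.leftMulMatrix b (c : B)).det ≠ 0 := fun c => by
    rw [← Algebra.norm_eq_matrix_det b]
    exact (c.isUnit.map (Algebra.norm k)).ne_zero
  set T : Bˣ ⧸ orderUnits O b hb h1 → Set (Fin r → k) := fun c =>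
    (Algebra.leftMulMatrix b (c.out : B)).mulVec '' unitCoords O b with hT
  have hTmem : ∀ c, ∀ y ∈ T c, ∃ u ∈ orderUnits O b hb h1,
      y = b.equivFun ((c.out : B) * (u : B)) := by
    rintro c _ ⟨x, hx, rfl⟩
    obtain ⟨u, hu, rfl⟩ := hU x hx
    exact ⟨u, hu, (equivFun_mul_eq_mulVec b _ _).symm⟩
  -- the translates of the units are the cosets `c U`
  have hdisj : (S : Set (Bˣ ⧸ orderUnits O b hb h1)).PairwiseDisjoint T := by
    intro c _ c' _ hcc
    refine Set.disjoint_left.2 fun y hy hy' => hcc ?_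
    obtain ⟨u, hu, hy⟩ := hTmem c y hy
    obtain ⟨u', hu', hy'⟩ := hTmem c' y hy'
    have h2 : c.out * u = c'.out * u' := by
      ext
      exact b.equivFun.injective (hy.symm.trans hy')
    have h3 : (c.out : Bˣ ⧸ orderUnits O b hb h1) = (c'.out : Bˣ ⧸ orderUnits O b hb h1) := by
      rw [← QuotientGroup.mk_mul_of_mem c.out hu, h2, QuotientGroup.mk_mul_of_mem c'.out hu']
    rwa [QuotientGroup.out_eq', QuotientGroup.out_eq'] at h3
  have hmeas : ∀ c ∈ S, MeasurableSet (T c) := fun c _ => by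
    obtain ⟨e, he⟩ := mulVec_image_eq (hdet c.out)
    have h2 : T c = e.symm ⁻¹' unitCoords O b := by
      rw [hT, ← LinearEquiv.image_eq_preimage_symm]
      exact Set.image_congr fun x _ => (he x).symm
    rw [h2]
    exact ((isOpen_unitCoords h b hb).preimage
      (LinearMap.continuous_on_pi e.symm.toLinearMap)).measurableSet
  calc (∑ c ∈ S, ENNReal.ofReal ‖Algebra.norm k (c.out : B)‖) * μ (unitCoords O b)
      = ∑ c ∈ S, μ (T c) := by
        rw [Finset.sum_mul]
        refine Finset.sum_congr rfl fun c _ => ?_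
        rw [hT, h.measure_image_mulVec α (hdet c.out), ← Algebra.norm_eq_matrix_det b]
    _ = μ (⋃ c ∈ S, T c) := (measure_biUnion_finset hdisj hmeas).symm
    _ ≤ μ X := by
        refine measure_mono (Set.iUnion₂_subset fun c hc y hy => ?_)
        obtain ⟨u, hu, rfl⟩ := hTmem c y hy
        exact hX c hc u hu

end LocalSum

end

/-! ### Integral nonunits and the local bound -/

section

open Module Filter Topology MeasureTheory
open scoped Pointwise ENNReal

section LocalEstimate

variable {k κ : Type*} [NormedField k] [Field κ] [Fintype κ] {O : Subring k} (ρ : O →+* κ)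
  (h : IsResidueMap ρ) {B : Type*} [Ring B] [Algebra k B] {r : ℕ}
  (b : Basis (Fin r) k B) (hb : ∀ i j l, Algebra.leftMulMatrix b (b i) j l ∈ O)
  (h1 : ∀ i, b.repr 1 i ∈ O)

/-- The reduction of the norm form of the order: a form of degree `r` over the residue field. -/
def reducedNormForm : MvPolynomial (Fin r) κ :=
  (∑ i, (MvPolynomial.X i : MvPolynomial (Fin r) κ) • (Matrix.of fun j l =>
    ρ ⟨Algebra.leftMulMatrix b (b i) j l, hb i j l⟩).map MvPolynomial.C).det

omit [Fintype κ] in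
theorem totalDegree_reducedNormForm_le : (reducedNormForm ρ b hb).totalDegree ≤ r := by
  rw [reducedNormForm, Matrix.det_apply]
  refine MvPolynomial.totalDegree_finsetSum_le fun σ _ => ?_
  refine (MvPolynomial.totalDegree_smul_le _ _).trans
    ((MvPolynomial.totalDegree_finsetProd _ _).trans ?_)
  refine (Finset.sum_le_card_nsmul Finset.univ _ 1 fun j _ => ?_).trans_eq (by simp)
  rw [Matrix.sum_apply]
  refine MvPolynomial.totalDegree_finsetSum_le fun i _ => ?_
  rw [Matrix.smul_apply, Matrix.map_apply, smul_eq_mul]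
  refine (MvPolynomial.totalDegree_mul _ _).trans ?_
  rw [MvPolynomial.totalDegree_X, MvPolynomial.totalDegree_C]

omit [Fintype κ] in
/-- The reduction of the norm of an integral element is the value of the reduced norm form at the
reduced coordinates. -/
theorem residue_norm_eq_eval (x : B) (hx : ∀ i, b.repr x i ∈ O) :
    ρ (integralMatrix O b hb x hx).det =
      MvPolynomial.eval (fun i => ρ ⟨b.repr x i, hx i⟩) (reducedNormForm ρ b hb) := by
  rw [RingHom.map_det, reducedNormForm, RingHom.map_det]
  congr 1
  ext j l
  have h2 : integralMatrix O b hb x hx j l =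
      ∑ i, (⟨b.repr x i, hx i⟩ : O) * ⟨Algebra.leftMulMatrix b (b i) j l, hb i j l⟩ := by
    apply Subtype.ext
    change Algebra.leftMulMatrix b x j l = O.subtype _
    rw [leftMulMatrix_eq_sum, Matrix.sum_apply, map_sum]
    rfl
  simp only [RingHom.mapMatrix_apply, Matrix.map_apply, h2, Matrix.sum_apply, Matrix.smul_apply,
    smul_eq_mul, map_sum, map_mul, MvPolynomial.eval_X, MvPolynomial.eval_C, Matrix.of_apply]

omit [Fintype κ] in
include h1 in
/-- The reduced form takes the value `1` at the unit element. -/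
theorem reducedNormForm_ne_zero : reducedNormForm ρ b hb ≠ 0 := by
  intro h0
  have h2 := residue_norm_eq_eval ρ b hb 1 h1
  have h3 : (integralMatrix O b hb 1 h1).det = 1 := by
    apply Subtype.ext
    rw [coe_det_integralMatrix, map_one]
    rfl
  rw [h0, h3, map_one, map_zero] at h2
  exact one_ne_zero h2

variable {ρ}

variable [MeasurableSpace k] [BorelSpace k] [ProperSpace k] (α : Measure k) [α.IsAddHaarMeasure]

include h hb h1 in
/-- The proportion of nonunits in the order is at most `r / q`, by the Schwartz–Zippel lemma for the
reduction of the norm form. -/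
theorem measure_nonunitCoords_le : Measure.pi (fun _ : Fin r => α) (nonunitCoords O b) ≤
    ((r : ℝ≥0) / Fintype.card κ : ℝ≥0) *
      Measure.pi (fun _ : Fin r => α) {x | ∀ i, x i ∈ O} := by
  classical
  set Z := {c ∈ Fintype.piFinset (fun _ : Fin r => (Finset.univ : Finset κ)) |
    MvPolynomial.eval c (reducedNormForm ρ b hb) = 0} with hZ
  have hq : (0 : ℝ≥0) < Fintype.card κ := by exact_mod_cast Fintype.card_pos
  have hcard : (Z.card : ℝ≥0) ≤ (r : ℝ≥0) / Fintype.card κ * (Fintype.card κ : ℝ≥0) ^ r := by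
    have h2 := MvPolynomial.schwartz_zippel_totalDegree (reducedNormForm_ne_zero ρ b hb h1)
      Finset.univ
    have h3 := (NNRat.cast_le (K := ℝ≥0)).2 h2
    push_cast at h3
    rw [Finset.card_univ, div_le_iff₀ (by positivity)] at h3
    refine h3.trans (mul_le_mul_of_nonneg_right (div_le_div_of_nonneg_right ?_ hq.le) (by positivity))
    exact_mod_cast totalDegree_reducedNormForm_le ρ b hb
  -- a nonunit reduces to a zero of the form
  have hsub : nonunitCoords O b ⊆ ⋃ c ∈ Z, Set.univ.pi fun i => residueFibre ρ (c i) := by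
    rintro x ⟨hx, hx1⟩
    have hrep : ∀ i, b.repr (b.equivFun.symm x) i = x i := fun i => by
      rw [← b.equivFun_apply, LinearEquiv.apply_symm_apply]
    have hx' : ∀ i, b.repr (b.equivFun.symm x) i ∈ O := fun i => by
      rw [hrep]
      exact hx i
    have h2 := residue_norm_eq_eval ρ b hb _ hx'
    refine Set.mem_iUnion₂.2 ⟨fun i => ρ ⟨b.repr (b.equivFun.symm x) i, hx' i⟩, ?_, ?_⟩
    · rw [hZ, Finset.mem_filter, ← h2, h.map_eq_zero_iff, coe_det_integralMatrix]
      exact ⟨by simp, hx1⟩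
    · intro i _
      refine ⟨hx i, ?_⟩
      congr 1
      exact Subtype.ext (hrep i).symm
  have hΛ : Measure.pi (fun _ : Fin r => α) {x | ∀ i, x i ∈ O} = α O ^ r := by
    have : {x : Fin r → k | ∀ i, x i ∈ O} = Set.univ.pi fun _ => (O : Set k) := by
      ext x
      simp
    rw [this, Measure.pi_pi, Finset.prod_const, Finset.card_univ, Fintype.card_fin]
  have hqt : (Fintype.card κ : ℝ≥0∞) ≠ ⊤ := ENNReal.natCast_ne_top _
  have hq0 : (Fintype.card κ : ℝ≥0∞) ≠ 0 := by exact_mod_cast Fintype.card_ne_zero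
  calc Measure.pi (fun _ : Fin r => α) (nonunitCoords O b)
      ≤ ∑ c ∈ Z, Measure.pi (fun _ : Fin r => α) (Set.univ.pi fun i => residueFibre ρ (c i)) :=
        (measure_mono hsub).trans (measure_biUnion_finset_le _ _)
    _ = Z.card * ((Fintype.card κ : ℝ≥0∞)⁻¹ * α O) ^ r := by
        rw [Finset.sum_congr rfl fun c _ => by
          rw [Measure.pi_pi, Finset.prod_congr rfl fun i _ => h.measure_residueFibre α (c i),
            Finset.prod_const, Finset.card_univ, Fintype.card_fin], Finset.sum_const, nsmul_eq_mul]
    _ ≤ (((r : ℝ≥0) / Fintype.card κ : ℝ≥0) * (Fintype.card κ : ℝ≥0∞) ^ r) *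
          ((Fintype.card κ : ℝ≥0∞)⁻¹ * α O) ^ r := by
        refine mul_le_mul_left ?_ _
        have := ENNReal.coe_le_coe.2 hcard
        push_cast at this ⊢
        exact this
    _ = _ := by
        rw [hΛ, mul_pow, mul_assoc, ← mul_assoc (_ ^ r), ← mul_pow, ENNReal.mul_inv_cancel hq0 hqt,
          one_pow, one_mul]

omit [MeasurableSpace k] [BorelSpace k] in
include h in
/-- The local factor: the sum of the `|N|^τ` over the nontrivial integral classes is finite, and
`O(q^{-τ})` uniformly in the field. -/
theorem exists_sum_rpow_norm_le {τ : ℝ} (hτ : 1 ≤ τ) : ∃ e : ℝ, 0 ≤ e ∧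
    (2 * r ≤ Fintype.card κ → e ≤ 2 * r * (Fintype.card κ : ℝ) ^ (-τ)) ∧
    ∀ S : Finset (Bˣ ⧸ orderUnits O b hb h1),
      (∀ c ∈ S, c ≠ ((1 : Bˣ) : Bˣ ⧸ orderUnits O b hb h1) ∧ ∀ i, b.repr (c.out : B) i ∈ O) →
      ∑ c ∈ S, ‖Algebra.norm k (c.out : B)‖ ^ τ ≤ e := by
  borelize k
  let α : Measure k := Measure.addHaar
  set μ := Measure.pi (fun _ : Fin r => α) with hμ
  have hq := one_lt_card_field κ
  have hq0 : (0 : ℝ) < Fintype.card κ := by linarith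
  set Λ : Set (Fin r → k) := {x | ∀ i, x i ∈ O} with hΛ
  have hΛt : μ Λ ≠ ⊤ := by
    have : Λ = Set.univ.pi fun _ => (O : Set k) := by
      ext x
      simp [hΛ]
    rw [this, Measure.pi_pi]
    exact ENNReal.prod_ne_top fun i _ => h.measure_ne_top α
  have hNΛ : nonunitCoords O b ⊆ Λ := fun x hx => hx.1
  have hUΛ : unitCoords O b ⊆ Λ := fun x hx => hx.1
  have hNt : μ (nonunitCoords O b) ≠ ⊤ := ((measure_mono hNΛ).trans_lt hΛt.lt_top).ne
  have hUt : μ (unitCoords O b) ≠ ⊤ := ((measure_mono hUΛ).trans_lt hΛt.lt_top).ne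
  have hone : b.equivFun 1 ∈ unitCoords O b := by
    refine ⟨h1, ?_⟩
    rw [LinearEquiv.symm_apply_apply, map_one, norm_one]
  have hU0 : μ (unitCoords O b) ≠ 0 := ((isOpen_unitCoords h b hb).measure_pos μ ⟨_, hone⟩).ne'
  have hle : μ Λ ≤ μ (unitCoords O b) + μ (nonunitCoords O b) := by
    refine (measure_mono fun x hx => ?_).trans (measure_union_le _ _)
    rcases (norm_le_one_of_coords h b hb hx).lt_or_eq with h2 | h2
    · exact Or.inr ⟨hx, h2⟩
    · exact Or.inl ⟨hx, h2⟩
  have hN := measure_nonunitCoords_le h b hb h1 α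
  rw [← hμ, ← hΛ] at hN
  -- the sum for `τ = 1` is at most the ratio `V / U` of the measures of the nonunits and the
  -- units, and the remaining factor `|N|^{τ-1}` is at most `q^{1-τ}`
  set U := (μ (unitCoords O b)).toReal with hUdef
  set V := (μ (nonunitCoords O b)).toReal with hVdef
  have hUpos : 0 < U := ENNReal.toReal_pos hU0 hUt
  have hV0 : 0 ≤ V := ENNReal.toReal_nonneg
  refine ⟨(Fintype.card κ : ℝ) ^ (-(τ - 1)) * (V / U), by positivity, fun hr => ?_, fun S hS => ?_⟩
  -- for `q ≥ 2 r` the units have at least half of the measure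
  · have h2 : V ≤ r / Fintype.card κ * (μ Λ).toReal := by
      have := ENNReal.toReal_mono (ENNReal.mul_ne_top ENNReal.coe_ne_top hΛt) hN
      rwa [ENNReal.toReal_mul, ENNReal.coe_toReal, NNReal.coe_div, NNReal.coe_natCast,
        NNReal.coe_natCast] at this
    have h3 : (μ Λ).toReal ≤ U + V := by
      have := ENNReal.toReal_mono (ENNReal.add_ne_top.2 ⟨hUt, hNt⟩) hle
      rwa [ENNReal.toReal_add hUt hNt] at this
    have h4 : (r : ℝ) / Fintype.card κ ≤ 1 / 2 := by
      rw [div_le_div_iff₀ hq0 two_pos]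
      exact_mod_cast (by omega : r * 2 ≤ 1 * Fintype.card κ)
    have h5 : (μ Λ).toReal ≤ 2 * U := by
      have : (r : ℝ) / Fintype.card κ * (μ Λ).toReal ≤ 1 / 2 * (μ Λ).toReal :=
        mul_le_mul_of_nonneg_right h4 ENNReal.toReal_nonneg
      linarith
    have h6 : V / U ≤ 2 * r * (Fintype.card κ : ℝ)⁻¹ := by
      rw [div_le_iff₀ hUpos]
      refine h2.trans ((mul_le_mul_of_nonneg_left h5 (by positivity)).trans_eq ?_)
      ring
    refine (mul_le_mul_of_nonneg_left h6 (by positivity)).trans_eq ?_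
    rw [← Real.rpow_neg_one, mul_left_comm, ← Real.rpow_add hq0]
    congr 2
    ring
  · have hlt : ∀ c ∈ S, ‖Algebra.norm k (c.out : B)‖ < 1 := by
      intro c hc
      obtain ⟨hc1, hc2⟩ := hS c hc
      have h2 : ‖Algebra.norm k (c.out : B)‖ ≤ 1 := (h.mem_iff _).1 (norm_mem_of_mem O b hb hc2)
      refine lt_of_le_of_ne h2 fun h3 => hc1 ?_
      have h4 : c.out ∈ orderUnits O b hb h1 := (mem_orderUnits_iff h b hb h1).2 ⟨hc2, h3⟩
      rw [← QuotientGroup.out_eq' c]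
      exact (QuotientGroup.eq.2 (by rwa [inv_one, one_mul])).symm
    have h2 := sum_norm_mul_le h b hb h1 α S (X := nonunitCoords O b) fun c hc u hu => by
      have h3 : ∀ i, b.repr ((c.out : B) * (u : B)) i ∈ O :=
        (basisOrder O b hb h1).mul_mem (hS c hc).2 hu.1
      refine ⟨h3, ?_⟩
      rw [LinearEquiv.symm_apply_apply, map_mul, norm_mul,
        norm_eq_one_of_mem_orderUnits h b hb h1 hu, mul_one]
      exact hlt c hc
    have h3 : (∑ c ∈ S, ‖Algebra.norm k (c.out : B)‖) * U ≤ V := by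
      have := ENNReal.toReal_mono hNt h2
      rwa [ENNReal.toReal_mul, ← ENNReal.ofReal_sum_of_nonneg fun _ _ => norm_nonneg _,
        ENNReal.toReal_ofReal (Finset.sum_nonneg fun _ _ => norm_nonneg _)] at this
    rw [← le_div_iff₀ hUpos] at h3
    refine le_trans ?_ (mul_le_mul_of_nonneg_left h3 (by positivity))
    rw [Finset.mul_sum]
    refine Finset.sum_le_sum fun c hc => ?_
    have h4 : 0 < ‖Algebra.norm k (c.out : B)‖ :=
      norm_pos_iff.2 (c.out.isUnit.map (Algebra.norm k)).ne_zero
    have h5 := h.norm_le_inv_card (hlt c hc)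
    calc ‖Algebra.norm k (c.out : B)‖ ^ τ
        = ‖Algebra.norm k (c.out : B)‖ ^ (τ - 1) * ‖Algebra.norm k (c.out : B)‖ := by
          rw [← Real.rpow_add_one h4.ne', sub_add_cancel]
      _ ≤ (Fintype.card κ : ℝ) ^ (-(τ - 1)) * ‖Algebra.norm k (c.out : B)‖ := by
          refine mul_le_mul_of_nonneg_right ?_ h4.le
          rw [Real.rpow_neg hq0.le, ← Real.inv_rpow hq0.le]
          exact Real.rpow_le_rpow h4.le h5 (by linarith)

end LocalEstimate

end

/-! ### The completions of a number field at its finite places -/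

section FinitePlaces

open NumberField IsDedekindDomain HeightOneSpectrum Module MeasureTheory

variable {F : Type*} [Field F] [NumberField F] (v : HeightOneSpectrum (𝓞 F))

theorem mem_adicCompletionIntegers_iff_norm_le_one (x : v.adicCompletion F) :
    x ∈ v.adicCompletionIntegers F ↔ ‖x‖ ≤ 1 := by
  rw [mem_adicCompletionIntegers, FinitePlace.norm_def, ← NNReal.coe_one, NNReal.coe_le_coe,
    WithZeroMulInt.toNNReal_le_one_iff (NumberField.HeightOneSpectrum.one_lt_absNorm_nnreal v)]

/-- Every integer of the completion is congruent to a global integer. -/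
theorem exists_norm_sub_embedding_lt_one {x : v.adicCompletion F} (hx : ‖x‖ ≤ 1) :
    ∃ a : 𝓞 F, ‖x - FinitePlace.embedding v (algebraMap (𝓞 F) F a)‖ < 1 := by
  -- first approximate by an element of `F`, then by an integer
  obtain ⟨y, hy⟩ := Metric.denseRange_iff.1 (denseRange_algebraMap (R := 𝓞 F) (K := F) v) x 1 one_pos
  rw [dist_eq_norm] at hy
  change ‖x - FinitePlace.embedding v y‖ < 1 at hy
  have hna : ∀ a b : v.adicCompletion F, ‖a + b‖ ≤ max ‖a‖ ‖b‖ := fun a b => by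
    simp only [FinitePlace.norm_def, ← NNReal.coe_max, NNReal.coe_le_coe]
    rcases le_total (Valued.v a) (Valued.v b) with hab | hab
    · refine le_max_of_le_right ((WithZeroMulInt.toNNReal_strictMono
        (NumberField.HeightOneSpectrum.one_lt_absNorm_nnreal v)).monotone ?_)
      exact (Valued.v.map_add _ _).trans (max_le hab le_rfl)
    · refine le_max_of_le_left ((WithZeroMulInt.toNNReal_strictMono
        (NumberField.HeightOneSpectrum.one_lt_absNorm_nnreal v)).monotone ?_)
      exact (Valued.v.map_add _ _).trans (max_le le_rfl hab)
  have hy1 : ‖FinitePlace.embedding v y‖ ≤ 1 := by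
    have := hna x (FinitePlace.embedding v y - x)
    rw [add_sub_cancel, norm_sub_rev] at this
    exact this.trans (max_le hx hy.le)
  have hy2 : v.valuation F y ≤ 1 := by
    rw [FinitePlace.norm_embedding', ← NNReal.coe_one, NNReal.coe_le_coe,
      WithZeroMulInt.toNNReal_le_one_iff
        (NumberField.HeightOneSpectrum.one_lt_absNorm_nnreal v)] at hy1
    exact hy1
  obtain ⟨a, ha⟩ := v.exists_valuation_sub_lt_of_integer hy2 1
  refine ⟨a, ?_⟩
  have h1 : ‖FinitePlace.embedding v (algebraMap (𝓞 F) F a - y)‖ < 1 := by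
    rw [FinitePlace.norm_embedding', ← NNReal.coe_one, NNReal.coe_lt_coe,
      WithZeroMulInt.toNNReal_lt_one_iff
        (NumberField.HeightOneSpectrum.one_lt_absNorm_nnreal v)]
    exact ha
  rw [map_sub] at h1
  have := hna (x - FinitePlace.embedding v y)
    (FinitePlace.embedding v y - FinitePlace.embedding v (algebraMap (𝓞 F) F a))
  rw [sub_add_sub_cancel] at this
  rw [norm_sub_rev] at h1
  exact this.trans_lt (max_lt hy h1)

/-- The residue field of a finite place. -/
abbrev PlaceResidue : Type _ := IsLocalRing.ResidueField (v.adicCompletionIntegers F)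

theorem residue_eq_zero_iff_norm_lt_one (x : v.adicCompletionIntegers F) :
    IsLocalRing.residue (v.adicCompletionIntegers F) x = 0 ↔ ‖(x : v.adicCompletion F)‖ < 1 := by
  rw [IsLocalRing.residue_eq_zero_iff, IsLocalRing.mem_maximalIdeal, mem_nonunits_iff,
    adicCompletionIntegers.isUnit_iff_valued_eq_one, FinitePlace.norm_def, ← NNReal.coe_one,
    NNReal.coe_lt_coe, WithZeroMulInt.toNNReal_lt_one_iff
      (NumberField.HeightOneSpectrum.one_lt_absNorm_nnreal v)]
  have : Valued.v (x : v.adicCompletion F) ≤ 1 := x.2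
  exact ⟨fun h => lt_of_le_of_ne this h, fun h => h.ne⟩

/-- The residue field of the completion is the quotient of the ring of integers by the prime
ideal. -/
theorem exists_residueEquiv : Nonempty (𝓞 F ⧸ v.asIdeal ≃ PlaceResidue v) := by
  let f : 𝓞 F →+* PlaceResidue v := (IsLocalRing.residue (v.adicCompletionIntegers F)).comp
    (algebraMap (𝓞 F) (v.adicCompletionIntegers F))
  have hf : ∀ a, f a = 0 ↔ a ∈ v.asIdeal := fun a => by
    rw [← FinitePlace.norm_lt_one_iff_mem F v a]
    exact residue_eq_zero_iff_norm_lt_one v _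
  have hs : Function.Surjective f := fun z => by
    obtain ⟨x, rfl⟩ := IsLocalRing.residue_surjective z
    obtain ⟨a, ha⟩ := exists_norm_sub_embedding_lt_one v
      ((mem_adicCompletionIntegers_iff_norm_le_one v _).1 x.2)
    refine ⟨a, ?_⟩
    have := (residue_eq_zero_iff_norm_lt_one v (x - algebraMap (𝓞 F) _ a)).2 ha
    rw [map_sub, sub_eq_zero] at this
    exact this.symm
  have hk : RingHom.ker f = v.asIdeal := Ideal.ext fun a => hf a
  rw [← hk]
  exact ⟨(RingHom.quotientKerEquivOfSurjective hs).toEquiv⟩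

instance finite_placeResidue : Finite (PlaceResidue v) := by
  obtain ⟨e⟩ := exists_residueEquiv v
  have := v.asIdeal.finiteQuotientOfFreeOfNeBot v.ne_bot
  exact Finite.of_equiv _ e

instance fintypePlaceResidue : Fintype (PlaceResidue v) := Fintype.ofFinite _

theorem card_placeResidue : Fintype.card (PlaceResidue v) = Ideal.absNorm v.asIdeal := by
  obtain ⟨e⟩ := exists_residueEquiv v
  rw [← Nat.card_eq_fintype_card, ← Nat.card_congr e]
  rfl

instance properSpace_adicCompletion : ProperSpace (v.adicCompletion F) := by
  refine Valued.integer.properSpace_iff_completeSpace_and_isDiscreteValuationRing_integer_and_finite_residueField.2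
    ⟨inferInstance, ?_, ?_⟩
  · exact inferInstanceAs (IsDiscreteValuationRing (v.adicCompletionIntegers F))
  · exact inferInstanceAs (Finite (PlaceResidue v))

/-- The reduction map at a finite place. -/
def placeReduction : (v.adicCompletionIntegers F).toSubring →+* PlaceResidue v :=
  IsLocalRing.residue (v.adicCompletionIntegers F)

/-- The norm of the completion at a finite place is normalized. -/
theorem isResidueMap_placeReduction : IsResidueMap (placeReduction v) where
  mem_iff := mem_adicCompletionIntegers_iff_norm_le_one v
  surjective := IsLocalRing.residue_surjective (R := v.adicCompletionIntegers F)
  map_eq_zero_iff := residue_eq_zero_iff_norm_lt_one v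
  exists_norm_eq := by
    obtain ⟨π, hπ⟩ := valuedAdicCompletion_surjective F v (WithZero.exp (-1))
    refine ⟨π, ?_⟩
    rw [FinitePlace.norm_def, hπ, card_placeResidue,
      WithZeroMulInt.toNNReal_neg_apply _ WithZero.exp_ne_zero]
    have : (WithZero.unzero (WithZero.exp_ne_zero (a := (-1 : ℤ)))).toAdd = -1 := rfl
    rw [this]
    simp
  norm_eq_zpow x hx := by
    have h0 : Valued.v x ≠ 0 := (Valuation.ne_zero_iff _).2 hx
    refine ⟨(WithZero.unzero h0).toAdd, ?_⟩
    rw [FinitePlace.norm_def, card_placeResidue, WithZeroMulInt.toNNReal_neg_apply _ h0]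
    simp

end FinitePlaces

/-! ### Convergence of the Euler product -/

section PrimeSum

open NumberField IsDedekindDomain Filter Topology Asymptotics

variable (F : Type*) [Field F] [NumberField F]

/-- The number of ideals of a given norm. -/
def idealCount (n : ℕ) : ℕ := Nat.card {I : Ideal (𝓞 F) // Ideal.absNorm I = n}

/-- The number of ideals of norm at most `n` is `O(n)`, so the Dirichlet series of the Dedekind
zeta function converges absolutely for `τ > 1`. -/
theorem summable_idealCount_rpow {τ : ℝ} (hτ : 1 < τ) :
    Summable fun n : ℕ => (idealCount F n : ℝ) * (n : ℝ) ^ (-τ) := by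
  have hsum : ∀ n : ℕ, ∑ k ∈ Finset.Icc 1 n, (idealCount F k : ℝ) ≤
      Nat.card {I : Ideal (𝓞 F) // (Ideal.absNorm I : ℝ) ≤ (n : ℝ)} := fun n => by
    have hfin := Ideal.finite_setOfPred_absNorm_le (S := 𝓞 F) n
    simp only [Nat.cast_le]
    rw [← Nat.cast_sum, Nat.cast_le]
    have : Finite {I : Ideal (𝓞 F) // Ideal.absNorm I ≤ n} := hfin.to_subtype
    have he : ∀ k : Finset.Icc 1 n, Finite {I : Ideal (𝓞 F) // Ideal.absNorm I = k} := fun k =>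
      (Ideal.finite_setOfPred_absNorm_eq (S := 𝓞 F) k).to_subtype
    have hc : Nat.card (Σ k : Finset.Icc 1 n, {I : Ideal (𝓞 F) // Ideal.absNorm I = k}) =
        ∑ k ∈ Finset.Icc 1 n, idealCount F k := by
      rw [Nat.card_sigma]
      exact Finset.sum_coe_sort (Finset.Icc 1 n) (fun k => idealCount F k)
    rw [← hc]
    refine Nat.card_le_card_of_injective (fun p => ⟨p.2.1, p.2.2.le.trans (Finset.mem_Icc.1 p.1.2).2⟩)
      fun p p' h => ?_
    obtain ⟨⟨k, hk⟩, I, hI⟩ := p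
    obtain ⟨⟨k', hk'⟩, I', hI'⟩ := p'
    have hII : I = I' := congrArg Subtype.val h
    subst hII
    have hI1 : Ideal.absNorm I = k := hI
    have hI2 : Ideal.absNorm I = k' := hI'
    obtain rfl : k = k' := hI1.symm.trans hI2
    rfl
  have hO : (fun n : ℕ => ∑ k ∈ Finset.Icc 1 n, (idealCount F k : ℝ)) =O[atTop]
      fun n : ℕ => (n : ℝ) ^ (1 : ℝ) := by
    have h1 := ((Ideal.tendsto_norm_le_div_atTop F).comp tendsto_natCast_atTop_atTop).isBigO_one ℝ
    have h2 : (fun n : ℕ => (Nat.card {I : Ideal (𝓞 F) // (Ideal.absNorm I : ℝ) ≤ (n : ℝ)} : ℝ))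
        =O[atTop] fun n : ℕ => (n : ℝ) ^ (1 : ℝ) := by
      have h3 := h1.mul (isBigO_refl (fun n : ℕ => (n : ℝ) ^ (1 : ℝ)) atTop)
      refine (h3.congr' ?_ ?_)
      · filter_upwards [eventually_ne_atTop 0] with n hn
        simp only [Function.comp_apply, Real.rpow_one]
        rw [div_mul_cancel₀ _ (by exact_mod_cast hn)]
      · exact Eventually.of_forall fun n => one_mul _
    refine IsBigO.trans (IsBigO.of_norm_le fun n => ?_) h2
    rw [Real.norm_of_nonneg (by positivity)]
    exact hsum n
  have hL := LSeriesSummable_of_sum_norm_bigO_and_nonneg (f := fun n => (idealCount F n : ℝ)) hO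
    (fun n => Nat.cast_nonneg _) zero_le_one (s := (τ : ℂ)) (by simpa using hτ)
  refine (summable_nat_add_iff 1).1 (((summable_nat_add_iff 1).2 hL.norm).congr fun n => ?_)
  rw [LSeries.norm_term_eq, if_neg (Nat.succ_ne_zero n), Complex.ofReal_re,
    Real.rpow_neg (Nat.cast_nonneg _), ← div_eq_mul_inv]
  simp

/-- The sum over the prime ideals is part of the Dedekind zeta function. -/
theorem summable_absNorm_rpow {τ : ℝ} (hτ : 1 < τ) :
    Summable fun v : HeightOneSpectrum (𝓞 F) => (Ideal.absNorm v.asIdeal : ℝ) ^ (-τ) := by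
  have h1 : Summable fun p : Σ n : ℕ, {I : Ideal (𝓞 F) // Ideal.absNorm I = n} =>
      (p.1 : ℝ) ^ (-τ) := by
    refine (summable_sigma_of_nonneg fun p => by positivity).2 ⟨fun n => ?_, ?_⟩
    · have := (Ideal.finite_setOfPred_absNorm_eq (S := 𝓞 F) n).to_subtype
      have : Finite {I : Ideal (𝓞 F) // Ideal.absNorm I = n} := this
      exact Summable.of_finite
    · refine (summable_idealCount_rpow F hτ).congr fun n => ?_
      have : Finite {I : Ideal (𝓞 F) // Ideal.absNorm I = n} :=
        (Ideal.finite_setOfPred_absNorm_eq (S := 𝓞 F) n).to_subtype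
      exact ((tsum_const (β := {I : Ideal (𝓞 F) // Ideal.absNorm I = n}) ((n : ℝ) ^ (-τ))).trans (nsmul_eq_mul _ _)).symm
  refine h1.comp_injective (i := fun v : HeightOneSpectrum (𝓞 F) =>
    (⟨Ideal.absNorm v.asIdeal, v.asIdeal, rfl⟩ :
      Σ n : ℕ, {I : Ideal (𝓞 F) // Ideal.absNorm I = n})) fun v w h => ?_
  have : ∀ p q : Σ n : ℕ, {I : Ideal (𝓞 F) // Ideal.absNorm I = n}, p = q → p.2.1 = q.2.1 :=
    fun p q hpq => by rw [hpq]
  exact HeightOneSpectrum.ext (this _ _ h)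

end PrimeSum

/-- A sum of products of functions of finitely many coordinates, which separate the points of
the finite set, is bounded by the product of the sums over the images. -/
theorem sum_prod_le_prod_sum {X ι : Type*} {Y : ι → Type*} [DecidableEq ι] [∀ i, DecidableEq (Y i)]
    (S : Finset X) (T : Finset ι) (p : ∀ i, X → Y i)
    (hp : ∀ x ∈ S, ∀ y ∈ S, (∀ i ∈ T, p i x = p i y) → x = y) (w : ∀ i, Y i → ℝ)
    (hw : ∀ i y, 0 ≤ w i y) :
    ∑ x ∈ S, ∏ i ∈ T, w i (p i x) ≤ ∏ i ∈ T, ∑ y ∈ S.image (p i), w i y := by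
  rw [Finset.prod_sum]
  let f : X → (∀ i ∈ T, Y i) := fun x i _ => p i x
  have hf : Set.InjOn f S := fun x hx y hy hxy =>
    hp x hx y hy fun i hi => congrFun (congrFun hxy i) hi
  have h1 : ∑ x ∈ S, ∏ i ∈ T, w i (p i x) =
      ∑ q ∈ S.image f, ∏ i ∈ T.attach, w i.1 (q i.1 i.2) := by
    rw [Finset.sum_image hf]
    exact Finset.sum_congr rfl fun x _ => (Finset.prod_attach T fun i => w i (p i x)).symm
  rw [h1]
  refine Finset.sum_le_sum_of_subset_of_nonneg ?_ fun q _ _ => Finset.prod_nonneg fun i _ => hw _ _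
  intro q hq
  obtain ⟨x, hx, rfl⟩ := Finset.mem_image.1 hq
  exact Finset.mem_pi.2 fun i _ => Finset.mem_image_of_mem _ hx

/-! ### Integral bases -/

section IntegralBasis

open Module

/-- A finite-dimensional algebra over the field of fractions of `R` has a basis with structure
constants in `R` such that `1` has coordinates in `R`. -/
theorem exists_integral_basis (R F A : Type*) [CommRing R] [IsDomain R] [Field F] [Algebra R F]
    [IsFractionRing R F] [Ring A] [Nontrivial A] [Algebra F A] [FiniteDimensional F A] :
    ∃ b : Basis (Fin (finrank F A)) F A,
      (∀ i j l, Algebra.leftMulMatrix b (b i) j l ∈ (algebraMap R F).range) ∧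
      ∀ i, b.repr 1 i ∈ (algebraMap R F).range := by
  classical
  -- a basis containing `1`
  obtain ⟨c, i₀, hc⟩ : ∃ (c : Basis (Fin (finrank F A)) F A) (i₀ : Fin (finrank F A)),
      c i₀ = 1 := by
    have hli : LinearIndepOn F id ({1} : Set A) := LinearIndepOn.singleton one_ne_zero
    let c₀ := Basis.extend hli
    have : Fintype (hli.extend (Set.subset_univ {1})) := FiniteDimensional.fintypeBasisIndex c₀
    let e : hli.extend (Set.subset_univ {1}) ≃ Fin (finrank F A) :=
      Fintype.equivFinOfCardEq (finrank_eq_card_basis c₀).symm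
    have h1 : (1 : A) ∈ hli.extend (Set.subset_univ {1}) :=
      hli.subset_extend _ (Set.mem_singleton 1)
    refine ⟨c₀.reindex e, e ⟨1, h1⟩, ?_⟩
    rw [Basis.reindex_apply, Equiv.symm_apply_apply]
    exact Basis.extend_apply_self hli ⟨1, h1⟩
  -- a common denominator of the structure constants
  obtain ⟨N, hN⟩ := IsLocalization.exist_integer_multiples_of_finite (nonZeroDivisors R)
    (fun p : Fin (finrank F A) × Fin (finrank F A) × Fin (finrank F A) =>
      c.repr (c p.1 * c p.2.1) p.2.2)
  have hN0 : algebraMap R F N ≠ 0 := IsFractionRing.to_map_ne_zero_of_mem_nonZeroDivisors N.2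
  have hN' : ∀ i l j, algebraMap R F N * c.repr (c i * c l) j ∈ (algebraMap R F).range :=
    fun i l j => by
      obtain ⟨y, hy⟩ := hN (i, l, j)
      exact ⟨y, by rw [hy, Algebra.smul_def]⟩
  -- scaling the basis vectors other than `1` by the common denominator makes all structure
  -- constants integral
  let w : Fin (finrank F A) → F := fun i => if i = i₀ then 1 else algebraMap R F N
  have hw0 : ∀ i, w i ≠ 0 := fun i => by
    by_cases h : i = i₀ <;> simp [w, h, hN0]
  let b := c.isUnitSMul (w := w) fun i => (hw0 i).isUnit
  have hb : ∀ i, b i = w i • c i := fun i => Basis.isUnitSMul_apply _ i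
  have hr : ∀ x i, b.repr x i = (w i)⁻¹ * c.repr x i := fun x i => by
    have h1 : c.repr x i = w i * b.repr x i := by
      conv_lhs => rw [← b.sum_repr x]
      simp only [map_sum, map_smul, hb, Finsupp.coe_finsetSum, Finset.sum_apply,
        Finsupp.smul_apply, Basis.repr_self, smul_eq_mul]
      rw [Finset.sum_eq_single i]
      · simp [mul_comm]
      · intro l _ hl
        simp [hl]
      · simp
    rw [h1, inv_mul_cancel_left₀ (hw0 i)]
  have hone : ∀ i, c.repr 1 i = if i = i₀ then 1 else 0 := fun i => by
    rw [← hc, Basis.repr_self, Finsupp.single_apply]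
    simp [eq_comm]
  have hdelta : ∀ j l, b.repr (b l) j ∈ (algebraMap R F).range := fun j l => by
    rw [Basis.repr_self, Finsupp.single_apply]
    split_ifs
    · exact one_mem _
    · exact zero_mem _
  have hb1 : b i₀ = 1 := by rw [hb, hc]; simp [w]
  refine ⟨b, fun i j l => ?_, fun i => ?_⟩
  · rw [Algebra.leftMulMatrix_eq_repr_mul]
    by_cases hi : i = i₀
    · rw [hi, hb1, one_mul]
      exact hdelta j l
    by_cases hl : l = i₀
    · rw [hl, hb1, mul_one]
      exact hdelta j i
    rw [hr, hb, hb]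
    simp only [w, if_neg hi, if_neg hl, smul_mul_smul_comm, map_smul, Finsupp.smul_apply,
      smul_eq_mul]
    split_ifs with hj
    · rw [inv_one, one_mul, mul_assoc]
      exact mul_mem ⟨_, rfl⟩ (hN' i l j)
    · rw [← mul_assoc, inv_mul_cancel_left₀ hN0]
      exact hN' i l j
  · rw [← hb1]
    exact hdelta i i₀

end IntegralBasis

/-! ### The order of integral finite adelic points -/

section BaseChange

open Module

variable {F A : Type*} [Field F] [Ring A] [Algebra F A] {r : ℕ} (b : Basis (Fin r) F A)

/-- Coordinates are compatible with a change of the ring of coefficients. -/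
theorem basis_repr_map {R R' : Type*} [CommRing R] [Algebra F R] [CommRing R'] [Algebra F R']
    (φ : R →ₐ[F] R') (x : R ⊗[F] A) (i : Fin r) :
    (Algebra.TensorProduct.basis R' b).repr (Algebra.TensorProduct.map φ (AlgHom.id F A) x) i =
      φ ((Algebra.TensorProduct.basis R b).repr x i) := by
  induction x with
  | zero => simp
  | add x y hx hy => simp only [map_add, Finsupp.add_apply, hx, hy]
  | tmul a m => simp [Algebra.TensorProduct.basis_repr_tmul]

include b in
theorem norm_map_tensorProduct {R R' : Type*} [CommRing R] [Algebra F R] [CommRing R']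
    [Algebra F R'] (φ : R →ₐ[F] R') (x : R ⊗[F] A) :
    Algebra.norm R' (Algebra.TensorProduct.map φ (AlgHom.id F A) x) = φ (Algebra.norm R x) := by
  rw [norm_eq_aeval_normPoly b, norm_eq_aeval_normPoly b]
  simp only [basis_repr_map]
  exact (MvPolynomial.comp_aeval_apply _ φ _).symm

variable {R₀ : Type*} [CommRing R₀] [Algebra R₀ F]

theorem leftMulMatrix_basis_mem (hb : ∀ i j l, Algebra.leftMulMatrix b (b i) j l ∈
    (algebraMap R₀ F).range) (R : Type*) [CommRing R] [Algebra F R] (O : Subring R)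
    (hO : ∀ a : R₀, algebraMap F R (algebraMap R₀ F a) ∈ O) (i j l : Fin r) :
    Algebra.leftMulMatrix (Algebra.TensorProduct.basis R b)
      (Algebra.TensorProduct.basis R b i) j l ∈ O := by
  obtain ⟨a, ha⟩ := hb i j l
  rw [leftMulMatrix_tensorProduct]
  simp only [Basis.repr_self, Matrix.sum_apply, Matrix.smul_apply, Matrix.map_apply, smul_eq_mul]
  rw [Finset.sum_eq_single i]
  · rw [Finsupp.single_eq_same, one_mul, ← ha]
    exact hO a
  · intro i' _ hi'
    rw [Finsupp.single_eq_of_ne hi', zero_mul]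
  · simp

theorem repr_one_mem (h1 : ∀ i, b.repr 1 i ∈ (algebraMap R₀ F).range) (R : Type*) [CommRing R]
    [Algebra F R] (O : Subring R) (hO : ∀ a : R₀, algebraMap F R (algebraMap R₀ F a) ∈ O)
    (i : Fin r) : (Algebra.TensorProduct.basis R b).repr 1 i ∈ O := by
  obtain ⟨a, ha⟩ := h1 i
  rw [Algebra.TensorProduct.one_def, Algebra.TensorProduct.basis_repr_tmul]
  simp only [one_smul, Finsupp.mapRange_apply, ← ha]
  exact hO a

end BaseChange

section FiniteAdeles

open Module NumberField IsDedekindDomain HeightOneSpectrum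

variable (F : Type*) [Field F] [NumberField F]

/-- The projection of the finite adeles to the completion at `v`. -/
def adeleEval (v : HeightOneSpectrum (𝓞 F)) :
    FiniteAdeleRing (𝓞 F) F →ₐ[F] v.adicCompletion F where
  toFun a := a v
  map_one' := rfl
  map_mul' _ _ := rfl
  map_zero' := rfl
  map_add' _ _ := rfl
  commutes' _ := rfl

/-- The integral finite adeles. -/
def integralAdeles : Subring (FiniteAdeleRing (𝓞 F) F) where
  carrier := {a | ∀ v, a v ∈ v.adicCompletionIntegers F}
  zero_mem' v := zero_mem (v.adicCompletionIntegers F)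
  one_mem' v := one_mem (v.adicCompletionIntegers F)
  add_mem' ha hb v := add_mem (ha v) (hb v)
  mul_mem' ha hb v := mul_mem (ha v) (hb v)
  neg_mem' ha v := neg_mem (ha v)

theorem isOpen_integralAdeles : IsOpen (integralAdeles F : Set (FiniteAdeleRing (𝓞 F) F)) :=
  RestrictedProduct.isOpen_forall_mem (fun _ => Valued.isOpen_valuationSubring _)

theorem isCompact_integralAdeles :
    IsCompact (integralAdeles F : Set (FiniteAdeleRing (𝓞 F) F)) := by
  have h1 : ∀ v : HeightOneSpectrum (𝓞 F), CompactSpace (v.adicCompletionIntegers F) := fun v =>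
    isCompact_iff_compactSpace.1 (by
      have : (v.adicCompletionIntegers F : Set (v.adicCompletion F)) = Metric.closedBall 0 1 := by
        ext x
        rw [mem_closedBall_zero_iff]
        exact mem_adicCompletionIntegers_iff_norm_le_one v x
      rw [this]
      exact isCompact_closedBall 0 1)
  have h2 := isCompact_range (RestrictedProduct.isEmbedding_structureMap
    (R := fun v : HeightOneSpectrum (𝓞 F) => v.adicCompletion F)
    (A := fun v => (v.adicCompletionIntegers F : Set (v.adicCompletion F)))
    (𝓕 := Filter.cofinite)).continuous
  rw [RestrictedProduct.range_structureMap] at h2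
  exact h2

instance t2Space_finiteAdeleRing : T2Space (FiniteAdeleRing (𝓞 F) F) :=
  inferInstanceAs (T2Space (RestrictedProduct (fun v : HeightOneSpectrum (𝓞 F) =>
    v.adicCompletion F) (fun v => (v.adicCompletionIntegers F : Set (v.adicCompletion F)))
    Filter.cofinite))

variable {F}

theorem algebraMap_integer_mem (v : HeightOneSpectrum (𝓞 F)) (a : 𝓞 F) :
    algebraMap F (v.adicCompletion F) (algebraMap (𝓞 F) F a) ∈
      (v.adicCompletionIntegers F).toSubring :=
  coe_mem_adicCompletionIntegers v a

theorem algebraMap_integer_mem_integralAdeles (a : 𝓞 F) :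
    algebraMap F (FiniteAdeleRing (𝓞 F) F) (algebraMap (𝓞 F) F a) ∈ integralAdeles F :=
  fun v => coe_mem_adicCompletionIntegers v a

/-- The absolute value `∏_v ‖a_v‖_v` of a finite adele. -/
def finAbs (a : FiniteAdeleRing (𝓞 F) F) : ℝ := ∏' v, ‖a v‖

theorem finite_norm_ne_one {a : FiniteAdeleRing (𝓞 F) F} (ha : IsUnit a) :
    {v | ‖a v‖ ≠ 1}.Finite := by
  have h1 := (FiniteAdeleRing.isUnit_iff.1 ha).2
  rw [Filter.eventually_cofinite] at h1
  refine h1.subset fun v hv h2 => hv ?_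
  rw [FinitePlace.norm_def, h2, map_one, NNReal.coe_one]

/-- For a finite adele which is a unit outside `T` the product is finite. -/
theorem finAbs_eq_prod {a : FiniteAdeleRing (𝓞 F) F} (T : Finset (HeightOneSpectrum (𝓞 F)))
    (hT : ∀ v ∉ T, ‖a v‖ = 1) : finAbs a = ∏ v ∈ T, ‖a v‖ :=
  tprod_eq_prod hT

theorem finAbs_mul {a c : FiniteAdeleRing (𝓞 F) F} (ha : IsUnit a) (hc : IsUnit c) :
    finAbs (a * c) = finAbs a * finAbs c := by
  classical
  let T := (finite_norm_ne_one ha).toFinset ∪ (finite_norm_ne_one hc).toFinset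
  have h1 : ∀ v ∉ T, ‖a v‖ = 1 := fun v hv => by
    by_contra h
    exact hv (Finset.mem_union_left _ ((finite_norm_ne_one ha).mem_toFinset.2 h))
  have h2 : ∀ v ∉ T, ‖c v‖ = 1 := fun v hv => by
    by_contra h
    exact hv (Finset.mem_union_right _ ((finite_norm_ne_one hc).mem_toFinset.2 h))
  have h3 : ∀ v, ‖(a * c) v‖ = ‖a v‖ * ‖c v‖ := fun v => norm_mul _ _
  rw [finAbs_eq_prod T h1, finAbs_eq_prod T h2, finAbs_eq_prod T
    (fun v hv => by rw [h3, h1 v hv, h2 v hv, one_mul]), ← Finset.prod_mul_distrib]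
  exact Finset.prod_congr rfl fun v _ => h3 v

theorem finAbs_pow (a : FiniteAdeleRing (𝓞 F) F) (ha : IsUnit a) (n : ℕ) :
    finAbs (a ^ n) = finAbs a ^ n := by
  induction n with
  | zero =>
    rw [pow_zero, pow_zero, finAbs_eq_prod ∅ (fun v _ => ?_), Finset.prod_empty]
    exact norm_one
  | succ n ih => rw [pow_succ, pow_succ, finAbs_mul (ha.pow n) ha, ih]

theorem finAbs_pos {a : FiniteAdeleRing (𝓞 F) F} (ha : IsUnit a) : 0 < finAbs a := by
  rw [finAbs_eq_prod (finite_norm_ne_one ha).toFinset fun v hv => by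
    by_contra h
    exact hv ((finite_norm_ne_one ha).mem_toFinset.2 h)]
  exact Finset.prod_pos fun v _ => norm_pos_iff.2 ((FiniteAdeleRing.isUnit_iff.1 ha).1 v)

variable {A : Type*} [Ring A] [Algebra F A] {r : ℕ} (b : Basis (Fin r) F A)
  (hb : ∀ i j l, Algebra.leftMulMatrix b (b i) j l ∈ (algebraMap (𝓞 F) F).range)
  (h1 : ∀ i, b.repr 1 i ∈ (algebraMap (𝓞 F) F).range)

/-- The basis of `𝔤(𝔸_fin)` over the finite adeles given by a basis of `A`. -/
def finBasisAdele : Basis (Fin r) (FiniteAdeleRing (𝓞 F) F) (gFin F A) :=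
  Algebra.TensorProduct.basis (FiniteAdeleRing (𝓞 F) F) b

/-- The stabilizer `Λ̂^×` of the lattice `Λ̂ = ⊕ Ô b_i` in the group of finite adelic points. -/
def finOrderUnits : Subgroup (gFin F A)ˣ :=
  orderUnits (integralAdeles F) (finBasisAdele b)
    (leftMulMatrix_basis_mem b hb _ _ algebraMap_integer_mem_integralAdeles)
    (repr_one_mem b h1 _ _ algebraMap_integer_mem_integralAdeles)

/-- The local component of `Λ̂^×`. -/
def placeOrderUnits (v : HeightOneSpectrum (𝓞 F)) : Subgroup (v.adicCompletion F ⊗[F] A)ˣ :=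
  orderUnits (v.adicCompletionIntegers F).toSubring
    (Algebra.TensorProduct.basis (v.adicCompletion F) b)
    (leftMulMatrix_basis_mem b hb _ _ (algebraMap_integer_mem v))
    (repr_one_mem b h1 _ _ (algebraMap_integer_mem v))

/-- The projection to the component at `v`. -/
def unitsEval (v : HeightOneSpectrum (𝓞 F)) : (gFin F A)ˣ →* (v.adicCompletion F ⊗[F] A)ˣ :=
  Units.map (Algebra.TensorProduct.map (adeleEval F v) (AlgHom.id F A) :
    FiniteAdeleRing (𝓞 F) F ⊗[F] A →* v.adicCompletion F ⊗[F] A)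

theorem repr_unitsEval (v : HeightOneSpectrum (𝓞 F)) (g : (gFin F A)ˣ) (i : Fin r) :
    (Algebra.TensorProduct.basis (v.adicCompletion F) b).repr (unitsEval v g : _) i =
      (finBasisAdele b).repr (g : gFin F A) i v :=
  basis_repr_map b (adeleEval F v) (g : gFin F A) i

include b in
theorem norm_unitsEval (v : HeightOneSpectrum (𝓞 F)) (g : (gFin F A)ˣ) :
    Algebra.norm (v.adicCompletion F) (unitsEval v g : v.adicCompletion F ⊗[F] A) =
      Algebra.norm (FiniteAdeleRing (𝓞 F) F) (g : gFin F A) v :=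
  norm_map_tensorProduct b (adeleEval F v) (g : gFin F A)

theorem mem_finOrderUnits_iff {g : (gFin F A)ˣ} :
    g ∈ finOrderUnits b hb h1 ↔ ∀ v, unitsEval v g ∈ placeOrderUnits b hb h1 v := by
  simp only [finOrderUnits, placeOrderUnits, mem_orderUnits, ← map_inv, repr_unitsEval]
  exact ⟨fun h v => ⟨fun i => h.1 i v, fun i => h.2 i v⟩,
    fun h => ⟨fun i v => (h v).1 i, fun i v => (h v).2 i⟩⟩

theorem isUnit_norm_gFin (g : (gFin F A)ˣ) :
    IsUnit (Algebra.norm (FiniteAdeleRing (𝓞 F) F) (g : gFin F A)) :=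
  g.isUnit.map (Algebra.norm (FiniteAdeleRing (𝓞 F) F))

theorem finAbs_norm_mul (g g' : (gFin F A)ˣ) :
    finAbs (Algebra.norm (FiniteAdeleRing (𝓞 F) F) ((g * g' : (gFin F A)ˣ) : gFin F A)) =
      finAbs (Algebra.norm (FiniteAdeleRing (𝓞 F) F) (g : gFin F A)) *
        finAbs (Algebra.norm (FiniteAdeleRing (𝓞 F) F) (g' : gFin F A)) := by
  rw [Units.val_mul, map_mul, finAbs_mul (isUnit_norm_gFin g) (isUnit_norm_gFin g')]

theorem finAbs_norm_of_mem {g : (gFin F A)ˣ} (hg : g ∈ finOrderUnits b hb h1) :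
    finAbs (Algebra.norm (FiniteAdeleRing (𝓞 F) F) (g : gFin F A)) = 1 := by
  rw [finAbs_eq_prod ∅ fun v _ => ?_, Finset.prod_empty]
  rw [← norm_unitsEval b v g]
  exact norm_eq_one_of_mem_orderUnits (isResidueMap_placeReduction v) _ _ _
    ((mem_finOrderUnits_iff b hb h1).1 hg v)

end FiniteAdeles

/-! ### The product over the finite places -/

section EulerProduct

open Module NumberField IsDedekindDomain HeightOneSpectrum

variable {F : Type*} [Field F] [NumberField F]
  {A : Type*} [Ring A] [Algebra F A] {r : ℕ} (b : Basis (Fin r) F A)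
  (hb : ∀ i j l, Algebra.leftMulMatrix b (b i) j l ∈ (algebraMap (𝓞 F) F).range)
  (h1 : ∀ i, b.repr 1 i ∈ (algebraMap (𝓞 F) F).range)

/-- Summability of the nontrivial parts of the local factors. -/
theorem exists_summable_local_bound {τ : ℝ} (hτ : 1 < τ) :
    ∃ e : HeightOneSpectrum (𝓞 F) → ℝ, (∀ v, 0 ≤ e v) ∧ Summable e ∧
      ∀ v, ∀ S : Finset ((v.adicCompletion F ⊗[F] A)ˣ ⧸ placeOrderUnits b hb h1 v),
        (∀ c ∈ S, c ≠ ((1 : (v.adicCompletion F ⊗[F] A)ˣ) : _) ∧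
          ∀ i, (Algebra.TensorProduct.basis (v.adicCompletion F) b).repr (c.out : _) i ∈
            v.adicCompletionIntegers F) →
        ∑ c ∈ S, ‖Algebra.norm (v.adicCompletion F) (c.out : v.adicCompletion F ⊗[F] A)‖ ^ τ ≤
          e v := by
  choose e he0 he hS using fun v : HeightOneSpectrum (𝓞 F) =>
    exists_sum_rpow_norm_le (isResidueMap_placeReduction v)
      (Algebra.TensorProduct.basis (v.adicCompletion F) b)
      (leftMulMatrix_basis_mem b hb _ _ (algebraMap_integer_mem v))
      (repr_one_mem b h1 _ _ (algebraMap_integer_mem v)) hτ.le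
  refine ⟨e, he0, ?_, hS⟩
  refine Summable.of_norm_bounded_eventually
    (((summable_absNorm_rpow F hτ).mul_left (2 * r : ℝ))) ?_
  have hfin : {v : HeightOneSpectrum (𝓞 F) | Ideal.absNorm v.asIdeal ≤ 2 * r}.Finite :=
    (Ideal.finite_setOfPred_absNorm_le (S := 𝓞 F) (2 * r)).preimage
      (f := HeightOneSpectrum.asIdeal) fun v _ w _ h => HeightOneSpectrum.ext h
  refine Filter.eventually_cofinite.2 (hfin.subset fun v hv => ?_)
  by_contra hlt
  rw [Set.mem_ofPred_eq, not_le] at hlt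
  refine hv ?_
  have := he v (by rw [card_placeResidue]; exact hlt.le)
  rw [card_placeResidue] at this
  rwa [Real.norm_of_nonneg (he0 v)]

/-- The norm of a local class does not depend on the representative. -/
theorem norm_out_eq (v : HeightOneSpectrum (𝓞 F)) (g : (v.adicCompletion F ⊗[F] A)ˣ) :
    ‖Algebra.norm (v.adicCompletion F)
        (((g : (v.adicCompletion F ⊗[F] A)ˣ ⧸ placeOrderUnits b hb h1 v).out :
          (v.adicCompletion F ⊗[F] A)ˣ) : v.adicCompletion F ⊗[F] A)‖ =
      ‖Algebra.norm (v.adicCompletion F) (g : v.adicCompletion F ⊗[F] A)‖ := by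
  obtain ⟨u, hu⟩ := QuotientGroup.mk_out_eq_mul (placeOrderUnits b hb h1 v) g
  rw [hu, Units.val_mul, map_mul, norm_mul, norm_eq_one_of_mem_orderUnits
    (isResidueMap_placeReduction v) _ _ _ u.2, mul_one]

/-- Representatives of integral local classes are integral. -/
theorem repr_out_mem (v : HeightOneSpectrum (𝓞 F)) {g : (v.adicCompletion F ⊗[F] A)ˣ}
    (hg : ∀ i, (Algebra.TensorProduct.basis (v.adicCompletion F) b).repr (g : _) i ∈
      v.adicCompletionIntegers F) (i : Fin r) :
    (Algebra.TensorProduct.basis (v.adicCompletion F) b).repr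
      (((g : (v.adicCompletion F ⊗[F] A)ˣ ⧸ placeOrderUnits b hb h1 v).out :
          (v.adicCompletion F ⊗[F] A)ˣ) : v.adicCompletion F ⊗[F] A) i ∈
      v.adicCompletionIntegers F := by
  obtain ⟨u, hu⟩ := QuotientGroup.mk_out_eq_mul (placeOrderUnits b hb h1 v) g
  rw [hu, Units.val_mul]
  exact (basisOrder (v.adicCompletionIntegers F).toSubring
    (Algebra.TensorProduct.basis (v.adicCompletion F) b)
    (leftMulMatrix_basis_mem b hb _ _ (algebraMap_integer_mem v))
    (repr_one_mem b h1 _ _ (algebraMap_integer_mem v))).mul_mem hg u.2.1 i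

/-- The sum of the `|N|^τ` over the integral classes of `G(𝔸_fin)` modulo the units of the order
converges for `τ > 1`: it is bounded by the product of the local sums. -/
theorem exists_sum_finAbs_rpow_le {τ : ℝ} (hτ : 1 < τ) :
    ∃ C : ℝ, ∀ S : Finset ((gFin F A)ˣ ⧸ finOrderUnits b hb h1),
      (∀ c ∈ S, ∀ i, (finBasisAdele b).repr (c.out : gFin F A) i ∈ integralAdeles F) →
      ∑ c ∈ S, finAbs (Algebra.norm (FiniteAdeleRing (𝓞 F) F) (c.out : gFin F A)) ^ τ ≤ C := by
  classical
  obtain ⟨e, he0, hes, he⟩ := exists_summable_local_bound b hb h1 hτ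
  refine ⟨Real.exp (∑' v, e v), fun S hS => ?_⟩
  -- the places where some class of `S` has a norm which is not a unit
  let T : Finset (HeightOneSpectrum (𝓞 F)) :=
    S.biUnion fun c => (finite_norm_ne_one (isUnit_norm_gFin c.out)).toFinset
  have hT : ∀ c ∈ S, ∀ v ∉ T,
      ‖Algebra.norm (FiniteAdeleRing (𝓞 F) F) (c.out : gFin F A) v‖ = 1 := fun c hc v hv => by
    by_contra h
    exact hv (Finset.mem_biUnion.2 ⟨c, hc, (Set.Finite.mem_toFinset _).2 h⟩)
  let p : ∀ v : HeightOneSpectrum (𝓞 F), (gFin F A)ˣ ⧸ finOrderUnits b hb h1 →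
      (v.adicCompletion F ⊗[F] A)ˣ ⧸ placeOrderUnits b hb h1 v := fun v c =>
    (unitsEval v c.out : _)
  let w : ∀ v : HeightOneSpectrum (𝓞 F),
      (v.adicCompletion F ⊗[F] A)ˣ ⧸ placeOrderUnits b hb h1 v → ℝ := fun v c =>
    ‖Algebra.norm (v.adicCompletion F) (c.out : v.adicCompletion F ⊗[F] A)‖ ^ τ
  have hw : ∀ v c, w v (p v c) =
      ‖Algebra.norm (FiniteAdeleRing (𝓞 F) F) (c.out : gFin F A) v‖ ^ τ := fun v c => by
    simp only [w, p]
    rw [norm_out_eq, norm_unitsEval b]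
  have hint : ∀ c ∈ S, ∀ v i, (Algebra.TensorProduct.basis (v.adicCompletion F) b).repr
      (unitsEval v c.out : _) i ∈ v.adicCompletionIntegers F := fun c hc v i => by
    rw [repr_unitsEval]
    exact hS c hc i v
  -- outside `T` an integral class is trivial
  have hp : ∀ x ∈ S, ∀ y ∈ S, (∀ v ∈ T, p v x = p v y) → x = y := by
    intro x hx y hy hxy
    rw [← QuotientGroup.out_eq' x, ← QuotientGroup.out_eq' y, QuotientGroup.eq,
      mem_finOrderUnits_iff]
    intro v
    rw [map_mul, map_inv]
    by_cases hv : v ∈ T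
    · exact QuotientGroup.eq.1 (hxy v hv)
    · have hmem : ∀ c ∈ S, unitsEval v c.out ∈ placeOrderUnits b hb h1 v := fun c hc =>
        (mem_orderUnits_iff (isResidueMap_placeReduction v) _ _ _).2
          ⟨hint c hc v, by rw [norm_unitsEval b]; exact hT c hc v hv⟩
      exact mul_mem (inv_mem (hmem x hx)) (hmem y hy)
  calc ∑ c ∈ S, finAbs (Algebra.norm (FiniteAdeleRing (𝓞 F) F) (c.out : gFin F A)) ^ τ
      = ∑ c ∈ S, ∏ v ∈ T, w v (p v c) := by
        refine Finset.sum_congr rfl fun c hc => ?_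
        rw [finAbs_eq_prod T (hT c hc), ← Real.finsetProd_rpow _ _ fun v _ => norm_nonneg _]
        exact Finset.prod_congr rfl fun v _ => (hw v c).symm
    _ ≤ ∏ v ∈ T, ∑ y ∈ S.image (p v), w v y :=
        sum_prod_le_prod_sum S T p hp w fun v y => Real.rpow_nonneg (norm_nonneg _) _
    _ ≤ ∏ v ∈ T, Real.exp (e v) := by
        refine Finset.prod_le_prod (fun v _ => Finset.sum_nonneg fun y _ =>
          Real.rpow_nonneg (norm_nonneg _) _) fun v _ => ?_
        -- the trivial class contributes `1`, the other ones at most `e v`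
        have h2 : w v ((1 : (v.adicCompletion F ⊗[F] A)ˣ) : _) = 1 := by
          simp only [w]
          rw [norm_out_eq, Units.val_one, map_one, norm_one, Real.one_rpow]
        have h3 : ∑ y ∈ (S.image (p v)).erase ((1 : (v.adicCompletion F ⊗[F] A)ˣ) : _), w v y ≤
            e v := by
          refine he v _ fun c hc => ?_
          obtain ⟨hc1, hc2⟩ := Finset.mem_erase.1 hc
          obtain ⟨x, hx, rfl⟩ := Finset.mem_image.1 hc2
          exact ⟨hc1, repr_out_mem b hb h1 v (hint x hx v)⟩
        have h4 : ∑ y ∈ S.image (p v), w v y ≤ ∑ y ∈ insert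
            ((1 : (v.adicCompletion F ⊗[F] A)ˣ) :
              (v.adicCompletion F ⊗[F] A)ˣ ⧸ placeOrderUnits b hb h1 v)
            ((S.image (p v)).erase ((1 : (v.adicCompletion F ⊗[F] A)ˣ) : _)), w v y :=
          Finset.sum_le_sum_of_subset_of_nonneg (Finset.insert_erase_subset _ _)
            fun y _ _ => Real.rpow_nonneg (norm_nonneg _) _
        rw [Finset.sum_insert (Finset.notMem_erase _ _), h2] at h4
        have h5 := Real.add_one_le_exp (e v)
        linarith
    _ = Real.exp (∑ v ∈ T, e v) := (Real.exp_sum T e).symm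
    _ ≤ Real.exp (∑' v, e v) := Real.exp_le_exp.2 (hes.sum_le_tsum T fun v _ => he0 v)

end EulerProduct

/-! ### Compact sets of finite adelic points -/

section FiniteAdelicTopology

open Module NumberField IsDedekindDomain HeightOneSpectrum Topology

variable {F : Type*} [Field F] [NumberField F]

/-- Finite adeles have denominators. -/
theorem exists_mul_mem_integralAdeles (a : FiniteAdeleRing (𝓞 F) F) :
    ∃ N : 𝓞 F, N ≠ 0 ∧ algebraMap (𝓞 F) (FiniteAdeleRing (𝓞 F) F) N * a ∈ integralAdeles F := by
  classical
  have hfin : {v | a v ∉ v.adicCompletionIntegers F}.Finite := Filter.eventually_cofinite.1 a.2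
  choose c hc hac using fun v => adicCompletion.mul_nonZeroDivisor_mem_adicCompletionIntegers
    (R := 𝓞 F) (K := F) v (a v)
  refine ⟨∏ v ∈ hfin.toFinset, c v, Finset.prod_ne_zero_iff.2 fun v _ =>
    nonZeroDivisors.ne_zero (hc v), fun v => ?_⟩
  change (algebraMap F (v.adicCompletion F) (algebraMap (𝓞 F) F (∏ v ∈ hfin.toFinset, c v))) * a v ∈ _
  by_cases hv : v ∈ hfin.toFinset
  · rw [← Finset.prod_erase_mul _ _ hv, map_mul, map_mul, mul_assoc]
    refine mul_mem (coe_mem_adicCompletionIntegers v _) ?_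
    rw [mul_comm]
    exact hac v
  · exact mul_mem (coe_mem_adicCompletionIntegers v _)
      (not_not.1 fun h => hv (hfin.mem_toFinset.2 h))

variable {A : Type*} [Ring A] [Algebra F A]

instance isModuleTopology_gFin : IsModuleTopology (FiniteAdeleRing (𝓞 F) F) (gFin F A) := ⟨rfl⟩

variable {r : ℕ} (b : Basis (Fin r) F A)
  (hb : ∀ i j l, Algebra.leftMulMatrix b (b i) j l ∈ (algebraMap (𝓞 F) F).range)
  (h1 : ∀ i, b.repr 1 i ∈ (algebraMap (𝓞 F) F).range)

instance isTopologicalRing_gFin [Module.Finite F A] : IsTopologicalRing (gFin F A) := by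
  have : Module.Finite (FiniteAdeleRing (𝓞 F) F) (gFin F A) :=
    inferInstanceAs (Module.Finite (FiniteAdeleRing (𝓞 F) F) (FiniteAdeleRing (𝓞 F) F ⊗[F] A))
  exact IsModuleTopology.isTopologicalRing (FiniteAdeleRing (𝓞 F) F) (gFin F A)

theorem continuous_finBasisAdele_equivFun : Continuous (finBasisAdele b).equivFun :=
  IsModuleTopology.continuous_of_linearMap (finBasisAdele b).equivFun.toLinearMap

theorem continuous_finBasisAdele_equivFun_symm : Continuous (finBasisAdele b).equivFun.symm := by
  have : ContinuousAdd (gFin F A) := IsModuleTopology.toContinuousAdd (FiniteAdeleRing (𝓞 F) F) _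
  exact IsModuleTopology.continuous_of_linearMap (finBasisAdele b).equivFun.symm.toLinearMap

theorem continuous_finBasisAdele_repr (i : Fin r) :
    Continuous fun x : gFin F A => (finBasisAdele b).repr x i :=
  (continuous_apply i).comp (continuous_finBasisAdele_equivFun b)

instance t2Space_gFin [Module.Finite F A] : T2Space (gFin F A) :=
  T2Space.of_injective_continuous (finBasisAdele (finBasis F A)).equivFun.injective
    (continuous_finBasisAdele_equivFun (finBasis F A))

/-- The lattice `Λ̂` is compact. -/
theorem isCompact_finLattice :
    IsCompact {x : gFin F A | ∀ i, (finBasisAdele b).repr x i ∈ integralAdeles F} := by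
  have h := (isCompact_univ_pi fun _ : Fin r => isCompact_integralAdeles F).image
    (continuous_finBasisAdele_equivFun_symm b)
  convert h using 1
  ext x
  refine ⟨fun hx => ⟨(finBasisAdele b).equivFun x, fun i _ => hx i, by simp⟩, ?_⟩
  rintro ⟨y, hy, rfl⟩ i
  rw [← Basis.equivFun_apply, LinearEquiv.apply_symm_apply]
  exact hy i (Set.mem_univ i)

theorem isOpen_finLattice (a : FiniteAdeleRing (𝓞 F) F) :
    IsOpen {x : gFin F A | ∀ i, a * (finBasisAdele b).repr x i ∈ integralAdeles F} := by
  simp only [Set.ofPred_forall]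
  exact isOpen_iInter_of_finite fun i => (isOpen_integralAdeles F).preimage
    (continuous_const.mul (continuous_finBasisAdele_repr b i))

theorem isOpen_finOrderUnits : IsOpen (finOrderUnits b hb h1 : Set (gFin F A)ˣ) := by
  have h2 : IsOpen {x : gFin F A | ∀ i, (finBasisAdele b).repr x i ∈ integralAdeles F} := by
    simpa using isOpen_finLattice b 1
  have h3 := (h2.preimage (Units.continuous_val (M := gFin F A))).inter
    (h2.preimage (Units.continuous_coe_inv (M := gFin F A)))
  exact h3

theorem isCompact_finOrderUnits [Module.Finite F A] :
    IsCompact (finOrderUnits b hb h1 : Set (gFin F A)ˣ) :=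
  isCompact_units (isCompact_finLattice b)

/-- A compact set of finite adelic points is contained in `N⁻¹ Λ̂` for some `N`. -/
theorem exists_mul_repr_mem {K : Set (gFin F A)} (hK : IsCompact K) :
    ∃ N : 𝓞 F, N ≠ 0 ∧ ∀ x ∈ K, ∀ i,
      algebraMap (𝓞 F) (FiniteAdeleRing (𝓞 F) F) N * (finBasisAdele b).repr x i ∈
        integralAdeles F := by
  let U : {N : 𝓞 F // N ≠ 0} → Set (gFin F A) := fun N => {x | ∀ i,
    algebraMap (𝓞 F) (FiniteAdeleRing (𝓞 F) F) N * (finBasisAdele b).repr x i ∈ integralAdeles F}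
  have hmem : ∀ N : 𝓞 F, algebraMap (𝓞 F) (FiniteAdeleRing (𝓞 F) F) N ∈ integralAdeles F :=
    fun N => algebraMap_integer_mem_integralAdeles N
  have hmul : ∀ N M : {N : 𝓞 F // N ≠ 0}, U N ⊆ U ⟨M * N, mul_ne_zero M.2 N.2⟩ := by
    intro N M x hx i
    simp only [map_mul, mul_assoc]
    exact mul_mem (hmem M) (hx i)
  have : Nonempty {N : 𝓞 F // N ≠ 0} := ⟨⟨1, one_ne_zero⟩⟩
  -- the lattices `N⁻¹ Λ̂` are open and directed, and cover everything
  obtain ⟨N, hN⟩ := hK.elim_directed_cover U (fun N => isOpen_finLattice b _) (fun x _ => by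
      choose N hN0 hN using fun i => exists_mul_mem_integralAdeles ((finBasisAdele b).repr x i)
      refine Set.mem_iUnion.2 ⟨⟨∏ i, N i, Finset.prod_ne_zero_iff.2 fun i _ => hN0 i⟩, fun i => ?_⟩
      classical
      simp only
      rw [← Finset.prod_erase_mul _ _ (Finset.mem_univ i), map_mul, mul_assoc]
      exact mul_mem (hmem _) (hN i))
    (fun N M => ⟨⟨M * N, mul_ne_zero M.2 N.2⟩, hmul N M, by
      have := hmul M N
      simpa only [mul_comm] using this⟩)
  exact ⟨N.1, N.2, hN⟩

/-- The points of the group in a compact set of finite adelic points are contained in a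
right invariant set for which the sums of the `|N|^τ` over the classes converge. -/
theorem exists_rightInvariant_set {K : Set (gFin F A)} (hK : IsCompact K) :
    ∃ Y : Set (gFin F A)ˣ, (∀ y : (gFin F A)ˣ, (y : gFin F A) ∈ K → y ∈ Y) ∧
      (∀ y ∈ Y, ∀ u ∈ finOrderUnits b hb h1, y * u ∈ Y) ∧
      ∀ τ : ℝ, 1 < τ → ∃ C : ℝ, ∀ S : Finset ((gFin F A)ˣ ⧸ finOrderUnits b hb h1),
        (∀ c ∈ S, c.out ∈ Y) →
        ∑ c ∈ S, finAbs (Algebra.norm (FiniteAdeleRing (𝓞 F) F) (c.out : gFin F A)) ^ τ ≤ C := by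
  classical
  obtain ⟨N, hN0, hN⟩ := exists_mul_repr_mem b hK
  have hu : IsUnit (algebraMap F (FiniteAdeleRing (𝓞 F) F) (algebraMap (𝓞 F) F N)) :=
    (isUnit_iff_ne_zero.2 (by
      rwa [Ne, FaithfulSMul.algebraMap_eq_zero_iff])).map (algebraMap F (FiniteAdeleRing (𝓞 F) F))
  obtain ⟨g, hg⟩ : IsUnit (algebraMap (FiniteAdeleRing (𝓞 F) F) (gFin F A)
      (algebraMap (𝓞 F) (FiniteAdeleRing (𝓞 F) F) N)) := hu.map (algebraMap _ (gFin F A))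
  have hrepr : ∀ y : gFin F A, ∀ i, (finBasisAdele b).repr ((g : gFin F A) * y) i =
      algebraMap (𝓞 F) (FiniteAdeleRing (𝓞 F) F) N * (finBasisAdele b).repr y i := fun y i => by
    rw [hg, ← Algebra.smul_def, map_smul]
    rfl
  let Y : Set (gFin F A)ˣ := {y | ∀ i,
    (finBasisAdele b).repr ((g : gFin F A) * (y : gFin F A)) i ∈ integralAdeles F}
  have hY : ∀ y ∈ Y, ∀ u ∈ finOrderUnits b hb h1, y * u ∈ Y := fun y hy u hu' i => by
    rw [Units.val_mul, ← mul_assoc]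
    exact (basisOrder (integralAdeles F) (finBasisAdele b)
      (leftMulMatrix_basis_mem b hb _ _ algebraMap_integer_mem_integralAdeles)
      (repr_one_mem b h1 _ _ algebraMap_integer_mem_integralAdeles)).mul_mem hy hu'.1 i
  refine ⟨Y, fun y hy i => ?_, hY, fun τ hτ => ?_⟩
  · rw [hrepr]
    exact hN _ hy i
  obtain ⟨C, hC⟩ := exists_sum_finAbs_rpow_le b hb h1 hτ
  set a := finAbs (Algebra.norm (FiniteAdeleRing (𝓞 F) F) (g : gFin F A)) with ha
  have ha0 : 0 < a := finAbs_pos (isUnit_norm_gFin g)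
  refine ⟨a ^ (-τ) * C, fun S hS => ?_⟩
  -- multiplication by `g` moves the classes into the integral ones
  have hout : ∀ c : (gFin F A)ˣ ⧸ finOrderUnits b hb h1,
      ∃ u : finOrderUnits b hb h1, (g • c).out = g * c.out * u := fun c => by
    obtain ⟨u, hu'⟩ := QuotientGroup.mk_out_eq_mul (finOrderUnits b hb h1) (g * c.out)
    refine ⟨u, ?_⟩
    rw [← hu']
    congr 1
    conv_lhs => rw [← QuotientGroup.out_eq' c]
    rfl
  have h2 := hC (S.image fun c => g • c) fun c hc i => by
    obtain ⟨c₀, hc₀, rfl⟩ := Finset.mem_image.1 hc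
    obtain ⟨u, hu'⟩ := hout c₀
    rw [hu', mul_assoc]
    exact hY _ (hS c₀ hc₀) u u.2 i
  rw [Finset.sum_image fun c _ c' _ h => smul_left_cancel g h] at h2
  have h3 : ∀ c : (gFin F A)ˣ ⧸ finOrderUnits b hb h1,
      finAbs (Algebra.norm (FiniteAdeleRing (𝓞 F) F) (c.out : gFin F A)) ^ τ = a ^ (-τ) *
        finAbs (Algebra.norm (FiniteAdeleRing (𝓞 F) F) ((g • c).out : gFin F A)) ^ τ := fun c => by
    obtain ⟨u, hu'⟩ := hout c
    rw [hu', finAbs_norm_mul, finAbs_norm_mul, finAbs_norm_of_mem b hb h1 u.2, mul_one, ← ha,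
      Real.mul_rpow ha0.le (finAbs_pos (isUnit_norm_gFin _)).le, ← mul_assoc,
      ← Real.rpow_add ha0, neg_add_cancel, Real.rpow_zero, one_mul]
  rw [Finset.sum_congr rfl fun c _ => h3 c, ← Finset.mul_sum]
  exact mul_le_mul_of_nonneg_left h2 (Real.rpow_nonneg ha0.le _)

end FiniteAdelicTopology

/-! ### Haar measure on the unit group of a real algebra -/

section RealUnits

open Module MeasureTheory Topology
open scoped ENNReal

variable (E : Type*) [Ring E] [Algebra ℝ E] [Module.Finite ℝ E] [TopologicalSpace E]
  [IsTopologicalRing E] [ContinuousSMul ℝ E] [T2Space E]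

theorem continuous_coord : Continuous (coord E) :=
  (coord E).toLinearMap.continuous_of_finiteDimensional

omit [T2Space E] in
theorem continuous_coord_symm : Continuous (coord E).symm :=
  (coord E).symm.toLinearMap.continuous_of_finiteDimensional

theorem isModuleTopology_real : IsModuleTopology ℝ E :=
  IsModuleTopology.iso (A := Fin (finrank ℝ E) → ℝ)
    { (coord E).symm with
      continuous_toFun := continuous_coord_symm E
      continuous_invFun := continuous_coord E }

theorem continuous_algebraNorm_real : Continuous (Algebra.norm ℝ : E → ℝ) := by
  have h := (contDiff_algebraNorm_coord E).continuous.comp (continuous_coord E)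
  simpa only [Function.comp_def, LinearEquiv.symm_apply_apply] using h

/-- Units of a real algebra, in coordinates. -/
def unitCoord (g : Eˣ) : Fin (finrank ℝ E) → ℝ := coord E (g : E)

/-- The inverse of a unit is a continuous function of its coordinates by Cramer’s rule, so the
topology of the units is induced by the algebra. -/
theorem isOpenEmbedding_unitCoord : IsOpenEmbedding (unitCoord E) := by
  have := isModuleTopology_real E
  have h1 : IsEmbedding (Units.val : Eˣ → E) := by
    refine Units.isEmbedding_val_mk'
      (f := fun x => (Algebra.norm ℝ x)⁻¹ • normAdj (finBasis ℝ E) x) ?_ fun u => ?_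
    · refine ((continuous_algebraNorm_real E).continuousOn.inv₀ fun x hx =>
        (isUnit_iff_algebraNorm_ne_zero x).1 hx).smul (continuous_normAdj _).continuousOn
    · rw [← norm_smul_inv, smul_smul,
        inv_mul_cancel₀ ((isUnit_iff_algebraNorm_ne_zero _).1 u.isUnit), one_smul]
  let e : E ≃ₜ (Fin (finrank ℝ E) → ℝ) :=
    { (coord E).toEquiv with
      continuous_toFun := continuous_coord E
      continuous_invFun := continuous_coord_symm E }
  refine ⟨e.isEmbedding.comp h1, ?_⟩
  convert isOpen_units_coord E using 1
  ext c
  refine ⟨?_, fun ⟨g, hg⟩ => ⟨g, ?_⟩⟩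
  · rintro ⟨g, rfl⟩
    change IsUnit ((coord E).symm (coord E (g : E)))
    rw [LinearEquiv.symm_apply_apply]
    exact g.isUnit
  · change coord E (g : E) = c
    rw [hg, LinearEquiv.apply_symm_apply]

theorem locallyCompactSpace_units : LocallyCompactSpace Eˣ :=
  (isOpenEmbedding_unitCoord E).locallyCompactSpace

theorem secondCountableTopology_units : SecondCountableTopology Eˣ :=
  (isOpenEmbedding_unitCoord E).isEmbedding.secondCountableTopology

variable [MeasurableSpace Eˣ] [BorelSpace Eˣ]

/-- Lebesgue measure on the units of a real algebra. -/
def unitLebesgue : Measure Eˣ := (volume : Measure (Fin (finrank ℝ E) → ℝ)).comap (unitCoord E)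

/-- The Haar measure `|N(g)|⁻¹ dg`. -/
def unitHaar : Measure Eˣ :=
  (unitLebesgue E).withDensity fun g => ENNReal.ofReal |Algebra.norm ℝ (g : E)|⁻¹

omit [MeasurableSpace Eˣ] [BorelSpace Eˣ] in
theorem continuous_abs_algebraNorm_inv : Continuous fun g : Eˣ => |Algebra.norm ℝ (g : E)|⁻¹ :=
  ((continuous_algebraNorm_real E).comp Units.continuous_val).abs.inv₀ fun g =>
    abs_ne_zero.2 ((isUnit_iff_algebraNorm_ne_zero _).1 g.isUnit)

variable {E} in
/-- Left multiplication by `g` has determinant `N(g)`. -/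
theorem map_mul_left_unitLebesgue (g : Eˣ) : (unitLebesgue E).map (g * ·) =
    ENNReal.ofReal |Algebra.norm ℝ (g : E)|⁻¹ • unitLebesgue E := by
  have hme := (isOpenEmbedding_unitCoord E).measurableEmbedding
  let L : (Fin (finrank ℝ E) → ℝ) →ₗ[ℝ] (Fin (finrank ℝ E) → ℝ) :=
    (coord E).toLinearMap ∘ₗ Algebra.lmul ℝ E (g : E) ∘ₗ (coord E).symm.toLinearMap
  have hdet : LinearMap.det L = Algebra.norm ℝ (g : E) := by
    rw [Algebra.norm_apply]
    exact LinearMap.det_conj (Algebra.lmul ℝ E (g : E)) (coord E)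
  have hL := Real.map_linearMap_volume_pi_eq_smul_volume_pi (f := L) (by
    rw [hdet]
    exact (isUnit_iff_algebraNorm_ne_zero _).1 g.isUnit)
  have hLm : Measurable L := (LinearMap.continuous_of_finiteDimensional L).measurable
  have hgm : Measurable fun x : Eˣ => g * x := (continuous_const_mul g).measurable
  ext s hs
  rw [Measure.map_apply hgm hs, Measure.smul_apply, unitLebesgue, hme.comap_apply, hme.comap_apply]
  have himg : unitCoord E '' ((fun x => g * x) ⁻¹' s) = L ⁻¹' (unitCoord E '' s) := by
    have hLg : ∀ x : Eˣ, L (unitCoord E x) = unitCoord E (g * x) := fun x => by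
      simp [L, unitCoord]
    ext c
    constructor
    · rintro ⟨x, hx, rfl⟩
      exact ⟨g * x, hx, (hLg x).symm⟩
    · rintro ⟨y, hy, hyc⟩
      refine ⟨g⁻¹ * y, by simpa using hy, ?_⟩
      change coord E _ = c
      have h1 : (y : E) = (g : E) * (coord E).symm c := (coord E).injective hyc
      rw [Units.val_mul, h1, Units.inv_mul_cancel_left, LinearEquiv.apply_symm_apply]
  rw [himg, ← Measure.map_apply hLm (hme.measurableSet_image.2 hs), hL, hdet, Measure.smul_apply,
    abs_inv]

theorem isMulLeftInvariant_unitHaar : (unitHaar E).IsMulLeftInvariant where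
  map_mul_left_eq_self g := by
    have hgm : Measurable fun x : Eˣ => g * x := (continuous_const_mul g).measurable
    have hρ : Measurable fun x : Eˣ => ENNReal.ofReal |Algebra.norm ℝ (x : E)|⁻¹ :=
      (continuous_abs_algebraNorm_inv E).measurable.ennreal_ofReal
    have hg : 0 < |Algebra.norm ℝ (g : E)| :=
      abs_pos.2 ((isUnit_iff_algebraNorm_ne_zero _).1 g.isUnit)
    ext s hs
    rw [Measure.map_apply hgm hs, unitHaar, withDensity_apply _ (hgm hs), withDensity_apply _ hs]
    have h1 : ∀ x : Eˣ, ENNReal.ofReal |Algebra.norm ℝ (x : E)|⁻¹ =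
        ENNReal.ofReal |Algebra.norm ℝ (g : E)| *
          ENNReal.ofReal |Algebra.norm ℝ ((g * x : Eˣ) : E)|⁻¹ := fun x => by
      rw [← ENNReal.ofReal_mul hg.le, Units.val_mul, map_mul, abs_mul, mul_inv,
        mul_inv_cancel_left₀ hg.ne']
    rw [lintegral_congr h1, lintegral_const_mul _
      (f := fun x : Eˣ => ENNReal.ofReal |Algebra.norm ℝ ((g * x : Eˣ) : E)|⁻¹) (hρ.comp hgm)]
    have h2 := setLIntegral_map (μ := unitLebesgue E) hs hρ hgm
    rw [map_mul_left_unitLebesgue, Measure.restrict_smul, lintegral_smul_measure] at h2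
    rw [← h2, smul_eq_mul, ← mul_assoc, ← ENNReal.ofReal_mul hg.le, mul_inv_cancel₀ hg.ne',
      ENNReal.ofReal_one, one_mul]

theorem isHaarMeasure_unitHaar : (unitHaar E).IsHaarMeasure := by
  have := isMulLeftInvariant_unitHaar E
  have := locallyCompactSpace_units E
  have hj := isOpenEmbedding_unitCoord E
  have hfin : IsFiniteMeasureOnCompacts (unitLebesgue E) :=
    IsFiniteMeasureOnCompacts.comap' _ hj.continuous hj.measurableEmbedding
  have hpos : (unitLebesgue E).IsOpenPosMeasure := Measure.IsOpenPosMeasure.comap _ hj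
  have hloc : IsLocallyFiniteMeasure (unitHaar E) :=
    IsLocallyFiniteMeasure.withDensity_ofReal (continuous_abs_algebraNorm_inv E)
  have hac : unitLebesgue E ≪ unitHaar E := by
    refine withDensity_absolutelyContinuous'
      (continuous_abs_algebraNorm_inv E).measurable.ennreal_ofReal.aemeasurable
      (Filter.Eventually.of_forall fun g => ?_)
    rw [Ne, ENNReal.ofReal_eq_zero, not_le]
    exact inv_pos.2 (abs_pos.2 ((isUnit_iff_algebraNorm_ne_zero _).1 g.isUnit))
  have hpos' : (unitHaar E).IsOpenPosMeasure := hac.isOpenPosMeasure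
  exact { }

omit [TopologicalSpace E] [IsTopologicalRing E] [ContinuousSMul ℝ E] [T2Space E] [MeasurableSpace Eˣ]
  [BorelSpace Eˣ] in
/-- The norm of a real algebra grows polynomially. -/
theorem exists_abs_algebraNorm_le :
    ∃ (C : ℝ) (M : ℕ), 0 ≤ C ∧ ∀ c, |Algebra.norm ℝ ((coord E).symm c)| ≤ C * (1 + ‖c‖) ^ M := by
  obtain ⟨C, hC⟩ := ((isCompact_closedBall (0 : Fin (finrank ℝ E) → ℝ) 1).image
    (contDiff_algebraNorm_coord E).continuous.abs).bddAbove
  have hC0 : 0 ≤ C := (abs_nonneg _).trans (hC ⟨0, by simp, rfl⟩)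
  refine ⟨C, finrank ℝ E, hC0, fun c => ?_⟩
  have hs : 0 < 1 + ‖c‖ := by positivity
  have h1 : |Algebra.norm ℝ ((coord E).symm ((1 + ‖c‖)⁻¹ • c))| ≤ C := by
    refine hC ⟨_, ?_, rfl⟩
    rw [mem_closedBall_zero_iff, norm_smul, norm_inv, Real.norm_of_nonneg hs.le,
      inv_mul_le_iff₀ hs]
    linarith
  rw [map_smul, Algebra.norm_apply, map_smul, LinearMap.det_smul, abs_mul, abs_pow,
    abs_inv, abs_of_pos hs, inv_pow, inv_mul_le_iff₀ (by positivity), mul_comm] at h1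
  exact h1

/-- The integral of `|N(g)|^τ` against a rapidly decreasing function over the unit group, for a Haar
measure, converges for `τ ≥ 1`. -/
theorem exists_lintegral_norm_rpow_lt_top (μ : Measure Eˣ) [μ.IsMulLeftInvariant]
    [IsFiniteMeasureOnCompacts μ] {τ : ℝ} (hτ : 1 ≤ τ) :
    ∃ k : ℕ, ∫⁻ g : Eˣ, ENNReal.ofReal (((1 + ‖unitCoord E g‖) ^ k)⁻¹ *
      |Algebra.norm ℝ (g : E)| ^ τ) ∂μ < ⊤ := by
  have := isHaarMeasure_unitHaar E
  have := locallyCompactSpace_units E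
  have := secondCountableTopology_units E
  obtain ⟨C, M, hC0, hC⟩ := exists_abs_algebraNorm_le E
  have hme := (isOpenEmbedding_unitCoord E).measurableEmbedding
  -- the exponent compensates the growth of `|N|^(τ - 1)` and leaves an integrable function
  obtain ⟨a, ha⟩ := exists_nat_ge (M * (τ - 1))
  refine ⟨a + finrank ℝ E + 1, ?_⟩
  -- by uniqueness, the measure is a multiple of `|N(g)|⁻¹ dg`
  rw [Measure.isMulLeftInvariant_eq_smul μ (unitHaar E)]
  have hmeas : Measurable fun g : Eˣ => ENNReal.ofReal (((1 + ‖unitCoord E g‖) ^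
      (a + finrank ℝ E + 1))⁻¹ * |Algebra.norm ℝ (g : E)| ^ τ) := by
    refine (Continuous.measurable ?_).ennreal_ofReal
    have h1 : Continuous fun g : Eˣ => unitCoord E g := (isOpenEmbedding_unitCoord E).continuous
    have h2 : Continuous fun g : Eˣ => |Algebra.norm ℝ (g : E)| :=
      ((continuous_algebraNorm_real E).comp Units.continuous_val).abs
    refine (((h1.norm.const_add 1).pow _).inv₀ fun g => ?_).mul
      (h2.rpow_const fun g => Or.inr (by linarith))
    exact pow_ne_zero _ (by positivity)
  refine (lintegral_smul_measure _ _).trans_lt (ENNReal.mul_lt_top ENNReal.coe_lt_top ?_)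
  rw [unitHaar, lintegral_withDensity_eq_lintegral_mul _
    (continuous_abs_algebraNorm_inv E).measurable.ennreal_ofReal hmeas]
  let W : (Fin (finrank ℝ E) → ℝ) → ℝ≥0∞ := fun c =>
    ENNReal.ofReal (C ^ (τ - 1)) * ENNReal.ofReal ((1 + ‖c‖) ^ (-((finrank ℝ E : ℝ) + 1)))
  calc _ ≤ ∫⁻ g : Eˣ, W (unitCoord E g) ∂(unitLebesgue E) := by
        refine lintegral_mono fun g => ?_
        have hg : 0 < |Algebra.norm ℝ (g : E)| :=
          abs_pos.2 ((isUnit_iff_algebraNorm_ne_zero _).1 g.isUnit)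
        have hs : 1 ≤ 1 + ‖unitCoord E g‖ := by
          have := norm_nonneg (unitCoord E g)
          linarith
        have hs0 : 0 < 1 + ‖unitCoord E g‖ := by linarith
        simp only [Pi.mul_apply, W]
        rw [← ENNReal.ofReal_mul (by positivity), ← ENNReal.ofReal_mul (by positivity)]
        refine ENNReal.ofReal_le_ofReal ?_
        have h1 : |Algebra.norm ℝ (g : E)|⁻¹ * |Algebra.norm ℝ (g : E)| ^ τ =
            |Algebra.norm ℝ (g : E)| ^ (τ - 1) := by
          rw [Real.rpow_sub hg, Real.rpow_one, div_eq_inv_mul]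
        have h2 : |Algebra.norm ℝ (g : E)| ^ (τ - 1) ≤
            C ^ (τ - 1) * (1 + ‖unitCoord E g‖) ^ (a : ℝ) := by
          have h3 := hC (unitCoord E g)
          rw [unitCoord, LinearEquiv.symm_apply_apply] at h3
          refine (Real.rpow_le_rpow hg.le h3 (by linarith)).trans ?_
          rw [Real.mul_rpow hC0 (by positivity), ← Real.rpow_natCast_mul (by positivity)]
          exact mul_le_mul_of_nonneg_left (Real.rpow_le_rpow_of_exponent_le hs ha)
            (by positivity)
        have h4 : (1 + ‖unitCoord E g‖) ^ (-((finrank ℝ E : ℝ) + 1)) =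
            ((1 + ‖unitCoord E g‖) ^ (a + finrank ℝ E + 1))⁻¹ *
              (1 + ‖unitCoord E g‖) ^ (a : ℝ) := by
          rw [← Real.rpow_natCast, ← Real.rpow_neg hs0.le, ← Real.rpow_add hs0]
          congr 1
          push_cast
          ring
        rw [mul_left_comm, h1, h4, mul_left_comm]
        exact mul_le_mul_of_nonneg_left h2 (by positivity)
    _ = ∫⁻ c in Set.range (unitCoord E), W c := by
        rw [← hme.lintegral_map, unitLebesgue, hme.map_comap]
    _ ≤ ∫⁻ c, W c := setLIntegral_le_lintegral _ _
    _ < ⊤ := by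
        have hm : Measurable fun c : Fin (finrank ℝ E) → ℝ =>
            ENNReal.ofReal ((1 + ‖c‖) ^ (-((finrank ℝ E : ℝ) + 1))) := by fun_prop
        rw [lintegral_const_mul _ hm]
        refine ENNReal.mul_lt_top ENNReal.ofReal_lt_top (finite_integral_one_add_norm ?_)
        simp

end RealUnits

/-! ### Archimedean points over a number field -/

section InfiniteAdeles

open Module NumberField NumberField.InfinitePlace NumberField.InfinitePlace.Completion Topology

theorem algebraNorm_prod {R B C : Type*} [CommRing R] [Ring B] [Ring C] [Algebra R B] [Algebra R C]
    [Module.Free R B] [Module.Finite R B] [Module.Free R C] [Module.Finite R C] (x : B × C) :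
    Algebra.norm R x = Algebra.norm R x.1 * Algebra.norm R x.2 := by
  rw [Algebra.norm_apply, Algebra.norm_apply, Algebra.norm_apply, ← LinearMap.det_prodMap]
  rfl

theorem algebraNorm_pi {R B ι : Type*} [CommRing R] [Ring B] [Algebra R B] [Module.Free R B]
    [Module.Finite R B] [Fintype ι] (x : ι → B) :
    Algebra.norm R x = ∏ i, Algebra.norm R (x i) := by
  simp only [Algebra.norm_apply]
  rw [← LinearMap.det_pi]
  rfl

variable (F : Type*) [Field F] [NumberField F]

instance algebraRealInfiniteAdeleRing : Algebra ℝ (InfiniteAdeleRing F) := (realToInf F).toAlgebra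

/-- The isomorphism of `F_∞` with `ℝ^{r₁} × ℂ^{r₂}`, as real algebras. -/
def infiniteAdeleEquiv : InfiniteAdeleRing F ≃ₐ[ℝ] mixedEmbedding.mixedSpace F :=
  AlgEquiv.ofRingEquiv (f := InfiniteAdeleRing.ringEquiv_mixedSpace F) fun r =>
    (InfiniteAdeleRing.ringEquiv_mixedSpace F).apply_symm_apply (algebraMap ℝ _ r)

omit [NumberField F] in
theorem infiniteAdeleEquiv_apply (x : InfiniteAdeleRing F) :
    infiniteAdeleEquiv F x =
      (fun v : {w : InfinitePlace F // IsReal w} => extensionEmbeddingOfIsReal v.2 (x v),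
       fun v : {w : InfinitePlace F // IsComplex w} => extensionEmbedding v.1 (x v)) := rfl

instance finite_infiniteAdeleRing : Module.Finite ℝ (InfiniteAdeleRing F) :=
  Module.Finite.equiv (infiniteAdeleEquiv F).symm.toLinearEquiv

omit [NumberField F] in
theorem norm_extensionEmbedding_apply {v : InfinitePlace F} (x : v.Completion) :
    ‖extensionEmbedding v x‖ = ‖x‖ := by
  simpa using (isometry_extensionEmbedding v).norm_map_of_map_zero (map_zero _) x

omit [NumberField F] in
theorem norm_extensionEmbeddingOfIsReal_apply {v : InfinitePlace F} (hv : v.IsReal)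
    (x : v.Completion) : ‖extensionEmbeddingOfIsReal hv x‖ = ‖x‖ := by
  simpa using (isometry_extensionEmbeddingOfIsReal hv).norm_map_of_map_zero (map_zero _) x

/-- The adelic absolute value on `F_∞` is the absolute value of the norm to `ℝ`. -/
theorem abs_norm_infiniteAdele (x : InfiniteAdeleRing F) : |Algebra.norm ℝ x| = ‖x‖ := by
  classical
  rw [← Algebra.norm_eq_of_algEquiv (infiniteAdeleEquiv F) x, algebraNorm_prod, algebraNorm_pi,
    algebraNorm_pi, InfiniteAdeleRing.norm_def, prod_eq_prod_mul_prod, abs_mul, Finset.abs_prod,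
    Finset.abs_prod]
  congr 1
  · refine Finset.prod_congr rfl fun v _ => ?_
    rw [IsReal.mult_eq_one v.2, pow_one, Algebra.norm_self, MonoidHom.id_apply, infiniteAdeleEquiv_apply,
      ← Real.norm_eq_abs, norm_extensionEmbeddingOfIsReal_apply]
  · refine Finset.prod_congr rfl fun v _ => ?_
    rw [IsComplex.mult_eq_two v.2, Algebra.norm_complex_apply, infiniteAdeleEquiv_apply,
      Complex.normSq_eq_norm_sq, abs_pow, abs_norm, norm_extensionEmbedding_apply]

omit [NumberField F] in
theorem continuous_realToInf : Continuous (realToInf F) := by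
  have h : ∀ r : ℝ, infiniteAdeleEquiv F (realToInf F r) = algebraMap ℝ _ r := fun r =>
    (InfiniteAdeleRing.ringEquiv_mixedSpace F).apply_symm_apply (algebraMap ℝ _ r)
  -- each component is an isometric embedding of `ℝ`
  have hn : ∀ (v : InfinitePlace F) (r : ℝ), ‖realToInf F r v‖ = ‖r‖ := fun v r => by
    have h1 := h r
    rw [infiniteAdeleEquiv_apply, Prod.ext_iff] at h1
    by_cases hv : v.IsReal
    · have h2 : extensionEmbeddingOfIsReal hv (realToInf F r v) = r := congrFun h1.1 ⟨v, hv⟩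
      rw [← norm_extensionEmbeddingOfIsReal_apply F hv, h2]
    · have h2 : extensionEmbedding v (realToInf F r v) = (r : ℂ) :=
        congrFun h1.2 ⟨v, not_isReal_iff_isComplex.1 hv⟩
      rw [← norm_extensionEmbedding_apply F, h2, Complex.norm_real]
  refine continuous_pi fun v => ?_
  let φ : ℝ →+ v.Completion :=
    ((Pi.evalRingHom (fun v : InfinitePlace F => v.Completion) v).comp (realToInf F)).toAddMonoidHom
  exact (AddMonoidHomClass.isometry_of_norm φ (hn v)).continuous

instance t2Space_infiniteAdeleRing : T2Space (InfiniteAdeleRing F) :=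
  inferInstanceAs (T2Space ((v : InfinitePlace F) → v.Completion))

variable (A : Type*) [Ring A] [Algebra F A]

instance isScalarTower_gInf : IsScalarTower ℝ (InfiniteAdeleRing F) (gInf F A) :=
  IsScalarTower.of_algebraMap_eq' rfl

instance isModuleTopology_gInf : IsModuleTopology (InfiniteAdeleRing F) (gInf F A) := ⟨rfl⟩

instance continuousSMul_gInf : ContinuousSMul ℝ (gInf F A) where
  continuous_smul := by
    have h : Continuous fun p : ℝ × gInf F A => realToInf F p.1 • p.2 :=
      ((continuous_realToInf F).comp continuous_fst).smul continuous_snd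
    exact h.congr fun p => algebraMap_smul (InfiniteAdeleRing F) p.1 p.2

variable [Module.Finite F A]

instance finite_gInf : Module.Finite (InfiniteAdeleRing F) (gInf F A) :=
  inferInstanceAs (Module.Finite (InfiniteAdeleRing F) (InfiniteAdeleRing F ⊗[F] A))

instance free_gInf : Module.Free (InfiniteAdeleRing F) (gInf F A) :=
  inferInstanceAs (Module.Free (InfiniteAdeleRing F) (InfiniteAdeleRing F ⊗[F] A))

instance isTopologicalRing_gInf : IsTopologicalRing (gInf F A) :=
  IsModuleTopology.isTopologicalRing (InfiniteAdeleRing F) (gInf F A)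

instance t2Space_gInf : T2Space (gInf F A) := by
  let b := Module.Free.chooseBasis (InfiniteAdeleRing F) (gInf F A)
  exact T2Space.of_injective_continuous b.equivFun.injective
    (IsModuleTopology.continuous_of_linearMap b.equivFun.toLinearMap)

theorem abs_norm_gInf (x : gInf F A) :
    |Algebra.norm ℝ x| = ‖Algebra.norm (InfiniteAdeleRing F) x‖ := by
  rw [← abs_norm_infiniteAdele, Algebra.norm_norm]

end InfiniteAdeles

/-! ### Integration over the adelic group -/

section AdelicIntegral

open Module NumberField IsDedekindDomain MeasureTheory Topology
open scoped ENNReal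

variable {F : Type*} [Field F] [NumberField F] {A : Type*} [Ring A] [Algebra F A]
  [Module.Finite F A]

instance isTopologicalGroup_GAdele : IsTopologicalGroup (GAdele F A) :=
  inferInstanceAs (IsTopologicalGroup ((gInf F A)ˣ × (gFin F A)ˣ))

omit [Module.Finite F A] in
theorem continuous_GAdele_fst : Continuous fun g : GAdele F A => g.1 :=
  continuous_fst (X := (gInf F A)ˣ) (Y := (gFin F A)ˣ)

omit [Module.Finite F A] in
theorem continuous_GAdele_snd : Continuous fun g : GAdele F A => g.2 :=
  continuous_snd (X := (gInf F A)ˣ) (Y := (gFin F A)ˣ)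

variable (μ : Measure (GAdele F A)) (J : Subgroup (gFin F A)ˣ)

section

variable [MeasurableSpace (gInf F A)ˣ] [BorelSpace (gInf F A)ˣ]

/-- The measure `X ↦ μ(X × J)` on the archimedean part of the adelic group. -/
def infMeasure : Measure (gInf F A)ˣ :=
  (μ.restrict {g : GAdele F A | g.2 ∈ J}).map fun g => g.1

variable {J} (hJ : IsOpen (J : Set (gFin F A)ˣ))

include hJ in
omit [Module.Finite F A] [MeasurableSpace (gInf F A)ˣ] [BorelSpace (gInf F A)ˣ] in
theorem measurableSet_snd_mem : MeasurableSet {g : GAdele F A | g.2 ∈ J} :=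
  (hJ.preimage continuous_GAdele_snd).measurableSet

/-- Translation by an archimedean element preserves the condition `g_fin ∈ J`. -/
theorem isMulLeftInvariant_infMeasure (J : Subgroup (gFin F A)ˣ) [μ.IsMulLeftInvariant] :
    (infMeasure μ J).IsMulLeftInvariant where
  map_mul_left_eq_self x := by
    ext s hs
    have hfst : Measurable fun g : GAdele F A => g.1 := continuous_GAdele_fst.measurable
    have hx : Measurable fun y : (gInf F A)ˣ => x * y := (continuous_const_mul x).measurable
    rw [Measure.map_apply hx hs, infMeasure, Measure.map_apply hfst (hx hs),
      Measure.map_apply hfst hs, Measure.restrict_apply (hfst (hx hs)),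
      Measure.restrict_apply (hfst hs)]
    rw [← measure_preimage_mul μ ((x, 1) : GAdele F A)
      ((fun g : GAdele F A => g.1) ⁻¹' s ∩ {g | g.2 ∈ J})]
    congr 1
    ext g
    change x * g.1 ∈ s ∧ g.2 ∈ J ↔ x * g.1 ∈ s ∧ 1 * g.2 ∈ J
    rw [one_mul]

theorem isFiniteMeasureOnCompacts_infMeasure [IsFiniteMeasureOnCompacts μ]
    (hJc : IsCompact (J : Set (gFin F A)ˣ)) : IsFiniteMeasureOnCompacts (infMeasure μ J) where
  lt_top_of_isCompact K hK := by
    have hfst : Measurable fun g : GAdele F A => g.1 := continuous_GAdele_fst.measurable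
    rw [infMeasure, Measure.map_apply hfst hK.measurableSet,
      Measure.restrict_apply (hfst hK.measurableSet)]
    have h : IsCompact ({g | g.1 ∈ K ∧ g.2 ∈ J} : Set (GAdele F A)) := hK.prod hJc
    exact h.measure_lt_top

include hJ in
/-- The integral of a product function which is right invariant in the finite variable is bounded by
a sum over the classes. -/
theorem lintegral_mul_le_tsum [μ.IsMulLeftInvariant] {Y : Set (gFin F A)ˣ}
    (hY : ∀ y ∈ Y, ∀ j ∈ J, y * j ∈ Y) {u : (gInf F A)ˣ → ℝ≥0∞} (hu : Measurable u)
    {w : (gFin F A)ˣ → ℝ≥0∞} (hw : ∀ y, ∀ j ∈ J, w (y * j) = w y)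
    (hc : {c : (gFin F A)ˣ ⧸ J | c.out ∈ Y}.Countable) :
    ∫⁻ g in {g : GAdele F A | g.2 ∈ Y}, u g.1 * w g.2 ∂μ ≤
      ∑' c : {c : (gFin F A)ˣ ⧸ J | c.out ∈ Y}, w c.1.out * ∫⁻ x, u x ∂(infMeasure μ J) := by
  have := hc.to_subtype
  have hfst : Measurable fun g : GAdele F A => g.1 := continuous_GAdele_fst.measurable
  have hJm : MeasurableSet {g : GAdele F A | g.2 ∈ J} := measurableSet_snd_mem hJ
  -- the set is covered by the cosets of `J`, each of which is translated to `J`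
  have hcov : {g : GAdele F A | g.2 ∈ Y} ⊆ ⋃ c : {c : (gFin F A)ˣ ⧸ J | c.out ∈ Y},
      {g : GAdele F A | c.1.out⁻¹ * g.2 ∈ J} := fun g hg => by
    refine Set.mem_iUnion.2 ⟨⟨(g.2 : (gFin F A)ˣ ⧸ J), ?_⟩, ?_⟩
    · obtain ⟨j, hj⟩ := QuotientGroup.mk_out_eq_mul J g.2
      rw [Set.mem_ofPred_eq, hj]
      exact hY _ hg j j.2
    · exact QuotientGroup.eq.1 (QuotientGroup.out_eq' _)
  refine (lintegral_mono_set hcov).trans ((lintegral_iUnion_le _ _).trans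
    (ENNReal.tsum_le_tsum fun c => le_of_eq ?_))
  let γ : GAdele F A := (1, c.1.out⁻¹)
  have hmul : Measurable fun g : GAdele F A => γ * g := (continuous_const_mul γ).measurable
  have hS : MeasurableSet {g : GAdele F A | c.1.out⁻¹ * g.2 ∈ J} := hmul hJm
  have h1 : ∀ g ∈ {g : GAdele F A | c.1.out⁻¹ * g.2 ∈ J}, u g.1 * w g.2 = w c.1.out * u g.1 :=
    fun g hg => by
      have h := hw c.1.out _ hg
      rw [mul_inv_cancel_left] at h
      rw [h, mul_comm]
  rw [setLIntegral_congr_fun hS h1, lintegral_const_mul (f := fun g : GAdele F A => u g.1) _ (hu.comp hfst),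
    infMeasure,
    lintegral_map hu hfst]
  congr 1
  rw [← lintegral_indicator hS, ← lintegral_indicator hJm]
  refine Eq.trans (lintegral_congr fun g => ?_) (lintegral_mul_left_eq_self _ γ)
  have h2 : (γ * g).1 = g.1 := one_mul g.1
  by_cases hg : c.1.out⁻¹ * g.2 ∈ J
  · refine (Set.indicator_of_mem (by exact hg) _).trans (Eq.trans ?_
      (Set.indicator_of_mem (a := γ * g) (by exact hg) fun g : GAdele F A => u g.1).symm)
    exact (congrArg u h2).symm
  · exact (Set.indicator_of_notMem (by exact hg) _).trans
      (Set.indicator_of_notMem (a := γ * g) (by exact hg) fun g : GAdele F A => u g.1).symm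

end

/-- The adelic absolute value of the norm of a point of the group. -/
def adeleNorm (g : GAdele F A) : ℝ :=
  |Algebra.norm ℝ (g.1 : gInf F A)| *
    finAbs (Algebra.norm (FiniteAdeleRing (𝓞 F) F) (g.2 : gFin F A))

theorem adeleNorm_pos (g : GAdele F A) : 0 < adeleNorm g :=
  mul_pos (abs_pos.2 ((isUnit_iff_algebraNorm_ne_zero _).1 g.1.isUnit))
    (finAbs_pos (isUnit_norm_gFin g.2))

/-- This function is locally constant, being invariant under the units of an order. -/
theorem continuous_finAbs_norm [Nontrivial A] : Continuous fun y : (gFin F A)ˣ =>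
    finAbs (Algebra.norm (FiniteAdeleRing (𝓞 F) F) (y : gFin F A)) := by
  obtain ⟨b, hb, h1⟩ := exists_integral_basis (𝓞 F) F A
  refine IsLocallyConstant.continuous ((IsLocallyConstant.iff_eventually_eq _).2 fun y => ?_)
  have hn : (fun z => y⁻¹ * z) ⁻¹' (finOrderUnits b hb h1 : Set (gFin F A)ˣ) ∈ 𝓝 y :=
    ((isOpen_finOrderUnits b hb h1).preimage (continuous_const_mul y⁻¹)).mem_nhds
      (by rw [Set.mem_preimage, inv_mul_cancel]; exact one_mem _)
  filter_upwards [hn] with z hz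
  rw [← mul_inv_cancel_left y z, finAbs_norm_mul, finAbs_norm_of_mem b hb h1 hz, mul_one]

theorem continuous_adeleNorm [Nontrivial A] : Continuous (adeleNorm (F := F) (A := A)) :=
  ((continuous_algebraNorm_real (gInf F A)).comp
    (Units.continuous_val.comp continuous_GAdele_fst)).abs.mul
    (continuous_finAbs_norm.comp continuous_GAdele_snd)

/-- Absolute convergence: a rapidly decreasing function of the archimedean variable, with compact
support in the finite variable, has a finite integral against `|N|^τ` for `τ > 1`. -/
theorem exists_lintegral_adeleNorm_rpow_lt_top [Nontrivial A] [μ.IsMulLeftInvariant]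
    [IsFiniteMeasureOnCompacts μ] {K : Set (gFin F A)} (hK : IsCompact K) {τ : ℝ} (hτ : 1 < τ) :
    ∃ k : ℕ, ∫⁻ g in {g : GAdele F A | (g.2 : gFin F A) ∈ K},
      ENNReal.ofReal (((1 + ‖unitCoord (gInf F A) g.1‖) ^ k)⁻¹ * adeleNorm g ^ τ) ∂μ < ⊤ := by
  borelize (gInf F A)ˣ
  obtain ⟨b, hb, h1⟩ := exists_integral_basis (𝓞 F) F A
  have hJ := isOpen_finOrderUnits b hb h1
  have hJc := isCompact_finOrderUnits b hb h1
  obtain ⟨Y, hKY, hY, hsum⟩ := exists_rightInvariant_set b hb h1 hK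
  obtain ⟨C, hC⟩ := hsum τ hτ
  have := isMulLeftInvariant_infMeasure μ (finOrderUnits b hb h1)
  have := isFiniteMeasureOnCompacts_infMeasure μ hJc
  obtain ⟨k, hk⟩ := exists_lintegral_norm_rpow_lt_top (gInf F A)
    (infMeasure μ (finOrderUnits b hb h1)) hτ.le
  set u : (gInf F A)ˣ → ℝ≥0∞ := fun x => ENNReal.ofReal (((1 + ‖unitCoord (gInf F A) x‖) ^ k)⁻¹ *
    |Algebra.norm ℝ (x : gInf F A)| ^ τ) with hu
  set w : (gFin F A)ˣ → ℝ≥0∞ := fun y => ENNReal.ofReal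
    (finAbs (Algebra.norm (FiniteAdeleRing (𝓞 F) F) (y : gFin F A)) ^ τ) with hw
  have hum : Measurable u := by
    refine (Continuous.measurable ?_).ennreal_ofReal
    have h1 : Continuous fun g => unitCoord (gInf F A) g :=
      (isOpenEmbedding_unitCoord (gInf F A)).continuous
    have h2 : Continuous fun g : (gInf F A)ˣ => |Algebra.norm ℝ (g : gInf F A)| :=
      ((continuous_algebraNorm_real (gInf F A)).comp Units.continuous_val).abs
    refine (((h1.norm.const_add 1).pow _).inv₀ fun g => ?_).mul
      (h2.rpow_const fun g => Or.inr (by linarith))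
    exact pow_ne_zero _ (by positivity)
  have hwinv : ∀ y, ∀ j ∈ finOrderUnits b hb h1, w (y * j) = w y := fun y j hj => by
    simp only [hw]
    rw [finAbs_norm_mul, finAbs_norm_of_mem b hb h1 hj, mul_one]
  have hw0 : ∀ y, w y ≠ 0 := fun y => by
    rw [hw, Ne, ENNReal.ofReal_eq_zero, not_le]
    exact Real.rpow_pos_of_pos (finAbs_pos (isUnit_norm_gFin y)) τ
  -- the sum over the classes converges, hence there are countably many of them
  have htsum : ∑' c : {c : (gFin F A)ˣ ⧸ finOrderUnits b hb h1 | c.out ∈ Y}, w c.1.out ≤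
      ENNReal.ofReal C := by
    rw [ENNReal.tsum_eq_iSup_sum]
    refine iSup_le fun S => ?_
    rw [← ENNReal.ofReal_sum_of_nonneg fun c _ =>
      (Real.rpow_pos_of_pos (finAbs_pos (isUnit_norm_gFin _)) τ).le]
    refine ENNReal.ofReal_le_ofReal ?_
    have h := hC (S.map (Function.Embedding.subtype _)) fun c hc => by
      obtain ⟨c, -, rfl⟩ := Finset.mem_map.1 hc
      exact c.2
    rwa [Finset.sum_map] at h
  have hcount : {c : (gFin F A)ˣ ⧸ finOrderUnits b hb h1 | c.out ∈ Y}.Countable := by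
    have h := Summable.countable_support_ennreal (htsum.trans_lt ENNReal.ofReal_lt_top).ne
    rw [Function.support_eq_univ fun c => hw0 _] at h
    exact Set.countable_coe_iff.1 (Set.countable_univ_iff.1 h)
  refine ⟨k, ?_⟩
  calc _ ≤ ∫⁻ g in {g : GAdele F A | g.2 ∈ Y},
        ENNReal.ofReal (((1 + ‖unitCoord (gInf F A) g.1‖) ^ k)⁻¹ * adeleNorm g ^ τ) ∂μ :=
        lintegral_mono_set fun g hg => hKY g.2 hg
    _ = ∫⁻ g in {g : GAdele F A | g.2 ∈ Y}, u g.1 * w g.2 ∂μ := by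
        refine lintegral_congr fun g => ?_
        rw [hu, hw, ← ENNReal.ofReal_mul (by positivity), adeleNorm,
          Real.mul_rpow (abs_nonneg _) (finAbs_pos (isUnit_norm_gFin g.2)).le, mul_assoc]
    _ ≤ _ := lintegral_mul_le_tsum μ hJ hY hum hwinv hcount
    _ < ⊤ := by
        rw [ENNReal.tsum_mul_right]
        exact ENNReal.mul_lt_top (htsum.trans_lt ENNReal.ofReal_lt_top) hk

/-- Integrability and bound of the integral for continuous functions with a suitable bound. -/
theorem exists_integrable_of_le_adeleNorm [Nontrivial A] [μ.IsMulLeftInvariant]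
    [IsFiniteMeasureOnCompacts μ] {K : Set (gFin F A)} (hK : IsCompact K) {τ₁ τ₂ : ℝ} (h1 : 1 < τ₁)
    (h2 : 1 < τ₂) : ∃ (k : ℕ) (C : ℝ), ∀ (f : GAdele F A → ℂ) (B : ℝ), Continuous f →
      (∀ g : GAdele F A, (g.2 : gFin F A) ∉ K → f g = 0) →
      (∀ g : GAdele F A, (1 + ‖unitCoord (gInf F A) g.1‖) ^ k * ‖f g‖ ≤
        B * (adeleNorm g ^ τ₁ + adeleNorm g ^ τ₂)) →
      Integrable f μ ∧ ∫ g, ‖f g‖ ∂μ ≤ B * C := by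
  obtain ⟨k₁, hk₁⟩ := exists_lintegral_adeleNorm_rpow_lt_top μ hK h1
  obtain ⟨k₂, hk₂⟩ := exists_lintegral_adeleNorm_rpow_lt_top μ hK h2
  set I₁ := ∫⁻ g in {g : GAdele F A | (g.2 : gFin F A) ∈ K},
      ENNReal.ofReal (((1 + ‖unitCoord (gInf F A) g.1‖) ^ k₁)⁻¹ * adeleNorm g ^ τ₁) ∂μ
  set I₂ := ∫⁻ g in {g : GAdele F A | (g.2 : gFin F A) ∈ K},
      ENNReal.ofReal (((1 + ‖unitCoord (gInf F A) g.1‖) ^ k₂)⁻¹ * adeleNorm g ^ τ₂) ∂μ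
  -- the exponent `k₁ + k₂` is large enough for both powers
  refine ⟨k₁ + k₂, (I₁ + I₂).toReal, fun f B hf hf0 hle => ?_⟩
  have hB : 0 ≤ B := by
    have h := (mul_nonneg (pow_nonneg (by positivity : 0 ≤ 1 + ‖unitCoord (gInf F A) (1 : GAdele F A).1‖)
      (k₁ + k₂)) (norm_nonneg (f 1))).trans (hle 1)
    have h' : 0 < adeleNorm (1 : GAdele F A) ^ τ₁ + adeleNorm (1 : GAdele F A) ^ τ₂ :=
      add_pos (Real.rpow_pos_of_pos (adeleNorm_pos _) _) (Real.rpow_pos_of_pos (adeleNorm_pos _) _)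
    exact nonneg_of_mul_nonneg_left h h'
  have hKm : MeasurableSet {g : GAdele F A | (g.2 : gFin F A) ∈ K} :=
    (hK.isClosed.preimage (Units.continuous_val.comp continuous_GAdele_snd)).measurableSet
  have hlin : ∫⁻ g, ‖f g‖ₑ ∂μ ≤ ENNReal.ofReal B * (I₁ + I₂) := by
    have hsup : ∫⁻ g, ‖f g‖ₑ ∂μ = ∫⁻ g in {g : GAdele F A | (g.2 : gFin F A) ∈ K}, ‖f g‖ₑ ∂μ := by
      rw [← lintegral_indicator hKm]
      refine lintegral_congr fun g => ?_
      by_cases hg : (g.2 : gFin F A) ∈ K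
      · rw [Set.indicator_of_mem (by exact hg)]
      · rw [Set.indicator_of_notMem (by exact hg), hf0 g hg, enorm_zero]
    have hmeas : ∀ (k : ℕ) {τ : ℝ}, 1 < τ → Measurable fun g : GAdele F A =>
        ENNReal.ofReal (((1 + ‖unitCoord (gInf F A) g.1‖) ^ k)⁻¹ * adeleNorm g ^ τ) := by
      intro k τ hτ
      refine (Continuous.measurable ?_).ennreal_ofReal
      have hc : Continuous fun g : GAdele F A => unitCoord (gInf F A) g.1 :=
        (isOpenEmbedding_unitCoord (gInf F A)).continuous.comp continuous_GAdele_fst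
      refine (((hc.norm.const_add 1).pow _).inv₀ fun g => ?_).mul
        (continuous_adeleNorm.rpow_const fun g => Or.inr (by linarith))
      exact pow_ne_zero _ (by positivity)
    rw [hsup, ← lintegral_add_left (hmeas k₁ h1), ← lintegral_const_mul (f := fun g : GAdele F A =>
        ENNReal.ofReal (((1 + ‖unitCoord (gInf F A) g.1‖) ^ k₁)⁻¹ * adeleNorm g ^ τ₁) +
        ENNReal.ofReal (((1 + ‖unitCoord (gInf F A) g.1‖) ^ k₂)⁻¹ * adeleNorm g ^ τ₂)) _
      ((hmeas k₁ h1).add (hmeas k₂ h2))]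
    refine lintegral_mono fun g => ?_
    have hs : 1 ≤ 1 + ‖unitCoord (gInf F A) g.1‖ := by
      have := norm_nonneg (unitCoord (gInf F A) g.1)
      linarith
    have hp₁ := Real.rpow_pos_of_pos (adeleNorm_pos g) τ₁
    have hp₂ := Real.rpow_pos_of_pos (adeleNorm_pos g) τ₂
    rw [← ENNReal.ofReal_add (by positivity) (by positivity), ← ENNReal.ofReal_mul hB,
      ← ofReal_norm]
    refine ENNReal.ofReal_le_ofReal ?_
    have h3 : ‖f g‖ ≤ ((1 + ‖unitCoord (gInf F A) g.1‖) ^ (k₁ + k₂))⁻¹ *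
        (B * (adeleNorm g ^ τ₁ + adeleNorm g ^ τ₂)) := by
      rw [← div_eq_inv_mul, le_div_iff₀ (by positivity), mul_comm]
      exact hle g
    refine h3.trans ?_
    rw [mul_left_comm]
    refine mul_le_mul_of_nonneg_left ?_ hB
    rw [mul_add]
    refine add_le_add (mul_le_mul_of_nonneg_right ?_ hp₁.le) (mul_le_mul_of_nonneg_right ?_ hp₂.le)
    · exact inv_anti₀ (by positivity) (pow_le_pow_right₀ hs (by omega))
    · exact inv_anti₀ (by positivity) (pow_le_pow_right₀ hs (by omega))
  have hfin : ENNReal.ofReal B * (I₁ + I₂) < ⊤ :=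
    ENNReal.mul_lt_top ENNReal.ofReal_lt_top (ENNReal.add_lt_top.2 ⟨hk₁, hk₂⟩)
  refine ⟨⟨hf.aestronglyMeasurable, hlin.trans_lt hfin⟩, ?_⟩
  rw [integral_norm_eq_lintegral_enorm hf.aestronglyMeasurable]
  refine (ENNReal.toReal_mono hfin.ne hlin).trans_eq ?_
  rw [ENNReal.toReal_mul, ENNReal.toReal_ofReal hB]

end AdelicIntegral

/-! ### The twisted functions on the adelic group -/

section AdelicTwist

open Module NumberField IsDedekindDomain MeasureTheory Topology Filter

/-- A power with exponent in `[a, c]` is dominated by the sum of the extreme powers. -/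
theorem rpow_le_rpow_add_rpow {w a b c : ℝ} (hw : 0 < w) (hab : a ≤ b) (hbc : b ≤ c) :
    w ^ b ≤ w ^ a + w ^ c := by
  have ha := Real.rpow_pos_of_pos hw a
  have hc := Real.rpow_pos_of_pos hw c
  rcases le_total 1 w with h | h
  · linarith [Real.rpow_le_rpow_of_exponent_le h hbc]
  · linarith [Real.rpow_le_rpow_of_exponent_ge hw h hab]

theorem abs_log_le_rpow_add_rpow {w δ : ℝ} (hw : 0 < w) (hδ : 0 < δ) :
    |Real.log w| ≤ (w ^ δ + w ^ (-δ)) / δ := by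
  have h1 := Real.log_le_rpow_div hw.le hδ
  have h2 := Real.log_le_rpow_div (inv_pos.2 hw).le hδ
  rw [Real.log_inv, Real.inv_rpow hw.le, ← Real.rpow_neg hw.le] at h2
  have h3 := div_pos (Real.rpow_pos_of_pos hw δ) hδ
  have h4 := div_pos (Real.rpow_pos_of_pos hw (-δ)) hδ
  rw [add_div, abs_le]
  constructor <;> linarith

/-- The logarithm is absorbed by a small change of the exponent. -/
theorem rpow_mul_one_add_abs_log_le {w a b δ ε : ℝ} (hw : 0 < w) (hδ : 0 < δ)
    (hε : ε ∈ Set.Icc a b) :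
    w ^ ε * (1 + |Real.log w|) ≤ (1 + 2 / δ) * (w ^ (a - δ) + w ^ (b + δ)) := by
  have h0 := Real.rpow_pos_of_pos hw ε
  have h1 : w ^ ε * (1 + |Real.log w|) ≤ w ^ ε * (1 + (w ^ δ + w ^ (-δ)) / δ) :=
    mul_le_mul_of_nonneg_left (by linarith [abs_log_le_rpow_add_rpow hw hδ]) h0.le
  have h2 : w ^ ε * (1 + (w ^ δ + w ^ (-δ)) / δ) =
      w ^ ε + (w ^ (ε + δ) + w ^ (ε + -δ)) / δ := by
    rw [Real.rpow_add hw, Real.rpow_add hw]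
    ring
  have h3 : ∀ t, a - δ ≤ t → t ≤ b + δ → w ^ t ≤ w ^ (a - δ) + w ^ (b + δ) :=
    fun t h h' => rpow_le_rpow_add_rpow hw h h'
  have h4 := h3 ε (by linarith [hε.1]) (by linarith [hε.2])
  have h5 := h3 (ε + δ) (by linarith [hε.1]) (by linarith [hε.2])
  have h6 := h3 (ε + -δ) (by linarith [hε.1]) (by linarith [hε.2])
  have h7 : (w ^ (ε + δ) + w ^ (ε + -δ)) / δ ≤ 2 / δ * (w ^ (a - δ) + w ^ (b + δ)) := by
    rw [div_mul_eq_mul_div]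
    exact div_le_div_of_nonneg_right (by linarith) hδ.le
  rw [h2] at h1
  linarith

variable {F : Type*} [Field F] [NumberField F] {A : Type*} [Ring A] [Algebra F A]
  [Module.Finite F A]

theorem isUnit_reducedNorm_gFin [Algebra.IsCentral F A] [IsSimpleRing A] {n : ℕ}
    (hn : finrank F A = n ^ 2) (y : (gFin F A)ˣ) :
    IsUnit (reducedNorm F A n (FiniteAdeleRing (𝓞 F) F) (y : gFin F A)) := by
  refine (isUnit_pow_iff (degree_pos A hn).ne').1 ?_
  rw [reducedNorm_pow F A hn (FiniteAdeleRing (𝓞 F) F) (y : gFin F A)]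
  exact isUnit_norm_gFin y

/-- As for local fields, the `n`-th power of `|ν|` is the absolute value of the norm. -/
theorem absNuAdele_pow [Algebra.IsCentral F A] [IsSimpleRing A] {n : ℕ}
    (hn : finrank F A = n ^ 2) (g : GAdele F A) :
    absNuAdele F A n (g.val F A) ^ n = adeleNorm g := by
  have h1 := reducedNorm_pow F A hn (InfiniteAdeleRing F) (g.1 : gInf F A)
  have h2 := reducedNorm_pow F A hn (FiniteAdeleRing (𝓞 F) F) (g.2 : gFin F A)
  have h3 : ∀ x : InfiniteAdeleRing F, ‖x ^ n‖ = ‖x‖ ^ n := fun x => by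
    rw [← abs_norm_infiniteAdele, ← abs_norm_infiniteAdele, map_pow, abs_pow]
  change (‖reducedNorm F A n (InfiniteAdeleRing F) (g.1 : gInf F A)‖ *
    finAbs (reducedNorm F A n (FiniteAdeleRing (𝓞 F) F) (g.2 : gFin F A))) ^ n = _
  rw [mul_pow, ← h3, ← finAbs_pow _ (isUnit_reducedNorm_gFin hn g.2), h1, h2, adeleNorm, abs_norm_gInf]
  rfl

theorem absNuAdele_pos [Algebra.IsCentral F A] [IsSimpleRing A] {n : ℕ}
    (hn : finrank F A = n ^ 2) (g : GAdele F A) : 0 < absNuAdele F A n (g.val F A) := by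
  have hn0 : n ≠ 0 := (degree_pos A hn).ne'
  refine lt_of_le_of_ne ?_ fun h => ?_
  · exact mul_nonneg (by rw [← abs_norm_infiniteAdele]; exact abs_nonneg _)
      (finAbs_pos (isUnit_reducedNorm_gFin hn g.2)).le
  · have h1 := adeleNorm_pos g
    rw [← absNuAdele_pow hn g, ← h, zero_pow hn0] at h1
    exact lt_irrefl _ h1

/-- For a fixed finite component the twisted function is a multiple of a twisted Schwartz function
on the archimedean group. -/
theorem adeleTwist_slice (h : LocConstCompact (gFin F A)) (z : ℂ) (φ : SchwartzFD (gInf F A))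
    (y : (gFin F A)ˣ) :
    (fun x : (gInf F A)ˣ => tensorMap F A h φ (GAdele.val F A (x, y)) *
      (adeleNorm ((x, y) : GAdele F A) : ℂ) ^ z) =
    (h.1 y * ((finAbs (Algebra.norm (FiniteAdeleRing (𝓞 F) F) (y : gFin F A)) : ℝ) : ℂ) ^ z) •
      (normTwist z φ).1 := by
  funext x
  change SchwartzFD.eval φ (x : gInf F A) * h.1 y * ((|Algebra.norm ℝ (x : gInf F A)| *
    finAbs (Algebra.norm (FiniteAdeleRing (𝓞 F) F) (y : gFin F A)) : ℝ) : ℂ) ^ z =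
    (h.1 y * _) * (SchwartzFD.eval φ (x : gInf F A) *
      ((|Algebra.norm ℝ (x : gInf F A)| : ℝ) : ℂ) ^ z)
  rw [Complex.ofReal_mul, Complex.mul_cpow_ofReal_nonneg (abs_nonneg _)
    (finAbs_pos (isUnit_norm_gFin y)).le]
  ring

/-- The function `g ↦ φ(g_∞) h(g_fin) |N(g)|^z` on the adelic group, smooth in the archimedean
variable. -/
def adeleTwist (h : LocConstCompact (gFin F A)) (z : ℂ) (φ : SchwartzFD (gInf F A)) :
    smoothAdele F A :=
  ⟨fun g => tensorMap F A h φ (g.val F A) * (adeleNorm g : ℂ) ^ z, fun y => by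
    rw [adeleTwist_slice]
    exact (smoothUnits (gInf F A)).smul_mem _ (normTwist z φ).2⟩

theorem adeleTwist_apply (h : LocConstCompact (gFin F A)) (z : ℂ) (φ : SchwartzFD (gInf F A))
    (g : GAdele F A) : (adeleTwist h z φ).1 g =
      SchwartzFD.eval φ (g.1 : gInf F A) * h.1 g.2 * (adeleNorm g : ℂ) ^ z := rfl

theorem adeleSlice_adeleTwist (h : LocConstCompact (gFin F A)) (z : ℂ)
    (φ : SchwartzFD (gInf F A)) (y : (gFin F A)ˣ) : adeleSlice (adeleTwist h z φ) y =
    (h.1 y * ((finAbs (Algebra.norm (FiniteAdeleRing (𝓞 F) F) (y : gFin F A)) : ℝ) : ℂ) ^ z) •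
      normTwist z φ :=
  Subtype.ext (adeleTwist_slice h z φ y)

/-- The invariant differential operators act on the twisted functions through their archimedean
component. -/
theorem exists_lift_adeleAct (X : FreeAlgebra ℂ (gInf F A)) :
    ∃ P : ℂ × SchwartzFD (gInf F A) → SchwartzFD (gInf F A), Continuous P ∧
      ∀ (h : LocConstCompact (gFin F A)) z φ,
        adeleAct F A X (adeleTwist h z φ) = adeleTwist h z (P (z, φ)) := by
  obtain ⟨P, hP, hPX⟩ := exists_lift_rightAct X
  refine ⟨P, hP, fun h z φ => ?_⟩
  have key : ∀ y, rightAct (gInf F A) X (adeleSlice (adeleTwist h z φ) y) =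
      adeleSlice (adeleTwist h z (P (z, φ))) y := fun y => by
    rw [adeleSlice_adeleTwist, adeleSlice_adeleTwist, map_smul, hPX]
  ext g
  exact congrFun (congrArg Subtype.val (key g.2)) g.1

theorem continuous_adeleTwist [Nontrivial A] (h : LocConstCompact (gFin F A)) (z : ℂ)
    (φ : SchwartzFD (gInf F A)) : Continuous (adeleTwist h z φ).1 := by
  have h1 : Continuous fun g : GAdele F A => unitCoord (gInf F A) g.1 :=
    (isOpenEmbedding_unitCoord (gInf F A)).continuous.comp continuous_GAdele_fst
  have h2 : Continuous fun g : GAdele F A => h.1 (g.2 : gFin F A) :=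
    h.2.1.continuous.comp (Units.continuous_val.comp continuous_GAdele_snd)
  exact ((φ.continuous.comp h1).mul h2).mul
    ((Complex.continuous_ofReal.comp continuous_adeleNorm).cpow continuous_const fun g =>
      Complex.ofReal_mem_slitPlane.2 (adeleNorm_pos g))

/-- The `L¹` norm of the twisted functions is locally uniformly bounded in `z`, for `Re z > 1`,
by continuous functions of the Schwartz function, and is locally Lipschitz in `z`. -/
theorem exists_integral_adeleTwist_le [Nontrivial A] (μ : Measure (GAdele F A))
    [μ.IsMulLeftInvariant] [IsFiniteMeasureOnCompacts μ] (h : LocConstCompact (gFin F A))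
    {a b : ℝ} (ha : 1 < a) (hab : a ≤ b) :
    ∃ q : SchwartzFD (gInf F A) → ℝ, Continuous q ∧ q 0 = 0 ∧ (∀ φ, 0 ≤ q φ) ∧
      ∀ φ z, z.re ∈ Set.Icc a b → (Integrable (adeleTwist h z φ).1 μ ∧
        ∫ g, ‖(adeleTwist h z φ).1 g‖ ∂μ ≤ q φ ∧ ∀ z₀ : ℂ, z₀.re ∈ Set.Icc a b →
          ∫ g, ‖(adeleTwist h z φ).1 g - (adeleTwist h z₀ φ).1 g‖ ∂μ ≤ q φ * ‖z - z₀‖) := by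
  -- half of the distance of `a` to the abscissa of convergence `1`
  have hδ : 0 < (a - 1) / 2 := by linarith
  set δ := (a - 1) / 2 with hδd
  obtain ⟨k, C, hC⟩ := exists_integrable_of_le_adeleNorm μ h.2.2 (τ₁ := a - δ) (τ₂ := b + δ)
    (by linarith) (by linarith)
  obtain ⟨q, hq, hq0, hle⟩ := exists_schwartz_bound (gInf F A) k
  obtain ⟨M, hM⟩ := h.2.2.exists_bound_of_continuous h.2.1.continuous
  have hM0 : 0 ≤ M := (norm_nonneg _).trans (hM 0)
  have hqnn : ∀ φ, 0 ≤ q φ := fun φ => le_trans (by positivity) (hle φ 0)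
  set L : ℝ := 1 + 2 / δ with hL
  have hL0 : 0 ≤ L := by positivity
  -- pointwise bound, uniform for exponents in the given interval
  have hpt : ∀ φ (g : GAdele F A), ∀ ε ∈ Set.Icc a b,
      (1 + ‖unitCoord (gInf F A) g.1‖) ^ k *
          ‖SchwartzFD.eval φ (g.1 : gInf F A) * h.1 g.2‖ *
        (adeleNorm g ^ (0 + ε) * (1 + |Real.log (adeleNorm g)|)) ≤
      q φ * M * L * (adeleNorm g ^ (a - δ) + adeleNorm g ^ (b + δ)) := by
    intro φ g ε hε
    rw [zero_add, norm_mul, ← mul_assoc ((1 + ‖unitCoord (gInf F A) g.1‖) ^ k),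
      mul_assoc (q φ * M)]
    refine mul_le_mul ?_ (rpow_mul_one_add_abs_log_le (adeleNorm_pos g) hδ hε) ?_
      (mul_nonneg (hqnn φ) hM0)
    · exact mul_le_mul (hle φ _) (hM _) (norm_nonneg _) (hqnn φ)
    · have := Real.rpow_pos_of_pos (adeleNorm_pos g) ε
      positivity
  have hsupp : ∀ (z : ℂ) φ (g : GAdele F A), (g.2 : gFin F A) ∉ tsupport h.1 →
      (adeleTwist h z φ).1 g = 0 := fun z φ g hg => by
    rw [adeleTwist_apply, image_eq_zero_of_notMem_tsupport hg, mul_zero, zero_mul]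
  refine ⟨fun φ => 2 * (q φ * M * L) * |C|, by fun_prop, by simp [hq0],
    fun φ => by have := hqnn φ; positivity, fun φ z hz => ?_⟩
  have hB : 0 ≤ q φ * M * L := mul_nonneg (mul_nonneg (hqnn φ) hM0) hL0
  obtain ⟨h1, h2⟩ := hC (adeleTwist h z φ).1 (q φ * M * L) (continuous_adeleTwist h z φ)
    (hsupp z φ) fun g => by
      rw [adeleTwist_apply, norm_mul, ← mul_assoc]
      exact mul_norm_cpow_le (e := 0) (by positivity) (adeleNorm_pos g) (hpt φ g)
        (by rwa [sub_zero])
  refine ⟨h1, ?_, fun z₀ hz₀ => ?_⟩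
  · refine h2.trans ((mul_le_mul_of_nonneg_left (le_abs_self C) hB).trans ?_)
    exact mul_le_mul_of_nonneg_right (by linarith) (abs_nonneg C)
  · obtain ⟨-, h3⟩ := hC (fun g => (adeleTwist h z φ).1 g - (adeleTwist h z₀ φ).1 g)
      (2 * (q φ * M * L) * ‖z - z₀‖)
      ((continuous_adeleTwist h z φ).sub (continuous_adeleTwist h z₀ φ))
      (fun g hg => by rw [hsupp z φ g hg, hsupp z₀ φ g hg, sub_zero]) fun g => by
        rw [adeleTwist_apply, adeleTwist_apply, ← mul_sub, norm_mul, ← mul_assoc]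
        refine (mul_norm_cpow_sub_le (e := 0) (by positivity) (adeleNorm_pos g) (hpt φ g)
          (by rwa [sub_zero]) (by rwa [sub_zero])).trans_eq ?_
        ring
    refine h3.trans ?_
    rw [mul_right_comm]
    exact mul_le_mul_of_nonneg_right (mul_le_mul_of_nonneg_left (le_abs_self C) (by positivity))
      (norm_nonneg _)

/-- The test function is invariant under its stabilizer, and `|N|` under the units of an order. -/
theorem adeleTwist_mem_smoothRightInvariant {r : ℕ} (b : Basis (Fin r) F A)
    (hb : ∀ i j l, Algebra.leftMulMatrix b (b i) j l ∈ (algebraMap (𝓞 F) F).range)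
    (h1 : ∀ i, b.repr 1 i ∈ (algebraMap (𝓞 F) F).range) {J : Subgroup (gFin F A)ˣ}
    {h : LocConstCompact (gFin F A)} (hJ : J ≤ biStabilizer h.1)
    (hJ' : J ≤ finOrderUnits b hb h1) (z : ℂ) (φ : SchwartzFD (gInf F A)) :
    adeleTwist h z φ ∈ smoothRightInvariant F A J := by
  intro x y j hj
  have h2 : h.1 ((y * j : (gFin F A)ˣ) : gFin F A) = h.1 y := (hJ hj (y : gFin F A)).2
  have h3 : adeleNorm ((x, y * j) : GAdele F A) = adeleNorm ((x, y) : GAdele F A) := by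
    change _ * finAbs (Algebra.norm _ ((y * j : (gFin F A)ˣ) : gFin F A)) = _ * _
    rw [finAbs_norm_mul, finAbs_norm_of_mem b hb h1 (hJ' hj), mul_one]
  exact congrArg₂ (fun t (r : ℝ) => SchwartzFD.eval φ (x : gInf F A) * t * (r : ℂ) ^ z) h2 h3

/-- The operators whose `L¹` norms define the topology of the space `𝒞(G(𝔸), J)`. -/
abbrev mflAct (J : CompactOpen (gFin F A)ˣ) : FreeAlgebra ℂ (gInf F A) →
    smoothRightInvariant F A J.1 →ₗ[ℂ] (GAdele F A → ℂ) := fun X =>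
  (smoothAdele F A).subtype.comp ((adeleAct F A X).comp (smoothRightInvariant F A J.1).subtype)

/-- The inclusion of the space `𝒞(G(𝔸), J)` in the functions on `G(𝔸)`. -/
abbrev mflIncl (μ : Measure (GAdele F A)) (J : CompactOpen (gFin F A)ˣ) :
    MFLLevel F A μ J →ₗ[ℂ] (GAdele F A → ℂ) :=
  (smoothAdele F A).subtype.comp
    ((smoothRightInvariant F A J.1).subtype.comp (IntegrableSpace.incl μ _))

/-- Restriction to the group, followed by multiplication by `|N|^z`. -/
def restrictTwist (z : ℂ) : (gAdele F A → ℂ) →ₗ[ℂ] (GAdele F A → ℂ) where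
  toFun f g := f (g.val F A) * (adeleNorm g : ℂ) ^ z
  map_add' _ _ := funext fun _ => add_mul _ _ _
  map_smul' _ _ := funext fun _ => mul_assoc _ _ _

section

variable [Nontrivial A] (μ : Measure (GAdele F A)) [μ.IsMulLeftInvariant]
  [IsFiniteMeasureOnCompacts μ] {J : CompactOpen (gFin F A)ˣ} {h : LocConstCompact (gFin F A)}
  (hinv : ∀ z φ, adeleTwist h z φ ∈ smoothRightInvariant F A J.1)

include hinv in
/-- All derivatives of a twisted function are twisted functions, hence integrable. -/
theorem adeleTwist_mem_integrableSub {z : ℂ} (hz : 1 < z.re) (φ : SchwartzFD (gInf F A)) :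
    (⟨_, hinv z φ⟩ : smoothRightInvariant F A J.1) ∈
      integrableSub (W := smoothRightInvariant F A J.1) μ (mflAct J) := by
  intro X
  obtain ⟨P, -, hP⟩ := exists_lift_adeleAct X
  obtain ⟨q, -, -, -, hq⟩ := exists_integral_adeleTwist_le μ h hz le_rfl
  have hTP : mflAct J X ⟨_, hinv z φ⟩ = (adeleTwist h z (P (z, φ))).1 :=
    congrArg Subtype.val (hP h z φ)
  rw [hTP]
  exact (hq _ z ⟨le_rfl, le_rfl⟩).1

/-- The function `g ↦ φ(g_∞) h(g_fin) |N(g)|^z` as an element of `𝒞(G(𝔸), J)`. -/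
def adeleTwistLevel (z : {z : ℂ // 1 < z.re}) (φ : SchwartzFD (gInf F A)) : MFLLevel F A μ J :=
  (⟨⟨_, hinv z φ⟩, adeleTwist_mem_integrableSub μ hinv z.2 φ⟩ : integrableSub (W := smoothRightInvariant F A J.1) μ (mflAct J))

/-- Joint continuity on a step of the inductive limit: the difference is split into a change of
the Schwartz function and a change of the exponent. -/
theorem continuous_adeleTwistLevel : Continuous fun p : {z : ℂ // 1 < z.re} × SchwartzFD (gInf F A) =>
    adeleTwistLevel μ hinv p.1 p.2 := by
  have key := @IntegrableSpace.continuous_of_tendsto (smoothRightInvariant F A J.1)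
    (FreeAlgebra ℂ (gInf F A)) (GAdele F A) ({z : ℂ // 1 < z.re} × SchwartzFD (gInf F A)) _ _ _ _ _
    μ (mflAct J)
  refine key (Φ := fun p => adeleTwistLevel μ hinv p.1 p.2) fun X p₀ => ?_
  obtain ⟨P, hPc, hP⟩ := exists_lift_adeleAct X
  have hTP : ∀ p : {z : ℂ // 1 < z.re} × SchwartzFD (gInf F A),
      mflAct J X (IntegrableSpace.incl (W := smoothRightInvariant F A J.1) μ (mflAct J) (adeleTwistLevel μ hinv p.1 p.2)) =
        (adeleTwist h p.1 (P (p.1, p.2))).1 :=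
    fun p => congrArg Subtype.val (hP h p.1 p.2)
  simp only [hTP]
  have hs : Continuous fun p : {z : ℂ // 1 < z.re} × SchwartzFD (gInf F A) => p.1.1 :=
    continuous_subtype_val.comp continuous_fst
  have hφ : Continuous fun p : {z : ℂ // 1 < z.re} × SchwartzFD (gInf F A) =>
      P (p.1.1, p.2) := hPc.comp (hs.prodMk continuous_snd)
  have hp₀ := p₀.1.2
  set t : ℝ := p₀.1.1.re with ht
  obtain ⟨q, hqc, hq0, hqnn, hq⟩ := exists_integral_adeleTwist_le μ h
    (by linarith : 1 < (1 + t) / 2) (by linarith : (1 + t) / 2 ≤ t + 1)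
  have hre : ∀ᶠ p : {z : ℂ // 1 < z.re} × SchwartzFD (gInf F A) in 𝓝 p₀,
      p.1.1.re ∈ Set.Icc ((1 + t) / 2) (t + 1) :=
    (Complex.continuous_re.comp hs).continuousAt.eventually
      (Icc_mem_nhds (by change _ < t; linarith) (by change t < _; linarith))
  have hlim : Tendsto (fun p : {z : ℂ // 1 < z.re} × SchwartzFD (gInf F A) =>
      q (P (p.1.1, p.2) - P (p₀.1.1, p₀.2)) +
        q (P (p₀.1.1, p₀.2)) * ‖p.1.1 - p₀.1.1‖) (𝓝 p₀) (𝓝 0) := by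
    have hc := (hqc.comp (hφ.sub continuous_const)).add
      (continuous_const.mul (hs.sub continuous_const).norm) |>.tendsto p₀
        (f := fun p : {z : ℂ // 1 < z.re} × SchwartzFD (gInf F A) =>
        q (P (p.1.1, p.2) - P (p₀.1.1, p₀.2)) +
          q (P (p₀.1.1, p₀.2)) * ‖p.1.1 - p₀.1.1‖)
    simpa [hq0] using hc
  refine tendsto_of_tendsto_of_tendsto_of_le_of_le' tendsto_const_nhds hlim
    (Eventually.of_forall fun p => integral_nonneg fun g => norm_nonneg _) ?_
  filter_upwards [hre] with p hp
  generalize P (p.1.1, p.2) = φ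
  generalize P (p₀.1.1, p₀.2) = φ₀
  have hz₀ : p₀.1.1.re ∈ Set.Icc ((1 + t) / 2) (t + 1) := ⟨by linarith, by linarith⟩
  generalize p.1.1 = z at hp ⊢
  generalize p₀.1.1 = z₀ at hz₀ ⊢
  have hsplit : ∀ g, (adeleTwist h z φ).1 g - (adeleTwist h z₀ φ₀).1 g =
      (adeleTwist h z (φ - φ₀)).1 g +
        ((adeleTwist h z φ₀).1 g - (adeleTwist h z₀ φ₀).1 g) := fun g => by
    have hsub : SchwartzFD.eval (φ - φ₀) (g.1 : gInf F A) =
      SchwartzFD.eval φ (g.1 : gInf F A) - SchwartzFD.eval φ₀ (g.1 : gInf F A) := rfl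
    simp only [adeleTwist_apply, hsub]
    ring
  obtain ⟨i1, i2, -⟩ := hq (φ - φ₀) z hp
  obtain ⟨i3, -, i4⟩ := hq φ₀ z hp
  have i5 := i3.sub (hq φ₀ z₀ hz₀).1
  calc ∫ g, ‖(adeleTwist h z φ).1 g - (adeleTwist h z₀ φ₀).1 g‖ ∂μ
      ≤ ∫ g, ‖(adeleTwist h z (φ - φ₀)).1 g‖ +
          ‖(adeleTwist h z φ₀).1 g - (adeleTwist h z₀ φ₀).1 g‖ ∂μ := by
        refine integral_mono_of_nonneg (Eventually.of_forall fun g => norm_nonneg _)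
          (i1.norm.add i5.norm) (Eventually.of_forall fun g => ?_)
        simp only [hsplit]
        exact norm_add_le _ _
    _ = _ := integral_add i1.norm i5.norm
    _ ≤ _ := add_le_add i2 (i4 _ hz₀)

end

/-- The map `f ↦ f |N|^z` from the Schwartz–Bruhat space, for `Re z > 1`, is well defined and
jointly continuous in `(z, f)`. -/
theorem exists_continuous_adeleTwist [Nontrivial A] (μ : Measure (GAdele F A))
    [μ.IsMulLeftInvariant] [IsFiniteMeasureOnCompacts μ] :
    ∃ Φ : {z : ℂ // 1 < z.re} → IndLimit (tensorMap F A) →ₗ[ℂ] IndLimit (mflIncl μ),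
      (∀ z f, (Φ z f).1 = restrictTwist z.1 f.1) ∧
      Continuous fun p : {z : ℂ // 1 < z.re} × IndLimit (tensorMap F A) => Φ p.1 p.2 := by
  obtain ⟨b, hb, h1⟩ := exists_integral_basis (𝓞 F) F A
  let J₀ : CompactOpen (gFin F A)ˣ :=
    ⟨finOrderUnits b hb h1, isOpen_finOrderUnits b hb h1, isCompact_finOrderUnits b hb h1⟩
  have hinv : ∀ (h : LocConstCompact (gFin F A)) (z : ℂ) φ,
      adeleTwist h z φ ∈ smoothRightInvariant F A (biStabilizerIn J₀ h).1 := fun h z φ =>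
    adeleTwist_mem_smoothRightInvariant b hb h1 inf_le_left inf_le_right z φ
  have hle : ∀ z : {z : ℂ // 1 < z.re}, indLimitSub (tensorMap F A) ≤
      (indLimitSub (mflIncl μ)).comap (restrictTwist z.1) := by
    intro z
    refine iSup_le fun h => ?_
    rintro _ ⟨φ, rfl⟩
    exact Submodule.mem_iSup_of_mem (p := fun J => LinearMap.range (mflIncl μ J))
      (biStabilizerIn J₀ h) ⟨adeleTwistLevel μ (hinv h) z φ, rfl⟩
  let Φ : {z : ℂ // 1 < z.re} → IndLimit (tensorMap F A) →ₗ[ℂ] IndLimit (mflIncl μ) :=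
    fun z => ((restrictTwist z.1).restrict (hle z) :
      indLimitSub (tensorMap F A) →ₗ[ℂ] indLimitSub (mflIncl μ))
  refine ⟨Φ, fun z f => rfl, ?_⟩
  have : LocallyCompactSpace {z : ℂ // 1 < z.re} :=
    (isOpen_lt continuous_const Complex.continuous_re).locallyCompactSpace
  refine continuous_indLimit_prod (tensorMap F A) Φ fun h => ?_
  exact (continuous_toIndLimit (mflIncl μ) (biStabilizerIn J₀ h)).comp
    (continuous_adeleTwistLevel μ (hinv h))

/-- Since `|ν|` is the `n`-th root of `|N|`, the exponent of `|N|` is `(s + (n-1)/2)/n`, which has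
real part greater than `1` exactly if `Re s > (n+1)/2`. -/
theorem one_lt_re_twist_exponent {n : ℕ} (hn : 0 < n) {s : ℂ} (hs : ((n : ℝ) + 1) / 2 < s.re) :
    1 < ((s + ((n : ℂ) - 1) / 2) / (n : ℂ)).re := by
  have hn' : (0 : ℝ) < n := by exact_mod_cast hn
  have h2 : ((n : ℂ) - 1) / 2 = ((((n : ℝ) - 1) / 2 : ℝ) : ℂ) := by push_cast; ring
  rw [h2, ← Complex.ofReal_natCast n, Complex.div_ofReal_re, Complex.add_re, Complex.ofReal_re,
    lt_div_iff₀ hn']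
  linarith

/-- The global inclusion for a central simple algebra of degree `n`. -/
theorem isContinuousInclusion_adelic [Algebra.IsCentral F A] [IsSimpleRing A] {n : ℕ}
    (hn : finrank F A = n ^ 2) (μ : Measure (GAdele F A)) [μ.IsMulLeftInvariant]
    [IsFiniteMeasureOnCompacts μ] :
    IsContinuousInclusion
      (GJRestr.eval : GJRestrAdele F A n {s : ℂ | ((n : ℝ) + 1) / 2 < s.re} → _)
      (MFL.eval F A : MFL F A μ → _) := by
  have hn0 : 0 < n := degree_pos A hn
  obtain ⟨Φ, hΦ, hc⟩ := exists_continuous_adeleTwist (F := F) (A := A) μ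
  let z : {s : ℂ | ((n : ℝ) + 1) / 2 < s.re} → {z : ℂ // 1 < z.re} :=
    fun s => ⟨_, one_lt_re_twist_exponent hn0 s.2⟩
  have hz : Continuous z :=
    ((continuous_subtype_val.add continuous_const).div_const _).subtype_mk _
  refine isContinuousInclusion_of_lift Subtype.val_injective (fun p => Φ (z p.1) p.2)
    (hc.comp ((hz.comp continuous_fst).prodMk continuous_snd)) fun p => ?_
  refine (hΦ (z p.1) p.2).trans ?_
  funext g
  change p.2.1 (g.val F A) * (adeleNorm g : ℂ) ^ (z p.1).1 =
    p.2.1 (g.val F A) * (absNuAdele F A n (g.val F A) : ℂ) ^ (p.1.1 + ((n : ℂ) - 1) / 2)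
  rw [← absNuAdele_pow hn, pow_cpow_div (absNuAdele_pos hn g) hn0.ne']

theorem isContinuousInclusion_global (F : Type*) [Field F] [NumberField F] (D : Type*)
    [DivisionRing D] [Algebra F D] [Algebra.IsCentral F D] [FiniteDimensional F D] (m d : ℕ)
    (hm : 0 < m) (hd : finrank F D = d ^ 2) (μ : Measure (GAdele F (Matrix (Fin m) (Fin m) D)))
    [μ.IsHaarMeasure] :
    IsContinuousInclusion
      (GJRestr.eval : GJRestrAdele F (Matrix (Fin m) (Fin m) D) (m * d)
        {s : ℂ | (((m * d : ℕ) : ℝ) + 1) / 2 < s.re} → _)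
      (MFL.eval F (Matrix (Fin m) (Fin m) D) : MFL F (Matrix (Fin m) (Fin m) D) μ → _) := by
  have : Nonempty (Fin m) := ⟨⟨0, hm⟩⟩
  exact isContinuousInclusion_adelic (finrank_matrix D hd m) μ

end AdelicTwist

end

end GodementJacquet

/-! ### The local and the global inclusions -/

theorem mainTheorem2 :
    -- the local inclusion, over a non-archimedean local field of characteristic zero
    (∀ (F : Type*) [Field F] [ValuativeRel F] [TopologicalSpace F] [IsNonarchimedeanLocalField F]
        [CharZero F] (D : Type*) [DivisionRing D] [Algebra F D] [Algebra.IsCentral F D]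
        [FiniteDimensional F D] [TopologicalSpace D] [IsModuleTopology F D] (m d : ℕ),
        0 < m → Module.finrank F D = d ^ 2 →
        ∀ [MeasurableSpace (maxCompactNA F D m)] [BorelSpace (maxCompactNA F D m)]
          (μ : MeasureTheory.Measure (maxCompactNA F D m)) [μ.IsHaarMeasure],
        IsContinuousInclusion
          (GJRestr.eval : GJRestrNA F D m d {s : ℂ | (1 - d : ℝ) / 2 < s.re} → _)
          (HCNA.eval F D : HCNA F D m d μ → _)) ∧
    -- the local inclusion, over an archimedean local field
    (∀ (F : Type*) [RCLike F] (D : Type*) [DivisionRing D] [Algebra F D] [Algebra.IsCentral F D]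
        [FiniteDimensional F D] [Algebra ℝ D] [IsScalarTower ℝ F D] [FiniteDimensional ℝ D]
        [TopologicalSpace D] [IsModuleTopology F D] (m d : ℕ),
        0 < m → Module.finrank F D = d ^ 2 →
        ∀ [MeasurableSpace (maxCompactArch D m)] [BorelSpace (maxCompactArch D m)]
          (μ : MeasureTheory.Measure (maxCompactArch D m)) [μ.IsHaarMeasure],
        IsContinuousInclusion
          (GJRestr.eval : GJRestrArch F D m d {s : ℂ | (1 - d : ℝ) / 2 < s.re} → _)
          (HCArch.eval F D : HCArch F D m d μ → _)) ∧
    -- the global inclusion, over a number field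
    (∀ (F : Type*) [Field F] [NumberField F] (D : Type*) [DivisionRing D] [Algebra F D]
        [Algebra.IsCentral F D] [FiniteDimensional F D] (m d : ℕ),
        0 < m → Module.finrank F D = d ^ 2 →
        ∀ (μ : MeasureTheory.Measure (GAdele F (Matrix (Fin m) (Fin m) D))) [μ.IsHaarMeasure],
        IsContinuousInclusion
          (GJRestr.eval : GJRestrAdele F (Matrix (Fin m) (Fin m) D) (m * d)
            {s : ℂ | (((m * d : ℕ) : ℝ) + 1) / 2 < s.re} → _)
          (MFL.eval F (Matrix (Fin m) (Fin m) D) :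
            MFL F (Matrix (Fin m) (Fin m) D) μ → _)) := by
  refine ⟨?_, ?_, ?_⟩
  · intro F _ _ _ _ _ D _ _ _ _ _ _ m d hm hd _ _ μ _
    exact isContinuousInclusion_nonarchimedean F D m d hm hd μ
  · intro F _ D _ _ _ _ _ _ _ _ _ m d hm hd _ _ μ _
    exact isContinuousInclusion_archimedean F D m d hm hd μ
  · intro F _ _ D _ _ _ _ m d hm hd μ _
    exact isContinuousInclusion_global F D m d hm hd μ
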